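/- Let $\mathbb K$ be a field. $A_\infty$-categories are small, strictly unital, over $\mathbb K$ and homologically $\mathbb Z$-graded: multiplications $m_k$ ($k\ge 1$) of degree $k-2$ with $\sum_{r+s+t=k,\,s>0}(-1)^{r+st}m_{r+1+t}(\mathrm{id}^{\otimes r}\otimes m_s\otimes \mathrm{id}^{\otimes t})=0$, and units $1_x$ of degree $0$ with $m_1(1_x)=0$, neutral for $m_2$, killed by $m_k$ for $k>2$. An $A_\infty$-functor $f$ has an object map and operations $f_k$ ($k\ge1$) of degree $k-1$ with $\sum(-1)^{r+st}f_{r+1+t}(\mathrm{id}^{\otimes r}\otimes m_s\otimes \mathrm{id}^{\otimes t})=\sum(-1)^{\epsilon(i_1,\dots,i_r)}m_r(f_{i_1}\otimes\cdots\otimes f_{i_r})$, where $\epsilon(i_1,\dots,i_r)=\sum_{l}(r-l)(i_l-1)$; moreover $f_1(1_x)=1_{f(x)}$ and $f_k$ ($k>1$) vanishes if one entry is a unit. Composition is $(g\circ f)_k=\sum(-1)^{\epsilon(i_1,\dots,i_r)}g_r(f_{i_1}\otimes\cdots\otimes f_{i_r})$. The Koszul sign rule is used for tensor products of graded maps. These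 form the category $A_\infty\mathrm{Cat}_{su}$. *Faonte's nerve.* Let $A_\infty[\Delta^n]$ be the linear category with objects $0,\dots,n$, with $\mathrm{Hom}(i,j)=\mathbb K\cdot(i,j)$ in degree $0$ if $i\le j$ and $0$ otherwise, and with $m_2((i,j)\otimes(j,k))=(i,k)$. Then $N^{A_\infty}(\mathcal A)$ is the simplicial set $[n]\mapsto \mathrm{Hom}_{A_\infty\mathrm{Cat}_{su}}(A_\infty[\Delta^n],\mathcal A)$. *Templicial vector spaces.* Let $\Delta_f$ be the monoidal category of the ordinals $[n]$ ($n\ge0$) and monotone endpoint-preserving maps, with $[m]+[n]=[m+n]$. For a set $O$, a $\mathbb K$-quiver on $O$ is a family of vector spaces $Q(a,b)$, $a,b\in O$; quivers are monoidal under $(P\otimes_O Q)(a,b)=\bigoplus_c P(a,c)\otimes Q(c,b)$. A templicial vector space is a set $O$ with a colax monoidal functor $X:\Delta_f^{op}\to\mathbb K\mathrm{Quiv}_O$ whose counit $X_0\to\mathbb K_O$ is an isomorphism; a morphism is a map of vertex sets with linear maps $X_n(a,b)\to Y_n(fa,fb)$ compatible with all the structure. The free functor $\tilde F:\mathrm{SSet}\to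 \mathrm{ts}\mathrm{Vect}(\mathbb K)$ sends $S$ to the templicial vector space with vertices $S_0$ for which $\tilde F(S)_n(a,b)$ is the free vector space on the $n$-simplices with first vertex $a$ and last vertex $b$, with comultiplications $\sigma\mapsto \sigma|_{[0,k]}\otimes\sigma|_{[k,k+l]}$. Its right adjoint $\tilde U$ is the underlying simplicial set: $\tilde U(X)_n=\mathrm{Hom}(\tilde F(\Delta^n),X)$. *The templicial $A_\infty$-nerve.* For a necklace $U=\Delta^{n_1}\vee\cdots\vee\Delta^{n_l}$ ($n_i>0$) put $\ell(U)=l$, $\dim U=\sum_i(n_i-1)$, $\epsilon(U)=\epsilon(n_1,\dots,n_l)$ and $(s\mathcal A)_U=\mathcal A_{n_1-1}\otimes_{\mathrm{Ob}}\cdots\otimes_{\mathrm{Ob}}\mathcal A_{n_l-1}$. A necklace map is inert if it is the identity on vertices. For $g:U\to\Delta^n$ and $h:V\to\Delta^{n_k}$ let $g\circ_k h$ be $g$ precomposed with $h$ in the $k$-th bead. Then $N^{A_\infty}_{\mathbb K}(\mathcal A)$ has vertex set $\mathrm{Ob}(\mathcal A)$, and $N^{A_\infty}_{\mathbb K}(\mathcal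 A)_n(a,b)$ is the space of all $(y_g)_g\in\bigoplus_{g:U\hookrightarrow\Delta^n\text{ injective}}(s\mathcal A)_U(a,b)$ such that for every $g:U\hookrightarrow\Delta^n$ and every $1\le k\le \ell(U)$ $$\sum_{\nu:S\hookrightarrow\Delta^{n_k}\ \mathrm{inert}}(-1)^{\epsilon(S)+\ell(S)\dim(\Delta^{n_1}\vee\cdots\vee\Delta^{n_{k-1}})}(\mathrm{id}^{\otimes k-1}\otimes m_{\ell(S)}\otimes\mathrm{id}^{\otimes \ell(U)-k})(y_{g\circ_k\nu})=\sum_{j=1}^{n_k-1}(-1)^{j-1}y_{g\circ_k\delta_j}.$$ For $f:[m]\to[n]$ in $\Delta_f$ and injective $g:U\hookrightarrow\Delta^m$, write $f\circ g=g'\circ e$ with $g'$ injective and $e=e_1\vee\cdots\vee e_l$ active surjective; then $(f^*y)_g=(\bar e_1\otimes\cdots\otimes\bar e_l)(y_{g'})$, where $\bar e_i$ is the unit map if $e_i:\Delta^1\to\Delta^0$, the identity if $e_i$ is an identity, and $0$ otherwise. The comultiplication $\mu_{k,l}$ sends $y$ to $(y_{g_1\vee g_2})_{g_1,g_2}$,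 with $g_1:U_1\hookrightarrow\Delta^k$, $g_2:U_2\hookrightarrow\Delta^l$ injective, under $(s\mathcal A)_{U_1\vee U_2}\cong(s\mathcal A)_{U_1}\otimes(s\mathcal A)_{U_2}$, and the counit is $y\mapsto y_{\mathrm{id}_{\Delta^0}}$. An $A_\infty$-functor $f$ acts by $$f(y)_g=\sum_{\nu=\nu_1\vee\cdots\vee\nu_l,\ \nu_i:S_i\hookrightarrow\Delta^{n_i}\ \mathrm{inert}}(-1)^{\sum_i\epsilon(S_i)+\sum_{i<j}\dim(S_i)(\ell(S_j)-1)}(f_{\ell(S_1)}\otimes\cdots\otimes f_{\ell(S_l)})(y_{g\circ\nu}).$$ **Statement.** These formulas define a functor $N^{A_\infty}_{\mathbb K}:A_\infty\mathrm{Cat}_{su}\to \mathrm{ts}\mathrm{Vect}(\mathbb K)$, and there is an isomorphism of functors $A_\infty\mathrm{Cat}_{su}\to\mathrm{SSet}$ $$\tilde U\circ N^{A_\infty}_{\mathbb K}\;\cong\;N^{A_\infty}.$$ In particular, for every strictly unital $A_\infty$-category $\mathcal A$ there is an isomorphism of simplicial sets $\tilde U(N^{A_\infty}_{\mathbb K}(\mathcal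 A))\cong N^{A_\infty}(\mathcal A)$, natural in $\mathcal A$. -/

import Mathlib

open CategoryTheory TensorProduct DirectSum

universe u

namespace AInf

noncomputable section

section Chains

variable {K : Type u} [Field K] {O : Type u}

/-- Composable sequences `(a₁, …, a_k)`, `k ≥ 0`, of homogeneous elements
`a_i ∈ H_{d_i}(x_{i-1}, x_i)` of a graded quiver `H`, from `x = x₀` to `y = x_k`. -/
inductive Chain (H : O → O → ℤ → ModuleCat.{u} K) : O → O → Type u
  | nil (x : O) : Chain H x x
  | cons {x y z : O} (d : ℤ) (a : H x y d) (c : Chain H y z) : Chain H x z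

variable {H : O → O → ℤ → ModuleCat.{u} K}

namespace Chain

/-- The number `k` of elements of a chain. -/
def len {x y : O} : Chain H x y → ℕ
  | nil _ => 0
  | cons _ _ c => c.len + 1

/-- The total degree `d₁ + ⋯ + d_k`. -/
def deg {x y : O} : Chain H x y → ℤ
  | nil _ => 0
  | cons d _ c => d + c.deg

/-- Concatenation. -/
def append {x y z : O} : Chain H x y → Chain H y z → Chain H x z
  | nil _, q => q
  | cons d a p, q => cons d a (append p q)

/-- `∑ φ p q` over all ways to write the chain as a concatenation `p q`. -/
def sumSplit {M : Type u} [AddCommMonoid M] {x y : O} :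
    Chain H x y → (∀ z, Chain H x z → Chain H z y → M) → M
  | nil x, φ => φ x (nil x) (nil x)
  | cons d a c, φ => φ _ (nil _) (cons d a c) + sumSplit c fun z p q => φ z (cons d a p) q

/-- `∑ φ p q t` over all ways to write the chain as a concatenation `p q t` with `q` nonempty. -/
def sumMid {M : Type u} [AddCommMonoid M] {x y : O} :
    Chain H x y → (∀ z w, Chain H x z → Chain H z w → Chain H w y → M) → M
  | nil _, _ => 0
  | cons d a c, φ =>
      sumSplit c (fun w q t => φ _ w (nil _) (cons d a q) t) +
        sumMid c fun z w p q t => φ z w (cons d a p) q t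

/-- Multilinearity of a function of the elements of a chain: it is linear in each entry. -/
def IsMultilinear {M : Type u} [AddCommGroup M] [Module K M] {x y : O}
    (φ : Chain H x y → M) : Prop :=
  ∀ (z w : O) (p : Chain H x z) (d : ℤ) (t : Chain H w y),
    IsLinearMap K fun a : H z w d => φ (p.append (cons d a t))

end Chain

/-- Decompositions of chains: composable sequences of chains `(c₁, …, c_r)`. -/
inductive Blocks (H : O → O → ℤ → ModuleCat.{u} K) : O → O → Type u
  | nil (x : O) : Blocks H x x
  | cons {x y z : O} (c : Chain H x y) (D : Blocks H y z) : Blocks H x z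

namespace Blocks

/-- The number `r` of blocks. -/
def num {x y : O} : Blocks H x y → ℕ
  | nil _ => 0
  | cons _ D => D.num + 1

/-- `∑_l (i_l - 1)` where `i_l` is the length of the `l`-th block. -/
def excess {x y : O} : Blocks H x y → ℤ
  | nil _ => 0
  | cons c D => (c.len - 1) + D.excess

/-- The sign exponent `ε_g(i₁, …, i_r) = ∑_{l=1}^{r-1} (r - l)(i_l - 1)`, where `i_l` is the length
of the `l`-th block. -/
def eps {x y : O} : Blocks H x y → ℤ
  | nil _ => 0
  | cons c D => D.num * (c.len - 1) + D.eps

/-- The Koszul sign exponent of `f_{i₁} ⊗ ⋯ ⊗ f_{i_r}` applied to `c₁ ⊗ ⋯ ⊗ c_r`, where `f_i` has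
degree `i - 1`: it is `∑_{j < l} (i_l - 1) |c_j|`. -/
def koszul {x y : O} : Blocks H x y → ℤ
  | nil _ => 0
  | cons c D => D.excess * c.deg + D.koszul

/-- The chain `(f(c₁), …, f(c_r))`, where `f` is a family of operations whose value on chains of
length `i` has degree `i - 1`. -/
def image {O' : Type u} {H' : O' → O' → ℤ → ModuleCat.{u} K} {o : O → O'}
    (f : ∀ {x y : O}, Chain H x y → ∀ d, H' (o x) (o y) d) {x y : O} :
    Blocks H x y → Chain H' (o x) (o y)
  | nil x => Chain.nil (o x)
  | cons c D => Chain.cons (c.deg + c.len - 1) (f c _) (image f D)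

/-- Put the element `a` into the first block (and return the value of `φ` there); `0` if there is
no first block. -/
def extendHead {M : Type u} [AddCommMonoid M] {x y z : O} (d : ℤ) (a : H x y d)
    (φ : Blocks H x z → M) : Blocks H y z → M
  | nil _ => 0
  | cons c D => φ (cons (Chain.cons d a c) D)

end Blocks

/-- `∑ φ (c₁, …, c_r)` over all ways to write the chain as a concatenation of nonempty chains
`c₁ ⋯ c_r`, `r ≥ 0`: the first element is a block by itself or joins the first block of a
decomposition of the rest. -/
def Chain.sumBlocks {M : Type u} [AddCommMonoid M] {x y : O} :
    Chain H x y → (Blocks H x y → M) → M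
  | nil x, φ => φ (Blocks.nil x)
  | cons d a c, φ =>
      sumBlocks c fun D => φ (Blocks.cons (cons d a (nil _)) D) + D.extendHead d a φ

end Chains

/-- A strictly unital (small) `A_∞`-category over the field `K`, in homological grading: graded
vector spaces `Hom x y` (`Hom x y d` is the part of degree `d`), multiplications
`m_k : Hom x₀ x₁ ⊗ ⋯ ⊗ Hom x_{k-1} x_k ⟶ Hom x₀ x_k` of degree `k - 2` for `k ≥ 1`, given as
multilinear functions of chains, and identities. `mul c d` is the component of `m_k(c)` in degree
`d`; it vanishes unless `d = |c| + k - 2`. (There is no `m_0`; `mul` is `0` on empty chains.) -/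
structure AInftyCat (K : Type u) [Field K] : Type (u + 1) where
  Ob : Type u
  Hom : Ob → Ob → ℤ → ModuleCat.{u} K
  mul : ∀ {x y : Ob}, Chain Hom x y → ∀ d : ℤ, Hom x y d
  mul_degree : ∀ {x y : Ob} (c : Chain Hom x y) (d : ℤ), d ≠ c.deg + c.len - 2 → mul c d = 0
  mul_nil : ∀ (x : Ob) (d : ℤ), mul (Chain.nil x) d = 0
  mul_multilinear : ∀ (x y : Ob) (d : ℤ), Chain.IsMultilinear fun c : Chain Hom x y => mul c d
  /-- The relation `∑_{r+s+t=k} (-1)^{r+st} m_{r+1+t}(id^r ⊗ m_s ⊗ id^t) = 0`, evaluated on a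
  chain; the Koszul rule gives the additional sign `(-1)^{(s-2)|p|}`. -/
  relation : ∀ {x y : Ob} (c : Chain Hom x y) (d : ℤ),
    c.sumMid (fun _ _ p q t =>
      (-1 : K) ^ ((p.len + q.len * t.len : ℤ) + (q.len - 2) * p.deg) •
        mul (p.append (Chain.cons (q.deg + q.len - 2) (mul q _) t)) d) = 0
  one : ∀ x : Ob, Hom x x 0
  /-- `1_x` is a cycle. -/
  mul_one_one : ∀ (x : Ob) (d : ℤ), mul (Chain.cons 0 (one x) (Chain.nil x)) d = 0
  one_mul : ∀ {x y : Ob} (d : ℤ) (a : Hom x y d),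
    mul (Chain.cons 0 (one x) (Chain.cons d a (Chain.nil y))) d = a
  mul_one : ∀ {x y : Ob} (d : ℤ) (a : Hom x y d),
    mul (Chain.cons d a (Chain.cons 0 (one y) (Chain.nil y))) d = a
  /-- `m_k(id^{j-1} ⊗ u ⊗ id^{k-j}) = 0` for `k > 2`. -/
  mul_unit : ∀ {x y z : Ob} (p : Chain Hom x y) (t : Chain Hom y z) (d : ℤ),
    2 < p.len + 1 + t.len → mul (p.append (Chain.cons 0 (one y) t)) d = 0

/-- A (strictly unital) `A_∞`-functor: an object map and multilinear operations `f_k`, `k ≥ 1`, of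
degree `k - 1`. `app c d` is the component of `f_k(c)` in degree `d`. -/
structure AInftyFunctor {K : Type u} [Field K] (A B : AInftyCat K) : Type u where
  obj : A.Ob → B.Ob
  app : ∀ {x y : A.Ob}, Chain A.Hom x y → ∀ d : ℤ, B.Hom (obj x) (obj y) d
  app_degree : ∀ {x y : A.Ob} (c : Chain A.Hom x y) (d : ℤ), d ≠ c.deg + c.len - 1 → app c d = 0
  app_nil : ∀ (x : A.Ob) (d : ℤ), app (Chain.nil x) d = 0
  app_multilinear : ∀ (x y : A.Ob) (d : ℤ),
    Chain.IsMultilinear fun c : Chain A.Hom x y => app c d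
  /-- The relation
  `∑ (-1)^{r+st} f_{r+1+t}(id^r ⊗ m_s ⊗ id^t) = ∑ (-1)^{ε_g(i₁,…,i_r)} m_r(f_{i₁} ⊗ ⋯ ⊗ f_{i_r})`,
  evaluated on a chain (with Koszul signs). -/
  relation : ∀ {x y : A.Ob} (c : Chain A.Hom x y) (d : ℤ),
    c.sumMid (fun _ _ p q t =>
      (-1 : K) ^ ((p.len + q.len * t.len : ℤ) + (q.len - 2) * p.deg) •
        app (p.append (Chain.cons (q.deg + q.len - 2) (A.mul q _) t)) d) =
    c.sumBlocks (fun D => (-1 : K) ^ (D.eps + D.koszul) • B.mul (D.image app) d)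
  app_one : ∀ x : A.Ob, app (Chain.cons 0 (A.one x) (Chain.nil x)) 0 = B.one (obj x)
  /-- `f_k(id^{j-1} ⊗ u ⊗ id^{k-j}) = 0` for `k > 1`. -/
  app_unit : ∀ {x y z : A.Ob} (p : Chain A.Hom x y) (t : Chain A.Hom y z) (d : ℤ),
    1 < p.len + 1 + t.len → app (p.append (Chain.cons 0 (A.one y) t)) d = 0

section Lemmas

set_option linter.unusedSectionVars false

variable {K : Type u} [Field K] {O : Type u} {H : O → O → ℤ → ModuleCat.{u} K}
variable {M N : Type u} [AddCommGroup M] [Module K M] [AddCommGroup N] [Module K N]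

theorem sg_add (a b : ℤ) : (-1 : K) ^ (a + b) = (-1) ^ a * (-1) ^ b :=
  zpow_add₀ (neg_ne_zero.mpr one_ne_zero) a b

theorem sg_congr {a b : ℤ} (h : Even (a - b)) : (-1 : K) ^ a = (-1) ^ b := by
  have : a = b + (a - b) := by ring
  rw [this, sg_add, h.neg_one_zpow, mul_one]

namespace Chain

@[simp] theorem nil_append {x y : O} (q : Chain H x y) : (nil x).append q = q := rfl

@[simp] theorem cons_append {x y z w : O} (d : ℤ) (a : H x y d) (p : Chain H y z)
    (q : Chain H z w) : (cons d a p).append q = cons d a (p.append q) := rfl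

@[simp] theorem append_nil {x y : O} (p : Chain H x y) : p.append (nil y) = p := by
  induction p with
  | nil => rfl
  | cons d a c ih => simp [ih]

theorem append_assoc {x y z w : O} (p : Chain H x y) (q : Chain H y z) (t : Chain H z w) :
    (p.append q).append t = p.append (q.append t) := by
  induction p with
  | nil => rfl
  | cons d a c ih => simp [ih]

@[simp] theorem len_nil (x : O) : (nil x : Chain H x x).len = 0 := rfl
@[simp] theorem len_cons {x y z : O} (d : ℤ) (a : H x y d) (c : Chain H y z) :
    (cons d a c).len = c.len + 1 := rfl
@[simp] theorem deg_nil (x : O) : (nil x : Chain H x x).deg = 0 := rfl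
@[simp] theorem deg_cons {x y z : O} (d : ℤ) (a : H x y d) (c : Chain H y z) :
    (cons d a c).deg = d + c.deg := rfl

@[simp] theorem len_append {x y z : O} (p : Chain H x y) (q : Chain H y z) :
    (p.append q).len = p.len + q.len := by
  induction p with
  | nil => simp
  | cons d a c ih => simp [ih]; omega

@[simp] theorem deg_append {x y z : O} (p : Chain H x y) (q : Chain H y z) :
    (p.append q).deg = p.deg + q.deg := by
  induction p with
  | nil => simp
  | cons d a c ih => simp [ih]; ring

/-- The weight `∑ (k - i) d_i`. -/
def wt {x y : O} : Chain H x y → ℤ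
  | nil _ => 0
  | cons d _ c => c.len * d + c.wt

theorem wt_append {x y z : O} (p : Chain H x y) (q : Chain H y z) :
    (p.append q).wt = p.wt + q.len * p.deg + q.wt := by
  induction p with
  | nil => simp [wt]
  | cons d a c ih => simp [wt, ih]; ring

theorem sumSplit_congr {x y : O} (c : Chain H x y)
    {φ ψ : ∀ z, Chain H x z → Chain H z y → M}
    (h : ∀ z p q, p.append q = c → φ z p q = ψ z p q) : c.sumSplit φ = c.sumSplit ψ := by
  induction c with
  | nil => exact h _ _ _ rfl
  | cons d a c ih =>
    simp only [sumSplit]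
    congr 1
    · exact h _ _ _ rfl
    · exact ih fun z p q e => h _ _ _ (by simp [e])

theorem sumMid_congr {x y : O} (c : Chain H x y)
    {φ ψ : ∀ z w, Chain H x z → Chain H z w → Chain H w y → M}
    (h : ∀ z w p q t, p.append (q.append t) = c → φ z w p q t = ψ z w p q t) :
    c.sumMid φ = c.sumMid ψ := by
  induction c with
  | nil => rfl
  | cons d a c ih =>
    simp only [sumMid]
    congr 1
    · exact sumSplit_congr _ fun z p q e => h _ _ _ _ _ (by simp [e])
    · exact ih fun z w p q t e => h _ _ _ _ _ (by simp [e])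

theorem sumSplit_add {x y : O} (c : Chain H x y) (φ ψ : ∀ z, Chain H x z → Chain H z y → M) :
    (c.sumSplit fun z p q => φ z p q + ψ z p q) = c.sumSplit φ + c.sumSplit ψ := by
  induction c with
  | nil => rfl
  | cons d a c ih =>
    simp only [sumSplit, ih]
    abel

theorem sumSplit_map {x y : O} (L : M →ₗ[K] N) (c : Chain H x y)
    (φ : ∀ z, Chain H x z → Chain H z y → M) :
    L (c.sumSplit φ) = c.sumSplit fun z p q => L (φ z p q) := by
  induction c with
  | nil => rfl
  | cons d a c ih => simp only [sumSplit, ih, map_add]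

theorem sumSplit_smul {x y : O} (k : K) (c : Chain H x y)
    (φ : ∀ z, Chain H x z → Chain H z y → M) :
    k • (c.sumSplit φ) = c.sumSplit fun z p q => k • (φ z p q) :=
  sumSplit_map (LinearMap.lsmul K M k) c φ

theorem sumSplit_zero {x y : O} (c : Chain H x y) :
    (c.sumSplit fun _ _ _ => (0 : M)) = 0 := by
  induction c with
  | nil => rfl
  | cons d a c ih => simp [sumSplit, ih]

theorem sumSplit_assoc {x y : O} (c : Chain H x y)
    (φ : ∀ z w, Chain H x z → Chain H z w → Chain H w y → M) :
    (c.sumSplit fun w r t => r.sumSplit fun z p q => φ z w p q t) =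
      c.sumSplit fun z p r => r.sumSplit fun w q t => φ z w p q t := by
  induction c with
  | nil => rfl
  | cons d a c ih =>
    simp only [sumSplit, sumSplit_add]
    rw [add_assoc]
    congr 1
    congr 1
    exact ih fun z w p q t => φ z w (cons d a p) q t

theorem sumMid_map {x y : O} (L : M →ₗ[K] N) (c : Chain H x y)
    (φ : ∀ z w, Chain H x z → Chain H z w → Chain H w y → M) :
    L (c.sumMid φ) = c.sumMid fun z w p q t => L (φ z w p q t) := by
  induction c with
  | nil => simp [sumMid]
  | cons d a c ih => simp only [sumMid, ih, map_add, sumSplit_map]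

theorem sumMid_smul {x y : O} (k : K) (c : Chain H x y)
    (φ : ∀ z w, Chain H x z → Chain H z w → Chain H w y → M) :
    k • (c.sumMid φ) = c.sumMid fun z w p q t => k • (φ z w p q t) :=
  sumMid_map (LinearMap.lsmul K M k) c φ

theorem sumMid_add {x y : O} (c : Chain H x y)
    (φ ψ : ∀ z w, Chain H x z → Chain H z w → Chain H w y → M) :
    (c.sumMid fun z w p q t => φ z w p q t + ψ z w p q t) = c.sumMid φ + c.sumMid ψ := by
  induction c with
  | nil => simp [sumMid]
  | cons d a c ih => simp only [sumMid, ih, sumSplit_add]; abel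

theorem sumMid_zero {x y : O} (c : Chain H x y) :
    (c.sumMid fun _ _ _ _ _ => (0 : M)) = 0 := by
  induction c with
  | nil => rfl
  | cons d a c ih => simp [sumMid, ih, sumSplit_zero]

end Chain

namespace Blocks

/-- The concatenation of all blocks. -/
def join {x y : O} : Blocks H x y → Chain H x y
  | nil x => Chain.nil x
  | cons c D => c.append D.join

end Blocks

namespace Chain

theorem sumBlocks_congr {x y : O} (c : Chain H x y) {φ ψ : Blocks H x y → M}
    (h : ∀ D, D.join = c → φ D = ψ D) : c.sumBlocks φ = c.sumBlocks ψ := by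
  induction c with
  | nil => exact h _ rfl
  | cons d a c ih =>
    simp only [sumBlocks]
    refine ih fun D e => ?_
    congr 1
    · exact h _ (by simp [Blocks.join, e])
    · cases D with
      | nil => rfl
      | cons b D => exact h _ (by simpa [Blocks.join] using e)

theorem sumBlocks_add {x y : O} (c : Chain H x y) (φ ψ : Blocks H x y → M) :
    (c.sumBlocks fun D => φ D + ψ D) = c.sumBlocks φ + c.sumBlocks ψ := by
  induction c with
  | nil => rfl
  | cons d a c ih =>
    simp only [sumBlocks, ← ih]
    refine sumBlocks_congr _ fun D _ => ?_
    cases D <;> simp only [Blocks.extendHead] <;> abel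

theorem sumBlocks_map {x y : O} (L : M →ₗ[K] N) (c : Chain H x y) (φ : Blocks H x y → M) :
    L (c.sumBlocks φ) = c.sumBlocks fun D => L (φ D) := by
  induction c with
  | nil => rfl
  | cons d a c ih =>
    simp only [sumBlocks, ih]
    refine sumBlocks_congr _ fun D _ => ?_
    cases D <;> simp [Blocks.extendHead]

theorem sumBlocks_smul {x y : O} (k : K) (c : Chain H x y) (φ : Blocks H x y → M) :
    k • (c.sumBlocks φ) = c.sumBlocks fun D => k • φ D :=
  sumBlocks_map (LinearMap.lsmul K M k) c φ

theorem sumBlocks_zero {x y : O} (c : Chain H x y) :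
    (c.sumBlocks fun _ => (0 : M)) = 0 := by
  simpa using (sumBlocks_map (0 : M →ₗ[K] M) c (fun _ => 0)).symm

/-- Summation over the first block. -/
theorem sumBlocks_cons {x y z : O} (d : ℤ) (a : H x y d) (c : Chain H y z)
    (φ : Blocks H x z → M) :
    (cons d a c).sumBlocks φ = c.sumSplit fun _ p q =>
      q.sumBlocks fun D => φ (Blocks.cons (cons d a p) D) := by
  induction c generalizing x d with
  | nil => simp [sumBlocks, sumSplit, Blocks.extendHead]
  | cons e b c ih =>
    rw [sumBlocks, sumBlocks_add]
    simp only [sumSplit]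
    congr 1
    exact ih e b fun D => D.extendHead d a φ

theorem sumBlocks_single {x y : O} (c : Chain H x y) (φ : Blocks H x y → M)
    (h0 : 0 < c.len) (h : ∀ D : Blocks H x y, D.join = c → D.num ≠ 1 → φ D = 0) :
    c.sumBlocks φ = φ (Blocks.cons c (Blocks.nil y)) := by
  induction c with
  | nil => simp at h0
  | cons d a c ih =>
    cases c with
    | nil => simp [sumBlocks, Blocks.extendHead]
    | cons e b c =>
      rw [sumBlocks, ih _ (by simp)]
      · simp only [Blocks.extendHead]
        rw [h _ (by simp [Blocks.join]) (by simp [Blocks.num]), zero_add]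
      · intro D hj hD
        cases D with
        | nil => cases hj
        | cons f D =>
          simp only [Blocks.extendHead]
          rw [h _ (by simpa [Blocks.join] using hj) (by simp [Blocks.num]),
            h _ (by simpa [Blocks.join] using hj) (by simpa [Blocks.num] using hD), zero_add]

/-- The decomposition into blocks of length one. -/
def singles {x y : O} : Chain H x y → Blocks H x y
  | nil x => Blocks.nil x
  | cons d a c => Blocks.cons (cons d a (nil _)) c.singles

theorem sumBlocks_singles {x y : O} (c : Chain H x y) (φ : Blocks H x y → M)
    (h : ∀ D : Blocks H x y, D.join = c → D.num < c.len → φ D = 0) :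
    c.sumBlocks φ = φ c.singles := by
  induction c with
  | nil => rfl
  | cons d a c ih =>
    rw [sumBlocks, ih]
    · cases c with
      | nil => simp [singles, Blocks.extendHead]
      | cons e b c =>
        have num_singles : ∀ {x y : O} (c : Chain H x y), c.singles.num = c.len := by
          intro x y c
          induction c with
          | nil => rfl
          | cons d a c ih => simp [singles, Blocks.num, ih]
        have join_singles : ∀ {x y : O} (c : Chain H x y), c.singles.join = c := by
          intro x y c
          induction c with
          | nil => rfl
          | cons d a c ih => simp [singles, Blocks.join, ih]
        simp only [singles, Blocks.extendHead]
        rw [h (Blocks.cons (cons d a (cons e b (nil _))) c.singles)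
          (by simp [Blocks.join, join_singles]) (by simp [Blocks.num, num_singles]), add_zero]
    · intro D hj hD
      rw [h _ (by simp [Blocks.join, hj]) (by simpa [Blocks.num] using hD), zero_add]
      cases D with
      | nil => rfl
      | cons f D =>
        exact h _ (by simpa [Blocks.join] using hj)
          (by simp only [Blocks.num, len_cons] at hD ⊢; omega)

namespace IsMultilinear

theorem cons {x y z : O} {φ : Chain H x z → M} (h : Chain.IsMultilinear φ) (d : ℤ) (a : H x y d) :
    Chain.IsMultilinear fun c : Chain H y z => φ (Chain.cons d a c) :=
  fun z w p e t => h z w (Chain.cons d a p) e t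

theorem head {x y z : O} {φ : Chain H x z → M} (h : Chain.IsMultilinear φ) (d : ℤ)
    (t : Chain H y z) : IsLinearMap K fun a : H x y d => φ (Chain.cons d a t) :=
  h _ _ (nil x) d t

end IsMultilinear

end Chain

end Lemmas
section Bar

set_option linter.unusedSectionVars false

open Chain

variable {K : Type u} [Field K] {O O' O'' : Type u}
variable {H : O → O → ℤ → ModuleCat.{u} K} {H' : O' → O' → ℤ → ModuleCat.{u} K}
variable {H'' : O'' → O'' → ℤ → ModuleCat.{u} K}
variable {M : Type u} [AddCommGroup M] [Module K M]

/-- Insertion of an operation of degree `k - 2` in all places of a chain, with the signs of the bar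
construction. -/
def barD (b : ∀ {x y : O}, Chain H x y → ∀ d, H x y d) {x y : O} (Φ : Chain H x y → M)
    (c : Chain H x y) : M :=
  c.sumMid fun _ _ p q t => (-1 : K) ^ (p.deg + p.len) •
    Φ (p.append (cons (q.deg + q.len - 2) (b q _) t))

/-- Application of a family of operations to all decompositions of a chain. -/
def barT {o : O → O'} (f : ∀ {x y : O}, Chain H x y → ∀ d, H' (o x) (o y) d) {x y : O}
    (Φ : Chain H' (o x) (o y) → M) (c : Chain H x y) : M :=
  c.sumBlocks fun D => Φ (D.image f)

theorem barD_cons (b : ∀ {x y : O}, Chain H x y → ∀ d, H x y d) {x y z : O}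
    (Φ : Chain H x z → M) (d : ℤ) (a : H x y d) (c : Chain H y z) :
    barD b Φ (cons d a c) = (c.sumSplit fun _ q t =>
        Φ (cons ((cons d a q).deg + (cons d a q).len - 2) (b (cons d a q) _) t)) +
      (-1 : K) ^ (d + 1) • barD b (fun c => Φ (cons d a c)) c := by
  simp only [barD, sumMid]
  congr 1
  · simp
  · rw [sumMid_smul]
    refine sumMid_congr _ fun _ _ p q t _ => ?_
    rw [smul_smul, ← sg_add]
    simp only [deg_cons, len_cons, cons_append]
    congr 2
    push_cast
    ring1

theorem barD_nil (b : ∀ {x y : O}, Chain H x y → ∀ d, H x y d) {x : O}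
    (Φ : Chain H x x → M) : barD b Φ (nil x) = 0 := rfl

theorem barD_congr (b : ∀ {x y : O}, Chain H x y → ∀ d, H x y d) {x y : O}
    {Φ Ψ : Chain H x y → M} (c : Chain H x y) (h : ∀ c, 0 < c.len → Φ c = Ψ c) :
    barD b Φ c = barD b Ψ c :=
  sumMid_congr _ fun _ _ p q t _ => by rw [h _ (by simp)]

theorem barD_zero (b : ∀ {x y : O}, Chain H x y → ∀ d, H x y d) {x y : O} (c : Chain H x y) :
    barD b (fun _ => (0 : M)) c = 0 := by
  simp [barD, sumMid_zero]

theorem barD_zero_fun (b : ∀ {x y : O}, Chain H x y → ∀ d, H x y d) {x y : O} :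
    barD b (fun _ : Chain H x y => (0 : M)) = fun _ => 0 :=
  funext fun c => barD_zero b c

theorem barD_add (b : ∀ {x y : O}, Chain H x y → ∀ d, H x y d) {x y : O}
    (Φ Ψ : Chain H x y → M) (c : Chain H x y) :
    barD b (fun c => Φ c + Ψ c) c = barD b Φ c + barD b Ψ c := by
  simp only [barD, smul_add, sumMid_add]

/-- The Leibniz rule. -/
theorem barD_sumSplit (b : ∀ {x y : O}, Chain H x y → ∀ d, H x y d) {x y : O}
    (c : Chain H x y) (Θ : ∀ z, Chain H x z → Chain H z y → M) :
    barD b (fun c => c.sumSplit Θ) c = c.sumSplit fun z p q =>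
      barD b (fun p => Θ z p q) p + (-1 : K) ^ (p.deg + p.len) • barD b (Θ z p) q := by
  induction c with
  | nil => simp [sumSplit, barD_nil]
  | cons d a c ih =>
    rw [barD_cons]
    simp only [sumSplit, sumSplit_add, barD_add, smul_add]
    rw [ih fun z p q => Θ z (cons d a p) q]
    simp only [barD_nil, zero_add, deg_nil, len_nil, Nat.cast_zero, add_zero, zpow_zero, one_smul]
    rw [barD_cons]
    simp only [barD_cons, sumSplit_add, smul_add, sumSplit_smul, smul_smul, ← sg_add]
    have e : ∀ (z : O) (p : Chain H _ z), d + 1 + (p.deg + (p.len : ℤ)) =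
        (cons d a p).deg + (cons d a p).len := by
      intro z p
      simp; ring
    simp only [e]
    have := sumSplit_assoc c fun z w q t s => Θ w
      (cons ((cons d a q).deg + (cons d a q).len - 2) (b (cons d a q) _) t) s
    rw [this]
    abel

variable {o : O → O'} (f : ∀ {x y : O}, Chain H x y → ∀ d, H' (o x) (o y) d)

theorem barT_cons {x y z : O} (Φ : Chain H' (o x) (o z) → M) (d : ℤ) (a : H x y d)
    (c : Chain H y z) :
    barT f Φ (cons d a c) = c.sumSplit fun _ p q => barT f (fun v =>
      Φ (cons ((cons d a p).deg + (cons d a p).len - 1) (f (cons d a p) _) v)) q := by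
  rw [barT, sumBlocks_cons]
  rfl

/-- Compatibility of the application of a family of operations with the splitting of chains. -/
theorem barT_split : ∀ (n : ℕ) {x y : O} (c : Chain H x y), c.len ≤ n →
    ∀ (Θ : ∀ z', Chain H' (o x) z' → Chain H' z' (o y) → M),
    barT f (fun v => v.sumSplit Θ) c =
      c.sumSplit fun z p q => barT f (fun u => barT f (fun v => Θ (o z) u v) q) p := by
  intro n
  induction n with
  | zero =>
    intro x y c hc Θ
    cases c with
    | nil => rfl
    | cons d a c => simp at hc
  | succ n ih =>
    intro x y c hc Θ
    cases c with
    | nil => rfl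
    | cons d a c =>
      rw [barT_cons]
      simp only [sumSplit, barT_cons]
      have hb : ∀ {x y : O} (c : Chain H x y) (Φ Ψ : Chain H' (o x) (o y) → M),
          barT f (fun v => Φ v + Ψ v) c = barT f Φ c + barT f Ψ c := fun c Φ Ψ =>
        sumBlocks_add _ _ _
      simp only [hb, sumSplit_add]
      congr 1
      rw [sumSplit_assoc c fun z w p q t => barT f (fun v => barT f (fun s => Θ (o w)
        (cons ((cons d a p).deg + (cons d a p).len - 1) (f (cons d a p) _) v) s) t) q]
      refine sumSplit_congr _ fun z p q e => ?_
      refine ih q ?_ _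
      have := congrArg Chain.len e
      simp at this hc
      omega

theorem Blocks.image_deg_len {x y : O} (D : Blocks H x y) :
    (D.image f).deg + (D.image f).len = D.join.deg + D.join.len := by
  induction D with
  | nil => simp [Blocks.image, Blocks.join]
  | cons c D ih =>
    simp only [Blocks.image, Blocks.join, deg_cons, len_cons, deg_append, len_append]
    push_cast
    linarith

theorem barT_map {N : Type u} [AddCommGroup N] [Module K N] (L : M →ₗ[K] N) {x y : O}
    (Φ : Chain H' (o x) (o y) → M) (c : Chain H x y) :
    L (barT f Φ c) = barT f (fun v => L (Φ v)) c :=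
  sumBlocks_map L c _

theorem barT_add {x y : O} (c : Chain H x y) (Φ Ψ : Chain H' (o x) (o y) → M) :
    barT f (fun v => Φ v + Ψ v) c = barT f Φ c + barT f Ψ c :=
  sumBlocks_add _ _ _

theorem barT_smul {x y : O} (k : K) (c : Chain H x y) (Φ : Chain H' (o x) (o y) → M) :
    k • barT f Φ c = barT f (fun v => k • Φ v) c :=
  sumBlocks_smul _ _ _

theorem barT_zero {x y : O} (c : Chain H x y) :
    barT f (fun _ : Chain H' (o x) (o y) => (0 : M)) c = 0 :=
  sumBlocks_zero (K := K) _

/-- The function of the first entry used in summations over the first block. -/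
def headMap {x y z : O} (Φ : Chain H' (o x) (o z) → M) (hΦ : IsMultilinear Φ) (q : Chain H y z)
    (e : ℤ) : H' (o x) (o y) e →ₗ[K] M where
  toFun a := barT f (fun v => Φ (cons e a v)) q
  map_add' a a' := by
    rw [← barT_add]
    congr 1
    funext v
    exact (hΦ.head e v).map_add a a'
  map_smul' k a := by
    rw [RingHom.id_apply, barT_smul]
    congr 1
    funext v
    exact (hΦ.head e v).map_smul k a

theorem barT_eq_sumSplit (hf0 : ∀ x d, f (nil x) d = 0) {x z : O}
    (Φ : Chain H' (o x) (o z) → M) (hΦ : IsMultilinear Φ) (c : Chain H x z) (hc : 0 < c.len) :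
    barT f Φ c = c.sumSplit fun _ p q => headMap f Φ hΦ q (p.deg + p.len - 1) (f p _) := by
  cases c with
  | nil => simp at hc
  | cons d a c =>
    rw [barT_cons]
    simp only [sumSplit, hf0, map_zero, zero_add]
    rfl

theorem cons_index {x y : O} {z : O'} (Φ : Chain H' (o x) z → M) (c : Chain H x y)
    (v : Chain H' (o y) z) {e e' : ℤ} (h : e = e') :
    Φ (cons e (f c e) v) = Φ (cons e' (f c e') v) := by
  subst h; rfl

theorem barT_barD_split (hf0 : ∀ x d, f (nil x) d = 0)
    (b' : ∀ {x y : O'}, Chain H' x y → ∀ d, H' x y d) (hb0 : ∀ x d, b' (nil x) d = 0) {x z : O}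
    (Φ : Chain H' (o x) (o z) → M) (hΦ : IsMultilinear Φ) (c : Chain H x z) (hc : 0 < c.len) :
    barT f (barD b' Φ) c =
      barT f (fun v => v.sumSplit fun _ u t => Φ (cons (u.deg + u.len - 2) (b' u _) t)) c +
      c.sumSplit fun _ p q => (-1 : K) ^ (p.deg + p.len) •
        barT f (barD b' fun v => Φ (cons (p.deg + p.len - 1) (f p _) v)) q := by
  cases c with
  | nil => simp at hc
  | cons d a c =>
    rw [barT_cons, barT_cons]
    have h1 : ∀ (v : Chain H' (o x) (o z)),
        Φ (cons ((nil (o x) : Chain H' _ _).deg + (nil (o x) : Chain H' _ _).len - 2)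
          (b' (nil (o x)) _) v) = 0 := by
      intro v
      rw [hb0]
      exact (hΦ.head _ v).map_zero
    have h2 : ∀ (v : Chain H' (o x) (o z)),
        Φ (cons ((nil x : Chain H _ _).deg + (nil x : Chain H _ _).len - 1)
          (f (nil x) _) v) = 0 := by
      intro v
      rw [hf0]
      exact (hΦ.head _ v).map_zero
    simp only [sumSplit, h1, h2, zero_add, barD_zero_fun, barT_zero, smul_zero]
    rw [← sumSplit_add]
    refine sumSplit_congr _ fun w p q _ => ?_
    rw [barT_smul, ← barT_add]
    congr 1
    funext v
    rw [barD_cons]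
    congr 2
    ring_nf

theorem barT_barD (hf0 : ∀ x d, f (nil x) d = 0)
    (b : ∀ {x y : O}, Chain H x y → ∀ d, H x y d)
    (b' : ∀ {x y : O'}, Chain H' x y → ∀ d, H' x y d) (hb0 : ∀ x d, b' (nil x) d = 0)
    (hrel : ∀ {x y : O} (c : Chain H x y) (d : ℤ),
      barD b (fun c => f c d) c = barT f (fun v => b' v d) c) :
    ∀ (n : ℕ) {x y : O} (c : Chain H x y), c.len ≤ n → ∀ (Φ : Chain H' (o x) (o y) → M),
      IsMultilinear Φ → barD b (barT f Φ) c = barT f (barD b' Φ) c := by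
  intro n
  induction n with
  | zero =>
    intro x y c hc Φ _
    cases c with
    | nil => rfl
    | cons d a c => simp at hc
  | succ n ih =>
    intro x y c hc Φ hΦ
    rcases Nat.eq_zero_or_pos c.len with h0 | hpos
    · cases c with
      | nil => rfl
      | cons d a c => simp at h0
    rw [barD_congr b c fun c hc => barT_eq_sumSplit f hf0 Φ hΦ c hc, barD_sumSplit,
      barT_barD_split f hf0 b' hb0 Φ hΦ c hpos, barT_split f _ c le_rfl, sumSplit_add]
    congr 1
    · refine sumSplit_congr _ fun z p q _ => ?_
      trans headMap f Φ hΦ q (p.deg + p.len - 2)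
        (barD b (fun c => f c (p.deg + p.len - 2)) p)
      · rw [barD, barD, sumMid_map]
        refine sumMid_congr _ fun _ _ p' q' t' e => ?_
        rw [map_smul]
        congr 1
        refine sumBlocks_congr _ fun D _ => ?_
        refine cons_index f Φ _ _ ?_
        subst e
        simp
        ring
      · rw [hrel, barT_map]
        refine sumBlocks_congr _ fun E e => ?_
        have := Blocks.image_deg_len f E
        rw [e] at this
        rw [← this]
        rfl
    · refine sumSplit_congr _ fun z p q e => ?_
      congr 1
      cases p with
      | nil =>
        simp only [hf0, map_zero]
        have h2 : ∀ (v : Chain H' (o x) (o y)),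
            Φ (cons ((nil x : Chain H _ _).deg + (nil x : Chain H _ _).len - 1)
              (0 : H' (o x) (o x) _) v) = 0 := fun v => (hΦ.head _ v).map_zero
        simp only [h2, barD_zero_fun, barT_zero]
      | cons d a p =>
        refine ih q ?_ _ (hΦ.cons _ _)
        have := congrArg Chain.len e
        simp at this
        omega

variable {o' : O' → O''} (g : ∀ {x y : O'}, Chain H' x y → ∀ d, H'' (o' x) (o' y) d)

theorem barT_barT (hg0 : ∀ x d, g (nil x) d = 0) :
    ∀ (n : ℕ) {x y : O} (c : Chain H x y), c.len ≤ n →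
    ∀ (Φ : Chain H'' (o' (o x)) (o' (o y)) → M), IsMultilinear Φ →
      barT f (barT (o := o') g Φ) c =
        barT (o := fun x => o' (o x)) (fun c d => barT f (fun v => g v d) c) Φ c := by
  intro n
  induction n with
  | zero =>
    intro x y c hc Φ _
    cases c with
    | nil => rfl
    | cons d a c => simp at hc
  | succ n ih =>
    intro x y c hc Φ hΦ
    rcases Nat.eq_zero_or_pos c.len with h0 | hpos
    · cases c with
      | nil => rfl
      | cons d a c => simp at h0
    rw [barT_eq_sumSplit (o := fun x => o' (o x)) (fun c d => barT f (fun v => g v d) c)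
      (fun x d => hg0 _ _) Φ hΦ c hpos]
    trans barT f (fun v => v.sumSplit fun _ u t =>
      headMap g Φ hΦ t (u.deg + u.len - 1) (g u _)) c
    · refine sumBlocks_congr _ fun D e => ?_
      refine barT_eq_sumSplit g hg0 Φ hΦ _ ?_
      cases D with
      | nil => subst e; simp [Blocks.join] at hpos
      | cons c D => simp [Blocks.image]
    · rw [barT_split f _ c le_rfl]
      refine sumSplit_congr _ fun z p q e => ?_
      cases p with
      | nil =>
        trans (0 : M)
        · trans barT f (fun _ : Chain H' (o x) (o y) => (0 : M)) q
          · change barT f (fun t => headMap g Φ hΦ t _ (g (nil (o x)) _)) q = _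
            congr 1
            funext t
            rw [hg0]
            exact (headMap g Φ hΦ t _).map_zero
          · exact barT_zero (K := K) (M := M) f q
        · symm
          change headMap (o := fun x => o' (o x)) (fun c d => barT f (fun v => g v d) c) Φ hΦ q _
            (g (nil (o x)) _) = 0
          rw [hg0]
          exact LinearMap.map_zero _
      | cons d a p =>
        rw [barT_map]
        refine sumBlocks_congr _ fun E e' => ?_
        have := Blocks.image_deg_len f E
        rw [e'] at this
        rw [← this]
        refine ih q ?_ _ (hΦ.cons _ _)
        have := congrArg Chain.len e
        simp at this
        omega

end Bar
section Signs

set_option linter.unusedSectionVars false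

open Chain

variable {K : Type u} [Field K] {O O' : Type u}
variable {H : O → O → ℤ → ModuleCat.{u} K} {H' : O' → O' → ℤ → ModuleCat.{u} K}
variable {M : Type u} [AddCommGroup M] [Module K M]

theorem isLinearMap_add {V : Type u} [AddCommGroup V] [Module K V] {φ ψ : V → M}
    (h : IsLinearMap K φ) (h' : IsLinearMap K ψ) : IsLinearMap K fun a => φ a + ψ a :=
  (h.mk' + h'.mk').isLinear

theorem isLinearMap_smul {V : Type u} [AddCommGroup V] [Module K V] {φ : V → M} (k : K)
    (h : IsLinearMap K φ) : IsLinearMap K fun a => k • φ a :=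
  (k • h.mk').isLinear

theorem isLinearMap_zero {V : Type u} [AddCommGroup V] [Module K V] :
    IsLinearMap K fun _ : V => (0 : M) :=
  (0 : V →ₗ[K] M).isLinear

theorem sumSplit_isLinearMap {V : Type u} [AddCommGroup V] [Module K V] {x y : O}
    (c : Chain H x y) (Θ : V → ∀ z, Chain H x z → Chain H z y → M)
    (h : ∀ z p q, IsLinearMap K fun a => Θ a z p q) :
    IsLinearMap K fun a => c.sumSplit (Θ a) := by
  induction c with
  | nil => exact h _ _ _
  | cons d a c ih =>
    simp only [sumSplit]
    exact isLinearMap_add (h _ _ _) (ih _ fun z p q => h _ _ _)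

theorem sumSplit_insert_isLinearMap {x z w y : O} (p : Chain H x z) (d : ℤ) (t : Chain H w y)
    (Θ : ∀ z, Chain H x z → Chain H z y → M)
    (h1 : ∀ v (t₁ : Chain H w v) (q : Chain H v y),
      IsLinearMap K fun a : H z w d => Θ v (p.append (cons d a t₁)) q)
    (h2 : ∀ v (p₁ : Chain H x v) (p₂ : Chain H v z), p₁.append p₂ = p →
      IsLinearMap K fun a : H z w d => Θ v p₁ (p₂.append (cons d a t))) :
    IsLinearMap K fun a : H z w d => (p.append (cons d a t)).sumSplit Θ := by
  induction p with
  | nil =>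
    simp only [nil_append, sumSplit]
    refine isLinearMap_add (h2 _ (nil _) (nil _) rfl) (sumSplit_isLinearMap _ _ fun v p q => ?_)
    exact h1 v p q
  | cons e b p ih =>
    simp only [cons_append, sumSplit]
    refine isLinearMap_add (h2 _ (nil _) (cons e b p) rfl) (ih _ (fun v t₁ q => ?_)
      fun v p₁ p₂ hp => ?_)
    · exact h1 v t₁ q
    · exact h2 v (cons e b p₁) p₂ (by simp [hp])

theorem barT_isMultilinear {o : O → O'} (f : ∀ {x y : O}, Chain H x y → ∀ d, H' (o x) (o y) d)
    (hf0 : ∀ x d, f (nil x) d = 0)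
    (hf : ∀ x y d, IsMultilinear fun c : Chain H x y => f c d) :
    ∀ (n : ℕ) {x y : O} (Φ : Chain H' (o x) (o y) → M), IsMultilinear Φ →
      ∀ (z w : O) (p : Chain H x z) (d : ℤ) (t : Chain H w y), p.len ≤ n →
        IsLinearMap K fun a : H z w d => barT f Φ (p.append (cons d a t)) := by
  intro n
  induction n with
  | zero =>
    intro x y Φ hΦ z w p d t hp
    cases p with
    | cons e b p => simp at hp
    | nil =>
      simp only [nil_append, barT_cons]
      refine sumSplit_isLinearMap _ _ fun v p q => ?_
      exact ((headMap f Φ hΦ q (d + p.deg + (p.len + 1 : ℕ) - 1)).comp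
        (hf _ _ _ _ _ (nil _) d p).mk').isLinear
  | succ n ih =>
    intro x y Φ hΦ z w p d t hp
    simp only [fun a : H z w d => barT_eq_sumSplit f hf0 Φ hΦ (p.append (cons d a t)) (by simp)]
    refine sumSplit_insert_isLinearMap p d t _ (fun v t₁ q => ?_) fun v p₁ p₂ e => ?_
    · have : (fun a : H z w d => headMap f Φ hΦ q ((p.append (cons d a t₁)).deg +
          ((p.append (cons d a t₁)).len : ℤ) - 1) (f (p.append (cons d a t₁)) _)) =
          fun a => headMap f Φ hΦ q (p.deg + (d + t₁.deg) + (p.len + (t₁.len + 1) : ℕ) - 1)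
            (f (p.append (cons d a t₁)) _) := by
        funext a
        refine sumBlocks_congr _ fun D _ => cons_index f Φ _ _ ?_
        simp
      rw [this]
      exact ((headMap f Φ hΦ q _).comp (hf _ _ _ _ _ p d t₁).mk').isLinear
    · cases p₁ with
      | nil =>
        simp only [hf0, map_zero]
        exact isLinearMap_zero
      | cons e' b p₁ =>
        refine ih _ (hΦ.cons _ _) z w p₂ d t ?_
        have := congrArg Chain.len e
        simp at this
        omega

theorem len_image {o : O → O'} (f : ∀ {x y : O}, Chain H x y → ∀ d, H' (o x) (o y) d) {x y : O}
    (D : Blocks H x y) : (D.image f).len = D.num := by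
  induction D with
  | nil => rfl
  | cons c D ih => simp [Blocks.image, Blocks.num, ih]

theorem Blocks.excess_eq {x y : O} (D : Blocks H x y) : D.excess = D.join.len - D.num := by
  induction D with
  | nil => simp [excess, join, num]
  | cons c D ih =>
    simp only [excess, join, num, ih, len_append]
    push_cast
    ring

/-- The sum of the weights of the blocks. -/
def Blocks.wts {x y : O} : Blocks H x y → ℤ
  | nil _ => 0
  | cons c D => c.wt + D.wts

theorem Blocks.wt_parity {o : O → O'} (f : ∀ {x y : O}, Chain H x y → ∀ d, H' (o x) (o y) d)
    {x y : O} (D : Blocks H x y) :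
    Even ((D.image f).wt + D.wts - (D.join.wt + (D.eps + D.koszul))) := by
  induction D with
  | nil => simp [image, wts, join, eps, koszul, Chain.wt]
  | cons c D ih =>
    obtain ⟨k, hk⟩ := ih
    simp only [image, wts, join, eps, koszul, Chain.wt, len_image, wt_append, excess_eq]
    refine ⟨k + D.num * c.deg - D.join.len * c.deg, ?_⟩
    linear_combination hk

/-- The operation with its bar construction sign. -/
def hat {x y : O} (Φ : Chain H x y → M) (c : Chain H x y) : M := (-1 : K) ^ c.wt • Φ c

theorem hat_isMultilinear {x y : O} {Φ : Chain H x y → M} (h : IsMultilinear Φ) :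
    IsMultilinear (hat Φ) := by
  intro z w p d t
  simp only [hat, wt_append, wt, len_cons]
  exact isLinearMap_smul _ (h z w p d t)

theorem image_hat {o : O → O'} (f : ∀ {x y : O}, Chain H x y → ∀ d, H' (o x) (o y) d) {x y : O}
    (D : Blocks H x y) (Ψ : Chain H' (o x) (o y) → M) (h : IsMultilinear Ψ) :
    Ψ (D.image fun c d => hat (fun c => f c d) c) = (-1 : K) ^ D.wts • Ψ (D.image f) := by
  induction D with
  | nil => simp [Blocks.image, Blocks.wts]
  | cons c D ih =>
    simp only [Blocks.image, Blocks.wts]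
    rw [hat, (h.head _ _).map_smul, ih (fun v => Ψ (cons _ _ v)) (h.cons _ _), smul_smul, sg_add]

theorem wt_image_hat {o : O → O'} (f g : ∀ {x y : O}, Chain H x y → ∀ d, H' (o x) (o y) d)
    {x y : O} (D : Blocks H x y) : (D.image f).wt = (D.image g).wt := by
  induction D with
  | nil => rfl
  | cons c D ih => simp [Blocks.image, wt, ih, len_image]

theorem barT_hat {o : O → O'} (f : ∀ {x y : O}, Chain H x y → ∀ d, H' (o x) (o y) d) {x y : O}
    (Ψ : Chain H' (o x) (o y) → M) (h : IsMultilinear Ψ) (c : Chain H x y) :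
    barT (fun c d => hat (fun c => f c d) c) (hat Ψ) c =
      (-1 : K) ^ c.wt • c.sumBlocks fun D =>
        (-1 : K) ^ (D.eps + D.koszul) • Ψ (D.image f) := by
  rw [barT, sumBlocks_smul]
  refine sumBlocks_congr _ fun D e => ?_
  rw [hat, image_hat f D Ψ h, smul_smul, smul_smul, ← sg_add, ← sg_add,
    wt_image_hat _ f]
  congr 1
  refine sg_congr ?_
  rw [← e]
  exact D.wt_parity f

theorem barD_hat (b : ∀ {x y : O}, Chain H x y → ∀ d, H x y d) {x y : O}
    (Ψ : Chain H x y → M) (h : IsMultilinear Ψ) (c : Chain H x y) :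
    barD (fun c d => hat (fun c => b c d) c) (hat Ψ) c =
      (-1 : K) ^ c.wt • c.sumMid fun _ _ p q t =>
        (-1 : K) ^ ((p.len + q.len * t.len : ℤ) + (q.len - 2) * p.deg) •
          Ψ (p.append (cons (q.deg + q.len - 2) (b q _) t)) := by
  rw [barD, sumMid_smul]
  refine sumMid_congr _ fun _ _ p q t e => ?_
  simp only [hat]
  rw [(h _ _ p _ t).map_smul, smul_smul, smul_smul, smul_smul, ← sg_add, ← sg_add, ← sg_add]
  congr 1
  refine sg_congr ?_
  rw [← e]
  simp only [wt_append, wt, len_cons, len_append]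
  refine ⟨p.deg * (2 - q.len) - t.len, ?_⟩
  push_cast
  ring

end Signs

namespace AInftyFunctor

open Chain

variable {K : Type u} [Field K]

theorem ext' {A B : AInftyCat K} {f g : AInftyFunctor A B} (h : f.obj = g.obj)
    (h' : ∀ (x y : A.Ob) (c : Chain A.Hom x y) (d : ℤ), HEq (f.app c d) (g.app c d)) : f = g := by
  obtain ⟨fo, fa, _, _, _, _, _, _⟩ := f
  obtain ⟨go, ga, _, _, _, _, _, _⟩ := g
  dsimp only at h
  subst h
  have : @fa = @ga := by
    funext x y c d
    exact eq_of_heq (h' x y c d)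
  subst this
  rfl

/-- The composition `g ∘ f`, with
`(g ∘ f)_k = ∑_{i₁+⋯+i_r=k} (-1)^{ε_g(i₁,…,i_r)} g_r(f_{i₁} ⊗ ⋯ ⊗ f_{i_r})`. -/
def compApp {A B C : AInftyCat K} (f : AInftyFunctor A B) (g : AInftyFunctor B C) {x y : A.Ob}
    (c : Chain A.Hom x y) (d : ℤ) : C.Hom (g.obj (f.obj x)) (g.obj (f.obj y)) d :=
  c.sumBlocks fun D => (-1 : K) ^ (D.eps + D.koszul) • g.app (D.image f.app) d

section

variable {A B C : AInftyCat K} (f : AInftyFunctor A B) (g : AInftyFunctor B C)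

/-- The operations of an `A_∞`-functor with the signs of the bar construction. -/
def bar {x y : A.Ob} (c : Chain A.Hom x y) (d : ℤ) : B.Hom (f.obj x) (f.obj y) d :=
  hat (fun c => f.app c d) c

/-- The operations of an `A_∞`-category with the signs of the bar construction. -/
def _root_.AInf.AInftyCat.bar (A : AInftyCat K) {x y : A.Ob} (c : Chain A.Hom x y) (d : ℤ) :
    A.Hom x y d :=
  hat (fun c => A.mul c d) c

theorem hat_inj {O : Type u} {H : O → O → ℤ → ModuleCat.{u} K} {x y : O}
    (c : Chain H x y) {M : Type u} [AddCommGroup M] [Module K M] {v w : M}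
    (h : (-1 : K) ^ c.wt • v = (-1 : K) ^ c.wt • w) : v = w :=
  smul_right_injective M (zpow_ne_zero c.wt (neg_ne_zero.mpr (one_ne_zero (α := K)))) h

theorem bar_nil (x : A.Ob) (d : ℤ) : f.bar (nil x) d = 0 := by simp [bar, hat, f.app_nil]

theorem bar_relation {x y : A.Ob} (c : Chain A.Hom x y) (d : ℤ) :
    barD A.bar (fun c => f.bar c d) c = barT f.bar (fun v => B.bar v d) c := by
  refine (barD_hat A.mul (fun c => f.app c d) (f.app_multilinear _ _ _) c).trans ?_
  rw [f.relation]
  exact (barT_hat f.app (fun v => B.mul v d) (B.mul_multilinear _ _ _) c).symm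

theorem bar_compApp {x y : A.Ob} (c : Chain A.Hom x y) (d : ℤ) :
    hat (fun c => compApp f g c d) c = barT f.bar (fun v => g.bar v d) c :=
  (barT_hat f.app (fun v => g.app v d) (g.app_multilinear _ _ _) c).symm

theorem hat_hat {O : Type u} {H : O → O → ℤ → ModuleCat.{u} K} {x y : O}
    {M : Type u} [AddCommGroup M] [Module K M] (Φ : Chain H x y → M) : hat (hat Φ) = Φ := by
  funext c
  rw [hat, hat, smul_smul, ← sg_add, Even.neg_one_zpow ⟨_, rfl⟩, one_smul]

theorem compApp_eq {x y : A.Ob} (d : ℤ) :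
    (fun c : Chain A.Hom x y => compApp f g c d) =
      hat (fun c => barT f.bar (fun v => g.bar v d) c) := by
  rw [← hat_hat (fun c : Chain A.Hom x y => compApp f g c d)]
  congr 1
  funext c
  exact bar_compApp f g c d

theorem compApp_multilinear (x y : A.Ob) (d : ℤ) :
    IsMultilinear fun c : Chain A.Hom x y => compApp f g c d := by
  rw [compApp_eq]
  refine hat_isMultilinear fun z w p e t => ?_
  exact barT_isMultilinear f.bar f.bar_nil
    (fun x y d => hat_isMultilinear (f.app_multilinear x y d)) _ _
    (hat_isMultilinear (g.app_multilinear _ _ d)) z w p e t le_rfl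

theorem compApp_relation {x y : A.Ob} (c : Chain A.Hom x y) (d : ℤ) :
    c.sumMid (fun _ _ p q t =>
      (-1 : K) ^ ((p.len + q.len * t.len : ℤ) + (q.len - 2) * p.deg) •
        compApp f g (p.append (cons (q.deg + q.len - 2) (A.mul q _) t)) d) =
    c.sumBlocks (fun D => (-1 : K) ^ (D.eps + D.koszul) •
      C.mul (D.image (o := fun x => g.obj (f.obj x)) (compApp f g)) d) := by
  refine hat_inj c ?_
  refine (barD_hat A.mul (fun c => compApp f g c d) (compApp_multilinear f g x y d) c).symm.trans ?_
  refine Eq.trans ?_ (barT_hat (o := fun x => g.obj (f.obj x)) (compApp f g)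
    (fun v => C.mul v d) (C.mul_multilinear _ _ _) c)
  have e1 : hat (fun c : Chain A.Hom x y => compApp f g c d) =
      barT f.bar (fun v => g.bar v d) := funext fun c => bar_compApp f g c d
  have e2 : (fun {x y} (c : Chain A.Hom x y) (d : ℤ) => hat (fun c => compApp f g c d) c) =
      fun {x y} c d => barT f.bar (fun v => g.bar v d) c := by
    funext x y c d
    exact bar_compApp f g c d
  rw [e1]
  change barD A.bar _ c = _
  refine (barT_barD f.bar f.bar_nil A.bar B.bar
    (fun x d => by simp [AInftyCat.bar, hat, B.mul_nil])
    f.bar_relation _ c le_rfl _ (hat_isMultilinear (g.app_multilinear _ _ d))).trans ?_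
  change barT f.bar (barD B.bar fun v => g.bar v d) c = _
  have e3 : barD B.bar (fun v : Chain B.Hom (f.obj x) (f.obj y) => g.bar v d) =
      barT g.bar (fun w => C.bar w d) := funext fun v => g.bar_relation v d
  rw [e3]
  refine (barT_barT f.bar g.bar g.bar_nil _ c le_rfl _
    (hat_isMultilinear (C.mul_multilinear _ _ d))).trans ?_
  refine congrArg (fun F : (∀ {x y : A.Ob}, Chain A.Hom x y → ∀ d, C.Hom (g.obj (f.obj x))
    (g.obj (f.obj y)) d) => barT (o := fun x => g.obj (f.obj x)) F _ c) ?_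
  exact e2.symm

end

end AInftyFunctor
section Strict

set_option linter.unusedSectionVars false

open Chain

variable {K : Type u} [Field K] {O : Type u} {H : O → O → ℤ → ModuleCat.{u} K}

/-- The element of a chain of length one, in the given degree; `0` for other chains. -/
def Chain.entry {x y : O} : Chain H x y → ∀ d : ℤ, H x y d
  | cons e a (nil _), d => if h : e = d then h ▸ a else 0
  | _, _ => 0

theorem Chain.entry_single {x y : O} (d : ℤ) (a : H x y d) : (cons d a (nil y)).entry d = a := by
  simp [entry]

theorem Chain.entry_of_len_ne {x y : O} (c : Chain H x y) (h : c.len ≠ 1) (d : ℤ) :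
    c.entry d = 0 := by
  cases c with
  | nil => rfl
  | cons e a c =>
    cases c with
    | nil => simp at h
    | cons e' b c => rfl

theorem Chain.entry_degree {x y : O} (c : Chain H x y) (d : ℤ) (h : d ≠ c.deg + c.len - 1) :
    c.entry d = 0 := by
  cases c with
  | nil => rfl
  | cons e a c =>
    cases c with
    | nil =>
      have : ¬ e = d := by
        rintro rfl
        simp at h
      simp [entry, this]
    | cons e' b c => rfl

theorem Chain.entry_multilinear (x y : O) (d : ℤ) :
    IsMultilinear fun c : Chain H x y => c.entry d := by
  intro z w p e t
  by_cases hp : (p.len + (t.len + 1)) = 1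
  · cases p with
    | cons e' b p => simp only [len_cons] at hp; omega
    | nil =>
      cases t with
      | cons e' b p => simp only [len_cons, len_nil] at hp; omega
      | nil =>
        simp only [nil_append, entry]
        split_ifs with h
        · subst h
          exact LinearMap.id.isLinear
        · exact isLinearMap_zero
  · have : ∀ a : H z w e, (p.append (cons e a t)).entry d = 0 := fun a =>
      entry_of_len_ne _ (by simpa using hp) d
    simp only [this]
    exact isLinearMap_zero

variable {M : Type u} [AddCommGroup M] [Module K M]

theorem Chain.sumSplit_last {x y : O} (c : Chain H x y) (φ : ∀ z, Chain H x z → Chain H z y → M)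
    (h : ∀ z p q, 0 < q.len → φ z p q = 0) : c.sumSplit φ = φ y c (nil y) := by
  induction c with
  | nil => rfl
  | cons d a c ih =>
    rw [sumSplit, h _ _ _ (by simp), zero_add, ih _ fun z p q hq => h _ _ _ hq]

theorem Chain.sumMid_zero' {x y : O} (c : Chain H x y)
    (φ : ∀ z w, Chain H x z → Chain H z w → Chain H w y → M)
    (h : ∀ z w p q t, φ z w p q t = 0) : c.sumMid φ = 0 := by
  rw [sumMid_congr (K := K) c (ψ := fun _ _ _ _ _ => 0) fun _ _ _ _ _ _ => h _ _ _ _ _]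
  exact sumMid_zero (K := K) c

theorem Chain.sumMid_whole {x y : O} (c : Chain H x y) (hc : 0 < c.len)
    (φ : ∀ z w, Chain H x z → Chain H z w → Chain H w y → M)
    (h : ∀ z w p q t, 0 < p.len + t.len → φ z w p q t = 0) :
    c.sumMid φ = φ x y (nil x) c (nil y) := by
  cases c with
  | nil => simp at hc
  | cons d a c =>
    rw [sumMid, sumSplit_last (K := K), sumMid_zero' (K := K), add_zero]
    · intro z w p q t
      exact h _ _ _ _ _ (by simp)
    · intro z p q hq
      exact h _ _ _ _ _ (by simpa using hq)

end Strict

namespace AInftyFunctor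

open Chain

variable {K : Type u} [Field K]

/-- Data of a strict functor: an object map and graded linear maps. (If these commute with all
multiplications and preserve the identities, `Strict.toFunctor` is the corresponding `A_∞`-functor
`f`, with `f_k = 0` for `k > 1`.) -/
structure Strict (A B : AInftyCat K) where
  obj : A.Ob → B.Ob
  map : ∀ x y d, A.Hom x y d →ₗ[K] B.Hom (obj x) (obj y) d

/-- The image of a chain under a strict functor. -/
def Strict.mapChain {A B : AInftyCat K} (φ : Strict A B) {x y : A.Ob} :
    Chain A.Hom x y → Chain B.Hom (φ.obj x) (φ.obj y)
  | Chain.nil x => Chain.nil (φ.obj x)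
  | Chain.cons d a c => Chain.cons d (φ.map _ _ d a) (mapChain φ c)

/-- The operations of a strict functor. -/
def Strict.app {A B : AInftyCat K} (φ : Strict A B) {x y : A.Ob} (c : Chain A.Hom x y) (d : ℤ) :
    B.Hom (φ.obj x) (φ.obj y) d :=
  φ.map x y d (c.entry d)

theorem cons_index' {O O' : Type u} {H : O → O → ℤ → ModuleCat.{u} K}
    {H' : O' → O' → ℤ → ModuleCat.{u} K} {o : O → O'}
    (f : ∀ {x y : O}, Chain H x y → ∀ d, H' (o x) (o y) d) {x y : O} {z : O'} (c : Chain H x y)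
    (v : Chain H' (o y) z) {e e' : ℤ} (h : e = e') :
    Chain.cons e (f c e) v = Chain.cons e' (f c e') v := by
  subst h; rfl

theorem Strict.image_singles {A B : AInftyCat K} (φ : Strict A B) {x y : A.Ob}
    (c : Chain A.Hom x y) : c.singles.image φ.app = φ.mapChain c := by
  induction c with
  | nil => rfl
  | cons d a c ih =>
    simp only [singles, Blocks.image, mapChain, ih]
    rw [cons_index' φ.app _ _ (e' := d) (by simp), Strict.app, entry_single]

theorem eps_singles {O : Type u} {H : O → O → ℤ → ModuleCat.{u} K} {x y : O} (c : Chain H x y) :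
    c.singles.eps + c.singles.koszul = 0 := by
  have h : ∀ {x y : O} (c : Chain H x y), c.singles.excess = 0 := by
    intro x y c
    induction c with
    | nil => rfl
    | cons d a c ih => simp [singles, Blocks.excess, ih]
  induction c with
  | nil => rfl
  | cons d a c ih =>
    simp only [singles, Blocks.eps, Blocks.koszul, h]
    simpa using ih

theorem multilinear_zero {O O' : Type u} {H : O → O → ℤ → ModuleCat.{u} K}
    {H' : O' → O' → ℤ → ModuleCat.{u} K} {o : O → O'} {M : Type u} [AddCommGroup M] [Module K M]
    (f : ∀ {x y : O}, Chain H x y → ∀ d, H' (o x) (o y) d)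
    (hf : ∀ {x y : O} (c : Chain H x y) (d : ℤ), c.len ≠ 1 → f c d = 0) {x y : O}
    (D : Blocks H x y) (h : D.num < D.join.len) (Φ : Chain H' (o x) (o y) → M)
    (hΦ : IsMultilinear Φ) : Φ (D.image f) = 0 := by
  induction D with
  | nil => simp [Blocks.num, Blocks.join] at h
  | cons c D ih =>
    simp only [Blocks.image]
    by_cases hc : c.len = 1
    · refine ih ?_ (fun v => Φ (cons _ _ v)) (hΦ.cons _ _)
      simp only [Blocks.num, Blocks.join, len_append, hc] at h
      omega
    · rw [hf _ _ hc]
      exact (hΦ.head _ _).map_zero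

theorem Strict.sumBlocks_app {A B : AInftyCat K} (φ : Strict A B) {M : Type u} [AddCommGroup M]
    [Module K M] {x y : A.Ob} (Φ : Chain B.Hom (φ.obj x) (φ.obj y) → M) (hΦ : IsMultilinear Φ)
    (c : Chain A.Hom x y) :
    (c.sumBlocks fun D => (-1 : K) ^ (D.eps + D.koszul) • Φ (D.image φ.app)) =
      Φ (φ.mapChain c) := by
  rw [sumBlocks_singles (K := K), φ.image_singles, eps_singles, zpow_zero, one_smul]
  intro D e hD
  rw [multilinear_zero φ.app (fun c d h => by simp [Strict.app, entry_of_len_ne c h]) D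
    (by rwa [e]) Φ hΦ, smul_zero]

/-- The `A_∞`-functor of a strict functor. -/
def Strict.toFunctor {A B : AInftyCat K} (φ : Strict A B)
    (hm : ∀ {x y : A.Ob} (c : Chain A.Hom x y) (d : ℤ),
      φ.map x y d (A.mul c d) = B.mul (φ.mapChain c) d)
    (h1 : ∀ x, φ.map x x 0 (A.one x) = B.one (φ.obj x)) : AInftyFunctor A B where
  obj := φ.obj
  app := φ.app
  app_degree c d h := by rw [Strict.app, entry_degree c d h, map_zero]
  app_nil x d := by simp [Strict.app, entry]
  app_multilinear x y d z w p e t :=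
    ((φ.map x y d).comp (Chain.entry_multilinear x y d z w p e t).mk').isLinear
  relation c d := by
    rw [φ.sumBlocks_app _ (B.mul_multilinear _ _ d) c, ← hm]
    rcases Nat.eq_zero_or_pos c.len with h0 | hpos
    · cases c with
      | nil => simp [sumMid, A.mul_nil]
      | cons d a c => simp at h0
    · rw [sumMid_whole (K := K) c hpos]
      · simp only [nil_append, len_nil, deg_nil, Strict.app]
        have : (cons (c.deg + c.len - 2) (A.mul c (c.deg + c.len - 2)) (nil _)).entry d =
            A.mul c d := by
          by_cases h : d = c.deg + c.len - 2
          · subst h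
            exact entry_single _ _
          · rw [A.mul_degree c d h]
            exact entry_degree _ _ (by simpa using h)
        rw [this]
        simp
      · intro z w p q t h
        rw [Strict.app, entry_of_len_ne, map_zero, smul_zero]
        simp only [len_append, len_cons]
        omega
  app_one x := by rw [Strict.app, entry_single, h1]
  app_unit p t d h := by
    rw [Strict.app, entry_of_len_ne, map_zero]
    simp only [len_append, len_cons]
    omega

section

variable {A B C : AInftyCat K}

theorem sumSplit_insert_zero {O : Type u} {H : O → O → ℤ → ModuleCat.{u} K}
    {M : Type u} [AddCommGroup M] [Module K M] {x z w y : O} (p : Chain H x z) (d : ℤ)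
    (a : H z w d) (t : Chain H w y) (Θ : ∀ z, Chain H x z → Chain H z y → M)
    (h1 : ∀ v (t₁ : Chain H w v) (q : Chain H v y), t₁.append q = t →
      Θ v (p.append (cons d a t₁)) q = 0)
    (h2 : ∀ v (p₁ : Chain H x v) (p₂ : Chain H v z), p₁.append p₂ = p →
      Θ v p₁ (p₂.append (cons d a t)) = 0) :
    (p.append (cons d a t)).sumSplit Θ = 0 := by
  induction p with
  | nil =>
    simp only [nil_append, sumSplit]
    refine (congrArg₂ (· + ·) (h2 _ (nil _) (nil _) rfl) ?_).trans (add_zero 0)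
    exact (sumSplit_congr (K := K) t (ψ := fun _ _ _ => 0) fun v p q e => h1 v p q e).trans
      (sumSplit_zero (K := K) t)
  | cons e b p ih =>
    simp only [cons_append, sumSplit]
    refine (congrArg₂ (· + ·) (h2 _ (nil _) (cons e b p) rfl) ?_).trans (add_zero 0)
    exact ih _ _ (fun v t₁ q e => h1 v t₁ q e) fun v p₁ p₂ hp => h2 v (cons _ b p₁) p₂ (by simp [hp])

variable (f : AInftyFunctor A B) (g : AInftyFunctor B C)

theorem bar_one (x : A.Ob) : f.bar (cons 0 (A.one x) (nil x)) 0 = B.one (f.obj x) := by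
  simp [bar, hat, wt, f.app_one]

theorem bar_unit {x y z : A.Ob} (p : Chain A.Hom x y) (t : Chain A.Hom y z) (d : ℤ)
    (h : 0 < p.len + t.len) : f.bar (p.append (cons 0 (A.one y) t)) d = 0 := by
  rw [bar, hat, f.app_unit p t d (by omega), smul_zero]

theorem headMap_one {M : Type u} [AddCommGroup M] [Module K M] {x z : A.Ob}
    (Φ : Chain B.Hom (f.obj x) (f.obj z) → M) (hΦ : IsMultilinear Φ) (q : Chain A.Hom x z)
    (e : ℤ) (he : e = 0) :
    headMap f.bar Φ hΦ q e (f.bar (cons 0 (A.one x) (nil x)) e) =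
      barT f.bar (fun v => Φ (cons 0 (B.one (f.obj x)) v)) q := by
  subst he
  rw [bar_one]
  rfl

theorem barT_unit {M : Type u} [AddCommGroup M] [Module K M] : ∀ (n : ℕ) {x y z : A.Ob}
    (p : Chain A.Hom x y) (t : Chain A.Hom y z), p.len < n →
    ∀ (Φ : Chain B.Hom (f.obj x) (f.obj z) → M), IsMultilinear Φ →
      (∀ (w : B.Ob) (p' : Chain B.Hom (f.obj x) w) (t' : Chain B.Hom w (f.obj z)),
        (0 < p.len + t.len → 0 < p'.len + t'.len) →
          Φ (p'.append (cons 0 (B.one w) t')) = 0) →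
      barT f.bar Φ (p.append (cons 0 (A.one y) t)) = 0 := by
  intro n
  induction n with
  | zero =>
    intro x y z p t hp
    simp at hp
  | succ n ih =>
    intro x y z p t hp Φ hΦ h
    rw [barT_eq_sumSplit f.bar f.bar_nil Φ hΦ _ (by simp)]
    refine sumSplit_insert_zero _ _ _ _ _ (fun v t₁ q e => ?_) fun v p₁ p₂ e => ?_
    · rcases Nat.eq_zero_or_pos (p.len + t₁.len) with h0 | hpos
      · cases p with
        | cons e' b p => simp at h0
        | nil =>
          cases t₁ with
          | cons e' b t₁ => simp at h0
          | nil =>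
            rw [nil_append, headMap_one f Φ hΦ _ _ (by simp)]
            rw [barT, sumBlocks_congr (K := K) q (ψ := fun _ => 0)]
            · exact sumBlocks_zero (K := K) q
            · intro D hD
              refine h _ (nil _) _ fun hlen => ?_
              simp only [len_nil, zero_add] at hlen ⊢
              rw [nil_append] at e
              subst e
              rw [len_image]
              cases D with
              | nil => subst hD; simp [Blocks.join] at hlen
              | cons => simp [Blocks.num]
      · rw [f.bar_unit _ _ _ hpos, map_zero]
    · cases p₁ with
      | nil => rw [bar_nil, map_zero]
      | cons e' b p₁ =>
        have hl := congrArg Chain.len e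
        simp only [len_append, len_cons] at hl
        refine ih p₂ t (by omega) _ (hΦ.cons _ _) fun w p' t' _ => ?_
        exact h w (cons ((cons e' b p₁).deg + (cons e' b p₁).len - 1) (f.bar (cons e' b p₁) _) p')
          t' fun _ => by simp

/-- Composition of `A_∞`-functors. -/
def comp : AInftyFunctor A C where
  obj x := g.obj (f.obj x)
  app := compApp f g
  app_degree c d h := by
    rw [compApp, sumBlocks_congr (K := K) c (ψ := fun _ => 0)]
    · exact sumBlocks_zero (K := K) c
    · intro D e
      have := D.image_deg_len f.app
      rw [g.app_degree _ _ (by rw [this, e]; exact h), smul_zero]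
  app_nil x d := by simp [compApp, sumBlocks, Blocks.image, g.app_nil]
  app_multilinear := compApp_multilinear f g
  relation := compApp_relation f g
  app_one x := by
    simp only [compApp, sumBlocks, Blocks.image, Blocks.extendHead, add_zero]
    rw [cons_index' f.app _ _ (e' := 0) (by simp), f.app_one, g.app_one]
    simp [Blocks.eps, Blocks.koszul, Blocks.num, Blocks.excess]
  app_unit {x y z} p t d h := by
    rw [congrFun (compApp_eq f g d) (p.append (cons 0 (A.one y) t)), hat]
    refine (congrArg _ (barT_unit f _ p t (Nat.lt_succ_self _) _
      (hat_isMultilinear (g.app_multilinear _ _ d)) ?_)).trans (smul_zero _)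
    intro w p' t' h'
    exact g.bar_unit _ _ _ (h' (by omega))

/-- The identity functor. -/
def id (A : AInftyCat K) : AInftyFunctor A A :=
  Strict.toFunctor ⟨fun x => x, fun _ _ _ => LinearMap.id⟩
    (fun c d => by
      have : ∀ {x y : A.Ob} (c : Chain A.Hom x y),
          Strict.mapChain (A := A) (B := A) ⟨fun x => x, fun _ _ _ => LinearMap.id⟩ c = c := by
        intro x y c
        induction c with
        | nil => rfl
        | cons d a c ih => simp [Strict.mapChain, ih]
      rw [this]; rfl)
    (fun _ => rfl)

theorem mapChain_id (A : AInftyCat K) {x y : A.Ob} (c : Chain A.Hom x y) :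
    Strict.mapChain (A := A) (B := A) ⟨fun x => x, fun _ _ _ => LinearMap.id⟩ c = c := by
  induction c with
  | nil => rfl
  | cons d a c ih => simp [Strict.mapChain, ih]

theorem toFunctor_comp_app (φ : Strict A B) (hm h1) {x y : A.Ob} (c : Chain A.Hom x y) (d : ℤ) :
    (comp (φ.toFunctor hm h1) g).app c d = g.app (φ.mapChain c) d :=
  φ.sumBlocks_app (fun v => g.app v d) (g.app_multilinear _ _ d) c

theorem sumBlocks_strict (φ : Strict B C) {x y : A.Ob} (c : Chain A.Hom x y) (d : ℤ) :
    (c.sumBlocks fun D => (-1 : K) ^ (D.eps + D.koszul) • φ.app (D.image f.app) d) =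
      φ.map _ _ d (f.app c d) := by
  rcases Nat.eq_zero_or_pos c.len with h0 | hpos
  · cases c with
    | nil =>
      rw [app_nil, map_zero]
      simp [sumBlocks, Blocks.image, Strict.app, entry]
    | cons d a c => simp at h0
  · rw [sumBlocks_single (K := K) c _ hpos fun D e hD => by
      rw [Strict.app, entry_of_len_ne _ (by rwa [len_image]), map_zero, smul_zero]]
    simp only [Blocks.eps, Blocks.koszul, Blocks.num, Blocks.excess, Blocks.image, Strict.app]
    by_cases h : c.deg + c.len - 1 = d
    · rw [cons_index' f.app _ _ h, entry_single]
      simp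
    · rw [f.app_degree c d (fun e => h e.symm), entry_degree _ _ (by simpa using fun e => h e.symm)]
      simp

theorem comp_toFunctor_app (φ : Strict B C) (hm h1) {x y : A.Ob} (c : Chain A.Hom x y) (d : ℤ) :
    (comp f (φ.toFunctor hm h1)).app c d = φ.map _ _ d (f.app c d) :=
  sumBlocks_strict f φ c d

theorem comp_assoc {D : AInftyCat K} (h : AInftyFunctor C D) :
    comp (comp f g) h = comp f (comp g h) := by
  refine ext' rfl fun x y c d => heq_of_eq ?_
  refine hat_inj c ?_
  refine (bar_compApp (comp f g) h c d).trans (Eq.trans ?_ (bar_compApp f (comp g h) c d).symm)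
  have e2 : (fun {x y} (c : Chain A.Hom x y) (d : ℤ) => (comp f g).bar c d) =
      fun {x y} c d => barT f.bar (fun v => g.bar v d) c := by
    funext x y c d
    exact bar_compApp f g c d
  have e3 : (fun v : Chain B.Hom (f.obj x) (f.obj y) => (comp g h).bar v d) =
      barT g.bar (fun w => h.bar w d) := funext fun v => bar_compApp g h v d
  rw [e3]
  refine Eq.trans ?_ (barT_barT f.bar g.bar g.bar_nil _ c le_rfl _
    (hat_isMultilinear (h.app_multilinear _ _ d))).symm
  exact congrArg (fun F : (∀ {x y : A.Ob}, Chain A.Hom x y → ∀ d, C.Hom (g.obj (f.obj x))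
    (g.obj (f.obj y)) d) => barT (o := fun x => g.obj (f.obj x)) F _ c) e2

end

end AInftyFunctor

/-- The category of strictly unital `A_∞`-categories and `A_∞`-functors. -/
instance (K : Type u) [Field K] : Category (AInftyCat K) where
  Hom A B := AInftyFunctor A B
  id A := AInftyFunctor.id A
  comp f g := AInftyFunctor.comp f g
  id_comp f := AInftyFunctor.ext' rfl fun x y c d => heq_of_eq <| by
    refine (AInftyFunctor.toFunctor_comp_app f _ _ _ c d).trans ?_
    rw [AInftyFunctor.mapChain_id]
  comp_id f := AInftyFunctor.ext' rfl fun x y c d => heq_of_eq <|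
    AInftyFunctor.comp_toFunctor_app f _ _ _ c d
  assoc f g h := AInftyFunctor.comp_assoc f g h
section Simplex

open Chain

variable (K : Type u) [Field K]

/-- The vector space `K` if `p` holds, and `0` otherwise. -/
def condK (p : Prop) : Submodule K K where
  carrier := {k | ¬ p → k = 0}
  add_mem' ha hb h := by rw [ha h, hb h, add_zero]
  zero_mem' _ := rfl
  smul_mem' c x hx h := by rw [hx h, smul_zero]

theorem condK_ext {p : Prop} {a b : condK K p} (h : a.1 = b.1) : a = b := Subtype.ext h

/-- The inclusion of `condK p` in `condK q` when `p` implies `q`. -/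
def condKMap {p q : Prop} (h : p → q) : condK K p →ₗ[K] condK K q :=
  Submodule.inclusion fun _ hk hq => hk fun hp => hq (h hp)

/-- The complexes of morphisms of the dg-category `A_∞[Δⁿ]`: `K · (i, j)` in degree `0` if
`i ≤ j`, and `0` otherwise. -/
def simplexHom (n : ℕ) (i j : ULift.{u} (Fin (n + 1))) (d : ℤ) : ModuleCat.{u} K :=
  ModuleCat.of K (condK K (i.down ≤ j.down ∧ d = 0))

variable {K}

/-- The scalar by which an element of `A_∞[Δⁿ](i, j)` is a multiple of `(i, j)`. -/
def simplexVal {n : ℕ} {i j : ULift.{u} (Fin (n + 1))} {d : ℤ} : simplexHom K n i j d →ₗ[K] K :=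
  (condK K (i.down ≤ j.down ∧ d = 0)).subtype

/-- The product of the scalars of a chain of length two (`0` for all other chains). -/
def simplexCoeff {n : ℕ} {i j : ULift.{u} (Fin (n + 1))} : Chain (simplexHom K n) i j → K
  | cons _ a (cons _ b (nil _)) => simplexVal a * simplexVal b
  | _ => 0

theorem simplexVal_eq {n : ℕ} {i j : ULift.{u} (Fin (n + 1))} {d : ℤ}
    (a : simplexHom K n i j d) (h : ¬ (i.down ≤ j.down ∧ d = 0)) : simplexVal a = 0 :=
  Subtype.property (p := fun k : K => k ∈ condK K (i.down ≤ j.down ∧ d = 0)) a h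

theorem simplex_ext {n : ℕ} {i j : ULift.{u} (Fin (n + 1))} {d : ℤ}
    {a b : simplexHom K n i j d} (h : simplexVal a = simplexVal b) : a = b := condK_ext K h

theorem simplexCoeff_of_len {n : ℕ} {i j : ULift.{u} (Fin (n + 1))}
    (c : Chain (simplexHom K n) i j) (h : c.len ≠ 2) : simplexCoeff c = 0 := by
  match c with
  | nil _ => rfl
  | cons _ _ (nil _) => rfl
  | cons _ _ (cons _ _ (nil _)) => simp at h
  | cons _ _ (cons _ _ (cons _ _ _)) => rfl

theorem simplexCoeff_le {n : ℕ} {i j : ULift.{u} (Fin (n + 1))}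
    (c : Chain (simplexHom K n) i j) (h : ¬ i.down ≤ j.down) : simplexCoeff c = 0 := by
  match c with
  | nil _ => rfl
  | cons _ _ (nil _) => rfl
  | cons (y := k) d a (cons e b (nil _)) =>
    simp only [simplexCoeff]
    by_cases h1 : i.down ≤ k.down
    · rw [simplexVal_eq b fun h2 => h (h1.trans h2.1), mul_zero]
    · rw [simplexVal_eq a fun h2 => h1 h2.1, zero_mul]
  | cons _ _ (cons _ _ (cons _ _ _)) => rfl

theorem simplexCoeff_deg {n : ℕ} {i j : ULift.{u} (Fin (n + 1))}
    (c : Chain (simplexHom K n) i j) (h : c.deg ≠ 0) : simplexCoeff c = 0 := by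
  match c with
  | nil _ => rfl
  | cons _ _ (nil _) => rfl
  | cons d a (cons (y := k) e b (nil _)) =>
    simp only [simplexCoeff]
    by_cases h1 : d = 0
    · rw [simplexVal_eq b fun h2 => h (by simp [h1, h2.2]), mul_zero]
    · rw [simplexVal_eq a fun h2 => h1 h2.2, zero_mul]
  | cons _ _ (cons _ _ (cons _ _ _)) => rfl

/-- The multiplications of `A_∞[Δⁿ]`: `m₂((i, j) ⊗ (j, k)) = (i, k)`, and `m_k = 0` for `k ≠ 2`. -/
def simplexMul {n : ℕ} {i j : ULift.{u} (Fin (n + 1))} (c : Chain (simplexHom K n) i j) (d : ℤ) :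
    simplexHom K n i j d :=
  (⟨if d = 0 then simplexCoeff c else 0, fun h => by
    split_ifs with hd
    · exact simplexCoeff_le c fun h' => h ⟨h', hd⟩
    · rfl⟩ : condK K (i.down ≤ j.down ∧ d = 0))

theorem simplexVal_mul {n : ℕ} {i j : ULift.{u} (Fin (n + 1))} (c : Chain (simplexHom K n) i j)
    (d : ℤ) : simplexVal (simplexMul c d) = if d = 0 then simplexCoeff c else 0 := rfl

theorem simplexMul_of_coeff {n : ℕ} {i j : ULift.{u} (Fin (n + 1))}
    (c : Chain (simplexHom K n) i j) (d : ℤ) (h : simplexCoeff c = 0) : simplexMul c d = 0 :=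
  simplex_ext (by rw [simplexVal_mul, h, ite_self, map_zero])

theorem simplexCoeff_multilinear {n : ℕ} (i j : ULift.{u} (Fin (n + 1))) :
    IsMultilinear fun c : Chain (simplexHom K n) i j => simplexCoeff c := by
  intro z w p d t
  match p, t with
  | nil _, nil _ => exact isLinearMap_zero
  | nil _, cons e b (nil _) =>
    exact ⟨fun x y => by simp [simplexCoeff, map_add, add_mul],
      fun c x => by simp [simplexCoeff, map_smul, smul_eq_mul, mul_assoc]⟩
  | cons e b (nil _), nil _ =>
    exact ⟨fun x y => by simp [simplexCoeff, map_add, mul_add],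
      fun c x => by simp [simplexCoeff, map_smul, smul_eq_mul, mul_left_comm]⟩
  | nil _, cons e b (cons e' b' t) => exact isLinearMap_zero
  | cons e b (nil _), cons e' b' t => exact isLinearMap_zero
  | cons e b (cons e' b' p), t =>
    have : ∀ a, simplexCoeff ((cons e b (cons e' b' p)).append (cons d a t)) = 0 := fun a =>
      simplexCoeff_of_len _ (by simp only [len_append, len_cons]; omega)
    simp only [this]
    exact isLinearMap_zero

theorem simplexMul_multilinear {n : ℕ} (i j : ULift.{u} (Fin (n + 1))) (d : ℤ) :
    IsMultilinear fun c : Chain (simplexHom K n) i j => simplexMul c d := by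
  intro z w p e t
  have h := simplexCoeff_multilinear i j z w p e t
  refine ⟨fun x y => simplex_ext ?_, fun c x => simplex_ext ?_⟩
  · simp only [map_add, simplexVal_mul]
    split_ifs
    · exact h.map_add x y
    · rw [add_zero]
  · simp only [map_smul, smul_eq_mul, simplexVal_mul]
    split_ifs
    · exact h.map_smul c x
    · rw [mul_zero]

theorem simplex_relation {n : ℕ} {i j : ULift.{u} (Fin (n + 1))} (c : Chain (simplexHom K n) i j)
    (d : ℤ) :
    c.sumMid (fun _ _ p q t =>
      (-1 : K) ^ ((p.len + q.len * t.len : ℤ) + (q.len - 2) * p.deg) •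
        simplexMul (p.append (cons (q.deg + q.len - 2) (simplexMul q _) t)) d) = 0 := by
  by_cases hc : c.len = 3
  · match c with
    | cons d₁ a₁ (cons d₂ a₂ (cons d₃ a₃ (nil _))) =>
      have hz : ∀ {x y : ULift.{u} (Fin (n + 1))} (q : Chain (simplexHom K n) x y) (e : ℤ),
          q.len ≠ 2 → simplexMul q e = 0 := fun q e hq =>
        simplexMul_of_coeff _ _ (simplexCoeff_of_len q hq)
      simp only [sumMid, sumSplit]
      refine simplex_ext ?_
      simp only [nil_append, cons_append, map_add, map_smul, smul_eq_mul, simplexVal_mul,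
        simplexCoeff, len_cons, len_nil, deg_cons, deg_nil]
      by_cases hd : d = 0
      · by_cases h1 : d₁ = 0
        · by_cases h2 : d₂ = 0
          · by_cases h3 : d₃ = 0
            · subst h1 h2 h3 hd
              simp [mul_assoc]
            · have := simplexVal_eq a₃ fun h => h3 h.2
              simp [this]
          · have := simplexVal_eq a₂ fun h => h2 h.2
            simp [this]
        · have := simplexVal_eq a₁ fun h => h1 h.2
          simp [this]
      · simp [hd]
  · have : ∀ z w (p : Chain (simplexHom K n) i z) (q : Chain (simplexHom K n) z w)
        (t : Chain (simplexHom K n) w j), p.append (q.append t) = c → 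
        (-1 : K) ^ ((p.len + q.len * t.len : ℤ) + (q.len - 2) * p.deg) •
        simplexMul (p.append (cons (q.deg + q.len - 2) (simplexMul q _) t)) d = 0 := by
      intro z w p q t e
      have hl := congrArg Chain.len e
      simp only [len_append] at hl
      by_cases hq : q.len = 2
      · rw [simplexMul_of_coeff _ d (simplexCoeff_of_len _ _), smul_zero]
        simp only [len_append, len_cons]
        omega
      · rw [simplexMul_of_coeff q _ (simplexCoeff_of_len q hq),
          show simplexMul (p.append (cons (q.deg + q.len - 2) 0 t)) d = 0 from
            (simplexMul_multilinear i j d z w p _ t).map_zero, smul_zero]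
    rw [sumMid_congr (K := K) c (ψ := fun _ _ _ _ _ => 0) fun z w p q t e => this z w p q t e]
    exact sumMid_zero (K := K) c

variable (K)

/-- The generator `(i, i)` of `A_∞[Δⁿ](i, i)`. -/
def simplexOne {n : ℕ} (i : ULift.{u} (Fin (n + 1))) : simplexHom K n i i 0 :=
  (⟨1, fun h => absurd ⟨le_rfl, rfl⟩ h⟩ : condK K (i.down ≤ i.down ∧ (0 : ℤ) = 0))

/-- The dg-category `A_∞[Δⁿ]`. -/
def simplexCat (n : ℕ) : AInftyCat K where
  Ob := ULift.{u} (Fin (n + 1))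
  Hom := simplexHom K n
  mul c d := simplexMul c d
  mul_degree c d h := by
    refine simplex_ext ?_
    rw [simplexVal_mul, map_zero]
    split_ifs with hd
    · by_cases hl : c.len = 2
      · refine simplexCoeff_deg c fun h0 => h ?_
        rw [hl, h0, hd]; rfl
      · exact simplexCoeff_of_len c hl
    · rfl
  mul_nil x d := simplexMul_of_coeff _ _ rfl
  mul_multilinear i j d := simplexMul_multilinear i j d
  relation c d := simplex_relation c d
  one i := simplexOne K i
  mul_one_one x d := simplexMul_of_coeff _ _ rfl
  one_mul {x y} d a := by
    refine simplex_ext ?_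
    rw [simplexVal_mul]
    split_ifs with hd
    · exact _root_.one_mul (simplexVal a)
    · exact (simplexVal_eq a fun h => hd h.2).symm
  mul_one {x y} d a := by
    refine simplex_ext ?_
    rw [simplexVal_mul]
    split_ifs with hd
    · exact _root_.mul_one (simplexVal a)
    · exact (simplexVal_eq a fun h => hd h.2).symm
  mul_unit p t d h := simplexMul_of_coeff _ _ (simplexCoeff_of_len _ (by
    simp only [len_append, len_cons]; omega))

/-- The strict functor `A_∞[Δᵐ] ⟶ A_∞[Δⁿ]`, `(i, j) ↦ (f i, f j)`, of a monotone map `f`. -/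
def simplexStrict {m n : ℕ} (f : Fin (m + 1) →o Fin (n + 1)) :
    AInftyFunctor.Strict (simplexCat K m) (simplexCat K n) where
  obj i := ⟨f i.down⟩
  map _ _ _ := condKMap K fun h => ⟨f.monotone h.1, h.2⟩

theorem simplexStrict_val {m n : ℕ} (f : Fin (m + 1) →o Fin (n + 1)) {x y d}
    (a : simplexHom K m x y d) :
    simplexVal (K := K) (n := n) ((simplexStrict K f).map x y d a) = simplexVal a := rfl

theorem simplexStrict_coeff {m n : ℕ} (f : Fin (m + 1) →o Fin (n + 1)) {x y}
    (c : Chain (simplexHom K m) x y) :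
    simplexCoeff (K := K) (n := n) ((simplexStrict K f).mapChain c) = simplexCoeff c := by
  match c with
  | nil _ => rfl
  | cons _ _ (nil _) => rfl
  | cons d a (cons (y := k) e b (nil _)) => rfl
  | cons _ _ (cons _ _ (cons _ _ _)) => rfl

/-- The functor `A_∞[Δᵐ] ⟶ A_∞[Δⁿ]` of a monotone map. -/
def simplexMap {m n : ℕ} (f : Fin (m + 1) →o Fin (n + 1)) :
    AInftyFunctor (simplexCat K m) (simplexCat K n) :=
  (simplexStrict K f).toFunctor
    (fun c d => simplex_ext (by
      refine (simplexStrict_val K f _).trans ?_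
      refine (simplexVal_mul c d).trans ?_
      refine Eq.trans ?_ (simplexVal_mul _ d).symm
      exact congrArg (fun k => if d = 0 then k else 0) (simplexStrict_coeff K f c).symm))
    (fun _ => rfl)

/-- The cosimplicial `A_∞`-category `A_∞[Δ^•]`. -/
def cosimplicial : SimplexCategory ⥤ AInftyCat K where
  obj n := simplexCat K n.len
  map f := simplexMap K f.toOrderHom
  map_id _ := rfl
  map_comp f g := AInftyFunctor.ext' rfl fun _ _ c d => heq_of_eq
    (AInftyFunctor.comp_toFunctor_app (simplexMap K f.toOrderHom)
      (simplexStrict K g.toOrderHom) _ _ c d).symm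

/-- Faonte's simplicial `A_∞`-nerve: `N(𝒜)_n` is the set of `A_∞`-functors `A_∞[Δⁿ] ⟶ 𝒜`. -/
def simplicialNerve : AInftyCat K ⥤ SSet.{u} :=
  yoneda ⋙ (Functor.whiskeringLeft _ _ _).obj (cosimplicial K).op

end Simplex
section Quivers

variable (K : Type u) [Field K]

/-- `K`-linear quivers with set of vertices `O`. -/
abbrev KQuiver (O : Type u) : Type (u + 1) := O → O → ModuleCat.{u} K

/-- The unit quiver: `K` at `(a, a)`, and `0` at `(a, b)` with `a ≠ b`. -/
def unitQ (O : Type u) : KQuiver K O := fun a b => ModuleCat.of K (condK K (a = b))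

variable {K} {O : Type u}

/-- The value in `K` of an element of the unit quiver. -/
def unitVal {a b : O} : unitQ K O a b →ₗ[K] K := (condK K (a = b)).subtype

/-- The generator `1` of `unitQ K O a b` when `a = b`. -/
def unitOne {a b : O} (h : a = b) : unitQ K O a b :=
  (⟨1, fun h' => absurd h h'⟩ : condK K (a = b))

theorem unitVal_one {a b : O} (h : a = b) : unitVal (unitOne (K := K) h) = 1 := rfl

theorem unit_ext {a b : O} {x y : unitQ K O a b} (h : unitVal x = unitVal y) : x = y :=
  condK_ext K h

theorem unitVal_of_ne {a b : O} (x : unitQ K O a b) (h : a ≠ b) : unitVal x = 0 :=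
  Subtype.property (p := fun k : K => k ∈ condK K (a = b)) x h

/-- The tensor product of quivers: `(P ⊗ Q)(a, b) = ⨁ c, P(a, c) ⊗ Q(c, b)`. -/
def qtensor (P Q : KQuiver K O) : KQuiver K O :=
  fun a b => ModuleCat.of K (⨁ c, P a c ⊗[K] Q c b)

open Classical in
/-- The element `x ⊗ y` of the summand of index `c`. -/
def qtmul {P Q : KQuiver K O} {a b : O} (c : O) : P a c →ₗ[K] Q c b →ₗ[K] qtensor P Q a b :=
  (TensorProduct.mk K (P a c) (Q c b)).compr₂ (DirectSum.lof K O (fun c => P a c ⊗[K] Q c b) c)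

open Classical in
/-- The linear map on a tensor product given by bilinear maps `P(a, c) × Q(c, b) → M`. -/
def qlift {P Q : KQuiver K O} {a b : O} {M : Type u} [AddCommGroup M] [Module K M]
    (φ : ∀ c, P a c →ₗ[K] Q c b →ₗ[K] M) : qtensor P Q a b →ₗ[K] M :=
  DirectSum.toModule K O M fun c => TensorProduct.lift (φ c)

@[simp] theorem qlift_tmul {P Q : KQuiver K O} {a b : O} {M : Type u} [AddCommGroup M] [Module K M]
    (φ : ∀ c, P a c →ₗ[K] Q c b →ₗ[K] M) (c : O) (x : P a c) (y : Q c b) :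
    qlift φ (qtmul c x y) = φ c x y := by
  classical
  exact (DirectSum.toModule_lof (φ := fun c => TensorProduct.lift (φ c)) K c (x ⊗ₜ[K] y)).trans
    (TensorProduct.lift.tmul x y)

theorem q_ext {P Q : KQuiver K O} {a b : O} {M : Type u} [AddCommGroup M] [Module K M]
    {f g : qtensor P Q a b →ₗ[K] M} (h : ∀ c x y, f (qtmul c x y) = g (qtmul c x y)) : f = g := by
  classical
  refine DirectSum.linearMap_ext K fun c => TensorProduct.ext' fun x y => h c x y

/-- Quiver morphisms along a map `o` of vertices. -/
abbrev QHom {O O' : Type u} (o : O → O') (P : KQuiver K O) (P' : KQuiver K O') : Type u :=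
  ∀ a b, P a b →ₗ[K] P' (o a) (o b)

/-- The tensor product of quiver morphisms. -/
def qmap {O' : Type u} {o : O → O'} {P Q : KQuiver K O} {P' Q' : KQuiver K O'} (φ : QHom o P P')
    (ψ : QHom o Q Q') : QHom o (qtensor P Q) (qtensor P' Q') := fun a b =>
  qlift fun c => (qtmul (o c)).compl₁₂ (φ a c) (ψ c b)

@[simp] theorem qmap_tmul {O' : Type u} {o : O → O'} {P Q : KQuiver K O} {P' Q' : KQuiver K O'}
    (φ : QHom o P P') (ψ : QHom o Q Q') (a b c : O) (x : P a c) (y : Q c b) :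
    qmap φ ψ a b (qtmul c x y) = qtmul (o c) (φ a c x) (ψ c b y) := qlift_tmul _ _ _ _

/-- The identity of a quiver. -/
def qid (P : KQuiver K O) : QHom (fun x => x) P P := fun _ _ => LinearMap.id

@[simp] theorem qid_apply (P : KQuiver K O) (a b : O) (x : P a b) : qid P a b x = x := rfl

/-- The associativity isomorphism `P ⊗ (Q ⊗ R) ⟶ (P ⊗ Q) ⊗ R`. -/
def qassoc (P Q R : KQuiver K O) :
    QHom (fun x => x) (qtensor P (qtensor Q R)) (qtensor (qtensor P Q) R) := fun a b =>
  qlift fun c => LinearMap.flip <| qlift fun d =>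
    LinearMap.mk₂ K (fun y z => (LinearMap.flip (qtmul d) z) ∘ₗ (LinearMap.flip (qtmul c) y))
      (fun y y' z => by ext x; simp) (fun k y z => by ext x; simp)
      (fun y z z' => by ext x; simp) (fun k y z => by ext x; simp)

@[simp] theorem qassoc_tmul (P Q R : KQuiver K O) (a b c d : O) (x : P a c) (y : Q c d)
    (z : R d b) :
    qassoc P Q R a b (qtmul c x (qtmul d y z)) = qtmul d (qtmul c x y) z := by
  simp [qassoc]

end Quivers

/-- Morphisms of the category of finite intervals: monotone maps `[m] → [n]` preserving the
endpoints. -/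
structure FInt (m n : ℕ) extends Fin (m + 1) →o Fin (n + 1) where
  map_zero : toFun 0 = 0
  map_last : toFun (Fin.last m) = Fin.last n

namespace FInt

/-- The value of `f` at `i ≤ m`, as a natural number (junk for `i > m`). -/
def val {m n : ℕ} (f : FInt m n) (i : ℕ) : ℕ :=
  if h : i < m + 1 then (f.toOrderHom ⟨i, h⟩ : ℕ) else 0

theorem val_eq {m n : ℕ} (f : FInt m n) (i : Fin (m + 1)) : f.val i = f.toOrderHom i := by
  simp [val, i.is_lt]

theorem val_lt {m n : ℕ} (f : FInt m n) (i : ℕ) : f.val i < n + 1 := by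
  unfold val
  split_ifs
  · exact Fin.is_lt _
  · exact Nat.succ_pos _

theorem val_mono {m n : ℕ} (f : FInt m n) {i j : ℕ} (h : i ≤ j) (hj : j ≤ m) :
    f.val i ≤ f.val j := by
  have h1 : i < m + 1 := by omega
  have h2 : j < m + 1 := by omega
  simp only [val, h1, h2, dif_pos]
  exact f.monotone' (show (⟨i, h1⟩ : Fin (m + 1)) ≤ ⟨j, h2⟩ from h)

theorem val_zero {m n : ℕ} (f : FInt m n) : f.val 0 = 0 := by
  have := congrArg Fin.val f.map_zero
  exact (f.val_eq 0).trans this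

theorem val_last {m n : ℕ} (f : FInt m n) : f.val m = n := by
  have := congrArg Fin.val f.map_last
  exact (f.val_eq (Fin.last m)).trans this

/-- The identity. -/
def id (n : ℕ) : FInt n n := ⟨OrderHom.id, rfl, rfl⟩

/-- The composition `g ∘ f`. -/
def comp {m n p : ℕ} (f : FInt m n) (g : FInt n p) : FInt m p :=
  ⟨g.toOrderHom.comp f.toOrderHom, (congrArg g.toFun f.map_zero).trans g.map_zero,
    (congrArg g.toFun f.map_last).trans g.map_last⟩

/-- The monoidal product `f + g : [k' + l'] → [k + l]`, which is `f` on `[0, k']` and `g` on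
`[k', k' + l']`. -/
def sum {k' k l' l : ℕ} (f : FInt k' k) (g : FInt l' l) : FInt (k' + l') (k + l) where
  toFun i := ⟨if (i : ℕ) ≤ k' then f.val i else k + g.val (i - k'), by
    have := f.val_lt i
    have := g.val_lt (i - k')
    split_ifs <;> omega⟩
  monotone' i j hij := by
    have hij : (i : ℕ) ≤ j := hij
    have hj := j.2
    show (if (i : ℕ) ≤ k' then f.val i else k + g.val (i - k')) ≤
      if (j : ℕ) ≤ k' then f.val j else k + g.val (j - k')
    have := f.val_lt i
    split_ifs with h1 h2
    · exact f.val_mono hij h2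
    · omega
    · omega
    · exact Nat.add_le_add_left (g.val_mono (by omega) (by omega)) _
  map_zero := by
    ext
    simp [f.val_zero]
  map_last := by
    ext
    show (if k' + l' ≤ k' then f.val (k' + l') else k + g.val (k' + l' - k')) = k + l
    split_ifs with h
    · have : l' = 0 := by omega
      subst this
      have := g.val_zero
      rw [g.val_last] at this
      rw [add_zero, f.val_last, this, add_zero]
    · rw [Nat.add_sub_cancel_left, g.val_last]

end FInt

/-- The structure of a templicial vector space (a strongly unital colax monoidal functor from the
opposite of the category of finite intervals to `K`-linear quivers) on a family `X` of quivers with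
set of vertices `O`. The comultiplication `comul k l : X_{k+l} ⟶ X_k ⊗ X_l` is written with
a parameter `n = k + l`. -/
structure TempStr (K : Type u) [Field K] {O : Type u} (X : ℕ → KQuiver K O) : Type u where
  map : ∀ {m n : ℕ}, FInt m n → QHom (fun x => x) (X n) (X m)
  map_id : ∀ (n : ℕ) (a b : O) (x : X n a b), map (FInt.id n) a b x = x
  map_comp : ∀ {m n p : ℕ} (f : FInt m n) (g : FInt n p) (a b : O) (x : X p a b),
    map (f.comp g) a b x = map f a b (map g a b x)
  comul : ∀ (n k l : ℕ), n = k + l → QHom (fun x => x) (X n) (qtensor (X k) (X l))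
  comul_natural : ∀ {k' k l' l : ℕ} (f : FInt k' k) (g : FInt l' l) (a b : O) (x : X (k + l) a b),
    comul (k' + l') k' l' rfl a b (map (f.sum g) a b x) =
      qmap (map f) (map g) a b (comul (k + l) k l rfl a b x)
  coassoc : ∀ (n k l p q r : ℕ) (hq : q = l + p) (hr : r = k + l) (h₁ : n = k + q)
    (h₂ : n = r + p) (a b : O) (x : X n a b),
    qassoc (X k) (X l) (X p) a b (qmap (qid (X k)) (comul q l p hq) a b (comul n k q h₁ a b x)) =
      qmap (comul r k l hr) (qid (X p)) a b (comul n r p h₂ a b x)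
  counit : QHom (fun x => x) (X 0) (unitQ K O)
  counit_left : ∀ (n : ℕ) (a b : O) (x : X n a b),
    qmap counit (qid (X n)) a b (comul n 0 n (Nat.zero_add n).symm a b x) =
      qtmul a (unitOne rfl) x
  counit_right : ∀ (n : ℕ) (a b : O) (x : X n a b),
    qmap (qid (X n)) counit a b (comul n n 0 rfl a b x) = qtmul b x (unitOne rfl)
  /-- Strong unitality. -/
  counit_bijective : ∀ a b : O, Function.Bijective (counit a b)

/-- Templicial vector spaces. -/
structure TempVect (K : Type u) [Field K] : Type (u + 1) where
  O : Type u
  X : ℕ → KQuiver K O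
  str : TempStr K X

namespace TempVect

variable {K : Type u} [Field K]

/-- Morphisms of templicial vector spaces: a map of vertices, and quiver morphisms along it
compatible with the functor structure, the comultiplications and the counits. -/
@[ext]
structure Hom (X Y : TempVect K) : Type u where
  obj : X.O → Y.O
  app : ∀ n : ℕ, QHom obj (X.X n) (Y.X n)
  natural : ∀ {m n : ℕ} (f : FInt m n) (a b : X.O) (x : X.X n a b),
    app m a b (X.str.map f a b x) = Y.str.map f (obj a) (obj b) (app n a b x)
  comul : ∀ (n k l : ℕ) (h : n = k + l) (a b : X.O) (x : X.X n a b),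
    Y.str.comul n k l h (obj a) (obj b) (app n a b x) =
      qmap (app k) (app l) a b (X.str.comul n k l h a b x)
  counit : ∀ (a b : X.O) (x : X.X 0 a b),
    unitVal (Y.str.counit (obj a) (obj b) (app 0 a b x)) = unitVal (X.str.counit a b x)

theorem qmap_id {O : Type u} (P Q : KQuiver K O) (a b : O) (x : qtensor P Q a b) :
    qmap (qid P) (qid Q) a b x = x := by
  have : qmap (qid P) (qid Q) a b = LinearMap.id := q_ext fun c x y => by simp
  rw [this]; rfl

theorem qmap_comp {O O' O'' : Type u} {o : O → O'} {o' : O' → O''} {P Q : KQuiver K O}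
    {P' Q' : KQuiver K O'} {P'' Q'' : KQuiver K O''} (φ : QHom o P P') (ψ : QHom o Q Q')
    (φ' : QHom o' P' P'') (ψ' : QHom o' Q' Q'') (a b : O) (x : qtensor P Q a b) :
    qmap (o := fun x => o' (o x)) (fun a b => φ' _ _ ∘ₗ φ a b) (fun a b => ψ' _ _ ∘ₗ ψ a b) a b x =
      qmap φ' ψ' _ _ (qmap φ ψ a b x) := by
  have : qmap (o := fun x => o' (o x)) (fun a b => φ' _ _ ∘ₗ φ a b)
      (fun a b => ψ' _ _ ∘ₗ ψ a b) a b = qmap φ' ψ' _ _ ∘ₗ qmap φ ψ a b :=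
    q_ext fun c x y => by simp
  rw [this]; rfl

/-- The category of templicial vector spaces. -/
instance : Category (TempVect K) where
  Hom := Hom
  id X :=
    { obj := fun x => x
      app := fun n => qid (X.X n)
      natural := fun _ _ _ _ => rfl
      comul := fun _ _ _ _ _ _ _ => (qmap_id _ _ _ _ _).symm
      counit := fun _ _ _ => rfl }
  comp f g :=
    { obj := fun x => g.obj (f.obj x)
      app := fun n a b => g.app n _ _ ∘ₗ f.app n a b
      natural := fun h a b x => (congrArg _ (f.natural h a b x)).trans (g.natural h _ _ _)
      comul := fun n k l h a b x => (g.comul n k l h _ _ _).trans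
        ((congrArg _ (f.comul n k l h a b x)).trans (qmap_comp _ _ _ _ _ _ _).symm)
      counit := fun a b x => (g.counit _ _ _).trans (f.counit a b x) }

end TempVect
/-- The underlying morphism of the simplex category. -/
def FInt.hom {m n : ℕ} (f : FInt m n) : SimplexCategory.mk m ⟶ SimplexCategory.mk n :=
  SimplexCategory.Hom.mk f.toOrderHom

namespace Free

open SimplexCategory Opposite

variable (X : SSet.{u})

/-- The `i`-th vertex of a simplex. -/
def vertex {n : ℕ} (i : Fin (n + 1)) (σ : X.obj (op (mk n))) : X.obj (op (mk 0)) :=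
  X.map ((mk 0).const (mk n) i).op σ

/-- The `n`-simplices with first vertex `a` and last vertex `b`. -/
abbrev Cell (n : ℕ) (a b : X.obj (op (mk 0))) : Type u :=
  {σ : X.obj (op (mk n)) // vertex X 0 σ = a ∧ vertex X (Fin.last n) σ = b}

theorem vertex_map {m n : ℕ} (f : mk m ⟶ mk n) (i : Fin (m + 1)) (σ : X.obj (op (mk n))) :
    vertex X i (X.map f.op σ) = vertex X (f.toOrderHom i) σ := by
  have : (X.map f.op ≫ X.map ((mk 0).const (mk m) i).op) σ =
      X.map ((mk 0).const (mk n) (f.toOrderHom i)).op σ := by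
    rw [← Functor.map_comp, ← op_comp, const_comp]
  exact this

/-- The action of the finite interval category on simplices. -/
def Cell.map {m n : ℕ} (f : FInt m n) {a b : X.obj (op (mk 0))} (σ : Cell X n a b) :
    Cell X m a b :=
  ⟨X.map f.hom.op σ.1, by
    rw [vertex_map, vertex_map]
    have h0 : f.hom.toOrderHom 0 = 0 := f.map_zero
    have h1 : f.hom.toOrderHom (Fin.last m) = Fin.last n := f.map_last
    rw [h0, h1]
    exact σ.2⟩

theorem interval_le {n j l : ℕ} (h : j + l ≤ n) (i : Fin (l + 1)) (k : Fin (n + 1))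
    (hk : (k : ℕ) = i + j) : (subinterval j l h).toOrderHom i = k := Fin.ext hk.symm

/-- The face of a simplex spanned by the vertices `j, …, j + l`. -/
def face {n : ℕ} (j l : ℕ) (h : j + l ≤ n) (σ : X.obj (op (mk n))) : X.obj (op (mk l)) :=
  X.map (subinterval j l h).op σ

theorem vertex_face {n : ℕ} (j l : ℕ) (h : j + l ≤ n) (σ : X.obj (op (mk n))) (i : Fin (l + 1))
    (k : Fin (n + 1)) (hk : (k : ℕ) = i + j) : vertex X i (face X j l h σ) = vertex X k σ := by
  rw [face, vertex_map, interval_le h i k hk]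

theorem map_face {m n : ℕ} (f : mk m ⟶ mk n) {j l j' l' : ℕ} (h : j' + l' ≤ m) (h' : j + l ≤ n)
    (g : mk l' ⟶ mk l)
    (e : ∀ i : Fin (l' + 1), (f.toOrderHom ⟨i + j', by have := i.is_lt; simp only; omega⟩ : ℕ) = g.toOrderHom i + j)
    (σ : X.obj (op (mk n))) :
    face X j' l' h (X.map f.op σ) = X.map g.op (face X j l h' σ) := by
  have h1 : subinterval j' l' h ≫ f = g ≫ subinterval j l h' := by
    apply SimplexCategory.Hom.ext
    ext i
    exact e i
  have : (X.map f.op ≫ X.map (subinterval j' l' h).op) σ =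
      (X.map (subinterval j l h').op ≫ X.map g.op) σ := by
    rw [← Functor.map_comp, ← Functor.map_comp, ← op_comp, ← op_comp, h1]
  exact this

theorem face_face {n : ℕ} {j l j' l' i : ℕ} (h : j + l ≤ n) (h' : j' + l' ≤ l) (hi : i = j + j')
    (h'' : i + l' ≤ n) (σ : X.obj (op (mk n))) :
    face X j' l' h' (face X j l h σ) = face X i l' h'' σ := by
  subst hi
  have h1 : subinterval j' l' h' ≫ subinterval j l h = subinterval (j + j') l' h'' := by
    apply SimplexCategory.Hom.ext
    ext i
    show (i : ℕ) + j' + j = i + (j + j')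
    omega
  have : (X.map (subinterval j l h).op ≫ X.map (subinterval j' l' h').op) σ =
      X.map (subinterval (j + j') l' h'').op σ := by
    rw [← Functor.map_comp, ← op_comp, h1]
  exact this

theorem face_full {n : ℕ} (h : 0 + n ≤ n) (σ : X.obj (op (mk n))) : face X 0 n h σ = σ := by
  have h1 : subinterval 0 n h = 𝟙 (mk n) := by
    apply SimplexCategory.Hom.ext
    ext i
    rfl
  rw [face, h1, op_id, X.map_id]
  rfl

theorem vertex_zero (i : Fin (0 + 1)) (σ : X.obj (op (mk 0))) : vertex X i σ = σ := by
  have h1 : (mk 0).const (mk 0) i = 𝟙 (mk 0) := by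
    apply SimplexCategory.Hom.ext
    ext j
    have hi := i.is_lt
    have hj : (j : ℕ) < 0 + 1 := j.is_lt
    show (i : ℕ) = j
    omega
  rw [vertex, h1, op_id, X.map_id]
  rfl

theorem face_vertex {n : ℕ} (j : ℕ) (h : j + 0 ≤ n) (σ : X.obj (op (mk n))) (k : Fin (n + 1))
    (hk : (k : ℕ) = j) : face X j 0 h σ = vertex X k σ := by
  rw [← vertex_zero X 0 (face X j 0 h σ), vertex_face X j 0 h σ 0 k (by simpa using hk)]

variable (K : Type u) [Field K]

/-- The free quivers `F(X)_n(a, b)` on the sets of `n`-simplices from `a` to `b`. -/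
def quiver (n : ℕ) : KQuiver K (X.obj (op (mk 0))) := fun a b => ModuleCat.of K (Cell X n a b →₀ K)

variable {X K}

/-- The basis element of a simplex. -/
def gen {n : ℕ} {a b : X.obj (op (mk 0))} (σ : Cell X n a b) : quiver X K n a b :=
  Finsupp.single (M := K) σ 1

/-- The linear map with given values on simplices. -/
def extend {M : Type u} [AddCommGroup M] [Module K M] {n : ℕ} {a b : X.obj (op (mk 0))}
    (φ : Cell X n a b → M) : quiver X K n a b →ₗ[K] M :=
  Finsupp.linearCombination K φ

@[simp] theorem extend_gen {M : Type u} [AddCommGroup M] [Module K M] {n : ℕ}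
    {a b : X.obj (op (mk 0))} (φ : Cell X n a b → M) (σ : Cell X n a b) :
    extend (K := K) φ (gen σ) = φ σ := by
  refine (Finsupp.linearCombination_single K (1 : K) σ).trans (one_smul K _)

theorem gen_ext {M : Type u} [AddCommGroup M] [Module K M] {n : ℕ} {a b : X.obj (op (mk 0))}
    {f g : quiver X K n a b →ₗ[K] M} (h : ∀ σ, f (gen σ) = g (gen σ)) : f = g :=
  Finsupp.lhom_ext' fun σ => LinearMap.ext_ring (h σ)

variable (X K)

/-- The front face of dimension `k` of a `(k + l)`-simplex. -/
def front {n k l : ℕ} (h : n = k + l) {a b : X.obj (op (mk 0))} (σ : Cell X n a b) :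
    Cell X k a (vertex X ⟨k, by omega⟩ σ.1) :=
  ⟨face X 0 k (by omega) σ.1, (vertex_face X _ _ _ _ _ 0 (by simp)).trans σ.2.1,
    vertex_face X _ _ _ _ _ _ (by simp)⟩

/-- The back face of dimension `l` of a `(k + l)`-simplex. -/
def back {n k l : ℕ} (h : n = k + l) {a b : X.obj (op (mk 0))} (σ : Cell X n a b) :
    Cell X l (vertex X ⟨k, by omega⟩ σ.1) b :=
  ⟨face X k l (by omega) σ.1, vertex_face X _ _ _ _ _ _ (by simp),
    (vertex_face X _ _ _ _ _ (Fin.last n) (by simp [h, add_comm])).trans σ.2.2⟩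

variable {X}

theorem tmul_congr {k l : ℕ} {a b c c' : X.obj (op (mk 0))} (σ : Cell X k a c) (τ : Cell X l c b)
    (σ' : Cell X k a c') (τ' : Cell X l c' b) (h : c = c') (h1 : σ.1 = σ'.1) (h2 : τ.1 = τ'.1) :
    qtmul (P := quiver X K k) (Q := quiver X K l) c (gen σ) (gen τ) =
      qtmul c' (gen σ') (gen τ') := by
  subst h
  cases Subtype.ext h1
  cases Subtype.ext h2
  rfl

theorem tmul_congr₃ {k l p : ℕ} {a b c c' d d' : X.obj (op (mk 0))} (σ : Cell X k a c)
    (τ : Cell X l c d) (ρ : Cell X p d b) (σ' : Cell X k a c') (τ' : Cell X l c' d')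
    (ρ' : Cell X p d' b) (hc : c = c') (hd : d = d') (h1 : σ.1 = σ'.1) (h2 : τ.1 = τ'.1)
    (h3 : ρ.1 = ρ'.1) :
    qtmul (P := qtensor (quiver X K k) (quiver X K l)) (Q := quiver X K p) d
        (qtmul c (gen σ) (gen τ)) (gen ρ) =
      qtmul d' (qtmul c' (gen σ') (gen τ')) (gen ρ') := by
  subst hc hd
  cases Subtype.ext h1
  cases Subtype.ext h2
  cases Subtype.ext h3
  rfl

variable (X)

/-- The comultiplication `σ ↦ front σ ⊗ back σ`. -/
def comul (n k l : ℕ) (h : n = k + l) :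
    QHom (fun x => x) (quiver X K n) (qtensor (quiver X K k) (quiver X K l)) := fun _ _ =>
  extend fun σ => qtmul _ (gen (front X h σ)) (gen (back X h σ))

theorem cell_eq {a b : X.obj (op (mk 0))} (σ : Cell X 0 a b) : a = b := by
  have h1 := σ.2.1
  have h2 := σ.2.2
  rw [vertex_zero] at h1 h2
  exact h1.symm.trans h2

/-- The counit `F(X)_0(a, b) ⟶ K`, sending the simplex `a` to `1` if `a = b`. -/
def counit : QHom (fun x => x) (quiver X K 0) (unitQ K (X.obj (op (mk 0)))) := fun _ _ =>
  extend fun σ => unitOne (cell_eq X σ)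

theorem unit_tmul_left {Q : KQuiver K (X.obj (op (mk 0)))} {a b c : X.obj (op (mk 0))} (h : a = c)
    (y : Q c b) (y' : Q a b) (hy : HEq y y') :
    qtmul (P := unitQ K _) c (unitOne (K := K) h) y = qtmul a (unitOne rfl) y' := by
  subst h; cases hy; rfl

theorem unit_tmul_right {Q : KQuiver K (X.obj (op (mk 0)))} {a b c : X.obj (op (mk 0))} (h : c = b)
    (y : Q a c) (y' : Q a b) (hy : HEq y y') :
    qtmul (Q := unitQ K _) c y (unitOne (K := K) h) = qtmul b y' (unitOne rfl) := by
  subst h; cases hy; rfl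

theorem gen_heq {n : ℕ} {a a' b b' : X.obj (op (mk 0))} (σ : Cell X n a b) (σ' : Cell X n a' b')
    (ha : a = a') (hb : b = b') (h : σ.1 = σ'.1) :
    HEq (gen (K := K) σ) (gen (K := K) σ') := by
  subst ha hb
  cases Subtype.ext h
  rfl

/-- The templicial structure on the free quivers. -/
def str : TempStr K (quiver X K) where
  map f a b := extend fun σ => gen (σ.map X f)
  map_id n a b x := by
    have : (extend (K := K) fun σ : Cell X n a b => gen (σ.map X (FInt.id n))) =
        LinearMap.id := by
      refine gen_ext fun σ => ?_
      rw [extend_gen]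
      congr 1
      refine Subtype.ext ?_
      show X.map (𝟙 _) σ.1 = σ.1
      rw [X.map_id]; rfl
    rw [this]; rfl
  map_comp {m n p} f g a b x := by
    have : (extend (K := K) fun σ : Cell X p a b => gen (K := K) (σ.map X (f.comp g))) =
        (extend (K := K) fun σ => gen (K := K) (σ.map X f)) ∘ₗ extend (K := K) fun σ => gen (K := K) (σ.map X g) := by
      refine gen_ext fun σ => ?_
      rw [LinearMap.comp_apply, extend_gen, extend_gen, extend_gen]
      congr 1
      refine Subtype.ext ?_
      show X.map (g.hom.op ≫ f.hom.op) σ.1 = X.map f.hom.op (X.map g.hom.op σ.1)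
      rw [X.map_comp]; rfl
    rw [this]; rfl
  comul := comul X K
  comul_natural {k' k l' l} f g a b x := by
    refine LinearMap.congr_fun (f := comul X K (k' + l') k' l' rfl a b ∘ₗ
        extend fun σ => gen (σ.map X (f.sum g)))
      (g := qmap (fun _ _ => extend fun σ => gen (σ.map X f))
        (fun _ _ => extend fun σ => gen (σ.map X g)) a b ∘ₗ comul X K (k + l) k l rfl a b)
      (gen_ext fun σ => ?_) x
    simp only [LinearMap.comp_apply, comul, extend_gen, qmap_tmul]
    have hF : ∀ i : Fin (k' + 1), ((f.sum g).hom.toOrderHom ⟨i + 0, by have := i.is_lt; simp only; omega⟩ : ℕ) =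
        f.hom.toOrderHom i + 0 := by
      intro i
      have hi : (i : ℕ) ≤ k' := by omega
      show (if (i : ℕ) ≤ k' then f.val i else _) = _
      rw [if_pos hi, f.val_eq]
      rfl
    have hB : ∀ i : Fin (l' + 1), ((f.sum g).hom.toOrderHom ⟨i + k', by have := i.is_lt; simp only; omega⟩ : ℕ) =
        g.hom.toOrderHom i + k := by
      intro i
      show (if (i : ℕ) + k' ≤ k' then f.val (i + k') else k + g.val (i + k' - k')) = _
      split_ifs with h
      · have h0 : i = 0 := Fin.ext (by simpa using h)
        subst h0
        have : (g.hom.toOrderHom 0 : ℕ) = 0 := congrArg Fin.val g.map_zero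
        rw [this, Fin.val_zero, zero_add, zero_add, f.val_last]
      · rw [Nat.add_sub_cancel, g.val_eq, add_comm]; rfl
    refine tmul_congr K _ _ _ _ ?_ ?_ ?_
    · show vertex X _ (X.map _ σ.1) = _
      rw [vertex_map]
      congr 1
      refine Fin.ext ?_
      have := hF (Fin.last k')
      have h2 : (f.hom.toOrderHom (Fin.last k') : ℕ) = k := congrArg Fin.val f.map_last
      rw [h2] at this
      exact this
    · exact map_face X _ _ _ f.hom hF σ.1
    · exact map_face X _ _ _ g.hom hB σ.1
  coassoc n k l p q r hq hr h₁ h₂ a b x := by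
    refine LinearMap.congr_fun (f := qassoc _ _ _ a b ∘ₗ
        qmap (qid _) (comul X K q l p hq) a b ∘ₗ comul X K n k q h₁ a b)
      (g := qmap (comul X K r k l hr) (qid _) a b ∘ₗ comul X K n r p h₂ a b)
      (gen_ext fun σ => ?_) x
    simp only [LinearMap.comp_apply, comul, extend_gen, qmap_tmul, qid_apply]
    rw [qassoc_tmul]
    refine tmul_congr₃ K _ _ _ _ _ _ ?_ ?_ ?_ ?_ ?_
    · exact (vertex_face X _ _ _ _ _ _ (by simp)).symm
    · exact vertex_face X _ _ _ _ _ _ (by simp [hr, add_comm])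
    · exact (face_face X _ _ (by simp) _ _).symm
    · exact (face_face X (i := k) _ _ (by simp) (by omega) _).trans
        (face_face X _ _ (by simp) (by omega) _).symm
    · exact face_face X _ _ (by simp [hr]) _ _
  counit := counit X K
  counit_left n a b x := by
    refine LinearMap.congr_fun (f := qmap (counit X K) (qid _) a b ∘ₗ
        comul X K n 0 n (Nat.zero_add n).symm a b)
      (g := qtmul (P := unitQ K _) (Q := quiver X K n) a (unitOne rfl)) (gen_ext fun σ => ?_) x
    simp only [LinearMap.comp_apply, comul, extend_gen, qmap_tmul, qid_apply, counit]
    refine unit_tmul_left X K _ _ _ (gen_heq X K _ _ ?_ rfl ?_)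
    · exact σ.2.1
    · exact face_full X _ _
  counit_right n a b x := by
    refine LinearMap.congr_fun (f := qmap (qid _) (counit X K) a b ∘ₗ comul X K n n 0 rfl a b)
      (g := (qtmul (P := quiver X K n) (Q := unitQ K _) b).flip (unitOne rfl))
      (gen_ext fun σ => ?_) x
    simp only [LinearMap.comp_apply, comul, extend_gen, qmap_tmul, qid_apply, counit,
      LinearMap.flip_apply]
    refine unit_tmul_right X K _ _ _ (gen_heq X K _ _ rfl ?_ ?_)
    · exact σ.2.2
    · exact face_full X _ _
  counit_bijective a b := by
    by_cases hab : a = b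
    · subst hab
      let τ : Cell X 0 a a := ⟨a, vertex_zero X _ a, vertex_zero X _ a⟩
      have hτ : ∀ σ : Cell X 0 a a, σ = τ := fun σ =>
        Subtype.ext ((vertex_zero X _ _).symm.trans σ.2.1)
      have hx : ∀ x : quiver X K 0 a a, x = unitVal (counit X K a a x) • gen τ := by
        intro x
        refine LinearMap.congr_fun (f := LinearMap.id)
          (g := (unitVal ∘ₗ counit X K a a).smulRight (gen τ)) (gen_ext fun σ => ?_) x
        rw [hτ σ]
        simp [counit, unitVal_one]
      constructor
      · intro x y h
        rw [hx x, hx y, h]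
      · intro k
        refine ⟨unitVal k • gen τ, unit_ext ?_⟩
        simp [counit, unitVal_one]
    · have : IsEmpty (Cell X 0 a b) := ⟨fun σ => hab (cell_eq X σ)⟩
      have h0 : ∀ x : quiver X K 0 a b, x = 0 := fun x =>
        LinearMap.congr_fun (f := LinearMap.id) (g := 0) (gen_ext fun σ => this.elim σ) x
      constructor
      · intro x y _
        rw [h0 x, h0 y]
      · intro k
        refine ⟨0, unit_ext ?_⟩
        rw [unitVal_of_ne k hab, unitVal_of_ne _ hab]

variable {X} {Y Z : SSet.{u}}

theorem vertex_app (f : X ⟶ Y) {n : ℕ} (i : Fin (n + 1)) (σ : X.obj (op (mk n))) :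
    vertex Y i (f.app _ σ) = f.app _ (vertex X i σ) :=
  (ConcreteCategory.congr_hom (f.naturality ((mk 0).const (mk n) i).op) σ).symm

theorem face_app (f : X ⟶ Y) {n : ℕ} (j l : ℕ) (h : j + l ≤ n) (σ : X.obj (op (mk n))) :
    face Y j l h (f.app _ σ) = f.app _ (face X j l h σ) :=
  (ConcreteCategory.congr_hom (f.naturality (subinterval j l h).op) σ).symm

/-- The map on simplices of a map of simplicial sets. -/
def Cell.app (f : X ⟶ Y) {n : ℕ} {a b : X.obj (op (mk 0))} (σ : Cell X n a b) :
    Cell Y n (f.app _ a) (f.app _ b) :=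
  ⟨f.app _ σ.1, by rw [vertex_app, vertex_app, σ.2.1, σ.2.2]; exact ⟨rfl, rfl⟩⟩

/-- The free templicial vector space on a simplicial set: the vertices are the vertices of `X`, and
`F(X)_n(a, b)` is the free vector space on the set of `n`-simplices from `a` to `b`. -/
def obj (X : SSet.{u}) : TempVect K := ⟨X.obj (op (mk 0)), quiver X K, str X K⟩

/-- The linear maps between free quivers of a map of simplicial sets. -/
def mapQ (f : X ⟶ Y) (n : ℕ) :
    QHom (fun a => f.app (op (mk 0)) a) (quiver X K n) (quiver Y K n) := fun _ _ =>
  extend fun σ => gen (σ.app f)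

theorem mapQ_gen (f : X ⟶ Y) {n : ℕ} {a b : X.obj (op (mk 0))} (σ : Cell X n a b) :
    mapQ K f n a b (gen σ) = gen (σ.app f) := extend_gen _ σ

theorem mapQ_natural (f : X ⟶ Y) {m n : ℕ} (h : FInt m n) (a b : X.obj (op (mk 0)))
    (x : quiver X K n a b) :
    mapQ K f m a b ((str X K).map h a b x) = (str Y K).map h _ _ (mapQ K f n a b x) := by
  refine LinearMap.congr_fun (f := mapQ K f m a b ∘ₗ extend fun σ => gen (σ.map X h))
    (g := (extend fun σ => gen (K := K) (σ.map Y h)) ∘ₗ mapQ K f n a b) (gen_ext fun σ => ?_) x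
  simp only [LinearMap.comp_apply, extend_gen, mapQ_gen]
  congr 1
  refine Subtype.ext ?_
  show f.app _ (X.map h.hom.op σ.1) = Y.map h.hom.op (f.app _ σ.1)
  exact ConcreteCategory.congr_hom (f.naturality h.hom.op) σ.1

theorem mapQ_comul (f : X ⟶ Y) (n k l : ℕ) (h : n = k + l) (a b : X.obj (op (mk 0)))
    (x : quiver X K n a b) :
    comul Y K n k l h _ _ (mapQ K f n a b x) =
      qmap (mapQ K f k) (mapQ K f l) a b (comul X K n k l h a b x) := by
  refine LinearMap.congr_fun (f := comul Y K n k l h _ _ ∘ₗ mapQ K f n a b)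
    (g := qmap (mapQ K f k) (mapQ K f l) a b ∘ₗ comul X K n k l h a b) (gen_ext fun σ => ?_) x
  simp only [LinearMap.comp_apply, mapQ_gen, comul, extend_gen, qmap_tmul]
  refine tmul_congr K _ _ _ _ ?_ ?_ ?_
  · exact vertex_app f _ _
  · exact face_app f _ _ _ _
  · exact face_app f _ _ _ _

theorem mapQ_counit (f : X ⟶ Y) (a b : X.obj (op (mk 0))) (x : quiver X K 0 a b) :
    unitVal (counit Y K _ _ (mapQ K f 0 a b x)) = unitVal (counit X K a b x) := by
  refine LinearMap.congr_fun (f := unitVal ∘ₗ counit Y K _ _ ∘ₗ mapQ K f 0 a b)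
    (g := unitVal ∘ₗ counit X K a b) (gen_ext fun σ => ?_) x
  simp only [LinearMap.comp_apply, extend_gen, counit, unitVal_one, mapQ_gen]

theorem mapQ_id (n : ℕ) (a b : X.obj (op (mk 0))) : mapQ K (𝟙 X) n a b = LinearMap.id :=
  gen_ext fun σ => mapQ_gen K (𝟙 X) σ

theorem mapQ_comp (f : X ⟶ Y) (g : Y ⟶ Z) (n : ℕ) (a b : X.obj (op (mk 0))) :
    mapQ K (f ≫ g) n a b = mapQ K g n _ _ ∘ₗ mapQ K f n a b := by
  refine gen_ext fun σ => (mapQ_gen K (f ≫ g) σ).trans (Eq.symm ?_)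
  exact (congrArg (mapQ K g n _ _) (mapQ_gen K f σ)).trans (mapQ_gen K g (σ.app f))

/-- The morphism of free templicial vector spaces of a map of simplicial sets. -/
def map (f : X ⟶ Y) : obj K X ⟶ obj K Y where
  obj a := f.app _ a
  app := mapQ K f
  natural := mapQ_natural K f
  comul := mapQ_comul K f
  counit := mapQ_counit K f

end Free

/-- The free templicial vector space functor. -/
def free (K : Type u) [Field K] : SSet.{u} ⥤ TempVect K where
  obj X := Free.obj K X
  map f := Free.map K f
  map_id X := TempVect.Hom.ext rfl (heq_of_eq (by
    funext n a b
    exact Free.mapQ_id K n a b))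
  map_comp f g := TempVect.Hom.ext rfl (heq_of_eq (by
    funext n a b
    exact Free.mapQ_comp K f g n a b))

/-- The underlying simplicial set functor, right adjoint to `free`: the `n`-simplices of `Ũ(X)` are
the morphisms `F(Δⁿ) ⟶ X`. -/
def underlying (K : Type u) [Field K] : TempVect K ⥤ SSet.{u} :=
  yoneda ⋙ (Functor.whiskeringLeft _ _ _).obj (SSet.stdSimplex.{u} ⋙ free K).op
section Tensors

variable {K : Type u} [Field K] {O : Type u}

open Chain

variable (H : O → O → ℤ → ModuleCat.{u} K)

/-- A bead `Δ^n ⟶ Δ^N` of an injective necklace map, given by the list of the `n` differences of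
consecutive vertices. -/
abbrev Bead := List ℕ

/-- The degree `n - 1` of a bead `Δⁿ`. -/
def Bead.dim (b : Bead) : ℤ := b.length - 1

/-- Lists of beads `(Δ^{n₁}, …, Δ^{n_l})`: together they describe an injective necklace map
`U = Δ^{n₁} ∨ ⋯ ∨ Δ^{n_l} ⟶ Δ^N`. -/
abbrev Beads := List Bead

namespace Beads

/-- The dimension `∑ (n_i - 1)` of the necklace `U`. -/
def dim (W : Beads) : ℤ := (W.map Bead.dim).sum

/-- The list of beads describes an injective necklace map `U ⟶ Δ^N`: the beads `Δ^{n_i}` of `U`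
have `n_i > 0`, the differences of consecutive vertices are positive, and their total sum is `N`. -/
def Valid (N : ℕ) (W : Beads) : Prop :=
  (∀ b ∈ W, b ≠ [] ∧ ∀ g ∈ b, 0 < g) ∧ W.flatten.sum = N

/-- The signature `ε(U) = ∑_i (l - i)(n_i - 1)` of the necklace `U`. -/
def eps : Beads → ℤ
  | [] => 0
  | b :: W => W.length * b.dim + eps W

end Beads

/-- All inert necklace maps `S ⟶ Δⁿ`, composed with a bead `b : Δⁿ ⟶ Δ^N`: all ways to cut the
nonempty list `b` into consecutive nonempty lists. -/
def Bead.subdiv : Bead → List Beads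
  | [] => [[]]
  | g :: b => (subdiv b).flatMap fun S => match S with
    | [] => [[[g]]]
    | s :: S => [[g] :: s :: S, (g :: s) :: S]

/-- Composition of a bead with the inner face map `δ_{j+1}`: the differences of indices `j`, `j + 1`
are replaced by their sum. -/
def Bead.merge : Bead → ℕ → Bead
  | p :: q :: b, 0 => (p + q) :: b
  | p :: b, j + 1 => p :: merge b j
  | b, _ => b

/-- The quiver `(sA)_U = A_{n₁ - 1} ⊗ ⋯ ⊗ A_{n_l - 1}`. -/
def sT : Beads → KQuiver K O
  | [] => unitQ K O
  | b :: W => qtensor (fun x y => H x y b.dim) (sT W)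

variable {H}

/-- Change of degree along an equality of degrees. -/
def degCast {d e : ℤ} (h : d = e) :
    QHom (fun x => x) (fun x y => H x y d) (fun x y => H x y e) :=
  fun _ _ => h ▸ LinearMap.id

/-- The isomorphism `(sA)_{U ∨ V} ⟶ (sA)_U ⊗ (sA)_V`. -/
def split : ∀ U V : Beads, QHom (fun x => x) (sT H (U ++ V)) (qtensor (sT H U) (sT H V))
  | [], _ => fun a _ => qtmul (P := unitQ K O) a (unitOne rfl)
  | _ :: U, V => fun a b => qassoc _ _ _ a b ∘ₗ qmap (qid _) (split U V) a b

/-- Multilinear functions of chains. -/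
def Mult (H : O → O → ℤ → ModuleCat.{u} K) (x y : O) (M : Type u) [AddCommGroup M] [Module K M] :
    Submodule K (Chain H x y → M) where
  carrier := {Φ | IsMultilinear Φ}
  add_mem' hf hg z w p d t := isLinearMap_add (hf z w p d t) (hg z w p d t)
  zero_mem' _ _ _ _ _ := isLinearMap_zero
  smul_mem' k _ hf z w p d t := isLinearMap_smul k (hf z w p d t)

variable {M : Type u} [AddCommGroup M] [Module K M]

/-- The multilinear function `c ↦ Φ (a, c)`. -/
def Mult.cons {x y z : O} (d : ℤ) (Φ : Mult H x z M) : H x y d →ₗ[K] Mult H y z M where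
  toFun a := ⟨fun c => Φ.1 (Chain.cons d a c), Φ.2.cons d a⟩
  map_add' a a' := Subtype.ext (funext fun c => (Φ.2.head d c).map_add a a')
  map_smul' k a := Subtype.ext (funext fun c => (Φ.2.head d c).map_smul k a)

open Classical in
/-- The linear map on the unit quiver given by a value at the empty chain. -/
def mliftNil (x y : O) : Mult H x y M →ₗ[K] (unitQ K O x y →ₗ[K] M) :=
  if h : x = y then
    { toFun := fun Φ => unitVal.smulRight (Φ.1 (h ▸ Chain.nil x))
      map_add' := fun _ _ => LinearMap.ext fun _ => smul_add _ _ _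
      map_smul' := fun _ _ => LinearMap.ext fun _ => smul_comm _ _ _ }
  else 0

/-- The linear map on `A_d ⊗ Q` given by a multilinear function `Φ` of chains and given linear maps
on `Q` for the multilinear functions `c ↦ Φ (a, c)`. -/
def mliftCons (d : ℤ) (Q : KQuiver K O) (x y : O)
    (φ : ∀ z, Mult H z y M →ₗ[K] (Q z y →ₗ[K] M)) :
    Mult H x y M →ₗ[K] (qtensor (fun x y => H x y d) Q x y →ₗ[K] M) where
  toFun Φ := qlift fun z => φ z ∘ₗ Mult.cons d Φ
  map_add' Φ Ψ := q_ext fun z a t => by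
    rw [LinearMap.add_apply, qlift_tmul, qlift_tmul, qlift_tmul]
    have : Mult.cons d (Φ + Ψ) a = Mult.cons d Φ a + Mult.cons d Ψ a := rfl
    rw [LinearMap.comp_apply, this, map_add]; rfl
  map_smul' c Φ := q_ext fun z a t => by
    rw [LinearMap.smul_apply, qlift_tmul, qlift_tmul]
    have : Mult.cons d (c • Φ) a = c • Mult.cons d Φ a := rfl
    rw [LinearMap.comp_apply, this, map_smul]; rfl

/-- The linear map on `(sA)_U(x, y)` given by a multilinear function `Φ` of chains: it sends
`a₁ ⊗ ⋯ ⊗ a_l` to `Φ (a₁, …, a_l)`. -/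
def mlift : ∀ (U : Beads) (x y : O), Mult H x y M →ₗ[K] (sT H U x y →ₗ[K] M)
  | [], x, y => mliftNil x y
  | b :: U, x, y => mliftCons b.dim (sT H U) x y fun z => mlift U z y

/-- The quiver `A_{n₁ - 1} ⊗ ⋯ ⊗ A_{n_l - 1} ⊗ Q`. -/
def tensL (H : O → O → ℤ → ModuleCat.{u} K) : Beads → KQuiver K O → KQuiver K O
  | [], Q => Q
  | b :: U, Q => qtensor (fun x y => H x y b.dim) (tensL H U Q)

/-- The morphism `id ⊗ φ : (sA)_{U ∨ V} ⟶ (sA)_U ⊗ Q` for `φ : (sA)_V ⟶ Q`. -/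
def idTens : ∀ (U : Beads) {V : Beads} {Q : KQuiver K O}, QHom (fun x => x) (sT H V) Q →
    QHom (fun x => x) (sT H (U ++ V)) (tensL H U Q)
  | [], _, _, φ => φ
  | _ :: U, _, _, φ => qmap (qid _) (idTens U φ)

end Tensors

section Nerve

variable {K : Type u} [Field K]

/-- The multiplication `m_l : (sA)_S ⟶ A_d`, where `l` is the number of beads of `S`. -/
def AInftyCat.mulS (A : AInftyCat K) (S : Beads) (d : ℤ) :
    QHom (fun x => x) (sT A.Hom S) (fun x y => A.Hom x y d) := fun x y =>
  mlift S x y ⟨fun c => A.mul c d, A.mul_multilinear x y d⟩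

/-- The operation `f_l : (sA)_S ⟶ B_d`, where `l` is the number of beads of `S`. -/
def AInftyFunctor.appS {A B : AInftyCat K} (f : AInftyFunctor A B) (S : Beads) (d : ℤ) :
    QHom f.obj (sT A.Hom S) (fun x y => B.Hom x y d) := fun x y =>
  mlift S x y ⟨fun c => f.app c d, f.app_multilinear x y d⟩

namespace Nerve

variable (A : AInftyCat K)

/-- Collections `(y_g)_g` of elements `y_g ∈ (sA)_U(a, b)`, indexed by lists of beads. -/
abbrev Fam (a b : A.Ob) : Type u := ∀ W : Beads, sT A.Hom W a b

variable {A}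

/-- The left-hand side
`∑_{S ⟶ Δⁿ inert} (-1)^{ε(S) + ℓ(S) dim(U^{<k})} (id ⊗ m_{ℓ(S)} ⊗ id)(y_S)` of the relation at a
bead `b : Δⁿ`, where `pre` and `post` are the lists of beads before and after `b`, so
that `U^{<k} = pre`. The sign `(-1)^{(ℓ(S) - 2) dim(pre)}` comes from the Koszul rule for
`id ⊗ m_{ℓ(S)} ⊗ id`. -/
def tanLeft {a b : A.Ob} (pre : Beads) (β : Bead) (post : Beads) :
    Fam A a b →ₗ[K]
      tensL A.Hom pre (qtensor (fun x y => A.Hom x y (β.length - 2)) (sT A.Hom post)) a b :=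
  (β.subdiv.map fun S =>
    (((-1 : K) ^ (S.eps + S.length * pre.dim)) * (-1 : K) ^ ((S.length - 2) * pre.dim)) •
      (idTens pre (fun x y => qmap (A.mulS S (β.length - 2)) (qid (sT A.Hom post)) x y ∘ₗ
        split S post x y) a b ∘ₗ LinearMap.proj (pre ++ (S ++ post)))).sum

theorem merge_dim : ∀ (β : Bead) (j : ℕ), j + 1 < β.length → (β.merge j).dim = β.length - 2
  | p :: q :: β, 0, _ => by simp [Bead.merge, Bead.dim]; ring
  | p :: q :: β, j + 1, h => by
    have := merge_dim (q :: β) j (by simpa using h)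
    simp only [Bead.merge, Bead.dim, List.length_cons] at this ⊢
    push_cast at this ⊢
    linarith

/-- The right-hand side `∑_{j=1}^{n-1} (-1)^{j-1} y_{g ∘_k δ_j}` of the relation at a bead
`b : Δⁿ`. -/
def tanRight {a b : A.Ob} (pre : Beads) (β : Bead) (post : Beads) :
    Fam A a b →ₗ[K]
      tensL A.Hom pre (qtensor (fun x y => A.Hom x y (β.length - 2)) (sT A.Hom post)) a b :=
  ∑ j : Fin (β.length - 1), (-1 : K) ^ (j : ℕ) •
    (idTens pre (V := β.merge j :: post)
      (qmap (degCast (merge_dim β j (by omega))) (qid (sT A.Hom post))) a b ∘ₗ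
      LinearMap.proj (pre ++ (β.merge j :: post)))

end Nerve

variable (A : AInftyCat K)

/-- The vector space `N(A)_n(a, b)` of the templicial `A_∞`-nerve: collections `(y_g)_g` of elements
`y_g ∈ (sA)_U(a, b)` indexed by the injective necklace maps `g : U ⟶ Δⁿ` satisfying
the relations. -/
def nerveModule (n : ℕ) (a b : A.Ob) : Submodule K (Nerve.Fam A a b) where
  carrier := {y | (∀ W : Beads, ¬ W.Valid n → y W = 0) ∧
    ∀ (pre : Beads) (β : Bead) (post : Beads), Beads.Valid n (pre ++ β :: post) →
      Nerve.tanLeft pre β post y = Nerve.tanRight pre β post y}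
  add_mem' hx hy := ⟨fun W h => by
      rw [Pi.add_apply, hx.1 W h, hy.1 W h, add_zero],
    fun pre β post h => by rw [map_add, map_add, hx.2 pre β post h, hy.2 pre β post h]⟩
  zero_mem' := ⟨fun _ _ => rfl, fun _ _ _ _ => by rw [map_zero, map_zero]⟩
  smul_mem' k _ hx := ⟨fun W h => by rw [Pi.smul_apply, hx.1 W h, smul_zero],
    fun pre β post h => by rw [map_smul, map_smul, hx.2 pre β post h]⟩

/-- The quiver `N(A)_n`. -/
def nerve (n : ℕ) : KQuiver K A.Ob := fun a b => ModuleCat.of K (nerveModule A n a b)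

namespace Nerve

variable {A}

/-- The component of an element of `N(A)_n(a, b)` at a list of beads. -/
def π {n : ℕ} (W : Beads) : QHom (fun x => x) (nerve A n) (sT A.Hom W) := fun a b =>
  LinearMap.proj W ∘ₗ (nerveModule A n a b).subtype

/-- The image in `Δⁿ` of a bead in `Δᵐ` starting at the vertex `p`. -/
def img {m n : ℕ} (f : FInt m n) : ℕ → Bead → Bead
  | _, [] => []
  | p, g :: β =>
    if f.val (p + g) = f.val p then img f (p + g) β
    else (f.val (p + g) - f.val p) :: img f (p + g) β

/-- Put the bead `β` in front of `W`, unless `β = Δ⁰`. -/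
def consBead (β : Bead) (W : Beads) : Beads :=
  match β with
  | [] => W
  | g :: β => (g :: β) :: W

/-- The image `g' : U' ⟶ Δⁿ` of an injective necklace map `g : U ⟶ Δᵐ`
under `f : Δᵐ ⟶ Δⁿ` (where `U` starts at the vertex `p` of `Δᵐ`): `f ∘ g = g' ∘ e` with
`e : U ⟶ U'` active surjective. -/
def imgs {m n : ℕ} (f : FInt m n) : ℕ → Beads → Beads
  | _, [] => []
  | p, β :: W => consBead (img f p β) (imgs f (p + β.sum) W)

/-- The map `ē ⊗ φ` for a surjective map `e : β ⟶ β'` of beads: `ē` is the unit for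
`Δ¹ ⟶ Δ⁰`, the identity if `e` is the identity, and `0` otherwise. -/
def barCons {W W' : Beads} (β : Bead) (φ : QHom (fun x => x) (sT A.Hom W') (sT A.Hom W)) :
    ∀ β' : Bead, QHom (fun x => x) (sT A.Hom (consBead β' W')) (sT A.Hom (β :: W))
  | [] => fun x y =>
    if h : 0 = β.dim then
      qtmul (P := fun x y => A.Hom x y β.dim) x (degCast h x x (A.one x)) ∘ₗ φ x y
    else 0
  | g :: β' => fun x y =>
    if h : Bead.dim (g :: β') = β.dim then
      qmap (P := fun x y => A.Hom x y (Bead.dim (g :: β'))) (degCast h) φ x y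
    else 0

/-- The map `ē : (sA)_{U'} ⟶ (sA)_U` of the active surjective map `e : U ⟶ U'`. -/
def bar {m n : ℕ} (f : FInt m n) :
    ∀ (p : ℕ) (W : Beads), QHom (fun x => x) (sT A.Hom (imgs f p W)) (sT A.Hom W)
  | _, [] => qid _
  | p, β :: W => barCons β (bar f (p + β.sum) W) (img f p β)

/-- The sum `∑ (l_i - 1)` over the members `S_i` of a list of subdivisions, where `l_i` is the
number of beads of `S_i`. -/
def excess : List Beads → ℤ
  | [] => 0
  | S :: Ss => (S.length - 1) + excess Ss

/-- The signature `∑_{i < j} dim(S_i) (ℓ(S_j) - 1)` of an inert map `S₁ ∨ ⋯ ∨ S_l ⟶ U`. -/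
def sig : List Beads → ℤ
  | [] => 0
  | S :: Ss => S.dim * excess Ss + sig Ss

/-- The map `f_{ℓ(S₁)} ⊗ ⋯ ⊗ f_{ℓ(S_l)} : (sA)_{S₁ ∨ ⋯ ∨ S_l} ⟶ (sB)_W` (with the signs of
the Koszul rule), where `S_i` is a subdivision of the `i`-th bead of `W`. -/
def appTens {A B : AInftyCat K} (f : AInftyFunctor A B) :
    ∀ (W : Beads) (Ss : List Beads), QHom f.obj (sT A.Hom Ss.flatten) (sT B.Hom W)
  | [], [] => fun _ _ => condKMap K (congrArg f.obj)
  | β :: W, S :: Ss => fun x y => (-1 : K) ^ (excess Ss * S.dim) •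
      (qmap (f.appS S β.dim) (appTens f W Ss) x y ∘ₗ split S Ss.flatten x y)
  | [], _ :: _ => 0
  | _ :: _, [] => 0

/-- The component at `W` of the image of a collection under an `A_∞`-functor `f`:
`∑ (-1)^{ε(S₁) + ⋯ + ε(S_l) + φ(ν)} (f_{ℓ(S₁)} ⊗ ⋯ ⊗ f_{ℓ(S_l)})(y_{S₁ ∨ ⋯ ∨ S_l})`,
the sum over all inert maps `ν : S₁ ∨ ⋯ ∨ S_l ⟶ U`, i.e. all choices of a subdivision `S_i` of
each bead. -/
def push {A B : AInftyCat K} (f : AInftyFunctor A B) {a b : A.Ob} (y : Fam A a b) (W : Beads) :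
    sT B.Hom W (f.obj a) (f.obj b) :=
  ((W.map Bead.subdiv).sections.map fun Ss =>
    (-1 : K) ^ ((Ss.map Beads.eps).sum + sig Ss) • appTens f W Ss a b (y Ss.flatten)).sum

end Nerve

/-- The templicial `A_∞`-nerve functor: a templicial structure on the quivers `N(A)_n` for
every `A`, and a templicial morphism for every `A_∞`-functor, given by the
formulas `map_apply`, `comul_apply`, `counit_apply` and `app_apply` (which determine them). -/
structure TemplicialNerve (K : Type u) [Field K] where
  /-- The templicial vector space `N(A)`. -/
  str : ∀ A : AInftyCat K, TempStr K (nerve A)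
  /-- `(f^* y)_g = ē (y_{g'})`. -/
  map_apply : ∀ (A : AInftyCat K) {m n : ℕ} (f : FInt m n) (a b : A.Ob) (y : nerve A n a b)
    (W : Beads), W.Valid m →
      Nerve.π W a b ((str A).map f a b y) =
        Nerve.bar f 0 W a b (Nerve.π (Nerve.imgs f 0 W) a b y)
  /-- `μ(y) = (y_{g₁ ∨ g₂})` under the isomorphism `(sA)_{U₁ ∨ U₂} ≅ (sA)_{U₁} ⊗ (sA)_{U₂}`. -/
  comul_apply : ∀ (A : AInftyCat K) (n k l : ℕ) (h : n = k + l) (a b : A.Ob) (y : nerve A n a b)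
    (W₁ W₂ : Beads), W₁.Valid k → W₂.Valid l →
      qmap (Nerve.π W₁) (Nerve.π W₂) a b ((str A).comul n k l h a b y) =
        split W₁ W₂ a b (Nerve.π (W₁ ++ W₂) a b y)
  counit_apply : ∀ (A : AInftyCat K) (a b : A.Ob) (y : nerve A 0 a b),
    (str A).counit a b y = Nerve.π [] a b y
  /-- The morphism `N(f) : N(A) ⟶ N(B)`, with `f` on vertices. -/
  app : ∀ {A B : AInftyCat K} (f : AInftyFunctor A B) (n : ℕ),
    QHom f.obj (nerve A n) (nerve B n)
  /-- `f(y)_g = ∑ (-1)^{ε(S₁) + ⋯ + ε(S_l) + φ(ν)} (f_{ℓ(S₁)} ⊗ ⋯ ⊗ f_{ℓ(S_l)})(y_{g ∘ ν})`. -/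
  app_apply : ∀ {A B : AInftyCat K} (f : AInftyFunctor A B) (n : ℕ) (a b : A.Ob)
    (y : nerve A n a b) (W : Beads), W.Valid n →
      Nerve.π W (f.obj a) (f.obj b) (app f n a b y) = Nerve.push f (fun V => Nerve.π V a b y) W
  app_natural : ∀ {A B : AInftyCat K} (f : AInftyFunctor A B) {m n : ℕ} (h : FInt m n) (a b : A.Ob)
    (y : nerve A n a b),
      app f m a b ((str A).map h a b y) = (str B).map h (f.obj a) (f.obj b) (app f n a b y)
  app_comul : ∀ {A B : AInftyCat K} (f : AInftyFunctor A B) (n k l : ℕ) (h : n = k + l)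
    (a b : A.Ob) (y : nerve A n a b),
      (str B).comul n k l h (f.obj a) (f.obj b) (app f n a b y) =
        qmap (app f k) (app f l) a b ((str A).comul n k l h a b y)
  app_counit : ∀ {A B : AInftyCat K} (f : AInftyFunctor A B) (a b : A.Ob) (y : nerve A 0 a b),
    unitVal ((str B).counit (f.obj a) (f.obj b) (app f 0 a b y)) = unitVal ((str A).counit a b y)
  app_id : ∀ (A : AInftyCat K) (n : ℕ) (a b : A.Ob) (y : nerve A n a b),
    app (AInftyFunctor.id A) n a b y = y
  app_comp : ∀ {A B C : AInftyCat K} (f : AInftyFunctor A B) (g : AInftyFunctor B C) (n : ℕ)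
    (a b : A.Ob) (y : nerve A n a b),
      app (AInftyFunctor.comp f g) n a b y = app g n (f.obj a) (f.obj b) (app f n a b y)

/-- The templicial `A_∞`-nerve as a functor. -/
def TemplicialNerve.functor {K : Type u} [Field K] (N : TemplicialNerve K) :
    AInftyCat K ⥤ TempVect K where
  obj A := ⟨A.Ob, nerve A, N.str A⟩
  map f :=
    { obj := f.obj
      app := N.app f
      natural := N.app_natural f
      comul := N.app_comul f
      counit := N.app_counit f }
  map_id A := TempVect.Hom.ext rfl (heq_of_eq (by
    funext n a b
    exact LinearMap.ext (N.app_id A n a b)))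
  map_comp f g := TempVect.Hom.ext rfl (heq_of_eq (by
    funext n a b
    exact LinearMap.ext (N.app_comp f g n a b)))

end Nerve

end

end AInf

namespace AInf

noncomputable section

section ListSums

variable {α β γ M N : Type*} [AddCommMonoid M] [AddCommMonoid N]

/-- The sum of the values of a function on the members of a list. -/
def lsum (l : List α) (f : α → M) : M := (l.map f).sum

@[simp] theorem lsum_nil (f : α → M) : lsum [] f = 0 := rfl

@[simp] theorem lsum_cons (a : α) (l : List α) (f : α → M) :
    lsum (a :: l) f = f a + lsum l f := by simp [lsum]

theorem lsum_append (l l' : List α) (f : α → M) : lsum (l ++ l') f = lsum l f + lsum l' f := by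
  simp [lsum]

theorem lsum_flatMap (l : List α) (g : α → List β) (f : β → M) :
    lsum (l.flatMap g) f = lsum l fun a => lsum (g a) f := by
  induction l with
  | nil => rfl
  | cons a l ih => rw [List.flatMap_cons, lsum_append, lsum_cons, ih]

theorem lsum_map (l : List α) (g : α → β) (f : β → M) :
    lsum (l.map g) f = lsum l fun a => f (g a) := by
  simp [lsum, Function.comp_def]

theorem lsum_congr {l : List α} {f g : α → M} (h : ∀ a ∈ l, f a = g a) : lsum l f = lsum l g := by
  rw [lsum, lsum, List.map_congr_left h]

theorem lsum_zero (l : List α) : lsum l (fun _ => (0 : M)) = 0 := by simp [lsum]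

theorem lsum_eq_zero {l : List α} {f : α → M} (h : ∀ a ∈ l, f a = 0) : lsum l f = 0 := by
  rw [lsum_congr h, lsum_zero]

theorem lsum_add (l : List α) (f g : α → M) :
    (lsum l fun a => f a + g a) = lsum l f + lsum l g := by
  induction l with
  | nil => simp
  | cons a l ih => simp only [lsum_cons, ih]; exact add_add_add_comm _ _ _ _

theorem lsum_comm (l : List α) (l' : List β) (f : α → β → M) :
    (lsum l fun a => lsum l' (f a)) = lsum l' fun b => lsum l fun a => f a b := by
  induction l with
  | nil => simp [lsum_zero]
  | cons a l ih => simp only [lsum_cons, ih, lsum_add]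

theorem map_lsum {F : Type*} [FunLike F M N] [AddMonoidHomClass F M N] (L : F) (l : List α)
    (f : α → M) : L (lsum l f) = lsum l fun a => L (f a) := by
  induction l with
  | nil => simp
  | cons a l ih => simp only [lsum_cons, map_add, ih]

theorem lsum_smul {K : Type*} [Field K] {M : Type*} [AddCommGroup M] [Module K M] (k : K)
    (l : List α) (f : α → M) : k • lsum l f = lsum l fun a => k • f a :=
  map_lsum (LinearMap.lsmul K M k) l f

theorem lsum_sub {M : Type*} [AddCommGroup M] (l : List α) (f g : α → M) :
    (lsum l fun a => f a - g a) = lsum l f - lsum l g := by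
  induction l with
  | nil => simp
  | cons a l ih => simp only [lsum_cons, ih]; abel

end ListSums

section Cuts

variable {α M : Type*} [AddCommMonoid M]

/-- All ways to write a list as a concatenation of two lists. -/
def splits : List α → List (List α × List α)
  | [] => [([], [])]
  | g :: l => ([], g :: l) :: (splits l).map fun p => (g :: p.1, p.2)

/-- All ways to write a list as a concatenation of nonempty lists. -/
def cuts : List α → List (List (List α))
  | [] => [[]]
  | g :: l => (cuts l).flatMap fun S => match S with
    | [] => [[[g]]]
    | s :: S => [[g] :: s :: S, (g :: s) :: S]

theorem subdiv_eq_cuts : ∀ b : Bead, b.subdiv = cuts b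
  | [] => rfl
  | g :: b => by 
    rw [Bead.subdiv, subdiv_eq_cuts b, cuts]
    congr 1
    funext S
    cases S <;> rfl

theorem append_of_mem_splits {l : List α} {p : List α × List α} (h : p ∈ splits l) :
    p.1 ++ p.2 = l := by
  induction l generalizing p with
  | nil => simp only [splits, List.mem_singleton] at h; subst h; rfl
  | cons g l ih =>
    simp only [splits, List.mem_cons, List.mem_map] at h
    rcases h with rfl | ⟨q, hq, rfl⟩
    · rfl
    · simp [ih hq]

theorem flatten_of_mem_cuts {l : List α} {S : List (List α)} (h : S ∈ cuts l) :
    S.flatten = l ∧ ∀ s ∈ S, s ≠ [] := by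
  induction l generalizing S with
  | nil => simp only [cuts, List.mem_singleton] at h; subst h; simp
  | cons g l ih =>
    simp only [cuts, List.mem_flatMap] at h
    obtain ⟨T, hT, hS⟩ := h
    obtain ⟨h1, h2⟩ := ih hT
    cases T with
    | nil => simp only [List.mem_singleton] at hS; subst hS; simp [← h1]
    | cons s T =>
      simp only [List.mem_cons, List.not_mem_nil, or_false] at hS
      rcases hS with rfl | rfl
      · refine ⟨by simp [← h1], fun t ht => ?_⟩
        rcases List.mem_cons.mp ht with rfl | ht
        · simp
        · exact h2 t ht
      · refine ⟨by simp [← h1], fun t ht => ?_⟩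
        rcases List.mem_cons.mp ht with rfl | ht
        · simp
        · exact h2 t (List.mem_cons_of_mem _ ht)

theorem lsum_splits_cons (g : α) (l : List α) (φ : List α → List α → M) :
    lsum (splits (g :: l)) (fun p => φ p.1 p.2) =
      φ [] (g :: l) + lsum (splits l) fun p => φ (g :: p.1) p.2 := by
  rw [splits, lsum_cons, lsum_map]

/-- Summation over the first block. -/
theorem lsum_cuts_cons (g : α) (l : List α) (φ : List (List α) → M) :
    lsum (cuts (g :: l)) φ =
      lsum (splits l) fun p => lsum (cuts p.2) fun S => φ ((g :: p.1) :: S) := by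
  induction l generalizing g φ with
  | nil => simp [cuts, splits]
  | cons h l ih =>
    have h1 := ih h fun S => match S with
      | [] => φ [[g]]
      | s :: S => φ ([g] :: s :: S) + φ ((g :: s) :: S)
    rw [cuts, lsum_flatMap,
      lsum_splits_cons h l fun p q => lsum (cuts q) fun S => φ ((g :: p) :: S)]
    trans lsum (cuts (h :: l)) fun S => match S with
      | [] => φ [[g]]
      | s :: S => φ ([g] :: s :: S) + φ ((g :: s) :: S)
    · refine lsum_congr fun S _ => ?_
      cases S <;> simp
    · rw [h1]
      simp only [lsum_add]
      rw [← ih h fun S => φ ([g] :: S)]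

theorem lsum_splits_assoc (l : List α) (φ : List α → List α → List α → M) :
    (lsum (splits l) fun r => lsum (splits r.1) fun p => φ p.1 p.2 r.2) =
      lsum (splits l) fun p => lsum (splits p.2) fun q => φ p.1 q.1 q.2 := by
  induction l generalizing φ with
  | nil => rfl
  | cons g l ih =>
    rw [lsum_splits_cons g l fun a b => lsum (splits a) fun p => φ p.1 p.2 b,
      lsum_splits_cons g l fun a b => lsum (splits b) fun p => φ a p.1 p.2]
    rw [lsum_congr (l := splits l) fun r _ => lsum_splits_cons g r.1 fun a b => φ a b r.2,
      lsum_add, ← ih fun a b c => φ (g :: a) b c]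
    rw [lsum_splits_cons g l fun a b => φ [] a b]
    simp only [splits, lsum_cons, lsum_nil, add_zero, add_assoc]

theorem lsum_cuts_splits : ∀ (n : ℕ) (l : List α), l.length ≤ n →
    ∀ φ : List (List α) → List (List α) → M,
    (lsum (cuts l) fun T => lsum (splits T) fun p => φ p.1 p.2) =
      lsum (splits l) fun p => lsum (cuts p.1) fun T₁ => lsum (cuts p.2) fun T₂ => φ T₁ T₂
  | n, [], _, φ => by simp [cuts, splits]
  | 0, g :: l, h, φ => by simp at h
  | n + 1, g :: l, h, φ => by
    rw [lsum_cuts_cons,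
      lsum_splits_cons g l fun a b => lsum (cuts a) fun T₁ => lsum (cuts b) fun T₂ => φ T₁ T₂]
    simp only [lsum_splits_cons _ _ φ, lsum_add]
    congr 1
    · simp only [cuts, lsum_cons, lsum_nil, add_zero]
      exact (lsum_cuts_cons g l (fun T => φ [] T)).symm
    · simp only [lsum_cuts_cons]
      rw [lsum_splits_assoc l fun a b c => lsum (cuts b) fun S => lsum (cuts c) fun T =>
        φ ((g :: a) :: S) T]
      refine lsum_congr fun p hp => ?_
      refine lsum_cuts_splits n p.2 ?_ fun T₁ T₂ => φ ((g :: p.1) :: T₁) T₂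
      have := congrArg List.length (append_of_mem_splits hp)
      simp at this h
      omega

theorem lsum_sections_cons {β : Type*} (l : List β) (L : List (List β)) (φ : List β → M) :
    lsum (List.sections (l :: L)) φ = lsum l fun a => lsum (List.sections L) fun s =>
      φ (a :: s) := by
  rw [List.sections, lsum_flatMap, lsum_comm]
  simp only [lsum_map]

/-- Coassociativity of subdivisions. -/
theorem lsum_cuts_sections : ∀ (n : ℕ) (l : List α), l.length ≤ n →
    ∀ φ : List (List (List α)) → M,
    (lsum (cuts l) fun S => lsum (S.map cuts).sections φ) =
      lsum (cuts l) fun T => lsum (cuts T) φ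
  | n, [], _, φ => by simp [cuts]
  | 0, g :: l, h, φ => by simp at h
  | n + 1, g :: l, h, φ => by
    rw [lsum_cuts_cons, lsum_cuts_cons]
    simp only [List.map_cons, lsum_sections_cons, lsum_cuts_cons]
    have e : ∀ p ∈ splits l, ∀ ψ : List (List α) → List (List α) → M,
        (lsum (cuts p.2) fun T => lsum (splits T) fun q => ψ q.1 q.2) = _ := fun p hp ψ =>
      lsum_cuts_splits n p.2 (by
        have := congrArg List.length (append_of_mem_splits hp)
        simp at this h
        omega) ψ
    rw [lsum_congr fun p hp => e p hp fun a b => lsum (cuts b) fun S => φ (((g :: p.1) :: a) :: S),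
      ← lsum_splits_assoc l fun a b c => lsum (cuts b) fun T₁ => lsum (cuts c) fun T₂ =>
        lsum (cuts T₂) fun D => φ (((g :: a) :: T₁) :: D)]
    refine lsum_congr fun p hp => ?_
    rw [lsum_comm]
    refine lsum_congr fun q hq => ?_
    rw [lsum_comm]
    refine lsum_congr fun U _ => ?_
    refine lsum_cuts_sections n p.2 ?_ fun D => φ (((g :: q.1) :: U) :: D)
    have := congrArg List.length (append_of_mem_splits hp)
    simp at this h
    omega

/-- The sum over all ways to write a list as a concatenation `p q t` with `q` nonempty. -/
def midSum (l : List α) (φ : List α → List α → List α → M) : M :=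
  lsum (splits l) fun p => lsum (splits p.2) fun q => if q.1 = [] then 0 else φ p.1 q.1 q.2

theorem midSum_nil (φ : List α → List α → List α → M) : midSum [] φ = 0 := by
  simp [midSum, splits]

theorem midSum_cons (g : α) (l : List α) (φ : List α → List α → List α → M) :
    midSum (g :: l) φ = (lsum (splits l) fun p => φ [] (g :: p.1) p.2) +
      midSum l fun p q t => φ (g :: p) q t := by
  rw [midSum, lsum_splits_cons g l fun a b => lsum (splits b) fun q =>
    if q.1 = [] then 0 else φ a q.1 q.2, lsum_splits_cons g l fun a b =>
    if a = [] then 0 else φ [] a b]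
  simp [midSum]

theorem midSum_congr {l : List α} {φ ψ : List α → List α → List α → M}
    (h : ∀ p q t, q ≠ [] → p ++ (q ++ t) = l → φ p q t = ψ p q t) :
    midSum l φ = midSum l ψ := by
  refine lsum_congr fun p hp => lsum_congr fun q hq => ?_
  split_ifs with h0
  · rfl
  · exact h _ _ _ h0 (by rw [append_of_mem_splits hq, append_of_mem_splits hp])

theorem cuts_ne_nil {l : List α} (h : l ≠ []) {S : List (List α)} (hS : S ∈ cuts l) : S ≠ [] := by
  rintro rfl
  exact h (flatten_of_mem_cuts hS).1.symm

theorem cuts_eq_nil {S : List (List α)} (hS : S ∈ cuts ([] : List α)) : S = [] := by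
  simpa [cuts] using hS

theorem lsum_cuts_midSum (l : List α) (φ : List (List α) → List (List α) → List (List α) → M) :
    (lsum (cuts l) fun T => midSum T φ) = midSum l fun b₁ b₂ b₃ =>
      lsum (cuts b₁) fun T₁ => lsum (cuts b₂) fun T₂ => lsum (cuts b₃) fun T₃ => φ T₁ T₂ T₃ := by
  simp only [midSum]
  rw [lsum_cuts_splits _ l le_rfl fun a b => lsum (splits b) fun q =>
    if q.1 = [] then 0 else φ a q.1 q.2]
  refine lsum_congr fun p _ => ?_
  rw [lsum_congr fun T₁ _ => lsum_cuts_splits _ p.2 le_rfl fun a b =>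
    if a = [] then 0 else φ T₁ a b, lsum_comm]
  refine lsum_congr fun q _ => ?_
  split_ifs with h
  · refine lsum_eq_zero fun T₁ _ => lsum_eq_zero fun T₂ hT => ?_
    rw [h] at hT
    simp [cuts_eq_nil hT, lsum_zero]
  · refine lsum_congr fun T₁ _ => lsum_congr fun T₂ hT => ?_
    simp [cuts_ne_nil h hT]

theorem lsum_cuts_single (l : List α) (h0 : l ≠ []) (φ : List (List α) → M)
    (h : ∀ S ∈ cuts l, S.length ≠ 1 → φ S = 0) : lsum (cuts l) φ = φ [l] := by
  induction l generalizing φ with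
  | nil => exact absurd rfl h0
  | cons g l ih =>
    cases l with
    | nil => simp [cuts]
    | cons g' l =>
      rw [cuts, lsum_flatMap, ih (by simp)]
      · rw [show (match [g' :: l] with
          | [] => [[[g]]]
          | s :: S => [[g] :: s :: S, (g :: s) :: S]) = [[[g], g' :: l], [g :: g' :: l]] from rfl]
        rw [lsum_cons, lsum_cons, lsum_nil, add_zero, h _ _ (by simp), zero_add]
        rw [cuts, List.mem_flatMap]
        refine ⟨[g' :: l], ?_, by simp⟩
        clear ih h h0 φ
        induction l generalizing g' with
        | nil => simp [cuts]
        | cons x l ih =>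
          rw [cuts, List.mem_flatMap]
          exact ⟨_, ih x, by simp⟩
      · intro S hS hl
        refine lsum_eq_zero fun T hT => h T ?_ ?_
        · rw [cuts, List.mem_flatMap]
          exact ⟨S, hS, hT⟩
        · have hne := cuts_ne_nil (by simp) hS
          cases S with
          | nil => exact absurd rfl hne
          | cons s S =>
            simp only [List.length_cons, List.mem_cons, List.not_mem_nil, or_false] at hl hT
            rcases hT with rfl | rfl
            · simp
            · simpa using hl

/-- A sum over subdivisions whose terms with at least three blocks vanish. -/
theorem lsum_cuts_pairs (g : α) (l : List α) (φ : List (List α) → M)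
    (h : ∀ S ∈ cuts (g :: l), 2 < S.length → φ S = 0) :
    lsum (cuts (g :: l)) φ =
      lsum (splits l) fun p => if p.2 = [] then φ [g :: l] else φ [g :: p.1, p.2] := by
  rw [lsum_cuts_cons]
  refine lsum_congr fun p hp => ?_
  split_ifs with hq
  · have := append_of_mem_splits hp
    rw [hq, List.append_nil] at this
    rw [hq, this]
    simp [cuts]
  · rw [lsum_cuts_single _ hq fun S => φ ((g :: p.1) :: S)]
    intro S hS hl
    refine h _ ?_ ?_
    · have key : ∀ (l : List α) (g : α) (p : List α × List α), p ∈ splits l → ∀ S ∈ cuts p.2,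
          (g :: p.1) :: S ∈ cuts (g :: l) := by
        intro l
        induction l with
        | nil =>
          intro g p hp S hS
          simp only [splits, List.mem_singleton] at hp
          subst hp
          simp [cuts_eq_nil hS, cuts]
        | cons x l ih =>
          intro g p hp S hS
          simp only [splits, List.mem_cons, List.mem_map] at hp
          rw [cuts, List.mem_flatMap]
          rcases hp with rfl | ⟨q, hq, rfl⟩
          · refine ⟨S, hS, ?_⟩
            have := cuts_ne_nil (by simp) hS
            cases S with
            | nil => exact absurd rfl this
            | cons s S => simp
          · exact ⟨_, ih x q hq S hS, by simp⟩
      exact key l g p hp S hS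
    · have := cuts_ne_nil hq hS
      cases S with
      | nil => exact absurd rfl this
      | cons s S => simp at hl ⊢; cases S <;> simp at hl ⊢

end Cuts

section Merge

variable {K : Type*} [Field K] {M : Type*} [AddCommGroup M] [Module K M]

/-- The alternating sum over the inner faces of a bead. -/
def mergeSum : Bead → (Bead → M) → M
  | g :: h :: b, ψ => ψ ((g + h) :: b) - mergeSum (h :: b) fun c => ψ (g :: c)
  | [], _ => 0
  | [_], _ => 0

theorem sum_merge : ∀ (b : Bead) (ψ : Bead → M),
    ∑ j : Fin (b.length - 1), (-1 : K) ^ (j : ℕ) • ψ (b.merge j) = mergeSum b ψ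
  | [], _ => rfl
  | [_], _ => rfl
  | g :: h :: b, ψ => by
    rw [mergeSum, ← sum_merge (h :: b) fun c => ψ (g :: c)]
    have : ∀ (n : ℕ) (F : ℕ → M), ∑ j : Fin (n + 1), (-1 : K) ^ (j : ℕ) • F j =
        F 0 - ∑ j : Fin n, (-1 : K) ^ (j : ℕ) • F (j + 1) := by
      intro n F
      rw [Fin.sum_univ_succ, sub_eq_add_neg, ← Finset.sum_neg_distrib]
      simp [pow_succ]
    exact this b.length fun j => ψ (Bead.merge (g :: h :: b) j)

theorem mergeSum_congr : ∀ {b : Bead} {ψ ψ' : Bead → M},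
    (∀ c : Bead, c.length + 1 = b.length → c ≠ [] → c.sum = b.sum → ψ c = ψ' c) →
      mergeSum b ψ = mergeSum b ψ'
  | [], _, _, _ => rfl
  | [_], _, _, _ => rfl
  | g :: h :: b, ψ, ψ', e => by
    rw [mergeSum, mergeSum, e _ (by simp) (by simp) (by simp; omega),
      mergeSum_congr (b := h :: b) fun c h1 h2 h3 => e (g :: c) (by simpa using h1) (by simp)
        (by simp only [List.sum_cons] at h3 ⊢; omega)]

theorem mergeSum_congr_pos : ∀ {b : Bead} {ψ ψ' : Bead → M}, (∀ g ∈ b, 0 < g) →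
    (∀ c : Bead, c.length + 1 = b.length → c ≠ [] → (∀ g ∈ c, 0 < g) → c.sum = b.sum →
      ψ c = ψ' c) → mergeSum b ψ = mergeSum b ψ'
  | [], _, _, _, _ => rfl
  | [_], _, _, _, _ => rfl
  | g :: h :: b, ψ, ψ', hp, e => by
    have hg := hp g (by simp)
    rw [mergeSum, mergeSum, e _ (by simp) (by simp) (fun x hx => ?_) (by simp; omega),
      mergeSum_congr_pos (b := h :: b) (fun x hx => hp x (List.mem_cons_of_mem _ hx))
        fun c h1 h2 h4 h3 => e (g :: c) (by simpa using h1) (by simp)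
        (fun x hx => by
          rcases List.mem_cons.mp hx with rfl | hx
          exacts [hg, h4 x hx])
        (by simp only [List.sum_cons] at h3 ⊢; omega)]
    rcases List.mem_cons.mp hx with rfl | hx
    · omega
    · exact hp x (by simp [hx])

theorem mergeSum_zero : ∀ b : Bead, mergeSum b (fun _ => (0 : M)) = 0
  | [] => rfl
  | [_] => rfl
  | g :: h :: b => by rw [mergeSum, mergeSum_zero (h :: b), sub_zero]

theorem mergeSum_lsum {α : Type*} (l : List α) : ∀ (b : Bead) (ψ : α → Bead → M),
    (mergeSum b fun c => lsum l fun a => ψ a c) = lsum l fun a => mergeSum b (ψ a)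
  | [], _ => (lsum_zero l).symm
  | [_], _ => (lsum_zero l).symm
  | g :: h :: b, ψ => by
    simp only [mergeSum, lsum_sub]
    rw [mergeSum_lsum l (h :: b) fun a c => ψ a (g :: c)]

theorem mergeSum_add : ∀ (b : Bead) (ψ ψ' : Bead → M),
    (mergeSum b fun c => ψ c + ψ' c) = mergeSum b ψ + mergeSum b ψ'
  | [], _, _ => (add_zero 0).symm
  | [_], _, _ => (add_zero 0).symm
  | g :: h :: b, ψ, ψ' => by
    rw [mergeSum, mergeSum, mergeSum, mergeSum_add (h :: b)]; abel

/-- Apply a function to the decompositions of a list after its first element. -/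
def splitTail (θ : Bead → Bead → M) : Bead → M
  | [] => 0
  | x :: l => lsum (splits l) fun p => θ (x :: p.1) p.2

variable (K) in
/-- The Leibniz rule for inner faces. -/
theorem mergeSum_splitTail (g : ℕ) (l : Bead) (θ : Bead → Bead → M) :
    mergeSum (g :: l) (splitTail θ) = lsum (splits l) fun p =>
      mergeSum (g :: p.1) (fun c => θ c p.2) +
        (-1 : K) ^ (p.1.length + 1) • mergeSum p.2 (θ (g :: p.1)) := by
  induction l generalizing g θ with
  | nil => simp [splits, mergeSum]
  | cons h l ih =>
    rw [mergeSum, lsum_splits_cons h l fun a b => mergeSum (g :: a) (fun c => θ c b) +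
      (-1 : K) ^ (a.length + 1) • mergeSum b (θ (g :: a))]
    have e : mergeSum (h :: l) (fun c => splitTail θ (g :: c)) =
        mergeSum (h :: l) (θ [g]) + mergeSum (h :: l) (splitTail fun a b => θ (g :: a) b) := by
      rw [← mergeSum_add]
      refine mergeSum_congr fun c _ hc _ => ?_
      cases c with
      | nil => exact absurd rfl hc
      | cons x c => exact lsum_splits_cons x c fun a b => θ (g :: a) b
    rw [e, ih]
    simp only [mergeSum, splitTail, lsum_add, lsum_sub, List.length_cons, pow_succ,
      mul_neg, mul_one, neg_smul, neg_neg, List.length_nil, pow_zero, one_smul]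
    have : ∀ (l : List (Bead × Bead)) (f : Bead × Bead → M),
        (lsum l fun a => -f a) = - lsum l f := fun l f => by
      have := lsum_sub l (fun _ => (0 : M)) f
      simpa [lsum_zero] using this
    simp only [this]
    abel

variable (K) in
theorem mergeSum_cuts : ∀ (n : ℕ) (l : Bead), l.length ≤ n → ∀ φ : Beads → M,
    (mergeSum l fun c => lsum (cuts c) φ) = midSum l fun b₁ b b₃ => (-1 : K) ^ b₁.length •
      lsum (cuts b₁) fun T₁ => lsum (cuts b₃) fun T₃ => mergeSum b fun c => φ (T₁ ++ c :: T₃)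
  | n, [], _, φ => by simp [mergeSum, midSum_nil]
  | 0, g :: l, h, φ => by simp at h
  | n + 1, g :: l, h, φ => by
    have e1 : (mergeSum (g :: l) fun c => lsum (cuts c) φ) =
        mergeSum (g :: l) (splitTail fun a b => lsum (cuts b) fun S => φ (a :: S)) := by
      refine mergeSum_congr fun c _ hc _ => ?_
      cases c with
      | nil => exact absurd rfl hc
      | cons x c => exact lsum_cuts_cons x c φ
    rw [e1, mergeSum_splitTail K, midSum_cons, lsum_add]
    congr 1
    · refine lsum_congr fun p _ => ?_
      simp only [List.length_nil, pow_zero, one_smul, cuts, lsum_cons, lsum_nil, add_zero,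
        List.nil_append]
      rw [mergeSum_lsum]
    · rw [lsum_congr fun p hp => by
        rw [mergeSum_cuts n p.2 (by
          have := congrArg List.length (append_of_mem_splits hp)
          simp at this h
          omega)]]
      simp only [lsum_cuts_cons, List.length_cons]
      simp only [midSum, lsum_smul]
      rw [← lsum_splits_assoc l fun a b c => lsum (splits c) fun q => (-1 : K) ^ (a.length + 1) •
        if q.1 = [] then 0 else lsum (cuts b) fun T₁ => lsum (cuts q.2) fun T₃ =>
          (-1 : K) ^ b.length • mergeSum q.1 fun x => φ ((g :: a) :: (T₁ ++ x :: T₃))]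
      refine lsum_congr fun p _ => ?_
      rw [lsum_comm]
      refine lsum_congr fun q _ => ?_
      split_ifs with h0
      · simp [lsum_zero]
      · simp only [lsum_smul]
        refine lsum_congr fun r hr => ?_
        have := congrArg List.length (append_of_mem_splits hr)
        rw [List.length_append] at this
        refine lsum_congr fun T₁ _ => lsum_congr fun T₃ _ => ?_
        rw [smul_smul, ← pow_add, ← this]
        congr 2
        omega

end Merge

section Steps

set_option linter.unusedSectionVars false

open Chain

variable {K : Type u} [Field K] {O O' O'' : Type u}
variable {H : O → O → ℤ → ModuleCat.{u} K} {H' : O' → O' → ℤ → ModuleCat.{u} K}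
variable {H'' : O'' → O'' → ℤ → ModuleCat.{u} K}

/-- The list of degrees of a chain. -/
def Chain.degs {x y : O} : Chain H x y → List ℤ
  | nil _ => []
  | cons d _ c => d :: c.degs

@[simp] theorem Chain.degs_nil (x : O) : (nil x : Chain H x x).degs = [] := rfl

@[simp] theorem Chain.degs_cons {x y z : O} (d : ℤ) (a : H x y d) (c : Chain H y z) :
    (cons d a c).degs = d :: c.degs := rfl

@[simp] theorem Chain.degs_append {x y z : O} (p : Chain H x y) (q : Chain H y z) :
    (p.append q).degs = p.degs ++ q.degs := by
  induction p with
  | nil => rfl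
  | cons d a c ih => simp [ih]

theorem Chain.length_degs {x y : O} (c : Chain H x y) : c.degs.length = c.len := by
  induction c with
  | nil => rfl
  | cons d a c ih => simp [ih]

theorem Chain.sum_degs {x y : O} (c : Chain H x y) : c.degs.sum = c.deg := by
  induction c with
  | nil => rfl
  | cons d a c ih => simp [ih]

/-- The value of a function at the splitting of a chain after `k` elements; `0` if the chain is
too short. -/
def Chain.cutAt {M : Type u} [AddCommMonoid M] : ∀ (_ : ℕ) {x y : O}, Chain H x y →
    (∀ z, Chain H x z → Chain H z y → M) → M
  | 0, x, _, c, φ => φ x (nil x) c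
  | _ + 1, _, _, nil _, _ => 0
  | k + 1, _, _, cons d a c, φ => cutAt k c fun z p q => φ z (cons d a p) q

theorem Chain.exists_append {x y : O} (c : Chain H x y) (k : ℕ) (h : k ≤ c.len) :
    ∃ (z : O) (p : Chain H x z) (q : Chain H z y), p.len = k ∧ p.append q = c := by
  induction c generalizing k with
  | nil => exact ⟨_, nil _, nil _, (Nat.le_zero.mp h).symm, rfl⟩
  | cons d a c ih =>
    cases k with
    | zero => exact ⟨_, nil _, _, rfl, rfl⟩
    | succ k =>
      obtain ⟨z, p, q, h1, h2⟩ := ih k (by simpa using h)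
      exact ⟨z, cons d a p, q, by simp [h1], by simp [h2]⟩

section

variable {M : Type u} [AddCommMonoid M]

@[simp] theorem Chain.cutAt_append {x y z : O} (p : Chain H x z) (q : Chain H z y)
    (φ : ∀ z, Chain H x z → Chain H z y → M) : cutAt p.len (p.append q) φ = φ z p q := by
  induction p with
  | nil => rfl
  | cons d a p ih => exact ih q fun z p q => φ z (cons d a p) q

theorem Chain.cutAt_append' {x y z : O} {k : ℕ} (p : Chain H x z) (q : Chain H z y)
    (φ : ∀ z, Chain H x z → Chain H z y → M) (h : k = p.len) :
    cutAt k (p.append q) φ = φ z p q := by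
  subst h; exact cutAt_append p q φ

theorem Chain.cutAt_len {x y : O} {k : ℕ} (c : Chain H x y)
    (φ : ∀ z, Chain H x z → Chain H z y → M) (h : k = c.len) : cutAt k c φ = φ y c (nil y) := by
  conv_lhs => rw [← append_nil c]
  exact cutAt_append' c (nil y) φ h

theorem Chain.cutAt_of_lt {x y : O} (k : ℕ) (c : Chain H x y)
    (φ : ∀ z, Chain H x z → Chain H z y → M) (h : c.len < k) : cutAt k c φ = 0 := by
  induction c generalizing k with
  | nil =>
    cases k with
    | zero => simp at h
    | succ k => rfl
  | cons d a c ih =>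
    cases k with
    | zero => simp at h
    | succ k => exact ih k _ (by simpa using h)

theorem Chain.cutAt_congr {x y : O} (k : ℕ) (c : Chain H x y)
    {φ ψ : ∀ z, Chain H x z → Chain H z y → M}
    (h : ∀ z p q, p.append q = c → p.len = k → φ z p q = ψ z p q) :
    cutAt k c φ = cutAt k c ψ := by
  rcases le_or_gt k c.len with hk | hk
  · obtain ⟨z, p, q, rfl, rfl⟩ := c.exists_append k hk
    rw [cutAt_append, cutAt_append, h _ _ _ rfl rfl]
  · rw [cutAt_of_lt _ _ _ hk, cutAt_of_lt _ _ _ hk]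

theorem Chain.cutAt_cutAt {x y : O} (k l : ℕ) (c : Chain H x y)
    (φ : ∀ z w, Chain H x z → Chain H z w → Chain H w y → M) :
    (cutAt k c fun z p r => cutAt l r fun w q t => φ z w p q t) =
      cutAt (k + l) c fun w r t => cutAt k r fun z p q => φ z w p q t := by
  rcases le_or_gt (k + l) c.len with hk | hk
  · obtain ⟨z, p, q, h1, rfl⟩ := c.exists_append (k + l) hk
    obtain ⟨w, p, r, h2, rfl⟩ := p.exists_append k (by omega)
    have h3 : l = r.len := by simp at h1; omega
    rw [cutAt_append' _ _ _ h1.symm, cutAt_append' _ _ _ h2.symm, append_assoc,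
      cutAt_append' _ _ _ h2.symm, cutAt_append' _ _ _ h3]
  · rw [cutAt_of_lt _ _ _ hk]
    rcases le_or_gt k c.len with hk' | hk'
    · obtain ⟨z, p, q, rfl, rfl⟩ := c.exists_append k hk'
      rw [cutAt_append, cutAt_of_lt]
      simp at hk
      exact hk
    · rw [cutAt_of_lt _ _ _ hk']

end

variable {M N : Type u} [AddCommGroup M] [Module K M] [AddCommGroup N] [Module K N]

theorem Chain.cutAt_map {x y : O} (L : M →ₗ[K] N) (k : ℕ) (c : Chain H x y)
    (φ : ∀ z, Chain H x z → Chain H z y → M) :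
    L (cutAt k c φ) = cutAt k c fun z p q => L (φ z p q) := by
  rcases le_or_gt k c.len with hk | hk
  · obtain ⟨z, p, q, rfl, rfl⟩ := c.exists_append k hk
    rw [cutAt_append, cutAt_append]
  · rw [cutAt_of_lt _ _ _ hk, cutAt_of_lt _ _ _ hk, map_zero]

theorem Chain.cutAt_isLinearMap {V : Type u} [AddCommGroup V] [Module K V] {x y : O} (k : ℕ)
    (c : Chain H x y) (Θ : V → ∀ z, Chain H x z → Chain H z y → M)
    (h : ∀ z p q, IsLinearMap K fun a => Θ a z p q) :
    IsLinearMap K fun a => cutAt k c (Θ a) := by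
  rcases le_or_gt k c.len with hk | hk
  · obtain ⟨z, p, q, rfl, rfl⟩ := c.exists_append k hk
    simp only [cutAt_append]
    exact h _ _ _
  · simp only [cutAt_of_lt _ _ _ hk]
    exact isLinearMap_zero

theorem Chain.cutAt_isMultilinear (k : ℕ) {x y : O} (φ : ∀ z, Chain H x z → Chain H z y → M)
    (h1 : ∀ z q, IsMultilinear fun p => φ z p q) (h2 : ∀ z p, IsMultilinear fun q => φ z p q) :
    IsMultilinear fun c : Chain H x y => cutAt k c φ := by
  induction k generalizing x with
  | zero => exact h2 x (nil x)
  | succ k ih =>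
    intro z w p d t
    cases p with
    | nil =>
      exact cutAt_isLinearMap k t (fun a z p q => φ z (cons d a p) q) fun v p q =>
        h1 v q _ _ (nil _) d p
    | cons e b p =>
      exact ih (fun z p q => φ z (cons e b p) q) (fun v q => (h1 v q).cons e b)
        (fun v p => h2 v (cons e b p)) z w p d t

theorem Chain.IsMultilinear.append {x y z : O} {φ : Chain H x z → M} (h : IsMultilinear φ)
    (p : Chain H x y) : IsMultilinear fun c : Chain H y z => φ (p.append c) := by
  induction p with
  | nil => exact h
  | cons d a p ih => exact ih (h.cons d a)

/-- Multilinear operations with values in degree `d`. -/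
def Op (H : O → O → ℤ → ModuleCat.{u} K) (H' : O' → O' → ℤ → ModuleCat.{u} K) (o : O → O')
    (d : ℤ) : Submodule K (∀ x y, Chain H x y → H' (o x) (o y) d) where
  carrier := {F | ∀ x y, IsMultilinear (F x y)}
  add_mem' hf hg x y z w p d t := isLinearMap_add (hf x y z w p d t) (hg x y z w p d t)
  zero_mem' _ _ _ _ _ _ _ := isLinearMap_zero
  smul_mem' k _ hf x y z w p d t := isLinearMap_smul k (hf x y z w p d t)

/-- An operation applied to `k` elements of a chain. -/
structure Step (H : O → O → ℤ → ModuleCat.{u} K) (H' : O' → O' → ℤ → ModuleCat.{u} K)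
    (o : O → O') : Type u where
  k : ℕ
  d : ℤ
  F : Op H H' o d

variable {o : O → O'} {o' : O' → O''}

/-- The number of elements to which the operations of a list are applied. -/
def width (L : List (Step H H' o)) : ℕ := (L.map Step.k).sum

@[simp] theorem width_nil : width ([] : List (Step H H' o)) = 0 := rfl

@[simp] theorem width_cons (s : Step H H' o) (L : List (Step H H' o)) :
    width (s :: L) = s.k + width L := by simp [width]

@[simp] theorem width_append (L L' : List (Step H H' o)) :
    width (L ++ L') = width L + width L' := by simp [width]

/-- The value of a function at the empty chain, on empty chains, and `0` on other chains. -/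
def runNil {x y : O} (Φ : Chain H' (o x) (o y) → M) (c : Chain H x y) : M :=
  match x, y, c, Φ with
  | _, _, nil x, Φ => Φ (nil (o x))
  | _, _, cons _ _ _, _ => 0

/-- The tensor product of operations, as a transformation of functions of chains. -/
def run : List (Step H H' o) → ∀ {x y : O}, (Chain H' (o x) (o y) → M) → Chain H x y → M
  | [], _, _, Φ, c => runNil Φ c
  | s :: L, _, _, Φ, c => cutAt s.k c fun z p q => run L (fun v => Φ (cons s.d (s.F.1 _ z p) v)) q

theorem run_cons (s : Step H H' o) (L : List (Step H H' o)) {x y : O}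
    (Φ : Chain H' (o x) (o y) → M) (c : Chain H x y) : run (s :: L) Φ c =
      cutAt s.k c fun z p q => run L (fun v => Φ (cons s.d (s.F.1 _ z p) v)) q := by
  rfl

theorem run_of_len_ne (L : List (Step H H' o)) {x y : O} (Φ : Chain H' (o x) (o y) → M)
    (c : Chain H x y) (h : c.len ≠ width L) : run L Φ c = 0 := by
  induction L generalizing x with
  | nil =>
    cases c with
    | nil => simp at h
    | cons => rfl
  | cons s L ih =>
    rw [run_cons]
    rcases le_or_gt s.k c.len with hk | hk
    · obtain ⟨z, p, q, h1, rfl⟩ := c.exists_append s.k hk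
      rw [cutAt_append' _ _ _ h1.symm]
      refine ih _ _ ?_
      simp at h
      omega
    · rw [cutAt_of_lt _ _ _ hk]

theorem run_append (L L' : List (Step H H' o)) {x y : O} (Φ : Chain H' (o x) (o y) → M)
    (c : Chain H x y) : run (L ++ L') Φ c = cutAt (width L) c fun _ p q =>
      run L (fun u => run L' (fun v => Φ (u.append v)) q) p := by
  induction L generalizing x with
  | nil => rfl
  | cons s L ih =>
    simp only [List.cons_append, run_cons, ih, width_cons]
    rw [cutAt_cutAt]
    rfl

theorem run_congr (L : List (Step H H' o)) {x y : O} {Φ Ψ : Chain H' (o x) (o y) → M}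
    (c : Chain H x y) (h : ∀ v, v.len = L.length → Φ v = Ψ v) : run L Φ c = run L Ψ c := by
  induction L generalizing x with
  | nil =>
    cases c with
    | nil => exact h _ rfl
    | cons => rfl
  | cons s L ih =>
    rw [run_cons, run_cons]
    exact cutAt_congr _ _ fun z p q _ _ => ih q fun v hv => h _ (by simp [hv])

theorem run_map (X : M →ₗ[K] N) (L : List (Step H H' o)) {x y : O}
    (Φ : Chain H' (o x) (o y) → M) (c : Chain H x y) :
    X (run L Φ c) = run L (fun v => X (Φ v)) c := by
  induction L generalizing x with
  | nil =>
    cases c with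
    | nil => rfl
    | cons => exact map_zero X
  | cons s L ih => simp only [run_cons, cutAt_map, ih]

theorem run_zero (L : List (Step H H' o)) {x y : O} (c : Chain H x y) :
    run L (fun _ : Chain H' (o x) (o y) => (0 : M)) c = 0 :=
  (run_map (0 : M →ₗ[K] M) L (fun _ => 0) c).symm

theorem run_add (L : List (Step H H' o)) {x y : O} (Φ Ψ : Chain H' (o x) (o y) → M)
    (c : Chain H x y) : run L (fun v => Φ v + Ψ v) c = run L Φ c + run L Ψ c := by
  induction L generalizing x with
  | nil =>
    cases c with
    | nil => rfl
    | cons => exact (add_zero 0).symm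
  | cons s L ih =>
    simp only [run_cons, ih]
    rcases le_or_gt s.k c.len with hk | hk
    · obtain ⟨z, p, q, h1, rfl⟩ := c.exists_append s.k hk
      simp only [cutAt_append' _ _ _ h1.symm]
    · simp only [cutAt_of_lt _ _ _ hk, add_zero]

theorem run_isLinearMap {V : Type u} [AddCommGroup V] [Module K V] (L : List (Step H H' o))
    {x y : O} (Φ : V → Chain H' (o x) (o y) → M) (h : ∀ v, IsLinearMap K fun a => Φ a v)
    (c : Chain H x y) : IsLinearMap K fun a => run L (Φ a) c := by
  induction L generalizing x with
  | nil =>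
    cases c with
    | nil => exact h _
    | cons => exact isLinearMap_zero
  | cons s L ih =>
    simp only [run_cons]
    exact cutAt_isLinearMap _ _ _ fun z p q => ih _ (fun v => h _) q

theorem run_isMultilinear (L : List (Step H H' o)) {x y : O} (Φ : Chain H' (o x) (o y) → M)
    (hΦ : IsMultilinear Φ) : IsMultilinear (run L Φ) := by
  induction L generalizing x with
  | nil =>
    intro z w p d t
    have : (fun a : H z w d => run [] Φ (p.append (cons d a t))) = fun _ => 0 := by
      funext a
      exact run_of_len_ne _ _ _ (by simp)
    rw [this]
    exact isLinearMap_zero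
  | cons s L ih =>
    have : run (s :: L) Φ = fun c => cutAt s.k c fun z p q =>
        run L (fun v => Φ (cons s.d (s.F.1 _ z p) v)) q := funext fun c => run_cons _ _ _ _
    rw [this]
    refine cutAt_isMultilinear _ _ (fun z q w v p d t => ?_) fun z p => ih _ (hΦ.cons _ _)
    exact run_isLinearMap _ _ (fun v' => ((hΦ.head s.d v').mk'.comp
      (s.F.2 _ _ _ _ p d t).mk').isLinear) q

/-- The tensor product of operations, as a transformation of multilinear functions of chains. -/
def runL (L : List (Step H H' o)) {x y : O} : Mult H' (o x) (o y) M →ₗ[K] Mult H x y M where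
  toFun Φ := ⟨run L Φ.1, run_isMultilinear L Φ.1 Φ.2⟩
  map_add' Φ Ψ := Subtype.ext (funext fun c => run_add L Φ.1 Ψ.1 c)
  map_smul' k Φ := Subtype.ext (funext fun c => (run_map (LinearMap.lsmul K M k) L Φ.1 c).symm)

/-- The composition of an operation with a tensor product of operations. -/
def Step.comp (L : List (Step H H' o)) (s : Step H' H'' o') :
    Step H H'' fun x => o' (o x) where
  k := width L
  d := s.d
  F := ⟨fun x y c => run L (fun v => s.F.1 (o x) (o y) v) c, fun _ _ =>
    run_isMultilinear L _ (s.F.2 _ _)⟩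

/-- Composition of tensor products of operations. -/
theorem run_run (G : List (List (Step H H' o) × Step H' H'' o'))
    (hG : ∀ g ∈ G, g.1.length = g.2.k) {x y : O} (Φ : Chain H'' (o' (o x)) (o' (o y)) → M)
    (hΦ : IsMultilinear Φ) (c : Chain H x y) :
    run (G.flatMap Prod.fst) (run (G.map Prod.snd) Φ) c =
      run (o := fun x => o' (o x)) (G.map fun g => Step.comp g.1 g.2) Φ c := by
  induction G generalizing x with
  | nil => cases c <;> rfl
  | cons g G ih =>
    rw [List.flatMap_cons, run_append, List.map_cons, List.map_cons, run_cons]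
    refine cutAt_congr _ _ fun z p q _ _ => ?_
    rw [← ih (fun g hg => hG g (List.mem_cons_of_mem _ hg)) _ (hΦ.cons _ _)]
    have e : ∀ u : Chain H' (o x) (o z), u.len = g.1.length →
        (run (G.flatMap Prod.fst) (fun v => run (g.2 :: G.map Prod.snd) Φ (u.append v)) q : M) =
        run (G.flatMap Prod.fst) (run (G.map Prod.snd) fun v =>
          Φ (cons g.2.d (g.2.F.1 _ _ u) v)) q := by
      intro u hu
      congr 1
      funext v
      rw [run_cons, cutAt_append' _ _ _ (by rw [hu, hG g (by simp)])]
    rw [run_congr _ _ e]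
    have hl : IsLinearMap K fun a : H'' (o' (o x)) (o' (o z)) g.2.d => run (G.flatMap Prod.fst)
        (run (o := o') (y := o y) (G.map Prod.snd) fun v => Φ (cons g.2.d a v)) q :=
      run_isLinearMap _ _ (fun v => run_isLinearMap _ _ (fun w => hΦ.head _ w) v) q
    exact (run_map hl.mk' g.1 (fun v => g.2.F.1 _ _ v) p).symm

/-- Application of an operation to the `l` elements after the first `k` elements of a chain. -/
def ins (k l : ℕ) {d : ℤ} (b : Op H H (fun x => x) d) {x y : O} (Φ : Chain H x y → M)
    (c : Chain H x y) : M :=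
  cutAt k c fun _ p r => cutAt l r fun _ q t => Φ (p.append (cons d (b.1 _ _ q) t))

theorem ins_isMultilinear (k l : ℕ) {d : ℤ} (b : Op H H (fun x => x) d) {x y : O}
    (Φ : Chain H x y → M) (hΦ : IsMultilinear Φ) : IsMultilinear (ins k l b Φ) := by
  refine cutAt_isMultilinear _ _ (fun z q w v p e t => ?_) fun z p => ?_
  · refine cutAt_isLinearMap _ _ _ fun z' q t' => ?_
    simp only [append_assoc, cons_append]
    exact hΦ _ _ _ _ _
  · refine cutAt_isMultilinear _ _ (fun w t => ?_) fun w q => (hΦ.append p).cons _ _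
    intro v w' p' e t'
    exact ((((hΦ.append p).head d t).mk').comp (b.2 _ _ _ _ p' e t').mk').isLinear

/-- `ins` as a transformation of multilinear functions. -/
def insL (k l : ℕ) {d : ℤ} (b : Op H H (fun x => x) d) {x y : O} :
    Mult H x y M →ₗ[K] Mult H x y M where
  toFun Φ := ⟨ins k l b Φ.1, ins_isMultilinear k l b Φ.1 Φ.2⟩
  map_add' Φ Ψ := Subtype.ext (funext fun c => by
    simp only [ins, Submodule.coe_add, Pi.add_apply]
    rcases le_or_gt k c.len with hk | hk
    · obtain ⟨z, p, q, h1, rfl⟩ := c.exists_append k hk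
      simp only [cutAt_append' _ _ _ h1.symm]
      rcases le_or_gt l q.len with hl | hl
      · obtain ⟨w, q, t, h2, rfl⟩ := q.exists_append l hl
        simp only [cutAt_append' _ _ _ h2.symm]
      · simp only [cutAt_of_lt _ _ _ hl, add_zero]
    · simp only [cutAt_of_lt _ _ _ hk, add_zero])
  map_smul' k Φ := Subtype.ext (funext fun c => by
    simp only [ins]
    refine Eq.trans ?_ (cutAt_map (LinearMap.lsmul K M k) _ _ _).symm
    refine cutAt_congr _ _ fun z p q _ _ => ?_
    exact (cutAt_map (LinearMap.lsmul K M k) _ _ _).symm)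

theorem run_ins (L₀ Q L₁ : List (Step H H' o)) {d : ℤ} (b : Op H' H' (fun x => x) d) {x y : O}
    (Φ : Chain H' (o x) (o y) → M) (hΦ : IsMultilinear Φ) (c : Chain H x y) :
    run (L₀ ++ (Q ++ L₁)) (ins L₀.length Q.length b Φ) c =
      run (L₀ ++ (Step.comp (o' := fun x => x) Q ⟨Q.length, d, b⟩ : Step H H' o) :: L₁) Φ c := by
  rw [run_append, run_append]
  refine cutAt_congr _ _ fun z p r _ _ => run_congr _ _ fun u hu => ?_
  rw [run_append, run_cons]
  refine cutAt_congr _ _ fun w q t _ _ => ?_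
  have e : ∀ u' : Chain H' (o z) (o w), u'.len = Q.length →
      (run L₁ (fun v => ins L₀.length Q.length b Φ (u.append (u'.append v))) t : M) =
      run L₁ (fun v => Φ (u.append (cons d (b.1 _ _ u') v))) t := by
    intro u' hu'
    congr 1
    funext v
    rw [ins, cutAt_append' _ _ _ hu.symm, cutAt_append' _ _ _ hu'.symm]
  rw [run_congr _ _ e]
  have hl : IsLinearMap K fun a : H' (o z) (o w) d =>
      run L₁ (fun v => Φ (u.append (cons d a v))) t :=
    run_isLinearMap _ _ (fun v => (hΦ.append u).head _ v) t
  exact (run_map hl.mk' Q (fun v => b.1 _ _ v) q).symm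

theorem ins_run (L₀ L₁ : List (Step H H' o)) (l₁ l₂ l₃ : ℕ) {d d' : ℤ}
    (b : Op H H (fun x => x) d) (F : Op H H' o d') {x y : O} (Φ : Chain H' (o x) (o y) → M)
    (c : Chain H x y) (hc : width L₀ + (l₁ + (l₂ + l₃)) ≤ c.len) :
    ins (width L₀ + l₁) l₂ b (run (L₀ ++ (⟨l₁ + 1 + l₃, d', F⟩ : Step H H' o) :: L₁) Φ) c =
      run (L₀ ++ (⟨l₁ + (l₂ + l₃), d', ⟨fun x y => ins l₁ l₂ b (F.1 x y), fun x y =>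
        ins_isMultilinear _ _ _ _ (F.2 x y)⟩⟩ : Step H H' o) :: L₁) Φ c := by
  obtain ⟨z₀, p, c, h0, rfl⟩ := c.exists_append (width L₀) (by omega)
  rw [len_append] at hc
  obtain ⟨z₁, q₁, c, h1, rfl⟩ := c.exists_append l₁ (by omega)
  rw [len_append] at hc
  obtain ⟨z₂, q₂, c, h2, rfl⟩ := c.exists_append l₂ (by omega)
  rw [len_append] at hc
  obtain ⟨z₃, q₃, c, h3, rfl⟩ := c.exists_append l₃ (by omega)
  subst h1 h2 h3
  rw [ins, ← append_assoc, cutAt_append' _ _ _ (by simp [h0]), cutAt_append, run_append,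
    run_append, append_assoc, append_assoc, cutAt_append' _ _ _ h0.symm,
    cutAt_append' _ _ _ h0.symm]
  congr 1
  funext u
  rw [run_cons, run_cons]
  have e1 : q₁.append (q₂.append (q₃.append c)) = (q₁.append (q₂.append q₃)).append c := by
    simp [append_assoc]
  have e2 : ∀ a : H z₁ z₂ d, q₁.append (cons d a (q₃.append c)) =
      (q₁.append (cons d a q₃)).append c := by
    simp [append_assoc]
  rw [e1, e2, cutAt_append' _ _ _ (by simp; omega), cutAt_append' _ _ _ (by simp)]
  simp only [ins]
  rw [cutAt_append, cutAt_append]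

end Steps

section Evaluations

set_option linter.unusedSectionVars false

open Chain

variable {K : Type u} [Field K] {O O' O'' : Type u}
variable {H : O → O → ℤ → ModuleCat.{u} K} {H' : O' → O' → ℤ → ModuleCat.{u} K}
variable {H'' : O'' → O'' → ℤ → ModuleCat.{u} K}
variable {M : Type u} [AddCommGroup M] [Module K M]
variable {o : O → O'} {o' : O' → O''}

theorem run_congr_degs (L : List (Step H H' o)) {x y : O} {Φ Ψ : Chain H' (o x) (o y) → M}
    (c : Chain H x y) (h : ∀ v, v.degs = L.map Step.d → Φ v = Ψ v) : run L Φ c = run L Ψ c := by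
  induction L generalizing x with
  | nil =>
    cases c with
    | nil => exact h _ rfl
    | cons => rfl
  | cons s L ih =>
    rw [run_cons, run_cons]
    exact cutAt_congr _ _ fun z p q _ _ => ih q fun v hv => h _ (by simp [hv])

variable (H) in
/-- Families of functionals, indexed by lists of beads `W`, that depend only on the values of
a multilinear function on chains of the degrees of `W`. -/
structure Ev (a b : O) (M : Type u) [AddCommGroup M] [Module K M] : Type u where
  val : Beads → Mult H a b M →ₗ[K] M
  congr : ∀ (W : Beads) (Φ Ψ : Mult H a b M),
    (∀ c : Chain H a b, c.degs = W.map Bead.dim → Φ.1 c = Ψ.1 c) → val W Φ = val W Ψ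

variable (H H' o) in
/-- Expansions of beads as formal sums of operations applied to lists of beads. -/
structure Expn : Type u where
  terms : Bead → List (Beads × Step H H' o)
  width_eq : ∀ b, ∀ p ∈ terms b, p.2.k = p.1.length
  deg_eq : ∀ b, ∀ p ∈ terms b, p.2.d = Bead.dim b

namespace Expn

/-- The expansion of a list of beads. -/
def choices (u : Expn H H' o) : Beads → List (Beads × List (Step H H' o))
  | [] => [([], [])]
  | b :: W => (u.terms b).flatMap fun p => (choices u W).map fun q => (p.1 ++ q.1, p.2 :: q.2)

theorem lsum_choices_cons {N : Type*} [AddCommMonoid N] (u : Expn H H' o) (b : Bead) (W : Beads)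
    (κ : Beads × List (Step H H' o) → N) : lsum (u.choices (b :: W)) κ =
      lsum (u.terms b) fun p => lsum (u.choices W) fun q => κ (p.1 ++ q.1, p.2 :: q.2) := by
  rw [choices, lsum_flatMap]
  simp only [lsum_map]

theorem lsum_choices_append {N : Type*} [AddCommMonoid N] (u : Expn H H' o) (U V : Beads)
    (κ : Beads × List (Step H H' o) → N) : lsum (u.choices (U ++ V)) κ =
      lsum (u.choices U) fun p => lsum (u.choices V) fun q => κ (p.1 ++ q.1, p.2 ++ q.2) := by
  induction U generalizing κ with
  | nil => simp [choices]
  | cons b U ih =>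
    rw [List.cons_append, lsum_choices_cons, lsum_choices_cons]
    simp only [ih, List.append_assoc, List.cons_append]

theorem choices_spec (u : Expn H H' o) {W : Beads} {p : Beads × List (Step H H' o)}
    (hp : p ∈ u.choices W) :
    p.2.length = W.length ∧ width p.2 = p.1.length ∧ p.2.map Step.d = W.map Bead.dim := by
  induction W generalizing p with
  | nil =>
    simp only [choices, List.mem_singleton] at hp
    subst hp
    simp
  | cons b W ih =>
    simp only [choices, List.mem_flatMap, List.mem_map] at hp
    obtain ⟨s, hs, q, hq, rfl⟩ := hp
    obtain ⟨h1, h2, h3⟩ := ih hq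
    simp [h1, h2, h3, u.width_eq b s hs, u.deg_eq b s hs]

/-- The composition of expansions. -/
def comp (u : Expn H H' o) (v : Expn H' H'' o') : Expn H H'' fun x => o' (o x) where
  terms b := (v.terms b).flatMap fun p => (u.choices p.1).map fun q => (q.1, Step.comp q.2 p.2)
  width_eq b p hp := by
    simp only [List.mem_flatMap, List.mem_map] at hp
    obtain ⟨p, _, q, hq, rfl⟩ := hp
    exact (u.choices_spec hq).2.1
  deg_eq b p hp := by
    simp only [List.mem_flatMap, List.mem_map] at hp
    obtain ⟨p, hp, q, _, rfl⟩ := hp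
    exact v.deg_eq b p hp

/-- Groups of operations whose compositions are the terms of the composition of two expansions. -/
def groups (u : Expn H H' o) (v : Expn H' H'' o') :
    Beads → List (List (Beads × (List (Step H H' o) × Step H' H'' o')))
  | [] => [[]]
  | b :: W => (v.terms b).flatMap fun p => (u.choices p.1).flatMap fun q =>
      (groups u v W).map fun G => (q.1, (q.2, p.2)) :: G

theorem lsum_groups {N : Type*} [AddCommMonoid N] (u : Expn H H' o) (v : Expn H' H'' o')
    (W : Beads) (κ : Beads → List (Step H H' o) → List (Step H' H'' o') → N) :
    (lsum (v.choices W) fun p => lsum (u.choices p.1) fun q => κ q.1 q.2 p.2) =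
      lsum (groups u v W) fun G => κ (G.flatMap Prod.fst) (G.flatMap fun g => g.2.1)
        (G.map fun g => g.2.2) := by
  induction W generalizing κ with
  | nil => simp [choices, groups]
  | cons b W ih =>
    rw [lsum_choices_cons, groups]
    simp only [lsum_choices_append, lsum_flatMap, lsum_map, List.flatMap_cons, List.map_cons]
    refine lsum_congr fun p _ => ?_
    rw [lsum_comm]
    exact lsum_congr fun q _ => ih fun X L L' => κ (q.1 ++ X) (q.2 ++ L) (p.2 :: L')

theorem lsum_comp_choices {N : Type*} [AddCommMonoid N] (u : Expn H H' o) (v : Expn H' H'' o')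
    (W : Beads) (κ : Beads × List (Step H H'' fun x => o' (o x)) → N) :
    lsum ((u.comp v).choices W) κ = lsum (groups u v W) fun G =>
      κ (G.flatMap Prod.fst, G.map fun g => Step.comp g.2.1 g.2.2) := by
  induction W generalizing κ with
  | nil => simp [choices, groups]
  | cons b W ih =>
    rw [lsum_choices_cons, groups]
    simp only [comp, lsum_flatMap, lsum_map, List.flatMap_cons, List.map_cons]
    refine lsum_congr fun p _ => lsum_congr fun q _ => ?_
    exact ih fun r => κ (q.1 ++ r.1, Step.comp q.2 p.2 :: r.2)

theorem length_of_mem_groups (u : Expn H H' o) (v : Expn H' H'' o') (W : Beads) :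
    ∀ G ∈ groups u v W, ∀ g ∈ G, g.2.1.length = g.2.2.k := by
  induction W with
  | nil => simp [groups]
  | cons b W ih =>
    intro G hG
    simp only [groups, List.mem_flatMap, List.mem_map] at hG
    obtain ⟨p, hp, q, hq, G, hG, rfl⟩ := hG
    intro g hg
    rcases List.mem_cons.mp hg with rfl | hg
    · exact ((u.choices_spec hq).1).trans (v.width_eq b p hp).symm
    · exact ih G hG g hg

end Expn

namespace Ev

variable {a b : O}

@[ext] theorem ext {E E' : Ev H a b M} (h : ∀ W Φ, E.val W Φ = E'.val W Φ) : E = E' := by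
  obtain ⟨v, _⟩ := E
  obtain ⟨v', _⟩ := E'
  have : v = v' := funext fun W => LinearMap.ext (h W)
  subst this
  rfl

/-- The transformation of functionals given by an expansion. -/
def bind (E : Ev H a b M) (u : Expn H H' o) : Ev H' (o a) (o b) M where
  val W := lsum (u.choices W) fun p => E.val p.1 ∘ₗ runL p.2
  congr W Φ Ψ h := by
    have e : ∀ Φ, (lsum (u.choices W) fun p => E.val p.1 ∘ₗ runL p.2) Φ =
        lsum (u.choices W) fun p => E.val p.1 (runL p.2 Φ) := fun Φ =>
      map_lsum (LinearMap.applyₗ Φ : _ →ₗ[K] M) _ _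
    rw [e, e]
    refine lsum_congr fun p hp => congrArg _ (Subtype.ext (funext fun c => ?_))
    exact run_congr_degs _ _ fun v hv => h v (by rw [hv, (u.choices_spec hp).2.2])

theorem bind_val (E : Ev H a b M) (u : Expn H H' o) (W : Beads) (Φ : Mult H' (o a) (o b) M) :
    (E.bind u).val W Φ = lsum (u.choices W) fun p => E.val p.1 (runL p.2 Φ) :=
  map_lsum (LinearMap.applyₗ Φ : _ →ₗ[K] M) _ _

theorem bind_bind (E : Ev H a b M) (u : Expn H H' o) (v : Expn H' H'' o') :
    (E.bind u).bind v = E.bind (u.comp v) := by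
  ext W Φ
  rw [bind_val, bind_val]
  simp only [bind_val]
  rw [Expn.lsum_comp_choices,
    Expn.lsum_groups u v W fun X L L' => E.val X (runL L (runL L' Φ))]
  refine lsum_congr fun G hG => congrArg _ (Subtype.ext (funext fun c => ?_))
  have := run_run (G.map Prod.snd) (fun g hg => by
    obtain ⟨g, hg', rfl⟩ := List.mem_map.mp hg
    exact Expn.length_of_mem_groups u v W G hG g hg') Φ.1 Φ.2 c
  rw [List.flatMap_map, List.map_map, List.map_map] at this
  exact this

theorem bind_congr (E : Ev H a b M) (u v : Expn H H' o) (W : Beads)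
    (h : ∀ β ∈ W, ∀ (X₀ X₁ : Beads) (L₀ L₁ : List (Step H H' o)) (Φ : Mult H' (o a) (o b) M),
      width L₀ = X₀.length → width L₁ = X₁.length →
      (lsum (u.terms β) fun p => E.val (X₀ ++ (p.1 ++ X₁)) (runL (L₀ ++ p.2 :: L₁) Φ)) =
      lsum (v.terms β) fun p => E.val (X₀ ++ (p.1 ++ X₁)) (runL (L₀ ++ p.2 :: L₁) Φ))
    (Φ : Mult H' (o a) (o b) M) : (E.bind u).val W Φ = (E.bind v).val W Φ := by
  rw [bind_val, bind_val]
  suffices ∀ (X₀ : Beads) (L₀ : List (Step H H' o)), width L₀ = X₀.length →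
      (lsum (u.choices W) fun p => E.val (X₀ ++ p.1) (runL (L₀ ++ p.2) Φ)) =
      lsum (v.choices W) fun p => E.val (X₀ ++ p.1) (runL (L₀ ++ p.2) Φ) from this [] [] rfl
  induction W with
  | nil => intro X₀ L₀ _; rfl
  | cons β W ih =>
    intro X₀ L₀ h0
    rw [Expn.lsum_choices_cons, Expn.lsum_choices_cons]
    have e : ∀ p ∈ u.terms β,
        (lsum (u.choices W) fun q => E.val (X₀ ++ (p.1 ++ q.1)) (runL (L₀ ++ p.2 :: q.2) Φ)) =
        lsum (v.choices W) fun q => E.val (X₀ ++ (p.1 ++ q.1)) (runL (L₀ ++ p.2 :: q.2) Φ) := by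
      intro p hp
      have := ih (fun β hβ => h β (List.mem_cons_of_mem _ hβ)) (X₀ ++ p.1) (L₀ ++ [p.2])
        (by simp [h0, u.width_eq β p hp])
      simpa only [List.append_assoc, List.singleton_append] using this
    rw [lsum_congr e, lsum_comm, lsum_comm (v.terms β)]
    refine lsum_congr fun q hq => ?_
    exact h β (by simp) X₀ q.1 L₀ q.2 Φ h0 (v.choices_spec hq).2.1

end Ev

/-- The tensor product of operations as a function of one of them. -/
def slotL (L₀ L₁ : List (Step H H' o)) (k : ℕ) (d : ℤ) {x y : O}
    (Φ : Mult H' (o x) (o y) M) : Op H H' o d →ₗ[K] Mult H x y M :=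
  IsLinearMap.mk' (fun F => runL (L₀ ++ (⟨k, d, F⟩ : Step H H' o) :: L₁) Φ) <| by
    have key : ∀ c : Chain H x y, IsLinearMap K fun F : Op H H' o d =>
        run (L₀ ++ (⟨k, d, F⟩ : Step H H' o) :: L₁) Φ.1 c := by
      intro c
      simp only [run_append, run_cons]
      refine cutAt_isLinearMap _ _ _ fun z p r => run_isLinearMap _ _ (fun u => ?_) _
      refine cutAt_isLinearMap _ _ _ fun w q t => run_isLinearMap _ _ (fun v => ?_) _
      have := (Chain.IsMultilinear.append Φ.2 u).head d v
      exact ⟨fun F G => this.map_add (F.1 z w q) (G.1 z w q),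
        fun c F => this.map_smul c (F.1 z w q)⟩
    exact ⟨fun F G => Subtype.ext (funext fun c => (key c).map_add F G),
      fun k F => Subtype.ext (funext fun c => (key c).map_smul k F)⟩

theorem slotL_apply (L₀ L₁ : List (Step H H' o)) (k : ℕ) (d : ℤ) {x y : O}
    (Φ : Mult H' (o x) (o y) M) (F : Op H H' o d) :
    slotL L₀ L₁ k d Φ F = runL (L₀ ++ (⟨k, d, F⟩ : Step H H' o) :: L₁) Φ := rfl

theorem degs_split {x y : O} (c : Chain H x y) (X Y : List ℤ) (h : c.degs = X ++ Y) :
    ∃ (z : O) (p : Chain H x z) (q : Chain H z y), p.append q = c ∧ p.degs = X ∧ q.degs = Y := by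
  obtain ⟨z, p, q, h1, rfl⟩ := c.exists_append X.length (by
    rw [← c.length_degs, h, List.length_append]; omega)
  rw [degs_append] at h
  have := List.append_inj h (by rw [length_degs, h1])
  exact ⟨z, p, q, rfl, this.1, this.2⟩

theorem len_of_degs {x y : O} {c : Chain H x y} {W : Beads} (h : c.degs = W.map Bead.dim) :
    c.len = W.length := by
  rw [← c.length_degs, h, List.length_map]

theorem slotL_congr {a b : O} (E : Ev H a b M) (X₀ X X₁ : Beads) (L₀ L₁ : List (Step H H' o))
    (d : ℤ) (Φ : Mult H' (o a) (o b) M) (F G : Op H H' o d) (h0 : width L₀ = X₀.length)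
    (h : ∀ x y (q : Chain H x y), q.degs = X.map Bead.dim → F.1 x y q = G.1 x y q) :
    E.val (X₀ ++ (X ++ X₁)) (slotL L₀ L₁ X.length d Φ F) =
      E.val (X₀ ++ (X ++ X₁)) (slotL L₀ L₁ X.length d Φ G) := by
  refine E.congr _ _ _ fun c hc => ?_
  rw [List.map_append] at hc
  obtain ⟨z, p, r, rfl, hp, hr⟩ := degs_split c _ _ hc
  rw [List.map_append] at hr
  obtain ⟨w, q, t, rfl, hq, ht⟩ := degs_split r _ _ hr
  show run (L₀ ++ (⟨X.length, d, F⟩ : Step H H' o) :: L₁) Φ.1 _ =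
    run (L₀ ++ (⟨X.length, d, G⟩ : Step H H' o) :: L₁) Φ.1 _
  rw [run_append, run_append, cutAt_append' _ _ _ (h0.trans (len_of_degs hp).symm),
    cutAt_append' _ _ _ (h0.trans (len_of_degs hp).symm)]
  congr 1
  funext u
  rw [run_cons, run_cons, cutAt_append' _ _ _ (len_of_degs hq).symm,
    cutAt_append' _ _ _ (len_of_degs hq).symm]
  show run L₁ (fun v => Φ.1 (u.append (cons d (F.1 z w q) v))) t =
    run L₁ (fun v => Φ.1 (u.append (cons d (G.1 z w q) v))) t
  rw [h _ _ q hq]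

end Evaluations

section ChainSums

set_option linter.unusedSectionVars false

open Chain

variable {K : Type u} [Field K] {O O' : Type u}
variable {H : O → O → ℤ → ModuleCat.{u} K} {H' : O' → O' → ℤ → ModuleCat.{u} K}
variable {M : Type u} [AddCommGroup M] [Module K M]
variable {o : O → O'}

theorem sumSplit_eq_lsum {α : Type*} (T : List α) {x y : O} (c : Chain H x y)
    (h : c.len = T.length) (φ : ∀ z, Chain H x z → Chain H z y → M) :
    c.sumSplit φ = lsum (splits T) fun p => cutAt p.1.length c φ := by
  induction T generalizing x with
  | nil =>
    cases c with
    | nil => simp [splits, sumSplit, cutAt]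
    | cons => simp at h
  | cons t T ih =>
    cases c with
    | nil => simp at h
    | cons d a c =>
      rw [lsum_splits_cons t T fun p _ => cutAt p.length (cons d a c) φ, sumSplit,
        ih c (by simpa using h)]
      rfl

theorem sumMid_eq_midSum {α : Type*} (T : List α) {x y : O} (c : Chain H x y)
    (h : c.len = T.length)
    (φ : ∀ z w, Chain H x z → Chain H z w → Chain H w y → M) :
    c.sumMid φ = midSum T fun p q _ => cutAt p.length c fun z u r =>
      cutAt q.length r fun w v t => φ z w u v t := by
  induction T generalizing x with
  | nil =>
    cases c with
    | nil => simp [midSum_nil, sumMid]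
    | cons => simp at h
  | cons t T ih =>
    cases c with
    | nil => simp at h
    | cons d a c =>
      rw [midSum_cons, sumMid, ih c (by simpa using h),
        sumSplit_eq_lsum T c (by simpa using h)]
      rfl

/-- The operation of a subdivision. -/
def stepOf (F : ∀ d, Op H H' o d) (S : Beads) : Step H H' o :=
  ⟨S.length, Bead.dim S.flatten, F _⟩

theorem deg_of_degs {x y : O} {c : Chain H x y} {W : Beads} (h : c.degs = W.map Bead.dim) :
    c.deg + c.len = (W.flatten.length : ℤ) := by
  rw [← c.sum_degs, h, len_of_degs h]
  clear h c
  induction W with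
  | nil => simp
  | cons b W ih => simp [Bead.dim] at ih ⊢; rw [← ih]; ring

theorem barT_eq_lsum (F : ∀ d, Op H H' o d) : ∀ (n : ℕ) (T : Beads), T.length ≤ n →
    ∀ {x y : O} (c : Chain H x y), c.degs = T.map Bead.dim →
    ∀ Φ : Chain H' (o x) (o y) → M,
      barT (fun {x y} c d => (F d).1 x y c) Φ c =
        lsum (cuts T) fun D => run (D.map (stepOf F)) Φ c
  | _, [], _, _, _, nil _, _, _ => by simp [cuts, barT, sumBlocks, Blocks.image]; rfl
  | _, [], _, _, _, cons _ _ _, h, _ => by simp at h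
  | 0, t :: T, hn, _, _, _, _, _ => by simp at hn
  | _ + 1, _ :: _, _, _, _, nil _, h, _ => by simp at h
  | n + 1, t :: T, hn, x, y, cons d a c, h, Φ => by
    rw [degs_cons, List.map_cons, List.cons.injEq] at h
    rw [barT_cons, lsum_cuts_cons, sumSplit_eq_lsum T c (len_of_degs h.2)]
    refine lsum_congr fun p hp => ?_
    have hT := append_of_mem_splits hp
    have hd := h.2
    rw [← hT, List.map_append] at hd
    obtain ⟨z, u, v, rfl, hu, hv⟩ := degs_split c _ _ hd
    rw [cutAt_append' _ _ _ (len_of_degs hu).symm,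
      barT_eq_lsum F n p.2 (by
        have := congrArg List.length hT
        simp at this hn
        omega) v hv]
    refine lsum_congr fun D _ => ?_
    rw [List.map_cons, run_cons]
    show _ = cutAt (t :: p.1).length ((cons d a u).append v) _
    rw [cutAt_append' _ _ _ (by simp [len_of_degs hu])]
    congr 1
    funext w
    have e : (cons d a u).degs = List.map Bead.dim (t :: p.1) := by simp [hu, h.1]
    refine cons_index (fun {x y} c d => (F d).1 x y c) Φ _ _ ?_
    rw [deg_of_degs e]
    rfl

theorem barD_eq_midSum (b : ∀ d, Op H H (fun x => x) d) (T : Beads) {x y : O} (c : Chain H x y)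
    (h : c.degs = T.map Bead.dim) (Φ : Chain H x y → M) :
    barD (fun {x y} c d => (b d).1 x y c) Φ c = midSum T fun T₁ T₂ _ =>
      (-1 : K) ^ T₁.flatten.length • ins T₁.length T₂.length (b (T₂.flatten.length - 2)) Φ c := by
  rw [barD, sumMid_eq_midSum T c (len_of_degs h)]
  refine midSum_congr fun T₁ T₂ T₃ _ e => ?_
  rw [← e, List.map_append, List.map_append] at h
  obtain ⟨z, p, r, rfl, hp, hr⟩ := degs_split c _ _ h
  obtain ⟨w, q, t, rfl, hq, ht⟩ := degs_split r _ _ hr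
  rw [ins, cutAt_append' _ _ _ (len_of_degs hp).symm, cutAt_append' _ _ _ (len_of_degs hq).symm,
    cutAt_append' _ _ _ (len_of_degs hp).symm, cutAt_append' _ _ _ (len_of_degs hq).symm,
    deg_of_degs hp, zpow_natCast]
  congr 1
  exact cons_index (o := fun x => x) (fun {x y} c d => (b d).1 x y c)
    (fun t => Φ (p.append t)) _ _ (by rw [deg_of_degs hq])

end ChainSums

section Relations

set_option linter.unusedSectionVars false

open Chain

variable {K : Type u} [Field K] {O O' : Type u}
variable {H : O → O → ℤ → ModuleCat.{u} K} {H' : O' → O' → ℤ → ModuleCat.{u} K}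
variable {M : Type u} [AddCommGroup M] [Module K M]
variable {o : O → O'}

/-- The expansion of beads in all subdivisions. -/
def cutExpn (F : ∀ d, Op H H' o d) : Expn H H' o where
  terms b := (cuts b).map fun S => (S, ⟨S.length, Bead.dim b, F _⟩)
  width_eq b p hp := by
    obtain ⟨S, _, rfl⟩ := List.mem_map.mp hp
    rfl
  deg_eq b p hp := by
    obtain ⟨S, _, rfl⟩ := List.mem_map.mp hp
    rfl

theorem lsum_cutExpn_choices {N : Type*} [AddCommMonoid N] (F : ∀ d, Op H H' o d) (W : Beads)
    (κ : Beads × List (Step H H' o) → N) : lsum ((cutExpn F).choices W) κ =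
      lsum (W.map cuts).sections fun D => κ (D.flatten, D.map (stepOf F)) := by
  induction W generalizing κ with
  | nil => simp [Expn.choices]
  | cons b W ih =>
    rw [Expn.lsum_choices_cons, List.map_cons, lsum_sections_cons]
    simp only [cutExpn, lsum_map] at ih ⊢
    refine lsum_congr fun S hS => ?_
    rw [ih]
    refine lsum_congr fun D _ => ?_
    rw [List.map_cons, stepOf, (flatten_of_mem_cuts hS).1]
    rfl

/-- The relation of the nerve at the bead `β` of `pre ++ β :: post`, with signs of the bar
construction. -/
def Rel (b : ∀ d, Op H H (fun x => x) d) {x y : O} (E : Ev H x y M) (pre : Beads) (β : Bead)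
    (post : Beads) : Prop :=
  ∀ Φ : Mult H x y M, (lsum (cuts β) fun S =>
    E.val (pre ++ (S ++ post)) (insL pre.length S.length (b (β.length - 2)) Φ)) =
      mergeSum β fun c => E.val (pre ++ c :: post) Φ

theorem valid_append {n : ℕ} {U V : Beads} : Beads.Valid n (U ++ V) ↔
    ∃ k l, n = k + l ∧ U.Valid k ∧ V.Valid l := by
  constructor
  · rintro ⟨h1, h2⟩
    refine ⟨_, _, ?_, ⟨fun b hb => h1 b (by simp [hb]), rfl⟩, ⟨fun b hb => h1 b (by simp [hb]), rfl⟩⟩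
    rw [← h2]
    simp
  · rintro ⟨k, l, rfl, ⟨h1, rfl⟩, h2, rfl⟩
    refine ⟨fun b hb => ?_, by simp⟩
    rcases List.mem_append.mp hb with hb | hb
    exacts [h1 b hb, h2 b hb]

theorem valid_cuts {n : ℕ} {b : Bead} {S : Beads} (hS : S ∈ cuts b) (h : ∀ g ∈ b, 0 < g)
    (hn : b.sum = n) : S.Valid n := by
  obtain ⟨h1, h2⟩ := flatten_of_mem_cuts hS
  refine ⟨fun s hs => ⟨h2 s hs, fun g hg => h g ?_⟩, by rw [h1, hn]⟩
  rw [← h1]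
  exact List.mem_flatten.mpr ⟨s, hs, hg⟩

theorem valid_sections {n : ℕ} {W : Beads} (h : W.Valid n) {D : List Beads}
    (hD : D ∈ (W.map cuts).sections) : Beads.Valid n D.flatten := by
  induction W generalizing n D with
  | nil =>
    simp only [List.map_nil, List.sections, List.mem_singleton] at hD
    subst hD
    exact h
  | cons b W ih =>
    obtain ⟨k, l, rfl, h1, h2⟩ := valid_append (U := [b]).mp h
    simp only [List.map_cons, List.sections, List.mem_flatMap, List.mem_map] at hD
    obtain ⟨D, hD, S, hS, rfl⟩ := hD
    refine valid_append (U := S).mpr ⟨k, l, rfl, valid_cuts hS (h1.1 b (by simp)).2 ?_, ih h2 hD⟩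
    simpa using h1.2

theorem valid_choices {n : ℕ} {W : Beads} (h : W.Valid n) (F : ∀ d, Op H H' o d)
    {p : Beads × List (Step H H' o)} (hp : p ∈ (cutExpn F).choices W) : p.1.Valid n := by
  induction W generalizing n p with
  | nil =>
    simp only [Expn.choices, List.mem_singleton] at hp
    subst hp
    exact h
  | cons b W ih =>
    obtain ⟨k, l, rfl, h1, h2⟩ := valid_append (U := [b]).mp h
    simp only [Expn.choices, cutExpn, List.mem_flatMap, List.mem_map] at hp
    obtain ⟨_, ⟨S, hS, rfl⟩, q, hq, rfl⟩ := hp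
    refine valid_append (U := S).mpr ⟨k, l, rfl, valid_cuts hS (h1.1 b (by simp)).2 ?_, ih h2 hq⟩
    simpa using h1.2

/-- The relation of an `A_∞`-functor gives the transport of the relations of the nerve. -/
theorem Rel.bind (F : ∀ d, Op H H' o d) (m : ∀ d, Op H H (fun x => x) d)
    (m' : ∀ d, Op H' H' (fun x => x) d)
    (hrel : ∀ {x y : O} (c : Chain H x y) (d : ℤ),
      barD (fun {x y} c d => (m d).1 x y c) (fun c => (F d).1 x y c) c =
        barT (fun {x y} c d => (F d).1 x y c) (fun v => (m' d).1 _ _ v) c)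
    {a b : O} (E : Ev H a b M) (n : ℕ)
    (hE : ∀ (pre : Beads) (β : Bead) (post : Beads), Beads.Valid n (pre ++ β :: post) →
      Rel m E pre β post)
    (pre : Beads) (β : Bead) (post : Beads) (hv : Beads.Valid n (pre ++ β :: post)) :
    Rel m' (E.bind (cutExpn F)) pre β post := by
  intro Φ
  obtain ⟨n₀, n', rfl, v0, hv'⟩ := valid_append.mp hv
  obtain ⟨n₁, n₂, rfl, v1, v2⟩ := valid_append (U := [β]).mp hv'
  have hpos := (v1.1 β (by simp)).2
  have hsum : β.sum = n₁ := by simpa using v1.2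
  simp only [Ev.bind_val]
  have hR : ∀ c : Bead, (lsum ((cutExpn F).choices (pre ++ c :: post)) fun p =>
      E.val p.1 (runL p.2 Φ)) = lsum ((cutExpn F).choices pre) fun P =>
        lsum ((cutExpn F).choices post) fun R => lsum (cuts c) fun Q =>
          E.val (P.1 ++ (Q ++ R.1)) (slotL P.2 R.2 Q.length (Bead.dim c) Φ (F (Bead.dim c))) := by
    intro c
    rw [Expn.lsum_choices_append]
    refine lsum_congr fun P _ => ?_
    rw [Expn.lsum_choices_cons, lsum_comm]
    refine lsum_congr fun R _ => ?_
    simp only [cutExpn, lsum_map]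
    rfl
  rw [mergeSum_congr fun c _ _ _ => hR c, mergeSum_lsum]
  simp only [Expn.lsum_choices_append]
  rw [lsum_comm]
  refine lsum_congr fun P hP => ?_
  rw [mergeSum_lsum,
    lsum_congr fun S _ => lsum_comm ((cutExpn F).choices S) ((cutExpn F).choices post) _,
    lsum_comm]
  refine lsum_congr fun R hR => ?_
  obtain ⟨hP1, hP2, _⟩ := (cutExpn F).choices_spec hP
  set d : ℤ := β.length - 2 with hd
  have s1 : ∀ S ∈ cuts β, (lsum ((cutExpn F).choices S) fun Q =>
      E.val (P.1 ++ (Q.1 ++ R.1)) (runL (P.2 ++ (Q.2 ++ R.2))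
        (insL pre.length S.length (m' d) Φ))) =
      lsum (S.map cuts).sections fun D => E.val (P.1 ++ (D.flatten ++ R.1))
        (slotL P.2 R.2 D.flatten.length d Φ
          ⟨fun x y c => run (D.map (stepOf F)) (fun v => (m' d).1 _ _ v) c,
            fun _ _ => run_isMultilinear _ _ ((m' d).2 _ _)⟩) := by
    intro S hS
    rw [← lsum_cutExpn_choices F S fun Q => E.val (P.1 ++ (Q.1 ++ R.1))
      (slotL P.2 R.2 Q.1.length d Φ ⟨fun x y c => run Q.2 (fun v => (m' d).1 _ _ v) c,
        fun _ _ => run_isMultilinear _ _ ((m' d).2 _ _)⟩)]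
    refine lsum_congr fun Q hQ => ?_
    obtain ⟨hQ1, hQ2, _⟩ := (cutExpn F).choices_spec hQ
    congr 1
    refine Subtype.ext (funext fun c => ?_)
    show run _ (ins _ _ _ Φ.1) c = run _ Φ.1 c
    rw [← hP1, ← hQ1, run_ins _ _ _ _ _ Φ.2, Step.comp, hQ2]
  rw [lsum_congr s1, lsum_cuts_sections _ β le_rfl fun D => E.val (P.1 ++ (D.flatten ++ R.1))
        (slotL P.2 R.2 D.flatten.length d Φ
          ⟨fun x y c => run (D.map (stepOf F)) (fun v => (m' d).1 _ _ v) c,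
            fun _ _ => run_isMultilinear _ _ ((m' d).2 _ _)⟩)]
  have s2 : ∀ T ∈ cuts β, (lsum (cuts T) fun D => E.val (P.1 ++ (D.flatten ++ R.1))
        (slotL P.2 R.2 D.flatten.length d Φ
          ⟨fun x y c => run (D.map (stepOf F)) (fun v => (m' d).1 _ _ v) c,
            fun _ _ => run_isMultilinear _ _ ((m' d).2 _ _)⟩)) =
      midSum T fun T₁ T₂ T₃ => (-1 : K) ^ T₁.flatten.length •
        E.val (P.1 ++ ((T₁ ++ (T₂ ++ T₃)) ++ R.1))
          (slotL P.2 R.2 (T₁ ++ (T₂ ++ T₃)).length d Φ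
            ⟨fun x y => ins T₁.length T₂.length (m (T₂.flatten.length - 2)) ((F d).1 x y),
              fun x y => ins_isMultilinear _ _ _ _ ((F d).2 x y)⟩) := by
    intro T hT
    trans E.val (P.1 ++ (T ++ R.1)) (slotL P.2 R.2 T.length d Φ (lsum (cuts T) fun D =>
      ⟨fun x y c => run (D.map (stepOf F)) (fun v => (m' d).1 _ _ v) c,
            fun _ _ => run_isMultilinear _ _ ((m' d).2 _ _)⟩))
    · rw [map_lsum (slotL P.2 R.2 T.length d Φ), map_lsum (E.val _)]
      refine lsum_congr fun D hD => ?_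
      rw [(flatten_of_mem_cuts hD).1]
    trans E.val (P.1 ++ (T ++ R.1)) (slotL P.2 R.2 T.length d Φ (midSum T fun T₁ T₂ _ =>
      (-1 : K) ^ T₁.flatten.length •
      ⟨fun x y => ins T₁.length T₂.length (m (T₂.flatten.length - 2)) ((F d).1 x y),
              fun x y => ins_isMultilinear _ _ _ _ ((F d).2 x y)⟩))
    · refine slotL_congr E _ _ _ _ _ _ _ _ _ hP2 fun x y q hq => ?_
      let ev : Op H H' o d →ₗ[K] H' (o x) (o y) d :=
        { toFun := fun G => G.1 x y q
          map_add' := fun _ _ => rfl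
          map_smul' := fun _ _ => rfl }
      change ev _ = ev _
      rw [map_lsum ev]
      refine (barT_eq_lsum F _ T le_rfl q hq fun v => (m' d).1 _ _ v).symm.trans ?_
      rw [← hrel, barD_eq_midSum m T q hq, midSum, midSum, map_lsum ev]
      refine lsum_congr fun p _ => ?_
      rw [map_lsum ev]
      refine lsum_congr fun r _ => ?_
      split_ifs
      · exact (map_zero ev).symm
      · rfl
    · rw [midSum, midSum, map_lsum (slotL P.2 R.2 T.length d Φ), map_lsum (E.val _)]
      refine lsum_congr fun p hp => ?_
      rw [map_lsum (slotL P.2 R.2 T.length d Φ), map_lsum (E.val _)]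
      refine lsum_congr fun r hr => ?_
      split_ifs
      · rw [map_zero, map_zero]
      · rw [map_smul, map_smul, append_of_mem_splits hr, append_of_mem_splits hp]
  rw [lsum_congr s2, lsum_cuts_midSum, mergeSum_congr fun c hc _ _ => by
    rw [show Bead.dim c = d by
      rw [Bead.dim, hd, ← hc]; push_cast; ring], mergeSum_cuts K _ β le_rfl fun Q =>
      E.val (P.1 ++ (Q ++ R.1)) (slotL P.2 R.2 Q.length d Φ (F d))]
  refine midSum_congr fun b₁ b₂ b₃ hb2 hb => ?_
  simp only [lsum_smul]
  refine lsum_congr fun T₁ hT₁ => ?_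
  rw [lsum_comm]
  refine lsum_congr fun T₃ hT₃ => ?_
  have hT1 := flatten_of_mem_cuts hT₁
  rw [hT1.1, ← lsum_smul]
  congr 1
  have hval : Beads.Valid (n₀ + (n₁ + n₂)) ((P.1 ++ T₁) ++ b₂ :: (T₃ ++ R.1)) := by
    have hp : ∀ g, g ∈ b₁ ∨ g ∈ b₂ ∨ g ∈ b₃ → 0 < g := fun g hg => hpos g (by rw [← hb]; simpa)
    rw [List.append_assoc]
    refine valid_append.mpr ⟨_, _, rfl, valid_choices v0 F hP, ?_⟩
    rw [show T₁ ++ b₂ :: (T₃ ++ R.1) = (T₁ ++ ([b₂] ++ T₃)) ++ R.1 by simp]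
    refine valid_append.mpr ⟨_, _, rfl, ?_, valid_choices v2 F hR⟩
    refine valid_append.mpr ⟨b₁.sum, b₂.sum + b₃.sum, by rw [← hsum, ← hb]; simp,
      valid_cuts hT₁ (fun g hg => hp g (by simp [hg])) rfl, ?_⟩
    exact valid_append.mpr ⟨_, _, rfl, ⟨fun b h => by
      rw [List.mem_singleton.mp h]
      exact ⟨hb2, fun g hg => hp g (by simp [hg])⟩, by simp⟩,
      valid_cuts hT₃ (fun g hg => hp g (by simp [hg])) rfl⟩
  have := hE _ _ _ hval (slotL P.2 R.2 (T₁.length + 1 + T₃.length) d Φ (F d))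
  refine Eq.trans ?_ (this.trans ?_)
  · refine lsum_congr fun T₂ hT₂ => ?_
    rw [(flatten_of_mem_cuts hT₂).1]
    rw [show P.1 ++ (T₁ ++ (T₂ ++ T₃) ++ R.1) = P.1 ++ T₁ ++ (T₂ ++ (T₃ ++ R.1)) by simp]
    refine E.congr _ _ _ fun c hc => ?_
    have := ins_run P.2 R.2 T₁.length T₂.length T₃.length (m (b₂.length - 2)) (F d) Φ.1 c (by
      rw [len_of_degs hc, hP2]; simp)
    rw [hP2] at this
    rw [List.length_append (as := P.1)]
    refine Eq.trans ?_ this.symm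
    rw [slotL_apply]
    simp only [List.length_append]
    rfl
  · refine mergeSum_congr fun c _ _ _ => ?_
    rw [show P.1 ++ T₁ ++ c :: (T₃ ++ R.1) = P.1 ++ (T₁ ++ c :: T₃ ++ R.1) by simp]
    congr 2
    simp only [List.length_append, List.length_cons]
    congr 1
    omega

end Relations

section Functionals

set_option linter.unusedSectionVars false

open Chain

variable {K : Type u} [Field K] {O O' : Type u}
variable {H : O → O → ℤ → ModuleCat.{u} K} {H' : O' → O' → ℤ → ModuleCat.{u} K}
variable {M N : Type u} [AddCommGroup M] [Module K M] [AddCommGroup N] [Module K N]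

/-- Composition of a multilinear function with a linear map. -/
def Mult.map (L : M →ₗ[K] N) {x y : O} (Φ : Mult H x y M) : Mult H x y N :=
  ⟨fun c => L (Φ.1 c), fun z w p d t => (L.comp (Φ.2 z w p d t).mk').isLinear⟩

/-- The element `a ⊗ t` of `(sA)_U` for `U = Δⁿ ∨ W`. -/
def tcons {b : Bead} {W : Beads} {x y : O} (z : O) :
    H x z b.dim →ₗ[K] sT H W z y →ₗ[K] sT H (b :: W) x y :=
  qtmul (P := fun x y => H x y b.dim) z

theorem tcons_ext {b : Bead} {W : Beads} {x y : O} {f g : sT H (b :: W) x y →ₗ[K] M}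
    (h : ∀ z a t, f (tcons z a t) = g (tcons z a t)) : f = g :=
  q_ext h

@[simp] theorem mlift_cons (b : Bead) (W : Beads) (x y z : O) (Φ : Mult H x y M)
    (a : H x z b.dim) (t : sT H W z y) :
    mlift (b :: W) x y Φ (tcons z a t) = mlift W z y (Mult.cons b.dim Φ a) t :=
  qlift_tmul _ _ _ _

/-- The scalar of an element of `(sA)_U` for `U = Δ⁰`. -/
def tval {x y : O} : sT H [] x y →ₗ[K] K := unitVal

theorem mliftCons_tmul (d : ℤ) (Q : KQuiver K O) (x y z : O)
    (φ : ∀ z, Mult H z y M →ₗ[K] (Q z y →ₗ[K] M)) (Φ : Mult H x y M) (a : H x z d) (t : Q z y) :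
    mliftCons d Q x y φ Φ (qtmul z a t) = φ z (Mult.cons d Φ a) t :=
  qlift_tmul _ _ _ _

theorem mlift_nil (x : O) (Φ : Mult H x x M) (t : sT H [] x x) :
    mlift [] x x Φ t = tval t • Φ.1 (nil x) := by
  simp [mlift, mliftNil]
  rfl

theorem mlift_nil_of_ne {x y : O} (h : x ≠ y) (Φ : Mult H x y M) (t : sT H [] x y) :
    mlift [] x y Φ t = 0 := by
  simp [mlift, mliftNil, h]
  rfl

/-- A linear functional on a quiver for every multilinear function of chains, naturally, such that
these functionals separate the elements. -/
structure IsPairing (Q : KQuiver K O) (y : O)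
    (φ : ∀ (M : Type u) [AddCommGroup M] [Module K M] (z : O),
      Mult H z y M →ₗ[K] (Q z y →ₗ[K] M)) : Prop where
  natural : ∀ (M N : Type u) [AddCommGroup M] [Module K M] [AddCommGroup N] [Module K N]
    (L : M →ₗ[K] N) (z : O) (Φ : Mult H z y M) (t : Q z y),
    L (φ M z Φ t) = φ N z (Mult.map L Φ) t
  exists_id : ∀ z, ∃ p : Mult H z y (Q z y), φ _ z p = LinearMap.id

theorem IsPairing.ext {Q : KQuiver K O} {y : O}
    {φ : ∀ (M : Type u) [AddCommGroup M] [Module K M] (z : O),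
      Mult H z y M →ₗ[K] (Q z y →ₗ[K] M)} (h : IsPairing Q y φ) {z : O} {t t' : Q z y}
    (e : ∀ (M : Type u) [AddCommGroup M] [Module K M] (Φ : Mult H z y M),
      φ M z Φ t = φ M z Φ t') : t = t' := by
  obtain ⟨p, hp⟩ := h.exists_id z
  simpa [hp] using e _ p

/-- The pure tensor of the first element of a chain and a function of the others. -/
def pureCons (d : ℤ) {Q : KQuiver K O} {y : O} (p : ∀ z, Chain H z y → Q z y) {x : O}
    (c : Chain H x y) : qtensor (fun x y => H x y d) Q x y :=
  match x, y, c, p with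
  | _, _, nil _, _ => 0
  | x, _, cons (y := z) e a c, p => open Classical in
      if h : e = d then qtmul z (degCast h x z a) (p z c) else 0

theorem pureCons_isMultilinear (d : ℤ) {Q : KQuiver K O} {y : O} (p : ∀ z, Mult H z y (Q z y))
    (x : O) : IsMultilinear (pureCons d (fun z => (p z).1) (x := x)) := by
  intro z w q e t
  cases q with
  | nil =>
    by_cases h : e = d
    · simp only [nil_append, pureCons, h, dite_true]
      exact ((qtmul (P := fun x y => H x y d) w).flip ((p w).1 t) ∘ₗ degCast h _ _).isLinear
    · simp only [nil_append, pureCons, h, dite_false]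
      exact isLinearMap_zero
  | cons e' b q =>
    by_cases h : e' = d
    · simp only [cons_append, pureCons, h, dite_true]
      exact ((qtmul (P := fun x y => H x y d) _ (degCast h _ _ b)).comp
        ((p _).2 z w q e t).mk').isLinear
    · simp only [cons_append, pureCons, h, dite_false]
      exact isLinearMap_zero

theorem isPairing_cons (d : ℤ) {Q : KQuiver K O} {y : O}
    {φ : ∀ (M : Type u) [AddCommGroup M] [Module K M] (z : O),
      Mult H z y M →ₗ[K] (Q z y →ₗ[K] M)} (h : IsPairing Q y φ) :
    IsPairing (qtensor (fun x y => H x y d) Q) y fun M _ _ x => mliftCons d Q x y (φ M) where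
  natural M N _ _ _ _ L x Φ t := by
    refine LinearMap.congr_fun (f := L ∘ₗ mliftCons d Q x y (φ M) Φ)
      (g := mliftCons d Q x y (φ N) (Mult.map L Φ)) (q_ext fun z a s => ?_) t
    rw [LinearMap.comp_apply, mliftCons_tmul, mliftCons_tmul]
    exact h.natural M N L z _ s
  exists_id x := by
    choose p hp using h.exists_id
    refine ⟨⟨pureCons d fun z => (p z).1, pureCons_isMultilinear d p x⟩, q_ext fun z a t => ?_⟩
    rw [mliftCons_tmul, LinearMap.id_apply]
    have : Mult.cons d (⟨pureCons d fun z => (p z).1, pureCons_isMultilinear d p x⟩ :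
        Mult H x y (qtensor (fun x y => H x y d) Q x y)) a = Mult.map (qtmul z a) (p z) := by
      refine Subtype.ext (funext fun c => ?_)
      show pureCons d (fun z => (p z).1) (cons d a c) = qtmul z a ((p z).1 c)
      simp [pureCons, degCast]
    rw [this, ← h.natural, hp]
    rfl

/-- The generator of the unit quiver on empty chains, and `0` on other chains. -/
def pureNil {x y : O} (c : Chain H x y) : sT H [] x y :=
  match x, y, c with
  | _, _, nil _ => (unitOne rfl : unitQ K O _ _)
  | _, _, cons _ _ _ => 0

theorem isPairing_mlift (W : Beads) (y : O) :
    IsPairing (H := H) (sT H W) y fun _ _ _ x => mlift W x y := by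
  induction W with
  | nil =>
    constructor
    · intro M N _ _ _ _ L z Φ t
      by_cases hz : z = y
      · subst hz
        rw [mlift_nil, mlift_nil, map_smul]
        rfl
      · rw [mlift_nil_of_ne hz, mlift_nil_of_ne hz, map_zero]
    · intro x
      refine ⟨⟨pureNil, fun z w p d t => ?_⟩, LinearMap.ext fun t => unit_ext ?_⟩
      · have : (fun a : H z w d => pureNil (p.append (cons d a t))) =
            fun _ => 0 := by
          funext a
          cases p <;> rfl
        rw [this]
        exact isLinearMap_zero
      · by_cases hx : x = y
        · subst hx
          refine (congrArg tval (mlift_nil x _ t)).trans ?_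
          rw [map_smul]
          exact mul_one _
        · refine (congrArg tval (mlift_nil_of_ne hx _ t)).trans ?_
          rw [map_zero]
          exact (unitVal_of_ne t hx).symm
  | cons b W ih => exact isPairing_cons b.dim ih

theorem mlift_map (L : M →ₗ[K] N) (W : Beads) {x y : O} (Φ : Mult H x y M) (t : sT H W x y) :
    L (mlift W x y Φ t) = mlift W x y (Mult.map L Φ) t :=
  (isPairing_mlift W y).natural M N L x Φ t

theorem sT_ext {W : Beads} {x y : O} {t t' : sT H W x y}
    (e : ∀ (M : Type u) [AddCommGroup M] [Module K M] (Φ : Mult H x y M),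
      mlift W x y Φ t = mlift W x y Φ t') : t = t' :=
  (isPairing_mlift W y).ext e

theorem mlift_congr (W : Beads) {x y : O} (Φ Ψ : Mult H x y M)
    (h : ∀ c : Chain H x y, c.degs = W.map Bead.dim → Φ.1 c = Ψ.1 c) :
    mlift W x y Φ = mlift W x y Ψ := by
  induction W generalizing x with
  | nil =>
    refine LinearMap.ext fun t => ?_
    by_cases hx : x = y
    · subst hx
      rw [mlift_nil, mlift_nil, h _ rfl]
    · rw [mlift_nil_of_ne hx, mlift_nil_of_ne hx]
  | cons b W ih =>
    refine tcons_ext fun z a t => ?_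
    rw [mlift_cons, mlift_cons]
    exact LinearMap.congr_fun (ih (Mult.cons b.dim Φ a) (Mult.cons b.dim Ψ a)
      fun c hc => h (cons b.dim a c) (by simp [hc])) t

/-- The evaluations of multilinear functions on a collection of tensors. -/
def famEv {x y : O} (t : ∀ W : Beads, sT H W x y) (M : Type u) [AddCommGroup M] [Module K M] :
    Ev H x y M where
  val W := (LinearMap.applyₗ (t W)).comp (mlift W x y)
  congr W Φ Ψ h := LinearMap.congr_fun (mlift_congr W Φ Ψ h) (t W)

theorem famEv_val {x y : O} (t : ∀ W : Beads, sT H W x y) (W : Beads) (Φ : Mult H x y M) :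
    (famEv t M).val W Φ = mlift W x y Φ (t W) := rfl

/-- The pairing of multilinear functions with tensors of `A_{n₁ - 1} ⊗ ⋯ ⊗ A_{n_l - 1} ⊗ Q`. -/
def tlift (Q : KQuiver K O) (y : O) (φ : ∀ z, Mult H z y M →ₗ[K] (Q z y →ₗ[K] M)) :
    ∀ (U : Beads) (x : O), Mult H x y M →ₗ[K] (tensL H U Q x y →ₗ[K] M)
  | [], x => φ x
  | b :: U, x => mliftCons b.dim (tensL H U Q) x y fun z => tlift Q y φ U z

theorem isPairing_tlift {Q : KQuiver K O} {y : O}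
    {φ : ∀ (M : Type u) [AddCommGroup M] [Module K M] (z : O),
      Mult H z y M →ₗ[K] (Q z y →ₗ[K] M)} (h : IsPairing Q y φ) (U : Beads) :
    IsPairing (tensL H U Q) y fun M _ _ => tlift Q y (φ M) U := by
  induction U with
  | nil => exact h
  | cons b U ih => exact isPairing_cons b.dim ih

theorem tlift_idTens {V : Beads} {Q : KQuiver K O} {y : O}
    (φ : ∀ z, Mult H z y M →ₗ[K] (Q z y →ₗ[K] M)) (ψ : QHom (fun x => x) (sT H V) Q)
    (T : ℕ → ∀ x, Mult H x y M → Mult H x y M)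
    (hT : ∀ k x z d (Φ : Mult H x y M) (a : H x z d),
      Mult.cons d (T (k + 1) x Φ) a = T k z (Mult.cons d Φ a))
    (h : ∀ z (Φ : Mult H z y M) (t : sT H V z y), φ z Φ (ψ z y t) = mlift V z y (T 0 z Φ) t)
    (U : Beads) (x : O) (Φ : Mult H x y M) (t : sT H (U ++ V) x y) :
    tlift Q y φ U x Φ (idTens U ψ x y t) = mlift (U ++ V) x y (T U.length x Φ) t := by
  induction U generalizing x with
  | nil => exact h x Φ t
  | cons b U ih =>
    refine LinearMap.congr_fun (f := tlift Q y φ (b :: U) x Φ ∘ₗ idTens (b :: U) ψ x y)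
      (g := mlift (b :: (U ++ V)) x y (T (U.length + 1) x Φ))
      (tcons_ext (b := b) (W := U ++ V) fun z a s => ?_) t
    refine Eq.trans ?_ (mlift_cons b (U ++ V) x y z (T (U.length + 1) x Φ) a s).symm
    rw [hT, ← ih z (Mult.cons b.dim Φ a) s]
    refine (congrArg (tlift Q y φ (b :: U) x Φ)
      (qmap_tmul (o := fun x => x) (qid fun x y => H x y b.dim) (idTens U ψ) x y z a s)).trans ?_
    exact mliftCons_tmul b.dim (tensL H U Q) x y z (fun z => tlift Q y φ U z) Φ a _

/-- Functionals on tensor products given by functions of two chains. -/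
def mlift₂ (U V : Beads) {x y : O} (Ψ : ∀ z, Mult H x z (Mult H z y M)) :
    qtensor (sT H U) (sT H V) x y →ₗ[K] M :=
  qlift fun z => mlift V z y ∘ₗ mlift U x z (Ψ z)

theorem mlift₂_tmul (U V : Beads) {x y : O} (Ψ : ∀ z, Mult H x z (Mult H z y M)) (z : O)
    (s : sT H U x z) (t : sT H V z y) :
    mlift₂ U V Ψ (qtmul z s t) = mlift V z y (mlift U x z (Ψ z) s) t :=
  qlift_tmul _ _ _ _

/-- The multilinear function given by a function of two chains, on chains cut after `k`
elements. -/
def cutL (k : ℕ) {x y : O} (Ψ : ∀ z, Mult H x z (Mult H z y M)) : Mult H x y M :=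
  ⟨fun c => cutAt k c fun z p q => ((Ψ z).1 p).1 q, cutAt_isMultilinear k _
    (fun z q w v p d t => by
      have := (Ψ z).2 w v p d t
      exact ⟨fun a b => congrArg (fun F => F.1 q) (this.map_add a b),
        fun c a => congrArg (fun F => F.1 q) (this.map_smul c a)⟩)
    fun z p => ((Ψ z).1 p).2⟩

theorem mlift₂_split (U V : Beads) {x y : O} (Ψ : ∀ z, Mult H x z (Mult H z y M))
    (t : sT H (U ++ V) x y) :
    mlift₂ U V Ψ (split U V x y t) = mlift (U ++ V) x y (cutL U.length Ψ) t := by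
  induction U generalizing x with
  | nil =>
    rw [mlift₂]
    refine (qlift_tmul _ _ _ _).trans ?_
    exact congrArg (fun F => mlift V x y F t)
      ((mlift_nil x (Ψ x) (unitOne rfl : unitQ K O x x)).trans (one_smul K _))
  | cons b U ih =>
    refine LinearMap.congr_fun (f := mlift₂ (b :: U) V Ψ ∘ₗ split (b :: U) V x y)
      (g := mlift (b :: (U ++ V)) x y (cutL (U.length + 1) Ψ))
      (tcons_ext (b := b) (W := U ++ V) fun z a s => ?_) t
    refine Eq.trans ?_ (mlift_cons b (U ++ V) x y z (cutL (U.length + 1) Ψ) a s).symm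
    refine Eq.trans ?_ (ih (fun w => Mult.cons b.dim (Ψ w) a) s)
    refine (congrArg (fun s => mlift₂ (b :: U) V Ψ (qassoc (fun x y => H x y b.dim) (sT H U)
      (sT H V) x y s)) (qmap_tmul (qid fun x y => H x y b.dim) (split U V) x y z a s)).trans ?_
    refine LinearMap.congr_fun (f := mlift₂ (b :: U) V Ψ ∘ₗ
      qassoc (fun x y => H x y b.dim) (sT H U) (sT H V) x y ∘ₗ qtmul z a)
      (g := mlift₂ U V fun w => Mult.cons b.dim (Ψ w) a) (q_ext fun w s v => ?_) (split U V z y s)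
    refine (congrArg (mlift₂ (b :: U) V Ψ) (qassoc_tmul (fun x y => H x y b.dim) (sT H U)
      (sT H V) x y z w a s v)).trans ?_
    refine (mlift₂_tmul (b :: U) V Ψ w (tcons z a s) v).trans ?_
    refine Eq.trans ?_ (mlift₂_tmul U V (fun w => Mult.cons b.dim (Ψ w) a) w s v).symm
    rw [mlift_cons]

variable {o : O → O'}

/-- The operation of a step on a tensor. -/
theorem mliftCons_split (S V : Beads) {x y : O} (d : ℤ) (F : Op H H' o d) {Q : KQuiver K O'}
    (φ : ∀ z, Mult H' z (o y) M →ₗ[K] (Q z (o y) →ₗ[K] M)) (ψ : QHom o (sT H V) Q)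
    (Θ : ∀ z, Mult H' (o z) (o y) M →ₗ[K] Mult H z y M)
    (h : ∀ z (Φ : Mult H' (o z) (o y) M) (t : sT H V z y),
      φ (o z) Φ (ψ z y t) = mlift V z y (Θ z Φ) t)
    (Φ : Mult H' (o x) (o y) M) (t : sT H (S ++ V) x y) :
    mliftCons d Q (o x) (o y) φ Φ (qmap (Q := sT H V) (P' := fun x y => H' x y d)
        (fun x y => mlift S x y (⟨F.1 x y, F.2 x y⟩ : Mult H x y _)) ψ x y (split S V x y t)) =
      mlift (S ++ V) x y (cutL S.length fun z =>
        Mult.map (Θ z ∘ₗ Mult.cons d Φ) (⟨F.1 x z, F.2 x z⟩ : Mult H x z _)) t := by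
  rw [← mlift₂_split]
  refine LinearMap.congr_fun (f := mliftCons d Q (o x) (o y) φ Φ ∘ₗ
    qmap (Q := sT H V) (P' := fun x y => H' x y d)
      (fun x y => mlift S x y (⟨F.1 x y, F.2 x y⟩ : Mult H x y _)) ψ x y)
    (q_ext fun z s v => ?_) (split S V x y t)
  rw [LinearMap.comp_apply, qmap_tmul, mliftCons_tmul, h, mlift₂, qlift_tmul,
    LinearMap.comp_apply, ← mlift_map]
  rfl

end Functionals

section NerveRelations

open Chain

variable {K : Type u} [Field K] (A : AInftyCat K)

/-- The multiplications of an `A_∞`-category, with the signs of the bar construction. -/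
def AInftyCat.barOp (d : ℤ) : Op A.Hom A.Hom (fun x => x) d :=
  ⟨fun _ _ c => A.bar c d, fun x y => hat_isMultilinear (A.mul_multilinear x y d)⟩

/-- The operations of an `A_∞`-functor, with the signs of the bar construction. -/
def AInftyFunctor.barOp {A B : AInftyCat K} (f : AInftyFunctor A B) (d : ℤ) :
    Op A.Hom B.Hom f.obj d :=
  ⟨fun _ _ c => f.bar c d, fun x y => hat_isMultilinear (f.app_multilinear x y d)⟩

theorem wt_of_degs {O : Type u} {H : O → O → ℤ → ModuleCat.{u} K} {x y : O} {c : Chain H x y}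
    {W : Beads} (h : c.degs = W.map Bead.dim) : c.wt = W.eps := by
  induction c generalizing W with
  | nil =>
    cases W with
    | nil => rfl
    | cons => simp at h
  | cons d a c ih =>
    cases W with
    | nil => simp at h
    | cons b W =>
      simp only [degs_cons, List.map_cons, List.cons.injEq] at h
      rw [Chain.wt, Beads.eps, ih h.2, h.1, len_of_degs h.2]

variable {A}

variable {M : Type u} [AddCommGroup M] [Module K M]

/-- The pairing on `A_{n₁ - 1} ⊗ ⋯ ⊗ A_{n_k - 1} ⊗ (A_d ⊗ (sA)_V)`. -/
def relPair (A : AInftyCat K) (pre : Beads) (d : ℤ) (post : Beads) (M : Type u) [AddCommGroup M]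
    [Module K M] (y x : A.Ob) : Mult A.Hom x y M →ₗ[K]
      (tensL A.Hom pre (qtensor (fun x y => A.Hom x y d) (sT A.Hom post)) x y →ₗ[K] M) :=
  tlift (qtensor (fun x y => A.Hom x y d) (sT A.Hom post)) y
    (fun z => mliftCons d (sT A.Hom post) z y fun w => mlift post w y) pre x

theorem isPairing_relPair (pre : Beads) (d : ℤ) (post : Beads) (y : A.Ob) :
    IsPairing (H := A.Hom)
      (tensL A.Hom pre (qtensor (fun x y => A.Hom x y d) (sT A.Hom post))) y
      fun M _ _ => relPair A pre d post M y :=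
  isPairing_tlift (isPairing_cons d (isPairing_mlift post y)) pre

theorem relPair_tanLeft (pre : Beads) (β : Bead) (post : Beads) {x y : A.Ob}
    (t : Nerve.Fam A x y) (Φ : Mult A.Hom x y M) :
    relPair A pre (β.length - 2) post M y x Φ (Nerve.tanLeft pre β post t) =
      lsum (cuts β) fun S => (famEv t M).val (pre ++ (S ++ post))
        (insL pre.length S.length (A.barOp (β.length - 2)) Φ) := by
  rw [Nerve.tanLeft, subdiv_eq_cuts]
  change relPair A pre (β.length - 2) post M y x Φ (LinearMap.applyₗ t (lsum (cuts β) _)) = _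
  rw [map_lsum (LinearMap.applyₗ t), map_lsum (relPair A pre (β.length - 2) post M y x Φ)]
  refine lsum_congr fun S _ => ?_
  simp only [LinearMap.applyₗ_apply_apply, LinearMap.comp_apply,
    LinearMap.proj_apply, map_smul]
  let mulOp : Op A.Hom A.Hom (fun x => x) (β.length - 2) :=
    ⟨fun _ _ c => A.mul c _, fun x y => A.mul_multilinear x y _⟩
  have h1 := tlift_idTens (fun z => mliftCons (M := M) (β.length - 2) (sT A.Hom post) z y
    fun w => mlift post w y) (fun x y => qmap (A.mulS S (β.length - 2)) (qid (sT A.Hom post)) x y ∘ₗ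
      split S post x y) (fun k x => insL k S.length mulOp) (fun k x z d Φ a => rfl)
      (fun z Φ t => by
        refine (mliftCons_split (o := fun x => x) S post _ mulOp (fun w => mlift post w y)
          (qid (sT A.Hom post)) (fun z => LinearMap.id) (fun z Φ t => rfl) Φ t).trans ?_
        congr 1) pre x Φ (t (pre ++ (S ++ post)))
  refine (congrArg (((-1 : K) ^ (Beads.eps S + S.length * pre.dim) *
    (-1 : K) ^ ((S.length - 2) * pre.dim)) • ·) h1).trans ?_
  rw [← LinearMap.smul_apply, ← map_smul, famEv_val]
  refine LinearMap.congr_fun (mlift_congr _ _ _ fun c hc => ?_) _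
  rw [List.map_append] at hc
  obtain ⟨z, p, r, rfl, hp, hr⟩ := degs_split c _ _ hc
  rw [List.map_append] at hr
  obtain ⟨w, q, s, rfl, hq, hs⟩ := degs_split r _ _ hr
  show (_ : K) • ins pre.length S.length mulOp Φ.1 _ = ins pre.length S.length (A.barOp _) Φ.1 _
  rw [ins, ins, cutAt_append' _ _ _ (len_of_degs hp).symm, cutAt_append' _ _ _ (len_of_degs hp).symm,
    cutAt_append' _ _ _ (len_of_degs hq).symm, cutAt_append' _ _ _ (len_of_degs hq).symm]
  have e : (A.barOp (β.length - 2)).1 z w q = (-1 : K) ^ (Beads.eps S) • mulOp.1 z w q :=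
    congrArg (fun n : ℤ => (-1 : K) ^ n • mulOp.1 z w q) (wt_of_degs hq)
  have hl := (Φ.2 z w p (β.length - 2 : ℤ) s).map_smul ((-1 : K) ^ (Beads.eps S)) (mulOp.1 z w q)
  rw [e]
  refine Eq.trans ?_ hl.symm
  rw [← sg_add]
  congr 1
  refine sg_congr (K := K) ⟨S.length * pre.dim - pre.dim, ?_⟩
  ring

theorem relPair_tanRight (pre : Beads) (β : Bead) (post : Beads) {x y : A.Ob}
    (t : Nerve.Fam A x y) (Φ : Mult A.Hom x y M) :
    relPair A pre (β.length - 2) post M y x Φ (Nerve.tanRight pre β post t) =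
      mergeSum β fun c => (famEv t M).val (pre ++ c :: post) Φ := by
  rw [Nerve.tanRight, ← sum_merge (K := K), LinearMap.sum_apply, map_sum]
  refine Finset.sum_congr rfl fun j _ => ?_
  rw [LinearMap.smul_apply, map_smul, LinearMap.comp_apply, LinearMap.proj_apply]
  congr 1
  refine tlift_idTens (fun z => mliftCons (M := M) (β.length - 2) (sT A.Hom post) z y
    fun w => mlift post w y) _ (fun k x Φ => Φ) (fun k x z d Φ a => rfl)
      (fun z Φ t => ?_) pre x Φ _
  refine LinearMap.congr_fun (f := mliftCons (β.length - 2) (sT A.Hom post) z y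
    (fun w => mlift post w y) Φ ∘ₗ qmap (degCast (Nerve.merge_dim β j (by omega)))
      (qid (sT A.Hom post)) z y) (g := mlift (β.merge j :: post) z y Φ)
    (tcons_ext fun w a s => ?_) t
  refine Eq.trans ?_ (mlift_cons (β.merge j) post z y w Φ a s).symm
  refine (congrArg (mliftCons (β.length - 2) (sT A.Hom post) z y (fun w => mlift post w y) Φ)
    (qmap_tmul (degCast (Nerve.merge_dim β j (by omega))) (qid (sT A.Hom post)) z y w a s)).trans ?_
  rw [mliftCons_tmul]
  have : ∀ {d e : ℤ} (h : d = e) (a : A.Hom z w d),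
      Mult.cons e Φ (degCast h z w a) = Mult.cons d Φ a := by
    rintro d _ rfl a
    rfl
  rw [this]
  rfl

theorem mem_nerveModule_iff (n : ℕ) {x y : A.Ob} (t : Nerve.Fam A x y) :
    t ∈ nerveModule A n x y ↔ (∀ W : Beads, ¬ W.Valid n → t W = 0) ∧
      ∀ (M : Type u) [AddCommGroup M] [Module K M] (pre : Beads) (β : Bead) (post : Beads),
        Beads.Valid n (pre ++ β :: post) → Rel A.barOp (famEv t M) pre β post := by
  refine and_congr_right fun _ => ⟨fun h M _ _ pre β post hv Φ => ?_,
    fun h pre β post hv => (isPairing_relPair pre _ post y).ext fun M _ _ Φ => ?_⟩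
  · rw [← relPair_tanLeft, h pre β post hv, relPair_tanRight]
  · rw [relPair_tanLeft, relPair_tanRight]
    exact h M pre β post hv Φ

end NerveRelations

section Push

open Chain

variable {K : Type u} [Field K] {A B : AInftyCat K} (f : AInftyFunctor A B)
variable {M : Type u} [AddCommGroup M] [Module K M]

theorem map_flatten_of_mem_sections {α : Type*} {W : List (List α)} {D : List (List (List α))}
    (h : D ∈ (W.map cuts).sections) : D.map List.flatten = W := by
  induction W generalizing D with
  | nil =>
    simp only [List.map_nil, List.sections, List.mem_singleton] at h
    subst h
    rfl
  | cons b W ih =>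
    simp only [List.map_cons, List.sections, List.mem_flatMap, List.mem_map] at h
    obtain ⟨D, hD, S, hS, rfl⟩ := h
    rw [List.map_cons, ih hD, (flatten_of_mem_cuts hS).1]

theorem mlift_appTens (Ss : List Beads) {a b : A.Ob} (Φ : Mult B.Hom (f.obj a) (f.obj b) M)
    (t : sT A.Hom Ss.flatten a b) :
    (-1 : K) ^ ((Ss.map Beads.eps).sum + Nerve.sig Ss) •
        mlift (Ss.map List.flatten) (f.obj a) (f.obj b) Φ
          (Nerve.appTens f (Ss.map List.flatten) Ss a b t) =
      mlift Ss.flatten a b (runL (Ss.map (stepOf f.barOp)) Φ) t := by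
  induction Ss generalizing a with
  | nil =>
    rw [List.map_nil, List.sum_nil, Nerve.sig, add_zero, zpow_zero, one_smul]
    by_cases h : a = b
    · subst h
      exact (mlift_nil (f.obj a) Φ _).trans (mlift_nil a (runL [] Φ) t).symm
    · have ht : t = 0 := unit_ext (K := K) (O := A.Ob) (unitVal_of_ne t h)
      rw [ht, map_zero, map_zero, map_zero]
  | cons S Ss ih =>
    set n : ℤ := (Ss.map Beads.eps).sum + Nerve.sig Ss with hn
    have hsq : ∀ m : ℤ, (-1 : K) ^ m * (-1 : K) ^ m = 1 := fun m => by
      rw [← sg_add, (Even.add_self m).neg_one_zpow]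
    let d : ℤ := Bead.dim S.flatten
    let appOp : Op A.Hom B.Hom f.obj d :=
      ⟨fun _ _ c => f.app c d, fun x y => f.app_multilinear x y d⟩
    have h1 := mliftCons_split (M := M) S Ss.flatten d appOp
      (fun z => mlift (Ss.map List.flatten) z (f.obj b))
      (Nerve.appTens f (Ss.map List.flatten) Ss)
      (fun z => (-1 : K) ^ n • runL (Ss.map (stepOf f.barOp)))
      (fun z Φ t => by
        rw [LinearMap.smul_apply, map_smul, LinearMap.smul_apply, ← ih, smul_smul, hsq, one_smul])
      Φ t
    have h2 : mlift ((S :: Ss).map List.flatten) (f.obj a) (f.obj b) Φ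
        (Nerve.appTens f ((S :: Ss).map List.flatten) (S :: Ss) a b t) =
        (-1 : K) ^ (Nerve.excess Ss * S.dim) • _ :=
      (map_smul (mlift ((S :: Ss).map List.flatten) (f.obj a) (f.obj b) Φ) _ _).trans
        (congrArg (fun m : M => (-1 : K) ^ (Nerve.excess Ss * S.dim) • m) h1)
    rw [h2, ← LinearMap.smul_apply, ← LinearMap.smul_apply, ← map_smul, ← map_smul]
    refine LinearMap.congr_fun (mlift_congr _ _ _ fun c hc => ?_) t
    rw [List.flatten_cons, List.map_append] at hc
    obtain ⟨z, p, q, rfl, hp, hq⟩ := degs_split c _ _ hc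
    change (-1 : K) ^ (((S :: Ss).map Beads.eps).sum + Nerve.sig (S :: Ss)) •
      (-1 : K) ^ (Nerve.excess Ss * S.dim) • (cutAt S.length (p.append q) fun z p q =>
        (-1 : K) ^ n • run (Ss.map (stepOf f.barOp)) (fun v => Φ.1 (cons d (f.app p d) v)) q) =
      cutAt S.length (p.append q) fun z p q => run (Ss.map (stepOf f.barOp))
        (fun v => Φ.1 (cons d ((-1 : K) ^ p.wt • f.app p d) v)) q
    rw [cutAt_append' _ _ _ (len_of_degs hp).symm, cutAt_append' _ _ _ (len_of_degs hp).symm]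
    rw [wt_of_degs hp, smul_smul, smul_smul]
    have e : (fun v => Φ.1 (cons d ((-1 : K) ^ (Beads.eps S) • f.app p d) v)) =
        fun v => (LinearMap.lsmul K M ((-1 : K) ^ (Beads.eps S))) (Φ.1 (cons d (f.app p d) v)) :=
      funext fun v => (Φ.2.head d v).map_smul _ _
    rw [e, ← run_map, LinearMap.lsmul_apply]
    congr 1
    rw [← sg_add, ← sg_add]
    refine sg_congr (K := K) ⟨(Ss.map Beads.eps).sum + Nerve.sig Ss + Nerve.excess Ss * S.dim, ?_⟩
    rw [List.map_cons, List.sum_cons, Nerve.sig, hn]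
    ring

theorem mlift_push {a b : A.Ob} (y : Nerve.Fam A a b) (W : Beads)
    (Φ : Mult B.Hom (f.obj a) (f.obj b) M) :
    mlift W (f.obj a) (f.obj b) Φ (Nerve.push f y W) =
      ((famEv y M).bind (cutExpn f.barOp)).val W Φ := by
  rw [Ev.bind_val, lsum_cutExpn_choices]
  have h : Nerve.push f y W = lsum (W.map cuts).sections fun Ss =>
      (-1 : K) ^ ((Ss.map Beads.eps).sum + Nerve.sig Ss) •
        Nerve.appTens f W Ss a b (y Ss.flatten) := by
    rw [Nerve.push, show Bead.subdiv = cuts from funext subdiv_eq_cuts]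
    rfl
  rw [h, map_lsum (mlift W (f.obj a) (f.obj b) Φ)]
  refine lsum_congr fun Ss hS => ?_
  rw [map_smul]
  have hW := map_flatten_of_mem_sections hS
  subst hW
  exact mlift_appTens f Ss Φ _

theorem famEv_push {a b : A.Ob} (y : Nerve.Fam A a b) :
    famEv (Nerve.push f y) M = (famEv y M).bind (cutExpn f.barOp) :=
  Ev.ext fun W Φ => mlift_push f y W Φ

/-- The components of `push` at lists of beads describing injective necklace maps to `Δⁿ`. -/
def pushFam (n : ℕ) {a b : A.Ob} (y : Nerve.Fam A a b) : Nerve.Fam B (f.obj a) (f.obj b) :=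
  open Classical in fun W => if W.Valid n then Nerve.push f y W else 0

theorem famEv_congr {O : Type u} {H : O → O → ℤ → ModuleCat.{u} K} {x y : O}
    {t t' : ∀ W : Beads, sT H W x y} {W : Beads} (h : t W = t' W) (Φ : Mult H x y M) :
    (famEv t M).val W Φ = (famEv t' M).val W Φ := by
  rw [famEv_val, famEv_val, h]

end Push

section PushFunctor

set_option linter.unusedSectionVars false

open Chain

variable {K : Type u} [Field K] {O O' : Type u}
variable {H : O → O → ℤ → ModuleCat.{u} K} {H' : O' → O' → ℤ → ModuleCat.{u} K}
variable {M : Type u} [AddCommGroup M] [Module K M]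

/-- The linear part of the identity. -/
def entryOp (d : ℤ) : Op H H (fun x => x) d :=
  ⟨fun _ _ c => c.entry d, fun x y => entry_multilinear x y d⟩

theorem run_entryOp (W : Beads) {x y : O} (Φ : Chain H x y → M) (c : Chain H x y)
    (h : c.degs = W.map Bead.dim) :
    run (o := fun x => x) (W.map fun b => (⟨1, b.dim, entryOp b.dim⟩ : Step H H fun x => x)) Φ c =
      Φ c := by
  induction W generalizing x with
  | nil =>
    cases c with
    | nil => rfl
    | cons => simp at h
  | cons b W ih =>
    cases c with
    | nil => simp at h
    | cons d a c =>
      rw [degs_cons, List.map_cons, List.cons.injEq] at h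
      obtain ⟨rfl, h⟩ := h
      rw [List.map_cons, run_cons]
      show run (o := fun x => x) _ (fun v => Φ (cons b.dim ((cons b.dim a (nil _)).entry b.dim) v))
        c = _
      rw [entry_single]
      exact ih (fun v => Φ (cons b.dim a v)) c h

variable (H) in
/-- The identical expansion. -/
def idExpn : Expn H H (fun x => x) where
  terms b := [([b], ⟨1, b.dim, entryOp b.dim⟩)]
  width_eq b p hp := by
    rw [List.mem_singleton.mp hp]
    rfl
  deg_eq b p hp := by
    rw [List.mem_singleton.mp hp]

theorem idExpn_choices (W : Beads) : (idExpn H).choices W =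
    [(W, W.map fun b => (⟨1, b.dim, entryOp b.dim⟩ : Step H H fun x => x))] := by
  induction W with
  | nil => rfl
  | cons b W ih =>
    rw [Expn.choices, ih]
    rfl

theorem Ev.bind_idExpn {a b : O} (E : Ev H a b M) (W : Beads) (Φ : Mult H a b M) :
    (E.bind (idExpn H)).val W Φ = E.val W Φ := by
  rw [Ev.bind_val, idExpn_choices, lsum_cons, lsum_nil, add_zero]
  exact E.congr _ _ _ fun c hc => run_entryOp W Φ.1 c hc

/-- Lists of beads that differ from `W` at one bead, by a subdivision or an inner face, keep the
relations. -/
theorem Rel.congr_valid {m : ∀ d, Op H H (fun x => x) d} {a b : O} {E E' : Ev H a b M} {n : ℕ}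
    {pre : Beads} {β : Bead} {post : Beads} (hv : Beads.Valid n (pre ++ β :: post))
    (h : ∀ W : Beads, W.Valid n → ∀ Φ, E.val W Φ = E'.val W Φ) (hR : Rel m E pre β post) :
    Rel m E' pre β post := by
  intro Φ
  obtain ⟨n₀, n', rfl, v0, hv'⟩ := valid_append.mp hv
  obtain ⟨n₁, n₂, rfl, v1, v2⟩ := valid_append (U := [β]).mp hv'
  have hpos := (v1.1 β (by simp)).2
  have hsum : β.sum = n₁ := by simpa using v1.2
  refine Eq.trans ?_ ((hR Φ).trans ?_)
  · refine lsum_congr fun S hS => (h _ ?_ _).symm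
    exact valid_append.mpr ⟨_, _, rfl, v0, valid_append.mpr ⟨_, _, rfl,
      valid_cuts hS hpos hsum, v2⟩⟩
  · refine mergeSum_congr_pos hpos fun c _ hc hp hs => h _ ?_ _
    refine valid_append.mpr ⟨_, _, rfl, v0, valid_append (U := [c]).mpr ⟨_, _, rfl,
      ⟨fun b hb => ?_, by simp [hs, hsum]⟩, v2⟩⟩
    rw [List.mem_singleton.mp hb]
    exact ⟨hc, hp⟩

section

variable {A B C : AInftyCat K} (f : AInftyFunctor A B) (g : AInftyFunctor B C)

theorem push_congr {n : ℕ} {a b : A.Ob} {y y' : Nerve.Fam A a b}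
    (h : ∀ V : Beads, V.Valid n → y V = y' V) (W : Beads) (hW : W.Valid n) :
    Nerve.push f y W = Nerve.push f y' W := by
  rw [Nerve.push, Nerve.push]
  congr 1
  refine List.map_congr_left fun Ss hS => ?_
  rw [show Bead.subdiv = cuts from funext subdiv_eq_cuts] at hS
  rw [h _ (valid_sections hW hS)]

theorem pushFam_of_valid {n : ℕ} {a b : A.Ob} (y : Nerve.Fam A a b) {W : Beads} (h : W.Valid n) :
    pushFam f n y W = Nerve.push f y W := by
  rw [pushFam, if_pos h]

theorem pushFam_mem {n : ℕ} {a b : A.Ob} {y : Nerve.Fam A a b} (hy : y ∈ nerveModule A n a b) :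
    pushFam f n y ∈ nerveModule B n (f.obj a) (f.obj b) := by
  rw [mem_nerveModule_iff] at hy ⊢
  refine ⟨fun W h => by rw [pushFam, if_neg h], fun M _ _ pre β post hv => ?_⟩
  refine Rel.congr_valid hv (E := famEv (Nerve.push f y) M)
    (fun W hW Φ => famEv_congr (pushFam_of_valid f y hW).symm Φ) ?_
  rw [famEv_push]
  exact Rel.bind f.barOp A.barOp B.barOp (fun c d => f.bar_relation c d) _ n
    (fun pre β post h => hy.2 M pre β post h) pre β post hv

theorem push_add {a b : A.Ob} (y y' : Nerve.Fam A a b) (W : Beads) :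
    Nerve.push f (y + y') W = Nerve.push f y W + Nerve.push f y' W := by
  simp only [Nerve.push, Pi.add_apply, map_add, smul_add]
  exact lsum_add _ _ _

theorem push_smul {a b : A.Ob} (k : K) (y : Nerve.Fam A a b) (W : Beads) :
    Nerve.push f (k • y) W = k • Nerve.push f y W := by
  simp only [Nerve.push, Pi.smul_apply, map_smul, smul_comm _ k]
  exact (lsum_smul k _ _).symm

/-- The action of an `A_∞`-functor on nerves. -/
def nerveApp (n : ℕ) : QHom f.obj (nerve A n) (nerve B n) := fun a b =>
  { toFun := fun y => (⟨pushFam f n y.1, pushFam_mem f y.2⟩ :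
      nerveModule B n (f.obj a) (f.obj b))
    map_add' := fun y y' => Subtype.ext (funext fun W => by
      show pushFam f n (y.1 + y'.1) W = pushFam f n y.1 W + pushFam f n y'.1 W
      simp only [pushFam]
      split_ifs
      · exact push_add f _ _ W
      · exact (add_zero 0).symm)
    map_smul' := fun k y => Subtype.ext (funext fun W => by
      show pushFam f n (k • y.1) W = k • pushFam f n y.1 W
      simp only [pushFam]
      split_ifs
      · exact push_smul f k _ W
      · exact (smul_zero k).symm) }

theorem push_comp {a b : A.Ob} (y : Nerve.Fam A a b) (W : Beads) :
    Nerve.push (AInftyFunctor.comp f g) y W = Nerve.push g (Nerve.push f y) W := by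
  refine sT_ext (x := g.obj (f.obj a)) (y := g.obj (f.obj b)) fun M _ _ Φ => ?_
  refine (mlift_push (AInftyFunctor.comp f g) y W Φ).trans
    (Eq.trans ?_ (mlift_push g (Nerve.push f y) W Φ).symm)
  rw [famEv_push, Ev.bind_bind]
  refine Ev.bind_congr (o := fun x => g.obj (f.obj x)) (famEv y M)
    (cutExpn (AInftyFunctor.comp f g).barOp) ((cutExpn f.barOp).comp (cutExpn g.barOp)) W (fun β _ X₀ X₁ L₀ L₁ Φ h0 h1 => ?_) Φ
  simp only [cutExpn, Expn.comp, lsum_map, lsum_flatMap]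
  set d := Bead.dim β with hd
  let ψ : List Beads → M := fun D => (famEv y M).val (X₀ ++ (D.flatten ++ X₁))
    (slotL (o := fun x => g.obj (f.obj x)) L₀ L₁ D.flatten.length d Φ
      ⟨fun x y c => run (D.map (stepOf f.barOp)) (fun v => (g.barOp d).1 _ _ v) c,
        fun _ _ => run_isMultilinear _ _ ((g.barOp d).2 _ _)⟩)
  have s1 : ∀ S ∈ cuts β, (lsum ((cutExpn f.barOp).choices S) fun q =>
      (famEv y M).val (X₀ ++ (q.1 ++ X₁)) (runL (o := fun x => g.obj (f.obj x))
        (L₀ ++ Step.comp q.2 ⟨S.length, d, g.barOp d⟩ :: L₁) Φ)) =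
      lsum (S.map cuts).sections ψ := by
    intro S hS
    rw [← lsum_cutExpn_choices f.barOp S fun q => (famEv y M).val (X₀ ++ (q.1 ++ X₁))
      (slotL (o := fun x => g.obj (f.obj x)) L₀ L₁ q.1.length d Φ
        ⟨fun x y c => run q.2 (fun v => (g.barOp d).1 _ _ v) c,
          fun _ _ => run_isMultilinear _ _ ((g.barOp d).2 _ _)⟩)]
    refine lsum_congr fun q hq => ?_
    rw [slotL_apply, ← ((cutExpn f.barOp).choices_spec hq).2.1]
    rfl
  refine Eq.trans ?_ (lsum_congr s1).symm
  rw [lsum_cuts_sections _ β le_rfl ψ]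
  refine lsum_congr fun T hT => ?_
  trans (famEv y M).val (X₀ ++ (T ++ X₁)) (slotL (o := fun x => g.obj (f.obj x)) L₀ L₁ T.length d Φ
    (lsum (cuts T) fun D =>
      ⟨fun x y c => run (D.map (stepOf f.barOp)) (fun v => (g.barOp d).1 _ _ v) c,
        fun _ _ => run_isMultilinear _ _ ((g.barOp d).2 _ _)⟩))
  · refine slotL_congr (o := fun x => g.obj (f.obj x)) (famEv y M) X₀ T X₁ L₀ L₁ d Φ
      ((AInftyFunctor.comp f g).barOp d) _ h0 fun x y q hq => ?_
    let ev : Op A.Hom C.Hom (fun x => g.obj (f.obj x)) d →ₗ[K] C.Hom (g.obj (f.obj x))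
        (g.obj (f.obj y)) d :=
      { toFun := fun G => G.1 x y q
        map_add' := fun _ _ => rfl
        map_smul' := fun _ _ => rfl }
    change _ = ev _
    rw [map_lsum ev]
    exact (AInftyFunctor.bar_compApp f g q d).trans
      (barT_eq_lsum f.barOp _ T le_rfl q hq fun v => (g.barOp d).1 _ _ v)
  · rw [map_lsum (slotL (o := fun x => g.obj (f.obj x)) L₀ L₁ T.length d Φ), map_lsum ((famEv y M).val _)]
    refine lsum_congr fun D hD => ?_
    show _ = ψ D
    simp only [ψ, (flatten_of_mem_cuts hD).1]

theorem push_id {n : ℕ} {a b : A.Ob} (y : Nerve.Fam A a b) (W : Beads) (hW : W.Valid n) :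
    Nerve.push (AInftyFunctor.id A) y W = y W := by
  refine sT_ext (x := a) (y := b) fun M _ _ Φ => ?_
  refine (mlift_push (AInftyFunctor.id A) y W Φ).trans
    (Eq.trans ?_ (Ev.bind_idExpn (famEv y M) W Φ))
  refine Ev.bind_congr (o := fun x => x) (famEv y M) (cutExpn (AInftyFunctor.id A).barOp)
    (idExpn A.Hom) W (fun β hβ X₀ X₁ L₀ L₁ Φ h0 h1 => ?_) Φ
  have hc : ∀ (d : ℤ) {x y : A.Ob} (c : Chain A.Hom x y),
      (AInftyFunctor.id A).bar c d = c.entry d := by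
    intro d x y c
    show (-1 : K) ^ c.wt • c.entry d = _
    by_cases hl : c.len = 1
    · cases c with
      | nil => simp at hl
      | cons e a c =>
        cases c with
        | nil => simp [wt]
        | cons => simp at hl
    · rw [entry_of_len_ne _ hl, smul_zero]
  simp only [cutExpn, idExpn, lsum_map]
  have e : (AInftyFunctor.id A).barOp β.dim = entryOp β.dim :=
    Subtype.ext (funext fun x => funext fun y => funext fun c => hc _ c)
  rw [lsum_cuts_single β (hW.1 β hβ).1]
  · rw [e]
    exact (add_zero _).symm
  · intro S hS hl
    refine Eq.trans (slotL_congr (famEv y M) X₀ S X₁ L₀ L₁ β.dim Φ _ 0 h0 fun x y q hq => ?_) ?_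
    · refine (hc _ q).trans (entry_of_len_ne _ ?_ _)
      rwa [len_of_degs hq]
    · rw [map_zero, map_zero]

end

end PushFunctor

section Units

set_option linter.unusedSectionVars false

open Chain

variable {K : Type u} [Field K] {M : Type u} [AddCommGroup M] [Module K M]

/-- Inner faces of a list with a vanishing difference, for a function that vanishes on such
lists. -/
theorem mergeSum_of_zero_mem : ∀ (l : Bead) (g : ℕ) (ψ : Bead → M),
    (∀ c : Bead, 0 ∈ c → ψ c = 0) → 0 ∈ g :: l →
    mergeSum (g :: l) ψ = (if g = 0 ∧ l ≠ [] then ψ l else 0) +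
      (-1 : K) ^ (l.length + 1) • lsum (splits l) fun p => if p.2 = [0] then ψ (g :: p.1) else 0
  | [], g, ψ, _, _ => by simp [mergeSum, splits]
  | h :: l, g, ψ, hψ, h0 => by
    rw [mergeSum, lsum_splits_cons h l fun a b => if b = [0] then ψ (g :: a) else 0]
    by_cases hg : g = 0
    · subst hg
      have e1 : ∀ c : Bead, ψ (0 :: c) = 0 := fun c => hψ _ (by simp)
      simp only [e1, mergeSum_zero, ite_self, lsum_zero]
      simp
    · have h0' : 0 ∈ h :: l := by
        rcases List.mem_cons.mp h0 with h0 | h0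
        · exact absurd h0.symm hg
        · exact h0
      rw [mergeSum_of_zero_mem l h (fun c => ψ (g :: c)) (fun c hc => hψ _ (by simp [hc])) h0']
      simp only [hg, false_and, if_false, zero_add]
      by_cases hh : h = 0
      · subst hh
        rw [add_zero]
        cases l with
        | nil => simp [splits]
        | cons h' l =>
          simp only [List.length_cons, pow_succ]
          simp
      · have h1 : ψ ((g + h) :: l) = 0 := hψ _ (by
          rcases List.mem_cons.mp h0' with h0 | h0
          · exact absurd h0.symm hh
          · simp [h0])
        rw [h1]
        simp [hh, pow_succ]

variable (A : AInftyCat K)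

/-- The identities, as an operation on empty chains. -/
def AInftyCat.oneOp : Op A.Hom A.Hom (fun x => x) 0 :=
  ⟨fun x y c => match x, y, c with
    | _, _, nil x => A.one x
    | _, _, cons _ _ _ => 0, fun x y z w p d t => by
    cases p <;> exact isLinearMap_zero⟩

/-- The expansion of beads with differences that may vanish: `Δ¹ ⟶ Δ⁰` gives an identity, other
degenerate beads give `0`. -/
def hatExpn : Expn A.Hom A.Hom (fun x => x) where
  terms b := if 0 ∈ b then if b = [0] then [([], ⟨0, 0, A.oneOp⟩)] else []
    else [([b], ⟨1, b.dim, entryOp b.dim⟩)]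
  width_eq b p hp := by
    split_ifs at hp
    · rw [List.mem_singleton.mp hp]; rfl
    · simp at hp
    · rw [List.mem_singleton.mp hp]; rfl
  deg_eq b p hp := by
    split_ifs at hp with _ h
    · rw [List.mem_singleton.mp hp, h]; rfl
    · simp at hp
    · rw [List.mem_singleton.mp hp]

variable {A}

theorem hatExpn_pos {b : Bead} (h : 0 ∉ b) :
    (hatExpn A).terms b = [([b], ⟨1, b.dim, entryOp b.dim⟩)] := by
  simp [hatExpn, h]

theorem hatExpn_unit : (hatExpn A).terms [0] = [([], ⟨0, 0, A.oneOp⟩)] := by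
  simp [hatExpn]

theorem hatExpn_bad {b : Bead} (h : 0 ∈ b) (h' : b ≠ [0]) : (hatExpn A).terms b = [] := by
  simp [hatExpn, h, h']

theorem hatExpn_choices_pos {W : Beads} (h : ∀ b ∈ W, 0 ∉ b) :
    (hatExpn A).choices W =
      [(W, W.map fun b => (⟨1, b.dim, entryOp b.dim⟩ : Step A.Hom A.Hom fun x => x))] := by
  induction W with
  | nil => rfl
  | cons b W ih =>
    rw [Expn.choices, ih fun b hb => h b (by simp [hb]), hatExpn_pos (h b (by simp))]
    rfl

theorem hat_of_pos {a b : A.Ob} (E : Ev A.Hom a b M) {W : Beads} (h : ∀ b ∈ W, 0 ∉ b)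
    (Φ : Mult A.Hom a b M) : (E.bind (hatExpn A)).val W Φ = E.val W Φ := by
  rw [Ev.bind_val, hatExpn_choices_pos h, lsum_cons, lsum_nil, add_zero]
  exact E.congr _ _ _ fun c hc => run_entryOp W Φ.1 c hc

theorem Expn.mem_choices_append {O O' : Type u} {H : O → O → ℤ → ModuleCat.{u} K}
    {H' : O' → O' → ℤ → ModuleCat.{u} K} {o : O → O'} (u : Expn H H' o) {U V : Beads}
    {Q : Beads × List (Step H H' o)} (h : Q ∈ u.choices (U ++ V)) :
    ∃ P ∈ u.choices U, ∃ R ∈ u.choices V, Q = (P.1 ++ R.1, P.2 ++ R.2) := by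
  induction U generalizing Q with
  | nil => exact ⟨([], []), by simp [choices], Q, h, rfl⟩
  | cons b U ih =>
    simp only [List.cons_append, choices, List.mem_flatMap, List.mem_map] at h
    obtain ⟨s, hs, q, hq, rfl⟩ := h
    obtain ⟨P, hP, R, hR, rfl⟩ := ih hq
    refine ⟨(s.1 ++ P.1, s.2 :: P.2), ?_, R, hR, by simp⟩
    simp only [choices, List.mem_flatMap, List.mem_map]
    exact ⟨s, hs, P, hP, rfl⟩

/-- An operation that vanishes on chains with an identity. -/
theorem run_hat_unit {S : Beads} (hS : [0] ∈ S) {Q : Beads × List (Step A.Hom A.Hom fun x => x)}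
    (hQ : Q ∈ (hatExpn A).choices S) {x y : A.Ob} (Ω : Chain A.Hom x y → M)
    (hΩ : ∀ (z : A.Ob) (p : Chain A.Hom x z) (t : Chain A.Hom z y), p.len + 1 + t.len = S.length →
      Ω (p.append (cons 0 (A.one z) t)) = 0) (q : Chain A.Hom x y) :
    run (o := fun x => x) Q.2 Ω q = 0 := by
  obtain ⟨S₁, S₂, rfl⟩ := List.append_of_mem hS
  obtain ⟨P, hP, R, hR, rfl⟩ := Expn.mem_choices_append _ hQ
  simp only [Expn.choices, hatExpn_unit, List.flatMap_cons, List.flatMap_nil, List.append_nil,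
    List.mem_map, List.nil_append] at hR
  obtain ⟨R, hR, rfl⟩ := hR
  have hP' := ((hatExpn A).choices_spec hP).1
  have hR' := ((hatExpn A).choices_spec hR).1
  rw [run_append]
  have : ∀ (z : A.Ob) (p : Chain A.Hom x z) (q : Chain A.Hom z y),
      run (o := fun x => x) P.2 (fun u => run (o := fun x => x) (⟨0, 0, A.oneOp⟩ :: R.2)
        (fun v => Ω (u.append v)) q) p = run (o := fun x => x) P.2 (fun _ => 0) p := by
    intro z p q
    refine run_congr _ _ fun u hu => ?_
    show run (o := fun x => x) R.2 (fun v => Ω (u.append (cons 0 (A.one z) v))) q = 0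
    refine (run_congr _ _ fun v hv => ?_).trans (run_zero R.2 q)
    refine hΩ z u v ?_
    rw [hu, hv, hP', hR']
    simp
    omega
  simp only [this, run_zero]
  exact (cutAt_map (0 : M →ₗ[K] M) _ q fun _ _ _ => 0).symm

theorem hatExpn_choices_bad {S : Beads} {b : Bead} (hb : b ∈ S) (h : 0 ∈ b) (h' : b ≠ [0]) :
    (hatExpn A).choices S = [] := by
  obtain ⟨S₁, S₂, rfl⟩ := List.append_of_mem hb
  refine List.eq_nil_iff_forall_not_mem.mpr fun Q hQ => ?_
  obtain ⟨P, hP, R, hR, rfl⟩ := Expn.mem_choices_append _ hQ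
  simp [Expn.choices, hatExpn_bad h h'] at hR

/-- Operations that vanish on chains with an identity, on subdivisions of degenerate beads. -/
theorem lsum_hat_choices_zero {S : Beads} (hS : 0 ∈ S.flatten) {N : Type*} [AddCommMonoid N]
    (κ : Beads × List (Step A.Hom A.Hom fun x => x) → N)
    (h : [0] ∈ S → ∀ Q ∈ (hatExpn A).choices S, κ Q = 0) :
    lsum ((hatExpn A).choices S) κ = 0 := by
  by_cases h0 : [0] ∈ S
  · exact lsum_eq_zero (h h0)
  · obtain ⟨b, hb, hb0⟩ := List.mem_flatten.mp hS
    rw [hatExpn_choices_bad hb hb0 fun e => h0 (e ▸ hb)]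
    rfl

end Units

section UnitRelations

set_option linter.unusedSectionVars false

open Chain

variable {K : Type u} [Field K] {M : Type u} [AddCommGroup M] [Module K M]
variable {A : AInftyCat K}

/-- The multiplication `m_{|S|}`, on subdivisions `S` of a bead after insertion of identities. -/
def hatMul {a b : A.Ob} (E : Ev A.Hom a b M) (X₀ X₁ : Beads)
    (L₀ L₁ : List (Step A.Hom A.Hom fun x => x)) (d : ℤ) (Φ : Mult A.Hom a b M) (S : Beads) : M :=
  lsum ((hatExpn A).choices S) fun Q => E.val (X₀ ++ (Q.1 ++ X₁))
    (slotL L₀ L₁ Q.1.length d Φ ⟨fun x y c => run Q.2 (fun v => (A.barOp d).1 x y v) c,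
      fun _ _ => run_isMultilinear _ _ ((A.barOp d).2 _ _)⟩)

/-- The term of a bead `c`, if it is nondegenerate. -/
def hatTerm {a b : A.Ob} (E : Ev A.Hom a b M) (X₀ X₁ : Beads)
    (L₀ L₁ : List (Step A.Hom A.Hom fun x => x)) (Φ : Mult A.Hom a b M) (c : Bead) : M :=
  if 0 ∈ c then 0 else
    E.val (X₀ ++ ([c] ++ X₁)) (slotL L₀ L₁ 1 c.dim Φ (entryOp c.dim))

section

variable {a b : A.Ob} (E : Ev A.Hom a b M) (X₀ X₁ : Beads)
    (L₀ L₁ : List (Step A.Hom A.Hom fun x => x)) (Φ : Mult A.Hom a b M)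

theorem bar_one_mul {x y : A.Ob} (d : ℤ) (a : A.Hom x y d) :
    A.bar (cons 0 (A.one x) (cons d a (nil y))) d = a := by
  rw [AInftyCat.bar, hat, A.one_mul]
  simp [wt]

theorem bar_mul_one {x y : A.Ob} (d : ℤ) (a : A.Hom x y d) :
    A.bar (cons d a (cons 0 (A.one y) (nil y))) d = (-1 : K) ^ d • a := by
  rw [AInftyCat.bar, hat, A.mul_one]
  simp [wt]

theorem hatMul_single {β : Bead} (h0 : 0 ∈ β) (h : β ≠ [0]) (d : ℤ) :
    hatMul E X₀ X₁ L₀ L₁ d Φ [β] = 0 := by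
  rw [hatMul, hatExpn_choices_bad (List.mem_singleton_self β) h0 h]
  rfl

theorem hatMul_long (hL : width L₀ = X₀.length) {S : Beads} (h0 : 0 ∈ S.flatten)
    (h : 2 < S.length) (d : ℤ) : hatMul E X₀ X₁ L₀ L₁ d Φ S = 0 := by
  refine lsum_hat_choices_zero h0 _ fun hS Q hQ => ?_
  refine (slotL_congr E X₀ Q.1 X₁ L₀ L₁ d Φ _ 0 hL fun x y q hq => ?_).trans ?_
  · refine run_hat_unit hS hQ _ (fun z p t hl => ?_) q
    show A.bar _ d = 0
    rw [AInftyCat.bar, hat, A.mul_unit p t d (by omega), smul_zero]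
  · rw [map_zero, map_zero]

theorem hatMul_unit_left (hL : width L₀ = X₀.length) {t : Bead} (ht : 0 ∉ t) :
    hatMul E X₀ X₁ L₀ L₁ t.dim Φ [[0], t] = hatTerm E X₀ X₁ L₀ L₁ Φ t := by
  rw [hatTerm, if_neg ht, hatMul, Expn.choices, hatExpn_unit, hatExpn_choices_pos (W := [t]) (by
    simpa using ht)]
  simp only [List.flatMap_cons, List.flatMap_nil, List.map_cons, List.map_nil, List.append_nil,
    lsum_cons, lsum_nil, add_zero, List.nil_append]
  refine slotL_congr E X₀ [t] X₁ L₀ L₁ t.dim Φ _ _ hL fun x y q hq => ?_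
  cases q with
  | nil => simp at hq
  | cons e v q =>
    cases q with
    | cons => simp at hq
    | nil => exact bar_one_mul t.dim _

theorem hatMul_unit_right (hL : width L₀ = X₀.length) {t : Bead} (ht : 0 ∉ t) :
    hatMul E X₀ X₁ L₀ L₁ t.dim Φ [t, [0]] =
      (-1 : K) ^ t.dim • hatTerm E X₀ X₁ L₀ L₁ Φ t := by
  rw [hatTerm, if_neg ht, hatMul, Expn.choices, hatExpn_pos ht, Expn.choices, hatExpn_unit]
  simp only [Expn.choices, List.flatMap_cons, List.flatMap_nil, List.map_cons, List.map_nil,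
    List.append_nil, lsum_cons, lsum_nil, add_zero]
  rw [← map_smul, ← map_smul]
  refine slotL_congr E X₀ [t] X₁ L₀ L₁ t.dim Φ _ _ hL fun x y q hq => ?_
  cases q with
  | nil => simp at hq
  | cons e v q =>
    cases q with
    | cons => simp at hq
    | nil => exact bar_mul_one (A := A) t.dim _

theorem hatMul_units (hL : width L₀ = X₀.length) :
    hatMul E X₀ X₁ L₀ L₁ 0 Φ [[0], [0]] =
      E.val (X₀ ++ X₁) (slotL L₀ L₁ 0 0 Φ A.oneOp) := by
  rw [hatMul, Expn.choices, Expn.choices, hatExpn_unit]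
  simp only [Expn.choices, List.flatMap_cons, List.flatMap_nil, List.map_cons, List.map_nil,
    List.append_nil, lsum_cons, lsum_nil, add_zero]
  refine slotL_congr E X₀ [] X₁ L₀ L₁ 0 Φ _ _ hL fun x y q hq => ?_
  cases q with
  | nil =>
    show A.bar (cons 0 (A.one x) (cons 0 (A.one x) (nil x))) 0 = A.one x
    rw [AInftyCat.bar, hat, A.one_mul]
    simp [wt]
  | cons => simp at hq

theorem hatMul_unit (hL : width L₀ = X₀.length) (d : ℤ) :
    hatMul E X₀ X₁ L₀ L₁ d Φ [[0]] = 0 := by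
  rw [hatMul, Expn.choices, hatExpn_unit]
  simp only [Expn.choices, List.flatMap_cons, List.flatMap_nil, List.map_cons, List.map_nil,
    List.append_nil, lsum_cons, lsum_nil, add_zero]
  refine (slotL_congr E X₀ [] X₁ L₀ L₁ d Φ _ 0 hL fun x y q hq => ?_).trans (by
    rw [map_zero, map_zero])
  cases q with
  | nil =>
    show A.bar (cons 0 (A.one x) (nil x)) d = 0
    rw [AInftyCat.bar, hat, A.mul_one_one, smul_zero]
  | cons => simp at hq

theorem hatMul_pair (hL : width L₀ = X₀.length) {s t : Bead} (hs : s ≠ []) (ht : t ≠ [])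
    (h : 2 < (s ++ t).length) (h0 : 0 ∈ s ++ t) :
    hatMul E X₀ X₁ L₀ L₁ ((s ++ t).length - 2) Φ [s, t] =
      (if s = [0] then hatTerm E X₀ X₁ L₀ L₁ Φ t else 0) +
        if t = [0] then (-1 : K) ^ (s ++ t).length • hatTerm E X₀ X₁ L₀ L₁ Φ s else 0 := by
  by_cases hs0 : s = [0]
  · subst hs0
    have ht0 : t ≠ [0] := by
      rintro rfl
      simp at h
    rw [if_pos rfl, if_neg ht0, add_zero]
    by_cases h1 : 0 ∈ t
    · rw [hatTerm, if_pos h1, hatMul, hatExpn_choices_bad (b := t) (by simp) h1 ht0]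
      rfl
    · have : (([0] ++ t).length - 2 : ℤ) = t.dim := by
        simp [Bead.dim]
        ring
      rw [this, hatMul_unit_left E X₀ X₁ L₀ L₁ Φ hL h1]
  · rw [if_neg hs0, zero_add]
    by_cases h1 : 0 ∈ s
    · rw [hatTerm, if_pos h1, smul_zero, ite_self, hatMul,
        hatExpn_choices_bad (b := s) (by simp) h1 hs0]
      rfl
    · by_cases ht0 : t = [0]
      · subst ht0
        have : ((s ++ [0]).length - 2 : ℤ) = s.dim := by
          simp [Bead.dim]
          ring
        rw [if_pos rfl, this, hatMul_unit_right E X₀ X₁ L₀ L₁ Φ hL h1, ← zpow_natCast]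
        congr 1
        refine sg_congr (K := K) ⟨-1, ?_⟩
        rw [← this]
        ring
      · have h2 : 0 ∈ t := by simpa [h1] using h0
        rw [if_neg ht0, hatMul, hatExpn_choices_bad (b := t) (by simp) h2 ht0]
        rfl

theorem hatMul_relation (hL : width L₀ = X₀.length) (β : Bead)
    (hβ : β ≠ []) (hR : 0 ∉ β → Rel A.barOp E X₀ β X₁) :
    lsum (cuts β) (hatMul E X₀ X₁ L₀ L₁ (β.length - 2) Φ) = mergeSum β fun c =>
      lsum ((hatExpn A).terms c) fun q => E.val (X₀ ++ (q.1 ++ X₁)) (runL (L₀ ++ q.2 :: L₁) Φ) := by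
  have hterm : ∀ c : Bead, c ≠ [0] → (lsum ((hatExpn A).terms c) fun q =>
      E.val (X₀ ++ (q.1 ++ X₁)) (runL (L₀ ++ q.2 :: L₁) Φ)) = hatTerm E X₀ X₁ L₀ L₁ Φ c := by
    intro c hc
    by_cases h : 0 ∈ c
    · rw [hatTerm, if_pos h, hatExpn_bad h hc]
      rfl
    · rw [hatTerm, if_neg h, hatExpn_pos h, lsum_cons, lsum_nil, add_zero]
      rfl
  by_cases h0 : 0 ∈ β
  · match β, hβ, h0 with
    | [g], _, h0 =>
      obtain rfl : 0 = g := by simpa using h0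
      show lsum [[[0]]] _ = 0
      rw [lsum_cons, lsum_nil, add_zero]
      exact hatMul_unit E X₀ X₁ L₀ L₁ Φ hL _
    | [g, h], _, h0 =>
      have hcuts : lsum (cuts [g, h]) (hatMul E X₀ X₁ L₀ L₁ 0 Φ) =
          hatMul E X₀ X₁ L₀ L₁ 0 Φ [[g], [h]] := by
        rw [show cuts [g, h] = [[[g], [h]], [[g, h]]] from rfl, lsum_cons, lsum_cons, lsum_nil,
          add_zero, hatMul_single E X₀ X₁ L₀ L₁ Φ h0 (by simp), add_zero]
      refine hcuts.trans ?_
      simp only [mergeSum, sub_zero]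
      by_cases hg : g = 0
      · subst hg
        by_cases hh : h = 0
        · subst hh
          rw [hatMul_units E X₀ X₁ L₀ L₁ Φ hL, hatExpn_unit, lsum_cons, lsum_nil, add_zero]
          rfl
        · rw [zero_add, hterm _ (by simpa using hh)]
          exact hatMul_unit_left E X₀ X₁ L₀ L₁ Φ hL (t := [h]) (by simpa using Ne.symm hh)
      · obtain rfl : 0 = h := by simpa [Ne.symm hg] using h0
        rw [add_zero, hterm _ (by simpa using hg)]
        refine (hatMul_unit_right E X₀ X₁ L₀ L₁ Φ hL (t := [g]) (by simpa using Ne.symm hg)).trans ?_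
        simp [Bead.dim]
    | g :: h :: k :: l, _, h0 =>
      have hlen : 2 < (g :: h :: k :: l).length := by simp
      generalize hm : h :: k :: l = m at *
      rw [lsum_cuts_pairs g m _ fun S hS hl => hatMul_long E X₀ X₁ L₀ L₁ Φ hL (by
        rwa [(flatten_of_mem_cuts hS).1]) hl _]
      rw [mergeSum_congr (ψ' := hatTerm E X₀ X₁ L₀ L₁ Φ) fun c hc _ _ => hterm c (by
        rintro rfl
        rw [← hc] at hlen
        simp at hlen), mergeSum_of_zero_mem (K := K) m g _ (fun c hc => by rw [hatTerm, if_pos hc]) h0]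
      have e : ∀ p ∈ splits m, (if p.2 = [] then
          hatMul E X₀ X₁ L₀ L₁ ((g :: m).length - 2) Φ [g :: m]
          else hatMul E X₀ X₁ L₀ L₁ ((g :: m).length - 2) Φ [g :: p.1, p.2]) =
          (if p.2 = [] then 0 else if g :: p.1 = [0] then hatTerm E X₀ X₁ L₀ L₁ Φ p.2 else 0) +
          (-1 : K) ^ (m.length + 1) •
            if p.2 = [0] then hatTerm E X₀ X₁ L₀ L₁ Φ (g :: p.1) else 0 := by
        intro p hp
        have hpm := append_of_mem_splits hp
        split_ifs with h1 h2 h3 h4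
        · simp [h1] at h2
        · rw [hatMul_single E X₀ X₁ L₀ L₁ Φ h0 (by
            intro e
            rw [e] at hlen
            simp at hlen)]
          simp
        all_goals
          have := hatMul_pair E X₀ X₁ L₀ L₁ Φ hL (s := g :: p.1) (t := p.2) (by simp) h1
            (by rw [List.cons_append, hpm]; exact hlen) (by rw [List.cons_append, hpm]; exact h0)
          rw [List.cons_append, hpm] at this
          rw [this]
          simp [*]
      rw [lsum_congr e, lsum_add, ← lsum_smul]
      congr 1
      rw [← hm, lsum_splits_cons h (k :: l) fun a b => if b = [] then 0 else
        if g :: a = [0] then hatTerm E X₀ X₁ L₀ L₁ Φ b else 0]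
      rw [lsum_eq_zero (l := splits (k :: l)) fun p _ => by simp]
      simp
  · trans mergeSum β fun c => E.val (X₀ ++ c :: X₁) (slotL L₀ L₁ 1 (β.length - 2) Φ (entryOp _))
    · rw [← hR h0]
      refine lsum_congr fun S hS => ?_
      have hpos : ∀ s ∈ S, 0 ∉ s := fun s hs h => h0 (by
        rw [← (flatten_of_mem_cuts hS).1]
        exact List.mem_flatten.mpr ⟨s, hs, h⟩)
      rw [hatMul, hatExpn_choices_pos hpos, lsum_cons, lsum_nil, add_zero]
      let G : Op A.Hom A.Hom (fun x => x) (β.length - 2) :=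
        ⟨fun x y => ins 0 S.length (A.barOp (β.length - 2)) ((entryOp (β.length - 2)).1 x y),
          fun x y => ins_isMultilinear _ _ _ _ ((entryOp (β.length - 2)).2 x y)⟩
      trans E.val (X₀ ++ (S ++ X₁)) (slotL L₀ L₁ S.length (β.length - 2) Φ G)
      · refine slotL_congr E X₀ S X₁ L₀ L₁ _ Φ _ _ hL fun x y q hq => ?_
        refine (run_entryOp S _ q hq).trans ?_
        have h1 := cutAt_append' q (nil y) (fun w q t =>
          (cons (β.length - 2 : ℤ) ((A.barOp (β.length - 2)).1 x w q) t).entry (β.length - 2))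
          (len_of_degs hq).symm
        rw [append_nil] at h1
        exact (h1.trans (entry_single _ _)).symm
      · refine E.congr _ _ _ fun c hc => ?_
        have := ins_run L₀ L₁ 0 S.length 0 (A.barOp (β.length - 2)) (entryOp (β.length - 2 : ℤ)) Φ.1
          c (by rw [len_of_degs hc, hL]; simp)
        rw [hL] at this
        simp only [zero_add, add_zero] at this
        exact this.symm
    · refine mergeSum_congr_pos (fun g hg => Nat.pos_of_ne_zero fun e => h0 (e ▸ hg))
        fun c hc _ hp _ => ?_
      rw [hatExpn_pos fun h => absurd (hp 0 h) (lt_irrefl 0), lsum_cons, lsum_nil, add_zero]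
      have : (β.length - 2 : ℤ) = c.dim := by
        rw [Bead.dim, ← hc]
        push_cast
        ring
      rw [this]
      rfl

end

end UnitRelations

section Gaps

set_option linter.unusedSectionVars false

variable {M : Type*} [AddCommGroup M]

/-- The image of a bead starting at the vertex `p` under a map of vertices, as a list of differences
of consecutive vertices which may vanish. -/
def gap (φ : ℕ → ℕ) : ℕ → Bead → Bead
  | _, [] => []
  | p, g :: β => (φ (p + g) - φ p) :: gap φ (p + g) β

/-- The images of the beads of a list. -/
def gaps (φ : ℕ → ℕ) : ℕ → Beads → Beads
  | _, [] => []
  | p, β :: W => gap φ p β :: gaps φ (p + β.sum) W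

@[simp] theorem gap_length (φ : ℕ → ℕ) (p : ℕ) (β : Bead) : (gap φ p β).length = β.length := by
  induction β generalizing p with
  | nil => rfl
  | cons g β ih => simp [gap, ih]

theorem gap_dim (φ : ℕ → ℕ) (p : ℕ) (β : Bead) : Bead.dim (gap φ p β) = β.dim := by
  rw [Bead.dim, Bead.dim, gap_length]

theorem gap_ne_nil {φ : ℕ → ℕ} {p : ℕ} {β : Bead} (h : β ≠ []) : gap φ p β ≠ [] := fun e =>
  h (List.length_eq_zero_iff.mp ((gap_length φ p β).symm.trans (congrArg List.length e)))

@[simp] theorem gaps_length (φ : ℕ → ℕ) (p : ℕ) (W : Beads) : (gaps φ p W).length = W.length := by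
  induction W generalizing p with
  | nil => rfl
  | cons g β ih => simp [gaps, ih]

theorem gaps_map_dim (φ : ℕ → ℕ) (p : ℕ) (W : Beads) :
    (gaps φ p W).map Bead.dim = W.map Bead.dim := by
  induction W generalizing p with
  | nil => rfl
  | cons g β ih => simp [gaps, ih, gap_dim]

theorem gaps_append (φ : ℕ → ℕ) (p : ℕ) (U V : Beads) :
    gaps φ p (U ++ V) = gaps φ p U ++ gaps φ (p + U.flatten.sum) V := by
  induction U generalizing p with
  | nil => simp [gaps]
  | cons b U ih => simp [gaps, ih, add_assoc]

theorem ne_nil_of_mem_gaps {φ : ℕ → ℕ} {p : ℕ} {W : Beads} (h : ∀ b ∈ W, b ≠ []) :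
    ∀ b ∈ gaps φ p W, b ≠ [] := by
  induction W generalizing p with
  | nil => simp [gaps]
  | cons c W ih =>
    intro b hb
    rcases List.mem_cons.mp hb with rfl | hb
    · exact gap_ne_nil (h c (by simp))
    · exact ih (fun b hb => h b (by simp [hb])) b hb

theorem lsum_cuts_gap (φ : ℕ → ℕ) (p : ℕ) (β : Bead) (F : Beads → M) :
    lsum (cuts (gap φ p β)) F = lsum (cuts β) fun S => F (gaps φ p S) := by
  induction β generalizing p F with
  | nil => rfl
  | cons g β ih =>
    rw [gap, cuts, cuts, lsum_flatMap, lsum_flatMap, ih]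
    refine lsum_congr fun S _ => ?_
    cases S with
    | nil => rfl
    | cons s S => simp [gaps, gap, add_assoc]

theorem mergeSum_gap {φ : ℕ → ℕ} (hφ : Monotone φ) : ∀ (β : Bead) (p : ℕ) (ψ : Bead → M),
    mergeSum (gap φ p β) ψ = mergeSum β fun c => ψ (gap φ p c)
  | [], _, _ => rfl
  | [_], _, _ => rfl
  | g :: h :: β, p, ψ => by
    have h1 := hφ (Nat.le_add_right p g)
    have h2 := hφ (Nat.le_add_right (p + g) h)
    have h3 := mergeSum_gap hφ (h :: β) (p + g) fun c => ψ ((φ (p + g) - φ p) :: c)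
    have e : φ (p + g) - φ p + (φ (p + g + h) - φ (p + g)) = φ (p + (g + h)) - φ p := by
      rw [← add_assoc]
      omega
    simp only [gap, mergeSum] at h3 ⊢
    rw [e, h3, add_assoc]

theorem gap_sum {φ : ℕ → ℕ} (hφ : Monotone φ) (p : ℕ) (β : Bead) :
    (gap φ p β).sum + φ p = φ (p + β.sum) := by
  induction β generalizing p with
  | nil => simp [gap]
  | cons g β ih =>
    have h1 := hφ (Nat.le_add_right p g)
    have := ih (p + g)
    simp only [gap, List.sum_cons]
    rw [← add_assoc p]
    omega

theorem gaps_sum {φ : ℕ → ℕ} (hφ : Monotone φ) (p : ℕ) (W : Beads) :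
    (gaps φ p W).flatten.sum + φ p = φ (p + W.flatten.sum) := by
  induction W generalizing p with
  | nil => simp [gaps]
  | cons b W ih =>
    have h1 := gap_sum hφ p b
    have := ih (p + b.sum)
    simp only [gaps, List.flatten_cons, List.sum_append]
    rw [← add_assoc p]
    omega

/-- The extension of a map of intervals to a monotone map of natural numbers. -/
def FInt.ext {m n : ℕ} (f : FInt m n) (i : ℕ) : ℕ := f.val (min i m)

theorem FInt.ext_mono {m n : ℕ} (f : FInt m n) : Monotone f.ext := fun i j h =>
  f.val_mono (by omega) (by omega)

theorem FInt.ext_of_le {m n : ℕ} (f : FInt m n) {i : ℕ} (h : i ≤ m) : f.ext i = f.val i := by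
  rw [FInt.ext, min_eq_left h]

theorem FInt.ext_zero {m n : ℕ} (f : FInt m n) : f.ext 0 = 0 := by
  rw [f.ext_of_le (Nat.zero_le m), f.val_zero]

theorem FInt.ext_last {m n : ℕ} (f : FInt m n) : f.ext m = n := by
  rw [f.ext_of_le le_rfl, f.val_last]

theorem FInt.ext_comp {m n k : ℕ} (f : FInt m n) (g : FInt n k) (i : ℕ) :
    (f.comp g).ext i = g.ext (f.ext i) := by
  have h1 : min i m < m + 1 := by omega
  have h2 := f.val_lt (min i m)
  have h3 : min (f.val (min i m)) n = f.val (min i m) := by omega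
  rw [FInt.ext, FInt.ext, FInt.ext, h3]
  simp only [FInt.val, h1, dif_pos] at h2 ⊢
  rw [dif_pos h2]
  rfl

theorem FInt.ext_id {n i : ℕ} (h : i ≤ n) : (FInt.id n).ext i = i := by
  rw [FInt.ext_of_le _ h, FInt.val, dif_pos (by omega)]
  rfl

theorem img_eq {m n : ℕ} (f : FInt m n) (p : ℕ) (β : Bead) (h : p + β.sum ≤ m) :
    Nerve.img f p β = (gap f.ext p β).filter (· ≠ 0) := by
  induction β generalizing p with
  | nil => rfl
  | cons g β ih =>
    rw [List.sum_cons] at h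
    have h1 := f.ext_mono (Nat.le_add_right p g)
    rw [f.ext_of_le (by omega), f.ext_of_le (by omega)] at h1
    rw [Nerve.img, gap, f.ext_of_le (by omega), f.ext_of_le (by omega), ih _ (by omega)]
    by_cases h2 : f.val (p + g) = f.val p
    · rw [if_pos h2, List.filter_cons_of_neg (by simp; omega)]
    · rw [if_neg h2, List.filter_cons_of_pos (by simp; omega)]

end Gaps

section Hat

set_option linter.unusedSectionVars false

open Chain

variable {K : Type u} [Field K] {M : Type u} [AddCommGroup M] [Module K M]
variable {A B : AInftyCat K}

theorem valid_hat_choices {W : Beads} (hW : ∀ b ∈ W, b ≠ [])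
    {Q : Beads × List (Step A.Hom A.Hom fun x => x)} (hQ : Q ∈ (hatExpn A).choices W) :
    Q.1.Valid W.flatten.sum := by
  induction W generalizing Q with
  | nil =>
    simp only [Expn.choices, List.mem_singleton] at hQ
    subst hQ
    exact ⟨by simp, rfl⟩
  | cons b W ih =>
    simp only [Expn.choices, List.mem_flatMap, List.mem_map] at hQ
    obtain ⟨s, hs, q, hq, rfl⟩ := hQ
    have := ih (fun b hb => hW b (by simp [hb])) hq
    refine valid_append.mpr ⟨_, _, by rw [List.flatten_cons, List.sum_append], ?_, this⟩
    simp only [hatExpn] at hs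
    split_ifs at hs with h1 h2
    · rw [List.mem_singleton.mp hs, h2]
      exact ⟨by simp, rfl⟩
    · simp at hs
    · rw [List.mem_singleton.mp hs]
      refine ⟨fun c hc => ?_, by simp⟩
      rw [List.mem_singleton.mp hc]
      exact ⟨hW b (by simp), fun g hg => Nat.pos_of_ne_zero fun e => h1 (e ▸ hg)⟩

/-- The relations hold for beads with differences that may vanish. -/
theorem Rel.hat {a b : A.Ob} (E : Ev A.Hom a b M) (n : ℕ)
    (hE : ∀ (pre : Beads) (β : Bead) (post : Beads), Beads.Valid n (pre ++ β :: post) →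
      Rel A.barOp E pre β post)
    (pre : Beads) (β : Bead) (post : Beads) (hne : ∀ b ∈ pre ++ β :: post, b ≠ [])
    (hn : (pre ++ β :: post).flatten.sum = n) :
    Rel A.barOp (E.bind (hatExpn A)) pre β post := by
  intro Φ
  simp only [Ev.bind_val]
  have hR : ∀ c : Bead, (lsum ((hatExpn A).choices (pre ++ c :: post)) fun p =>
      E.val p.1 (runL p.2 Φ)) = lsum ((hatExpn A).choices pre) fun P =>
        lsum ((hatExpn A).choices post) fun R => lsum ((hatExpn A).terms c) fun q =>
          E.val (P.1 ++ (q.1 ++ R.1)) (runL (P.2 ++ q.2 :: R.2) Φ) := by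
    intro c
    rw [Expn.lsum_choices_append]
    refine lsum_congr fun P _ => ?_
    rw [Expn.lsum_choices_cons, lsum_comm]
  rw [mergeSum_congr fun c _ _ _ => hR c, mergeSum_lsum]
  simp only [Expn.lsum_choices_append]
  rw [lsum_comm]
  refine lsum_congr fun P hP => ?_
  rw [mergeSum_lsum,
    lsum_congr fun S _ => lsum_comm ((hatExpn A).choices S) ((hatExpn A).choices post) _,
    lsum_comm]
  refine lsum_congr fun R hR => ?_
  obtain ⟨hP1, hP2, _⟩ := (hatExpn A).choices_spec hP
  rw [← hatMul_relation E P.1 R.1 P.2 R.2 Φ hP2 β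
    (hne β (by simp)) fun h0 => hE _ _ _ ?_]
  · refine lsum_congr fun S hS => lsum_congr fun Q hQ => ?_
    obtain ⟨hQ1, hQ2, _⟩ := (hatExpn A).choices_spec hQ
    congr 1
    refine Subtype.ext (funext fun c => ?_)
    show run (o := fun x => x) _ (ins _ _ _ Φ.1) c = run (o := fun x => x) _ Φ.1 c
    rw [← hP1, ← hQ1, run_ins (o := fun x => x) _ _ _ _ Φ.1 Φ.2, Step.comp, hQ2]
  · refine valid_append.mpr ⟨pre.flatten.sum, β.sum + post.flatten.sum, by rw [← hn]; simp,
      valid_hat_choices (fun b hb => hne b (by simp [hb])) hP,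
      valid_append (U := [β]).mpr ⟨_, _, rfl, ⟨fun c hc => ?_, by simp⟩,
        valid_hat_choices (fun b hb => hne b (by simp [hb])) hR⟩⟩
    rw [List.mem_singleton.mp hc]
    exact ⟨hne β (by simp), fun g hg => Nat.pos_of_ne_zero fun e => h0 (e ▸ hg)⟩

/-- Reindexing along a map of vertices. -/
def Ev.gaps {a b : A.Ob} (φ : ℕ → ℕ) (E : Ev A.Hom a b M) : Ev A.Hom a b M where
  val W := E.val (AInf.gaps φ 0 W)
  congr W Φ Ψ h := E.congr _ _ _ (by rwa [gaps_map_dim])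

theorem Rel.gaps {a b : A.Ob} {φ : ℕ → ℕ} (hφ : Monotone φ) (E : Ev A.Hom a b M)
    (pre : Beads) (β : Bead) (post : Beads)
    (h : Rel A.barOp E (AInf.gaps φ 0 pre) (gap φ (0 + pre.flatten.sum) β)
      (AInf.gaps φ (0 + pre.flatten.sum + β.sum) post)) :
    Rel A.barOp (E.gaps φ) pre β post := by
  intro Φ
  have := h Φ
  rw [lsum_cuts_gap, mergeSum_gap hφ] at this
  refine Eq.trans (lsum_congr fun S hS => ?_) (this.trans (mergeSum_congr fun c _ _ hc => ?_))
  · show E.val (AInf.gaps φ 0 (pre ++ (S ++ post))) _ = _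
    rw [gaps_append, gaps_append, (flatten_of_mem_cuts hS).1, gaps_length, gaps_length, gap_length]
  · show _ = E.val (AInf.gaps φ 0 (pre ++ c :: post)) _
    rw [gaps_append, AInf.gaps, hc]

/-- The pairing with the map `ē` of a bead. -/
theorem bar_spec {m n : ℕ} (f : FInt m n) (W : Beads) (p : ℕ) (hp : p + W.flatten.sum ≤ m)
    (hW : ∀ b ∈ W, b ≠ []) :
    ((hatExpn A).choices (gaps f.ext p W) = [] ∧
      ∀ (x y : A.Ob) (t : sT A.Hom (Nerve.imgs f p W) x y), Nerve.bar f p W x y t = 0) ∨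
    ∃ L, (hatExpn A).choices (gaps f.ext p W) = [(Nerve.imgs f p W, L)] ∧
      ∀ (M : Type u) [AddCommGroup M] [Module K M] (x y : A.Ob) (Φ : Mult A.Hom x y M)
        (t : sT A.Hom (Nerve.imgs f p W) x y),
        mlift W x y Φ (Nerve.bar f p W x y t) = mlift (Nerve.imgs f p W) x y (runL L Φ) t := by
  induction W generalizing p with
  | nil =>
    refine Or.inr ⟨[], rfl, fun M _ _ x y Φ t => ?_⟩
    refine LinearMap.congr_fun (mlift_congr [] _ _ fun c hc => ?_) t
    cases c with
    | nil => rfl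
    | cons => simp at hc
  | cons β W ih =>
    rw [List.flatten_cons, List.sum_append] at hp
    have ih := ih (p + β.sum) (by omega) fun b hb => hW b (by simp [hb])
    have himg : Nerve.img f p β = _ := img_eq f p β (by omega)
    have hlen := gap_length f.ext p β
    rw [gaps, Expn.choices]
    show (_ ∧ ∀ (x y : A.Ob) (t : sT A.Hom (Nerve.consBead (Nerve.img f p β)
        (Nerve.imgs f (p + β.sum) W)) x y),
      Nerve.barCons β (Nerve.bar f (p + β.sum) W) (Nerve.img f p β) x y t = 0) ∨
      ∃ L, _ = [(Nerve.consBead (Nerve.img f p β) (Nerve.imgs f (p + β.sum) W), L)] ∧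
      ∀ (M : Type u) [AddCommGroup M] [Module K M] (x y : A.Ob) (Φ : Mult A.Hom x y M)
        (t : sT A.Hom (Nerve.consBead (Nerve.img f p β) (Nerve.imgs f (p + β.sum) W)) x y),
        mlift (β :: W) x y Φ (Nerve.barCons β (Nerve.bar f (p + β.sum) W) (Nerve.img f p β) x y t) =
          mlift (Nerve.consBead (Nerve.img f p β) (Nerve.imgs f (p + β.sum) W)) x y (runL L Φ) t
    rw [himg]
    generalize gap f.ext p β = γ at hlen ⊢
    generalize Nerve.bar (A := A) f (p + β.sum) W = ψ at ih ⊢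
    generalize Nerve.imgs f (p + β.sum) W = W' at ψ ih ⊢
    have hγ : γ ≠ [] := by
      rintro rfl
      exact hW β (by simp) (List.length_eq_zero_iff.mp hlen.symm)
    by_cases h0 : 0 ∈ γ
    · by_cases h1 : γ = [0]
      · subst h1
        obtain ⟨g, rfl⟩ := List.length_eq_one_iff.mp hlen.symm
        rw [show [0].filter (· ≠ 0) = [] from rfl]
        have hz : 0 = Bead.dim [g] := rfl
        have hbar : ∀ (x y : A.Ob) (t : sT A.Hom W' x y), Nerve.barCons [g] ψ [] x y t =
            tcons x (degCast hz x x (A.one x)) (ψ x y t) := by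
          intro x y t
          simp only [Nerve.barCons]
          rw [dif_pos hz]
          rfl
        rcases ih with ⟨h1, h2⟩ | ⟨L, h1, h2⟩
        · refine Or.inl ⟨by rw [hatExpn_unit, h1]; rfl, fun x y t => (hbar x y t).trans ?_⟩
          exact (congrArg (fun s => tcons x (degCast hz x x (A.one x)) s) (h2 x y t)).trans
            (map_zero _)
        · refine Or.inr ⟨⟨0, 0, A.oneOp⟩ :: L, by rw [hatExpn_unit, h1]; rfl,
            fun M _ _ x y Φ t => ?_⟩
          refine (congrArg _ (hbar x y t)).trans ((mlift_cons _ _ _ _ _ _ _ _).trans ?_)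
          exact h2 M x y _ t
      · refine Or.inl ⟨by rw [hatExpn_bad h0 h1]; rfl, ?_⟩
        have hlt : (γ.filter (· ≠ 0)).length < γ.length :=
          List.length_filter_lt_length_iff_exists.mpr ⟨0, h0, by simp⟩
        have h2 : γ.length ≠ 1 := fun e => by
          obtain ⟨g, rfl⟩ := List.length_eq_one_iff.mp e
          exact h1 (by simpa using (List.mem_singleton.mp h0).symm)
        have h3 := List.length_pos_of_ne_nil hγ
        generalize γ.filter (· ≠ 0) = δ at hlt
        intro x y t
        cases δ with
        | nil =>
          have hne : ¬ 0 = β.dim := by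
            simp only [Bead.dim]
            omega
          exact LinearMap.congr_fun (f := Nerve.barCons β ψ [] x y) (g := 0) (dif_neg hne) t
        | cons g δ =>
          have hne : ¬ Bead.dim (g :: δ) = β.dim := by
            simp only [Bead.dim]
            omega
          exact LinearMap.congr_fun (f := Nerve.barCons β ψ (g :: δ) x y) (g := 0)
            (dif_neg hne) t
    · have hf : γ.filter (· ≠ 0) = γ := List.filter_eq_self.mpr fun g hg => by
        simpa using fun e : g = 0 => h0 (e ▸ hg)
      rw [hf, hatExpn_pos h0]
      cases γ with
      | nil => exact absurd rfl hγ
      | cons g γ =>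
        have hd : Bead.dim (g :: γ) = β.dim := by rw [Bead.dim, Bead.dim, hlen]
        have hbar : ∀ (x y : A.Ob), Nerve.barCons β ψ (g :: γ) x y =
            qmap (P := fun x y => A.Hom x y (Bead.dim (g :: γ))) (degCast hd) ψ x y := by
          intro x y
          exact dif_pos hd
        rcases ih with ⟨h1, h2⟩ | ⟨L, h1, h2⟩
        · refine Or.inl ⟨by rw [h1]; rfl, fun x y t => (congrArg (fun F => F t) (hbar x y)).trans ?_⟩
          refine LinearMap.congr_fun (g := 0) (tcons_ext (b := g :: γ) (W := W') fun z a s => ?_) t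
          refine (qmap_tmul _ _ _ _ _ _ _).trans ?_
          exact (congrArg (fun s => qtmul (P := fun x y => A.Hom x y β.dim) z
            (degCast hd x z a) s) (h2 z y s)).trans (map_zero _)
        · refine Or.inr ⟨⟨1, Bead.dim (g :: γ), entryOp _⟩ :: L, by rw [h1]; rfl,
            fun M _ _ x y Φ t => ?_⟩
          refine (congrArg (fun F => mlift (β :: W) x y Φ (F t)) (hbar x y)).trans ?_
          refine LinearMap.congr_fun (f := mlift (β :: W) x y Φ ∘ₗ
              qmap (P := fun x y => A.Hom x y (Bead.dim (g :: γ))) (degCast hd) ψ x y)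
            (g := mlift ((g :: γ) :: W') x y (runL (⟨1, Bead.dim (g :: γ), entryOp _⟩ :: L) Φ))
            (tcons_ext (b := g :: γ) (W := W') fun z a s => ?_) t
          refine Eq.trans ?_ (mlift_cons (g :: γ) W' x y z _ a s).symm
          refine (congrArg (mlift (β :: W) x y Φ) (qmap_tmul (degCast hd) ψ x y z a s)).trans ?_
          refine (mlift_cons β W x y z Φ _ _).trans ((h2 M z y _ s).trans ?_)
          congr 2
          refine Subtype.ext (funext fun c => ?_)
          show run (o := fun x => x) L (fun v => Φ.1 (cons β.dim (degCast hd x z a) v)) c =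
            run (o := fun x => x) L (fun v => Φ.1 (cons (Bead.dim (g :: γ))
              ((cons (Bead.dim (g :: γ)) a (nil z)).entry _) v)) c
          congr 1
          funext v
          rw [entry_single]
          have hcast : ∀ {d e : ℤ} (h : d = e) (a : A.Hom x z d),
              Φ.1 (cons e (degCast h x z a) v) = Φ.1 (cons d a v) := by
            rintro d _ rfl a
            rfl
          exact hcast hd a

variable (A) in
/-- The action of a map of intervals on collections. -/
def mapFam {m n : ℕ} (f : FInt m n) {a b : A.Ob} : Nerve.Fam A a b →ₗ[K] Nerve.Fam A a b :=
  LinearMap.pi fun W => open Classical in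
    if W.Valid m then Nerve.bar f 0 W a b ∘ₗ LinearMap.proj (Nerve.imgs f 0 W) else 0

theorem mapFam_of_valid {m n : ℕ} (f : FInt m n) {a b : A.Ob} (y : Nerve.Fam A a b) {W : Beads}
    (h : W.Valid m) : mapFam A f y W = Nerve.bar f 0 W a b (y (Nerve.imgs f 0 W)) := by
  rw [mapFam, LinearMap.pi_apply, if_pos h]
  rfl

theorem mapFam_of_not_valid {m n : ℕ} (f : FInt m n) {a b : A.Ob} (y : Nerve.Fam A a b)
    {W : Beads} (h : ¬ W.Valid m) : mapFam A f y W = 0 := by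
  rw [mapFam, LinearMap.pi_apply, if_neg h]
  rfl

theorem famEv_mapFam {m n : ℕ} (f : FInt m n) {a b : A.Ob} (y : Nerve.Fam A a b) {W : Beads}
    (h : W.Valid m) (Φ : Mult A.Hom a b M) :
    (famEv (mapFam A f y) M).val W Φ =
      ((famEv y M).bind (hatExpn A)).val (gaps f.ext 0 W) Φ := by
  rw [famEv_val, mapFam_of_valid f y h, Ev.bind_val]
  rcases bar_spec (A := A) f W 0 (by rw [h.2, zero_add]) fun b hb => (h.1 b hb).1 with
    ⟨h1, h2⟩ | ⟨L, h1, h2⟩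
  · rw [h1, h2, map_zero]
    rfl
  · rw [h1, h2, lsum_cons, lsum_nil, add_zero]
    rfl

theorem mapFam_mem {m n : ℕ} (f : FInt m n) {a b : A.Ob} {y : Nerve.Fam A a b}
    (hy : y ∈ nerveModule A n a b) : mapFam A f y ∈ nerveModule A m a b := by
  rw [mem_nerveModule_iff] at hy ⊢
  refine ⟨fun W h => mapFam_of_not_valid f y h, fun M _ _ pre β post hv => ?_⟩
  refine Rel.congr_valid hv (E := ((famEv y M).bind (hatExpn A)).gaps f.ext)
    (fun W hW Φ => (famEv_mapFam f y hW Φ).symm) ?_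
  have e : gaps f.ext 0 (pre ++ β :: post) = gaps f.ext 0 pre ++ (gap f.ext
      (0 + pre.flatten.sum) β :: gaps f.ext (0 + pre.flatten.sum + β.sum) post) := by
    rw [gaps_append, gaps]
  refine Rel.gaps f.ext_mono _ _ _ _ (Rel.hat _ n (fun pre β post h => hy.2 M pre β post h) _ _ _
    ?_ ?_)
  · rw [← e]
    exact ne_nil_of_mem_gaps fun b hb => (hv.1 b hb).1
  · rw [← e]
    have := gaps_sum f.ext_mono 0 (pre ++ β :: post)
    rw [hv.2, f.ext_zero, zero_add, f.ext_last] at this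
    exact this

end Hat

section MapFunctor

set_option linter.unusedSectionVars false

open Chain

variable {K : Type u} [Field K] {M : Type u} [AddCommGroup M] [Module K M]
variable {A B : AInftyCat K}

theorem gap_gap {φ : ℕ → ℕ} (hφ : Monotone φ) (ψ : ℕ → ℕ) (p : ℕ) (β : Bead) :
    gap ψ (φ p) (gap φ p β) = gap (fun i => ψ (φ i)) p β := by
  induction β generalizing p with
  | nil => rfl
  | cons g β ih =>
    rw [gap, gap, gap, Nat.add_sub_cancel' (hφ (Nat.le_add_right p g)), ih]

theorem gap_of_eqOn {φ : ℕ → ℕ} {n : ℕ} (hφ : ∀ i ≤ n, φ i = i) (p : ℕ) (β : Bead)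
    (h : p + β.sum ≤ n) : gap φ p β = β := by
  induction β generalizing p with
  | nil => rfl
  | cons g β ih =>
    rw [List.sum_cons] at h
    rw [gap, hφ _ (by omega), hφ _ (by omega), Nat.add_sub_cancel_left, ih _ (by omega)]

theorem gaps_of_eqOn {φ : ℕ → ℕ} {n : ℕ} (hφ : ∀ i ≤ n, φ i = i) (p : ℕ) (W : Beads)
    (h : p + W.flatten.sum ≤ n) : gaps φ p W = W := by
  induction W generalizing p with
  | nil => rfl
  | cons b W ih =>
    rw [List.flatten_cons, List.sum_append] at h
    rw [gaps, gap_of_eqOn hφ _ _ (by omega), ih _ (by omega)]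

theorem zero_notMem_of_valid {n : ℕ} {W : Beads} (h : W.Valid n) : ∀ b ∈ W, 0 ∉ b :=
  fun b hb h0 => absurd ((h.1 b hb).2 0 h0) (lt_irrefl 0)

theorem entry_cons_eq {O : Type u} {H : O → O → ℤ → ModuleCat.{u} K} {x y z : O} {d e : ℤ}
    (h : d = e) (a : H x z d) (c : Chain H z y) :
    cons e ((cons d a (nil z)).entry e) c = cons d a c := by
  subst h
  rw [entry_single]

theorem lsum_hat_hat {N : Type*} [AddCommMonoid N] {φ : ℕ → ℕ} (hφ : Monotone φ) (ψ : ℕ → ℕ)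
    (W : Beads) (hW : ∀ b ∈ W, b ≠ []) (p : ℕ)
    (κ : Beads → (∀ x y : A.Ob, (Chain A.Hom x y → M) → Chain A.Hom x y → M) → N) :
    (lsum ((hatExpn A).choices (gaps φ p W)) fun Q =>
      lsum ((hatExpn A).choices (gaps ψ (φ p) Q.1)) fun R =>
        κ R.1 fun _ _ Φ => run (o := fun x => x) R.2 (run (o := fun x => x) Q.2 Φ)) =
      lsum ((hatExpn A).choices (gaps (fun i => ψ (φ i)) p W)) fun R =>
        κ R.1 fun _ _ Φ => run (o := fun x => x) R.2 Φ := by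
  induction W generalizing p κ with
  | nil =>
    simp only [gaps, Expn.choices, lsum_cons, lsum_nil, add_zero]
    congr 1
    funext x y Φ c
    cases c <;> rfl
  | cons β W ih =>
    have ih := ih (fun b hb => hW b (by simp [hb])) (p + β.sum)
    have hg := gap_gap hφ ψ p β
    have hs := gap_sum hφ p β
    have hd := gap_dim ψ (φ p) (gap φ p β)
    have hne := gap_ne_nil (φ := φ) (p := p) (hW β (by simp))
    rw [gaps, gaps, Expn.lsum_choices_cons, Expn.lsum_choices_cons, ← hg]
    generalize gap φ p β = γ at hg hs hd hne ⊢
    by_cases h0 : 0 ∈ γ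
    · have h0' : 0 ∈ gap ψ (φ p) γ := by
        clear hg hs hd hne
        generalize φ p = q
        induction γ generalizing q with
        | nil => simp at h0
        | cons g γ ih =>
          rcases List.mem_cons.mp h0 with rfl | h0
          · simp [gap]
          · exact List.mem_cons_of_mem _ (ih h0 _)
      by_cases h1 : γ = [0]
      · subst h1
        have e : φ (p + β.sum) = φ p := by rw [← hs]; simp
        rw [show gap ψ (φ p) [0] = [0] by simp [gap], hatExpn_unit]
        simp only [lsum_cons, lsum_nil, add_zero, List.nil_append]
        have := ih fun U R => κ U fun x y Φ c => R x y (fun v => Φ (cons 0 (A.one x) v)) c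
        rw [e] at this
        exact this
      · have h1' : gap ψ (φ p) γ ≠ [0] := fun e => h1 <| by
          obtain ⟨g, rfl⟩ := List.length_eq_one_iff.mp
            ((gap_length ψ (φ p) γ).symm.trans (congrArg List.length e))
          simpa using (List.mem_singleton.mp h0).symm
        rw [hatExpn_bad h0 h1, hatExpn_bad h0' h1']
        rfl
    · rw [hatExpn_pos h0]
      simp only [lsum_cons, lsum_nil, add_zero]
      have e : ∀ Q : Beads × List (Step A.Hom A.Hom fun x => x), gaps ψ (φ p) ([γ] ++ Q.1) =
          gap ψ (φ p) γ :: gaps ψ (φ (p + β.sum)) Q.1 := fun Q => by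
        rw [← hs, add_comm]
        rfl
      simp only [e, Expn.lsum_choices_cons]
      rw [lsum_comm]
      refine lsum_congr fun s hs => ?_
      refine Eq.trans ?_ (ih fun U R => κ (s.1 ++ U) fun x y Φ c => cutAt s.2.k c fun z p q =>
        R z y (fun v => Φ (cons s.2.d (s.2.F.1 _ z p) v)) q)
      refine lsum_congr fun Q _ => lsum_congr fun R _ => congrArg _ ?_
      funext x y Φ c
      rw [run_cons]
      congr 1
      funext z u q
      congr 1
      funext v
      show run (o := fun x => x) Q.2 (fun v => Φ (cons γ.dim
        ((cons s.2.d (s.2.F.1 _ z u) (nil z)).entry γ.dim) v)) v = _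
      simp only [entry_cons_eq (((hatExpn A).deg_eq _ s hs).trans hd)]

theorem mapFam_id {n : ℕ} {a b : A.Ob} (y : Nerve.Fam A a b) {W : Beads} (hW : W.Valid n) :
    mapFam A (FInt.id n) y W = y W := by
  refine sT_ext fun M _ _ Φ => ?_
  refine (famEv_mapFam (FInt.id n) y hW Φ).trans ?_
  rw [gaps_of_eqOn (fun i hi => FInt.ext_id hi) 0 W (by rw [hW.2, zero_add])]
  exact hat_of_pos _ (zero_notMem_of_valid hW) Φ

theorem valid_of_hat_gaps {m n : ℕ} (f : FInt m n) {W : Beads} (hW : W.Valid m)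
    {Q : Beads × List (Step A.Hom A.Hom fun x => x)}
    (hQ : Q ∈ (hatExpn A).choices (gaps f.ext 0 W)) : Q.1.Valid n := by
  have := valid_hat_choices (ne_nil_of_mem_gaps fun b hb => (hW.1 b hb).1) hQ
  have e := gaps_sum f.ext_mono 0 W
  rw [hW.2, f.ext_zero, zero_add, f.ext_last, add_zero] at e
  rwa [e] at this

theorem mapFam_comp {m n k : ℕ} (f : FInt m n) (g : FInt n k) {a b : A.Ob}
    (y : Nerve.Fam A a b) : mapFam A (f.comp g) y = mapFam A f (mapFam A g y) := by
  funext W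
  by_cases hW : W.Valid m
  · refine sT_ext fun M _ _ Φ => ?_
    refine (famEv_mapFam (f.comp g) y hW Φ).trans
      (Eq.trans ?_ (famEv_mapFam f (mapFam A g y) hW Φ).symm)
    simp only [Ev.bind_val]
    rw [lsum_congr fun Q hQ => famEv_mapFam g y (valid_of_hat_gaps f hW hQ) (runL Q.2 Φ)]
    rw [show (f.comp g).ext = fun i => g.ext (f.ext i) from funext (f.ext_comp g)]
    have := lsum_hat_hat (A := A) (M := M) f.ext_mono g.ext W (fun b hb => (hW.1 b hb).1) 0
      fun U R => open Classical in if h : IsMultilinear (R a b Φ.1) then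
        (famEv y M).val U ⟨R a b Φ.1, h⟩ else 0
    rw [f.ext_zero] at this
    refine Eq.trans ?_ (this.symm.trans ?_)
    · refine lsum_congr fun R _ => ?_
      rw [dif_pos (run_isMultilinear (o := fun x => x) R.2 Φ.1 Φ.2)]
      rfl
    · refine lsum_congr fun Q _ => ?_
      rw [Ev.bind_val]
      refine lsum_congr fun R _ => ?_
      rw [dif_pos (run_isMultilinear (o := fun x => x) R.2 _
        (run_isMultilinear (o := fun x => x) Q.2 Φ.1 Φ.2))]
      rfl
  · rw [mapFam_of_not_valid _ _ hW, mapFam_of_not_valid _ _ hW]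

variable (f : AInftyFunctor A B)

/-- Functors and the insertion of identities. -/
theorem lsum_hat_cut {a b : A.Ob} (E : Ev A.Hom a b M) (X₀ X₁ : Beads)
    (L₀ L₁ : List (Step A.Hom B.Hom f.obj)) (Φ : Mult B.Hom (f.obj a) (f.obj b) M)
    (hL : width L₀ = X₀.length) {β : Bead} (hβ : β ≠ []) :
    (lsum (((hatExpn A).comp (cutExpn f.barOp)).terms β) fun p =>
      E.val (X₀ ++ (p.1 ++ X₁)) (runL (L₀ ++ p.2 :: L₁) Φ)) =
      lsum (((cutExpn f.barOp).comp (hatExpn B)).terms β) fun p =>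
        E.val (X₀ ++ (p.1 ++ X₁)) (runL (L₀ ++ p.2 :: L₁) Φ) := by
  have hl : (lsum (((hatExpn A).comp (cutExpn f.barOp)).terms β) fun p =>
      E.val (X₀ ++ (p.1 ++ X₁)) (runL (L₀ ++ p.2 :: L₁) Φ)) = lsum (cuts β) fun S =>
      lsum ((hatExpn A).choices S) fun Q => E.val (X₀ ++ (Q.1 ++ X₁))
        (slotL L₀ L₁ Q.1.length β.dim Φ ⟨fun x y c => run (o := fun x => x) Q.2
          (fun v => (f.barOp β.dim).1 x y v) c,
        fun x y => run_isMultilinear (o := fun x => x) _ _ ((f.barOp β.dim).2 x y)⟩) := by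
    simp only [cutExpn, Expn.comp, lsum_map, lsum_flatMap]
    refine lsum_congr fun S _ => lsum_congr fun Q hQ => ?_
    rw [slotL_apply, ← ((hatExpn A).choices_spec hQ).2.1]
    rfl
  have hr : (lsum (((cutExpn f.barOp).comp (hatExpn B)).terms β) fun p =>
      E.val (X₀ ++ (p.1 ++ X₁)) (runL (L₀ ++ p.2 :: L₁) Φ)) =
      lsum ((hatExpn B).terms β) fun p => lsum ((cutExpn f.barOp).choices p.1) fun q =>
        E.val (X₀ ++ (q.1 ++ X₁)) (slotL L₀ L₁ q.1.length p.2.d Φ ⟨fun x y c => run q.2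
          (fun v => p.2.F.1 (f.obj x) (f.obj y) v) c,
          fun x y => run_isMultilinear _ _ (p.2.F.2 _ _)⟩) := by
    simp only [Expn.comp, lsum_map, lsum_flatMap]
    refine lsum_congr fun p _ => lsum_congr fun q hq => ?_
    rw [slotL_apply, ← ((cutExpn f.barOp).choices_spec hq).2.1]
    rfl
  rw [hl, hr]
  clear hl hr
  by_cases h0 : 0 ∈ β
  · by_cases h1 : β = [0]
    · subst h1
      rw [hatExpn_unit]
      have hc : cuts [0] = [[[0]]] := rfl
      simp only [hc, lsum_cons, lsum_nil, add_zero, Expn.choices, hatExpn_unit, List.flatMap_cons,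
        List.flatMap_nil, List.map_cons, List.map_nil, List.append_nil]
      refine slotL_congr E X₀ [] X₁ L₀ L₁ 0 Φ _ _ hL fun x y q hq => ?_
      cases q with
      | nil => exact f.bar_one x
      | cons => simp at hq
    · rw [hatExpn_bad h0 h1]
      refine lsum_eq_zero fun S hS => lsum_hat_choices_zero
        (by rwa [(flatten_of_mem_cuts hS).1]) _ fun hS0 Q hQ => ?_
      refine (slotL_congr E X₀ Q.1 X₁ L₀ L₁ β.dim Φ _ 0 hL fun x y q hq => ?_).trans ?_
      · refine run_hat_unit hS0 hQ _ (fun z p t hl => f.bar_unit p t _ ?_) q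
        by_contra hlt
        obtain ⟨s, rfl⟩ := List.length_eq_one_iff.mp (show S.length = 1 by omega)
        rw [List.mem_singleton] at hS0
        rw [← hS0] at hS
        exact h1 (flatten_of_mem_cuts hS).1.symm
      · rw [map_zero, map_zero]
  · rw [hatExpn_pos h0]
    simp only [lsum_cons, lsum_nil, add_zero]
    have hc : (cutExpn f.barOp).choices [β] = (cuts β).map fun S =>
        (S, [⟨S.length, β.dim, f.barOp β.dim⟩]) := by
      simp [Expn.choices, cutExpn, ← List.map_eq_flatMap, Function.comp_def]
    rw [hc, lsum_map]
    refine lsum_congr fun S hS => ?_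
    have hpos : ∀ b ∈ S, 0 ∉ b := fun b hb hb0 =>
      h0 ((flatten_of_mem_cuts hS).1 ▸ List.mem_flatten.mpr ⟨b, hb, hb0⟩)
    rw [hatExpn_choices_pos hpos, lsum_cons, lsum_nil, add_zero]
    refine slotL_congr E X₀ S X₁ L₀ L₁ β.dim Φ _ _ hL fun x y q hq => ?_
    refine (run_entryOp S (fun v => (f.barOp β.dim).1 x y v) q hq).trans ?_
    show _ = run (⟨S.length, β.dim, f.barOp β.dim⟩ :: [])
      (fun v => (entryOp (H := B.Hom) β.dim).1 (f.obj x) (f.obj y) v) q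
    rw [run_cons, cutAt_len q _ (len_of_degs hq).symm]
    exact (entry_single _ _).symm

theorem step_gaps {O O' : Type u} {H : O → O → ℤ → ModuleCat.{u} K}
    {H' : O' → O' → ℤ → ModuleCat.{u} K} {o : O → O'} (F : ∀ d, Op H H' o d) (φ : ℕ → ℕ) (p : ℕ)
    (β : Bead) (S : Beads) :
    (⟨(gaps φ p S).length, (gap φ p β).dim, F _⟩ : Step H H' o) = ⟨S.length, β.dim, F _⟩ := by
  rw [gaps_length, gap_dim]

theorem lsum_cut_gaps {O O' : Type u} {H : O → O → ℤ → ModuleCat.{u} K}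
    {H' : O' → O' → ℤ → ModuleCat.{u} K} {o : O → O'} {N : Type*} [AddCommGroup N]
    (F : ∀ d, Op H H' o d) (φ : ℕ → ℕ) (p : ℕ) (W : Beads)
    (κ : Beads × List (Step H H' o) → N) :
    lsum ((cutExpn F).choices (gaps φ p W)) κ =
      lsum ((cutExpn F).choices W) fun Q => κ (gaps φ p Q.1, Q.2) := by
  induction W generalizing p κ with
  | nil => rfl
  | cons β W ih =>
    rw [gaps, Expn.lsum_choices_cons, Expn.lsum_choices_cons]
    simp only [ih]
    simp only [cutExpn, lsum_map]
    refine (lsum_cuts_gap φ p β _).trans (lsum_congr fun S hS => ?_)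
    refine lsum_congr fun Q _ => ?_
    rw [step_gaps F φ p β, gaps_append, (flatten_of_mem_cuts hS).1]

theorem push_mapFam {m n : ℕ} (h : FInt m n) {a b : A.Ob} (y : Nerve.Fam A a b) {W : Beads}
    (hW : W.Valid m) : Nerve.push f (mapFam A h y) W = mapFam B h (Nerve.push f y) W := by
  refine sT_ext (x := f.obj a) (y := f.obj b) fun M _ _ Φ => ?_
  refine (mlift_push f (mapFam A h y) W Φ).trans
    (Eq.trans ?_ (famEv_mapFam h (Nerve.push f y) hW Φ).symm)
  have hne : ∀ b ∈ gaps h.ext 0 W, b ≠ [] := ne_nil_of_mem_gaps fun b hb => (hW.1 b hb).1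
  rw [famEv_push, Ev.bind_bind, ← Ev.bind_congr (o := f.obj) _ ((hatExpn A).comp (cutExpn f.barOp))
    ((cutExpn f.barOp).comp (hatExpn B)) _ (fun β hβ X₀ X₁ L₀ L₁ Φ h0 _ =>
      lsum_hat_cut f _ X₀ X₁ L₀ L₁ Φ h0 (hne β hβ)) Φ, ← Ev.bind_bind, Ev.bind_val, Ev.bind_val,
    lsum_cut_gaps]
  exact lsum_congr fun Q hQ => famEv_mapFam h y (valid_choices hW f.barOp hQ) _

end MapFunctor

section ValidLists

theorem mem_cuts_flatten {α : Type*} {W : List (List α)} (h : ∀ b ∈ W, b ≠ []) :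
    W ∈ cuts W.flatten := by
  induction W with
  | nil => simp [cuts]
  | cons b W ih =>
    have ih := ih fun b hb => h b (by simp [hb])
    have hb := h b (by simp)
    induction b with
    | nil => exact absurd rfl hb
    | cons g b ihb =>
      rw [List.flatten_cons, List.cons_append, cuts, List.mem_flatMap]
      cases b with
      | nil =>
        refine ⟨W, ih, ?_⟩
        cases W <;> simp
      | cons k b =>
        refine ⟨(k :: b) :: W, ?_, by simp⟩
        refine ihb (fun c hc => ?_) (by simp)
        rcases List.mem_cons.mp hc with rfl | hc
        · simp
        · exact h c (by simp [hc])

theorem finite_compositions (n : ℕ) : {l : List ℕ | (∀ g ∈ l, 0 < g) ∧ l.sum = n}.Finite := by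
  induction n using Nat.strong_induction_on with
  | _ n ih =>
    refine Set.Finite.subset (s := {[]} ∪ ⋃ g : Fin n, List.cons (n - g) ''
      {l : List ℕ | (∀ g ∈ l, 0 < g) ∧ l.sum = (g : ℕ)}) ?_ ?_
    · exact (Set.finite_singleton _).union (Set.finite_iUnion fun g => (ih g g.2).image _)
    · rintro (_ | ⟨g, l⟩) ⟨h1, h2⟩
      · exact Or.inl rfl
      · have hg := h1 g (by simp)
        rw [List.sum_cons] at h2
        refine Or.inr (Set.mem_iUnion.mpr ⟨⟨l.sum, by omega⟩, l,
          ⟨fun g hg => h1 g (by simp [hg]), rfl⟩, ?_⟩)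
        show (n - l.sum) :: l = g :: l
        congr 1
        omega

theorem finite_valid (n : ℕ) : {W : Beads | W.Valid n}.Finite := by
  refine ((finite_compositions n).biUnion (t := fun l => {W | W ∈ cuts l})
    fun l _ => List.finite_toSet _).subset fun W hW => ?_
  refine Set.mem_biUnion (x := W.flatten) ⟨fun g hg => ?_, hW.2⟩
    (mem_cuts_flatten fun b hb => (hW.1 b hb).1)
  obtain ⟨b, hb, hg⟩ := List.mem_flatten.mp hg
  exact (hW.1 b hb).2 g hg

/-- The injective necklace maps to `Δⁿ`. -/
def validBeads (n : ℕ) : Finset Beads := (finite_valid n).toFinset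

theorem mem_validBeads {n : ℕ} {W : Beads} : W ∈ validBeads n ↔ W.Valid n :=
  (finite_valid n).mem_toFinset

end ValidLists

section Slices

set_option linter.unusedSectionVars false

variable {K : Type u} [Field K] {O O' : Type u} {o : O → O'}
variable {P Q P' Q' : KQuiver K O} {a b : O}

open Classical in
/-- The component of index `c` of a tensor product of quivers. -/
def qcomp (c : O) : qtensor P Q a b →ₗ[K] P a c ⊗[K] Q c b :=
  DirectSum.component K O (fun c => P a c ⊗[K] Q c b) c

theorem qcomp_tmul (c : O) (x : P a c) (y : Q c b) :
    qcomp c (qtmul (P := P) c x y) = x ⊗ₜ[K] y := by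
  classical
  exact DirectSum.component.lof_self (M := fun c => P a c ⊗[K] Q c b) K c (x ⊗ₜ[K] y)

theorem qcomp_tmul_of_ne {c c' : O} (h : c' ≠ c) (x : P a c') (y : Q c' b) :
    qcomp c (qtmul (P := P) c' x y) = 0 := by
  classical
  exact (DirectSum.component.of (M := fun c => P a c ⊗[K] Q c b) K c c' (x ⊗ₜ[K] y)).trans
    (dif_neg h)

/-- The slice of a tensor along a linear form on the second factor. -/
def sliceR (c : O) (l : Q c b →ₗ[K] K) : qtensor P Q a b →ₗ[K] P a c :=
  (TensorProduct.rid K (P a c)).toLinearMap ∘ₗ LinearMap.lTensor (P a c) l ∘ₗ qcomp c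

/-- The slice of a tensor along a linear form on the first factor. -/
def sliceL (c : O) (l : P a c →ₗ[K] K) : qtensor P Q a b →ₗ[K] Q c b :=
  (TensorProduct.lid K (Q c b)).toLinearMap ∘ₗ LinearMap.rTensor (Q c b) l ∘ₗ qcomp c

theorem sliceR_tmul (c : O) (l : Q c b →ₗ[K] K) (x : P a c) (y : Q c b) :
    sliceR (P := P) c l (qtmul c x y) = l y • x := by
  rw [sliceR, LinearMap.comp_apply, LinearMap.comp_apply, qcomp_tmul]
  simp

theorem sliceR_tmul_of_ne {c c' : O} (h : c' ≠ c) (l : Q c b →ₗ[K] K) (x : P a c') (y : Q c' b) :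
    sliceR (P := P) c l (qtmul c' x y) = 0 := by
  rw [sliceR, LinearMap.comp_apply, LinearMap.comp_apply, qcomp_tmul_of_ne h, map_zero, map_zero]

theorem sliceL_tmul (c : O) (l : P a c →ₗ[K] K) (x : P a c) (y : Q c b) :
    sliceL (Q := Q) c l (qtmul c x y) = l x • y := by
  rw [sliceL, LinearMap.comp_apply, LinearMap.comp_apply, qcomp_tmul]
  simp

theorem sliceL_tmul_of_ne {c c' : O} (h : c' ≠ c) (l : P a c →ₗ[K] K) (x : P a c') (y : Q c' b) :
    sliceL (Q := Q) c l (qtmul c' x y) = 0 := by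
  rw [sliceL, LinearMap.comp_apply, LinearMap.comp_apply, qcomp_tmul_of_ne h, map_zero, map_zero]

theorem sliceR_qmap (φ : QHom (fun x => x) P P') (c : O) (l : Q c b →ₗ[K] K)
    (t : qtensor P Q a b) :
    sliceR c l (qmap φ (qid Q) a b t) = φ a c (sliceR c l t) := by
  refine LinearMap.congr_fun (f := sliceR c l ∘ₗ qmap φ (qid Q) a b)
    (g := φ a c ∘ₗ sliceR c l) (q_ext fun c' x y => ?_) t
  refine (congrArg (sliceR c l) (qmap_tmul φ (qid Q) a b c' x y)).trans ?_
  rw [LinearMap.comp_apply]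
  by_cases h : c' = c
  · subst h
    refine (sliceR_tmul _ _ _ _).trans ?_
    rw [sliceR_tmul, map_smul]
    rfl
  · refine (sliceR_tmul_of_ne h _ _ _).trans ?_
    rw [sliceR_tmul_of_ne h, map_zero]

theorem sliceL_qmap (ψ : QHom (fun x => x) Q Q') (c : O) (l : P a c →ₗ[K] K)
    (t : qtensor P Q a b) :
    sliceL c l (qmap (qid P) ψ a b t) = ψ c b (sliceL c l t) := by
  refine LinearMap.congr_fun (f := sliceL c l ∘ₗ qmap (qid P) ψ a b)
    (g := ψ c b ∘ₗ sliceL c l) (q_ext fun c' x y => ?_) t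
  refine (congrArg (sliceL c l) (qmap_tmul (qid P) ψ a b c' x y)).trans ?_
  rw [LinearMap.comp_apply]
  by_cases h : c' = c
  · subst h
    refine (sliceL_tmul _ _ _ _).trans ?_
    rw [sliceL_tmul, map_smul]
    rfl
  · refine (sliceL_tmul_of_ne h _ _ _).trans ?_
    rw [sliceL_tmul_of_ne h, map_zero]

theorem ext_sliceR {t t' : qtensor P Q a b}
    (h : ∀ c (l : Q c b →ₗ[K] K), sliceR (P := P) c l t = sliceR c l t') : t = t' := by
  classical
  refine DirectSum.ext_component K fun c => ?_
  let 𝒞 := Module.Basis.ofVectorSpace K (Q c b)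
  refine (TensorProduct.equivFinsuppOfBasisRight (M := P a c) 𝒞).injective (Finsupp.ext fun i => ?_)
  have key : ∀ s : P a c ⊗[K] Q c b, TensorProduct.equivFinsuppOfBasisRight (M := P a c) 𝒞 s i =
      TensorProduct.rid K (P a c) (LinearMap.lTensor (P a c) (𝒞.coord i) s) := by
    intro s
    induction s with
    | zero => simp
    | tmul m n => simp
    | add s s' hs hs' => rw [map_add, Finsupp.add_apply, hs, hs', map_add, map_add]
  rw [key, key]
  exact h c (𝒞.coord i)

theorem ext_sliceL {t t' : qtensor P Q a b}
    (h : ∀ c (l : P a c →ₗ[K] K), sliceL (Q := Q) c l t = sliceL c l t') : t = t' := by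
  classical
  refine DirectSum.ext_component K fun c => ?_
  let 𝒞 := Module.Basis.ofVectorSpace K (P a c)
  refine (TensorProduct.equivFinsuppOfBasisLeft (N := Q c b) 𝒞).injective (Finsupp.ext fun i => ?_)
  have key : ∀ s : P a c ⊗[K] Q c b, TensorProduct.equivFinsuppOfBasisLeft (N := Q c b) 𝒞 s i =
      TensorProduct.lid K (Q c b) (LinearMap.rTensor (Q c b) (𝒞.coord i) s) := by
    intro s
    induction s with
    | zero => simp
    | tmul m n => simp
    | add s s' hs hs' => rw [map_add, Finsupp.add_apply, hs, hs', map_add, map_add]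
  rw [key, key]
  exact h c (𝒞.coord i)

/-- A family of morphisms from which an element can be recovered. -/
def Resolves {ι : Type*} (s : Finset ι) {R : ι → KQuiver K O}
    (φ : ∀ i, QHom (fun x => x) P (R i)) : Prop :=
  ∃ e : ∀ i, QHom (fun x => x) (R i) P, ∀ a b (x : P a b), ∑ i ∈ s, e i a b (φ i a b x) = x

theorem Resolves.ext {ι : Type*} {s : Finset ι} {R : ι → KQuiver K O}
    {φ : ∀ i, QHom (fun x => x) P (R i)} (h : Resolves s φ) {x y : P a b}
    (e : ∀ i ∈ s, φ i a b x = φ i a b y) : x = y := by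
  obtain ⟨p, hp⟩ := h
  rw [← hp a b x, ← hp a b y]
  exact Finset.sum_congr rfl fun i hi => by rw [e i hi]

theorem Resolves.id (P : KQuiver K O) :
    Resolves {()} (fun _ : Unit => qid P) := ⟨fun _ => qid P, fun a b x => by simp⟩

theorem qmap_qmap {P'' Q'' : KQuiver K O} (φ : QHom (fun x => x) P P') (ψ : QHom (fun x => x) Q Q')
    (φ' : QHom (fun x => x) P' P'') (ψ' : QHom (fun x => x) Q' Q'') (t : qtensor P Q a b) :
    qmap φ' ψ' a b (qmap φ ψ a b t) =
      qmap (o := fun x => x) (fun a b => φ' a b ∘ₗ φ a b) (fun a b => ψ' a b ∘ₗ ψ a b) a b t :=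
  (TempVect.qmap_comp φ ψ φ' ψ' a b t).symm

theorem Resolves.qmap {ι κ : Type*} {s : Finset ι} {t : Finset κ} {R : ι → KQuiver K O}
    {S : κ → KQuiver K O} {φ : ∀ i, QHom (fun x => x) P (R i)}
    {ψ : ∀ i, QHom (fun x => x) Q (S i)} (hφ : Resolves s φ) (hψ : Resolves t ψ) :
    Resolves (s ×ˢ t) fun i : ι × κ => AInf.qmap (φ i.1) (ψ i.2) := by
  obtain ⟨e, he⟩ := hφ
  obtain ⟨e', he'⟩ := hψ
  refine ⟨fun i => AInf.qmap (e i.1) (e' i.2), fun a b x => ?_⟩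
  have : ∑ i ∈ s ×ˢ t, AInf.qmap (e i.1) (e' i.2) a b ∘ₗ AInf.qmap (φ i.1) (ψ i.2) a b =
      LinearMap.id := q_ext fun c x y => by
    rw [LinearMap.sum_apply, Finset.sum_product]
    refine (Finset.sum_congr rfl fun i _ => Finset.sum_congr rfl fun j _ =>
      (congrArg (AInf.qmap (e i) (e' j) a b) (qmap_tmul _ _ _ _ _ _ _)).trans
        (qmap_tmul _ _ _ _ _ _ _)).trans ?_
    have key : ∀ (X : ι → P a c) (Y : κ → Q c b), ∑ i ∈ s, ∑ j ∈ t, qtmul (P := P) c (X i) (Y j) =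
        qtmul c (∑ i ∈ s, X i) (∑ j ∈ t, Y j) := fun X Y => by
      rw [map_sum (qtmul (P := P) c) X s, LinearMap.sum_apply]
      exact Finset.sum_congr rfl fun i _ => (map_sum (qtmul (P := P) c (X i)) Y t).symm
    refine (key (fun i => e i a c (φ i a c x)) fun j => e' j c b (ψ j c b y)).trans ?_
    rw [he, he']
    rfl
  have := LinearMap.congr_fun this x
  rwa [LinearMap.sum_apply] at this

end Slices

section Pairs

set_option linter.unusedSectionVars false

open Chain

variable {K : Type u} [Field K] {O : Type u} {H : O → O → ℤ → ModuleCat.{u} K}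
variable {M M₁ M₂ : Type u} [AddCommGroup M] [Module K M] [AddCommGroup M₁] [Module K M₁]
variable [AddCommGroup M₂] [Module K M₂] {a b c : O}

/-- The multilinear functions `B (m, Ψ)` for `m` in a vector space. -/
def Mult.mapL (B : M₁ →ₗ[K] M₂ →ₗ[K] M) (Ψ : Mult H c b M₂) : M₁ →ₗ[K] Mult H c b M where
  toFun m := Mult.map (B m) Ψ
  map_add' m m' := Subtype.ext (funext fun v => by
    show B (m + m') (Ψ.1 v) = _
    rw [map_add]
    rfl)
  map_smul' k m := Subtype.ext (funext fun v => by
    show B (k • m) (Ψ.1 v) = _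
    rw [map_smul]
    rfl)

open Classical in
/-- The product of two multilinear functions of chains which meet at the object `c`. -/
def pairM (B : M₁ →ₗ[K] M₂ →ₗ[K] M) (Φ : Mult H a c M₁) (Ψ : Mult H c b M₂) (z : O) :
    Mult H a z (Mult H z b M) :=
  if h : z = c then h ▸ Mult.map (Mult.mapL B Ψ) Φ else 0

theorem pairM_self (B : M₁ →ₗ[K] M₂ →ₗ[K] M) (Φ : Mult H a c M₁) (Ψ : Mult H c b M₂) :
    pairM B Φ Ψ c = Mult.map (Mult.mapL B Ψ) Φ := by
  rw [pairM, dif_pos rfl]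

theorem pairM_of_ne (B : M₁ →ₗ[K] M₂ →ₗ[K] M) (Φ : Mult H a c M₁) (Ψ : Mult H c b M₂) {z : O}
    (h : z ≠ c) : pairM B Φ Ψ z = 0 := by
  rw [pairM, dif_neg h]

theorem mlift₂_pairM (U V : Beads) (B : M₁ →ₗ[K] M₂ →ₗ[K] M) (Φ : Mult H a c M₁)
    (Ψ : Mult H c b M₂) (s : sT H U a c) (t : sT H V c b) :
    mlift₂ U V (pairM B Φ Ψ) (qtmul c s t) = B (mlift U a c Φ s) (mlift V c b Ψ t) := by
  rw [mlift₂_tmul, pairM_self, ← mlift_map]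
  exact (mlift_map (B (mlift U a c Φ s)) V Ψ t).symm

theorem mlift₂_pairM_of_ne (U V : Beads) (B : M₁ →ₗ[K] M₂ →ₗ[K] M) (Φ : Mult H a c M₁)
    (Ψ : Mult H c b M₂) {z : O} (h : z ≠ c) (s : sT H U a z) (t : sT H V z b) :
    mlift₂ U V (pairM B Φ Ψ) (qtmul z s t) = 0 := by
  rw [mlift₂_tmul, pairM_of_ne B Φ Ψ h, map_zero, LinearMap.zero_apply, map_zero,
    LinearMap.zero_apply]

theorem mlift_sliceR (U V : Beads) (Φ : Mult H a c M) (Λ : Mult H c b K)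
    (t : qtensor (sT H U) (sT H V) a b) :
    mlift U a c Φ (sliceR c (mlift V c b Λ) t) =
      mlift₂ U V (pairM (LinearMap.lsmul K M).flip Φ Λ) t := by
  refine LinearMap.congr_fun (f := mlift U a c Φ ∘ₗ sliceR c (mlift V c b Λ))
    (g := mlift₂ U V (pairM (LinearMap.lsmul K M).flip Φ Λ)) (q_ext fun z s t => ?_) t
  by_cases h : z = c
  · subst h
    refine (congrArg (mlift U a z Φ) (sliceR_tmul z _ s t)).trans
      (Eq.trans ?_ (mlift₂_pairM U V _ Φ Λ s t).symm)
    rw [map_smul]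
    rfl
  · refine (congrArg (mlift U a c Φ) (sliceR_tmul_of_ne h _ s t)).trans
      (Eq.trans (map_zero _) (mlift₂_pairM_of_ne U V _ Φ Λ h s t).symm)

theorem mlift_sliceL (U V : Beads) (Φ : Mult H c b M) (Λ : Mult H a c K)
    (t : qtensor (sT H U) (sT H V) a b) :
    mlift V c b Φ (sliceL c (mlift U a c Λ) t) =
      mlift₂ U V (pairM (LinearMap.lsmul K M) Λ Φ) t := by
  refine LinearMap.congr_fun (f := mlift V c b Φ ∘ₗ sliceL c (mlift U a c Λ))
    (g := mlift₂ U V (pairM (LinearMap.lsmul K M) Λ Φ)) (q_ext fun z s t => ?_) t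
  by_cases h : z = c
  · subst h
    refine (congrArg (mlift V z b Φ) (sliceL_tmul z _ s t)).trans
      (Eq.trans ?_ (mlift₂_pairM U V _ Λ Φ s t).symm)
    rw [map_smul]
    rfl
  · refine (congrArg (mlift V c b Φ) (sliceL_tmul_of_ne h _ s t)).trans
      (Eq.trans (map_zero _) (mlift₂_pairM_of_ne U V _ Λ Φ h s t).symm)

theorem exists_mlift_eq {W : Beads} {x y : O} (l : sT H W x y →ₗ[K] M) :
    ∃ Λ : Mult H x y M, mlift W x y Λ = l := by
  obtain ⟨p, hp⟩ := (isPairing_mlift (H := H) W y).exists_id x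
  refine ⟨Mult.map l p, LinearMap.ext fun t => ?_⟩
  exact (mlift_map l W p t).symm.trans (congrArg l (LinearMap.congr_fun hp t))

theorem mlift₂_ext {U V : Beads} {t t' : qtensor (sT H U) (sT H V) a b}
    (h : ∀ (M : Type u) [AddCommGroup M] [Module K M] (Ψ : ∀ z, Mult H a z (Mult H z b M)),
      mlift₂ U V Ψ t = mlift₂ U V Ψ t') : t = t' := by
  refine ext_sliceR fun c l => sT_ext fun M _ _ Φ => ?_
  obtain ⟨Λ, rfl⟩ := exists_mlift_eq l
  rw [mlift_sliceR, mlift_sliceR, h]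

theorem insL_map (L : M →ₗ[K] M₁) (k l : ℕ) {d : ℤ} (β : Op H H (fun x => x) d) (Φ : Mult H a b M) :
    insL k l β (Mult.map L Φ) = Mult.map L (insL k l β Φ) := by
  refine Subtype.ext (funext fun v => ?_)
  show ins k l β (fun v => L (Φ.1 v)) v = L (ins k l β Φ.1 v)
  rw [ins, ins, cutAt_map]
  congr 1
  funext z p r
  rw [cutAt_map]

theorem insL_pairM (B : M₁ →ₗ[K] M₂ →ₗ[K] M) (k l : ℕ) {d : ℤ} (β : Op H H (fun x => x) d)
    (Φ : Mult H a c M₁) (Ψ : Mult H c b M₂) (z : O) :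
    pairM B (insL k l β Φ) Ψ z = insL k l β (pairM B Φ Ψ z) := by
  by_cases h : z = c
  · subst h
    rw [pairM_self, pairM_self, insL_map]
  · rw [pairM_of_ne _ _ _ h, pairM_of_ne _ _ _ h, map_zero]

theorem pairM_insL (B : M₁ →ₗ[K] M₂ →ₗ[K] M) (k l : ℕ) {d : ℤ} (β : Op H H (fun x => x) d)
    (Φ : Mult H a c M₁) (Ψ : Mult H c b M₂) (z : O) :
    pairM B Φ (insL k l β Ψ) z = Mult.map (insL k l β) (pairM B Φ Ψ z) := by
  by_cases h : z = c
  · subst h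
    rw [pairM_self, pairM_self]
    exact Subtype.ext (funext fun v => (insL_map (B (Φ.1 v)) k l β Ψ).symm)
  · rw [pairM_of_ne _ _ _ h, pairM_of_ne _ _ _ h]
    exact Subtype.ext (funext fun v => (map_zero (insL k l β)).symm)

theorem cutL_insL (pre S post V : Beads) {d : ℤ} (β : Op H H (fun x => x) d)
    (Ψ : ∀ z, Mult H a z (Mult H z b M)) {v : Chain H a b}
    (hv : v.degs = (pre ++ (S ++ (post ++ V))).map Bead.dim) :
    (cutL (pre ++ (S ++ post)).length fun z => insL pre.length S.length β (Ψ z)).1 v =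
      (insL pre.length S.length β (cutL (pre.length + 1 + post.length) Ψ)).1 v := by
  rw [List.map_append] at hv
  obtain ⟨z, p, r, rfl, hp, hr⟩ := degs_split v _ _ hv
  rw [List.map_append] at hr
  obtain ⟨w, q, r, rfl, hq, hr⟩ := degs_split r _ _ hr
  rw [List.map_append] at hr
  obtain ⟨x, s, t, rfl, hs, ht⟩ := degs_split r _ _ hr
  have hp := len_of_degs hp
  have hq := len_of_degs hq
  have hs := len_of_degs hs
  show cutAt _ (p.append (q.append (s.append t))) (fun z p q =>
      (ins pre.length S.length β (Ψ z).1 p).1 q) =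
    ins pre.length S.length β (fun c => cutAt _ c fun z p q => ((Ψ z).1 p).1 q) _
  rw [ins, cutAt_append' _ _ _ hp.symm, cutAt_append' _ _ _ hq.symm, ← append_assoc q,
    ← append_assoc p, cutAt_append' _ _ _ (by simp [hp, hq, hs]), ins,
    cutAt_append' _ _ _ hp.symm, cutAt_append' _ _ _ hq.symm,
    ← cons_append, ← append_assoc p, cutAt_append' _ _ _ (by simp [hp, hs]; omega)]

theorem cutL_map_insL (U pre S post : Beads) {d : ℤ} (β : Op H H (fun x => x) d)
    (Ψ : ∀ z, Mult H a z (Mult H z b M)) {v : Chain H a b}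
    (hv : v.degs = (U ++ (pre ++ (S ++ post))).map Bead.dim) :
    (cutL U.length fun z => Mult.map (insL pre.length S.length β) (Ψ z)).1 v =
      (insL (U ++ pre).length S.length β (cutL U.length Ψ)).1 v := by
  rw [List.map_append] at hv
  obtain ⟨z, p, r, rfl, hp, hr⟩ := degs_split v _ _ hv
  rw [List.map_append] at hr
  obtain ⟨w, q, r, rfl, hq, hr⟩ := degs_split r _ _ hr
  rw [List.map_append] at hr
  obtain ⟨x, s, t, rfl, hs, ht⟩ := degs_split r _ _ hr
  have hp := len_of_degs hp
  have hq := len_of_degs hq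
  have hs := len_of_degs hs
  show cutAt _ (p.append (q.append (s.append t))) (fun z p r =>
      ins pre.length S.length β ((Ψ z).1 p).1 r) =
    ins (U ++ pre).length S.length β (fun c => cutAt _ c fun z p q => ((Ψ z).1 p).1 q) _
  rw [cutAt_append' _ _ _ hp.symm, ins, ins, cutAt_append' _ _ _ hq.symm,
    cutAt_append' _ _ _ hs.symm, ← append_assoc p, cutAt_append' _ _ _ (by simp [hp, hq]),
    cutAt_append' _ _ _ hs.symm, append_assoc p, cutAt_append' _ _ _ hp.symm]

theorem valid_subst {n : ℕ} {pre : Beads} {β : Bead} {post : Beads}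
    (hv : Beads.Valid n (pre ++ β :: post)) : (∀ g ∈ β, 0 < g) ∧
      (∀ S ∈ cuts β, Beads.Valid n (pre ++ (S ++ post))) ∧
      ∀ γ : Bead, γ ≠ [] → (∀ g ∈ γ, 0 < g) → γ.sum = β.sum →
        Beads.Valid n (pre ++ γ :: post) := by
  obtain ⟨n₀, n', rfl, v0, hv'⟩ := valid_append.mp hv
  obtain ⟨n₁, n₂, rfl, v1, v2⟩ := valid_append (U := [β]).mp hv'
  have hpos := (v1.1 β (by simp)).2
  have hsum : β.sum = n₁ := by simpa using v1.2
  refine ⟨hpos, fun S hS => ?_, fun γ h1 h2 h3 => ?_⟩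
  · exact valid_append.mpr ⟨_, _, rfl, v0, valid_append.mpr ⟨_, _, rfl,
      valid_cuts hS hpos hsum, v2⟩⟩
  · refine valid_append.mpr ⟨_, _, rfl, v0, valid_append (U := [γ]).mpr ⟨_, _, rfl,
      ⟨fun b hb => ?_, by simp [h3, hsum]⟩, v2⟩⟩
    rw [List.mem_singleton.mp hb]
    exact ⟨h1, h2⟩

theorem Rel.sliceR {m : ∀ d, Op H H (fun x => x) d} {E : Ev H a b M} {E' : Ev H a c M} {n : ℕ}
    {pre : Beads} {β : Bead} {post V : Beads} (hv : Beads.Valid n (pre ++ β :: post))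
    (B : M →ₗ[K] M₂ →ₗ[K] M) (Λ : Mult H c b M₂) (h : ∀ W : Beads, W.Valid n → ∀ Φ,
      E'.val W Φ = E.val (W ++ V) (cutL W.length (pairM B Φ Λ)))
    (hR : Rel m E pre β (post ++ V)) : Rel m E' pre β post := by
  intro Φ
  obtain ⟨hpos, h1, h2⟩ := valid_subst hv
  refine Eq.trans ?_ ((hR (cutL (pre.length + 1 + post.length) (pairM B Φ Λ))).trans ?_)
  · refine lsum_congr fun S hS => ?_
    rw [h _ (h1 S hS), List.append_assoc, List.append_assoc]
    refine E.congr _ _ _ fun v hv => ?_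
    rw [show pairM B (insL pre.length S.length (m (β.length - 2)) Φ) Λ = _ from
      funext (insL_pairM B _ _ _ Φ Λ)]
    exact cutL_insL pre S post V _ _ hv
  · refine mergeSum_congr_pos hpos fun γ _ g1 g2 g3 => ?_
    rw [h _ (h2 γ g1 g2 g3), List.append_assoc, List.cons_append]
    congr 2
    simp
    omega

theorem Rel.sliceL {m : ∀ d, Op H H (fun x => x) d} {E : Ev H a b M} {E' : Ev H c b M} {n : ℕ}
    {U pre : Beads} {β : Bead} {post : Beads} (hv : Beads.Valid n (pre ++ β :: post))
    (B : M₁ →ₗ[K] M →ₗ[K] M) (Λ : Mult H a c M₁) (h : ∀ W : Beads, W.Valid n → ∀ Φ,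
      E'.val W Φ = E.val (U ++ W) (cutL U.length (pairM B Λ Φ)))
    (hR : Rel m E (U ++ pre) β post) : Rel m E' pre β post := by
  intro Φ
  obtain ⟨hpos, h1, h2⟩ := valid_subst hv
  refine Eq.trans ?_ ((hR (cutL U.length (pairM B Λ Φ))).trans ?_)
  · refine lsum_congr fun S hS => ?_
    rw [h _ (h1 S hS), List.append_assoc]
    refine E.congr _ _ _ fun v hv => ?_
    rw [show pairM B Λ (insL pre.length S.length (m (β.length - 2)) Φ) = _ from
      funext (pairM_insL B _ _ _ Λ Φ)]
    exact cutL_map_insL U pre S post _ _ hv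
  · refine mergeSum_congr_pos hpos fun γ _ g1 g2 g3 => ?_
    rw [h _ (h2 γ g1 g2 g3), List.append_assoc]

end Pairs

section Comultiplication

set_option linter.unusedSectionVars false

open Chain Nerve

variable {K : Type u} [Field K] (A : AInftyCat K)

/-- A linear retraction of the nerve in the space of all collections. -/
def retract (n : ℕ) (a b : A.Ob) : Fam A a b →ₗ[K] nerve A n a b :=
  Classical.choose (LinearMap.exists_leftInverse_of_injective (nerveModule A n a b).subtype
    (Submodule.ker_subtype _))

variable {A}

theorem retract_of_mem {n : ℕ} {a b : A.Ob} {y : Fam A a b} (hy : y ∈ nerveModule A n a b) :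
    retract A n a b y = (⟨y, hy⟩ : nerveModule A n a b) :=
  LinearMap.congr_fun (Classical.choose_spec (LinearMap.exists_leftInverse_of_injective
    (nerveModule A n a b).subtype (Submodule.ker_subtype _))) ⟨y, hy⟩

variable (A) in
/-- The projection to the nerve of a single component. -/
def inj (n : ℕ) (W : Beads) : QHom (fun x => x) (sT A.Hom W) (nerve A n) := fun a b =>
  retract A n a b ∘ₗ LinearMap.single K (fun W : Beads => sT A.Hom W a b) W

theorem sum_inj {n : ℕ} {a b : A.Ob} {y : Fam A a b} (hy : y ∈ nerveModule A n a b) :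
    ∑ W ∈ validBeads n, inj A n W a b (y W) = (⟨y, hy⟩ : nerveModule A n a b) := by
  rw [← retract_of_mem hy]
  refine (map_sum (retract A n a b) (fun W => Pi.single W (y W)) _).symm.trans (congrArg _ ?_)
  funext V
  rw [Finset.sum_apply]
  by_cases hV : V.Valid n
  · rw [Finset.sum_eq_single V (fun W _ h => Pi.single_eq_of_ne h.symm _)
      fun h => absurd (mem_validBeads.mpr hV) h, Pi.single_eq_same]
  · rw [hy.1 V hV]
    refine Finset.sum_eq_zero fun W hW => Pi.single_eq_of_ne (fun h => hV ?_) _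
    exact h ▸ mem_validBeads.mp hW

theorem resolves_π (n : ℕ) : Resolves (validBeads n) fun W => π (A := A) (n := n) W :=
  ⟨inj A n, fun _ _ x => sum_inj x.2⟩

open Classical in
theorem sliceR_mem {k l : ℕ} {a b c : A.Ob} {y : Fam A a b} (hy : y ∈ nerveModule A (k + l) a b)
    {V : Beads} (hV : V.Valid l) (f : sT A.Hom V c b →ₗ[K] K) :
    (fun W => if W.Valid k then sliceR c f (split W V a b (y (W ++ V))) else 0) ∈
      nerveModule A k a c := by
  rw [mem_nerveModule_iff] at hy ⊢
  refine ⟨fun W h => if_neg h, fun M _ _ pre β post hv => ?_⟩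
  obtain ⟨Λ, rfl⟩ := exists_mlift_eq f
  refine Rel.sliceR (E := famEv y M) hv (LinearMap.lsmul K M).flip Λ (fun W hW Φ => ?_)
    (hy.2 M pre β (post ++ V) ?_)
  · simp only [famEv_val]
    rw [if_pos hW]
    exact (mlift_sliceR W V Φ Λ _).trans (mlift₂_split W V _ _)
  · rw [← List.cons_append, ← List.append_assoc]
    exact valid_append.mpr ⟨k, l, rfl, hv, hV⟩

open Classical in
theorem sliceL_mem {k l : ℕ} {a b c : A.Ob} {y : Fam A a b} (hy : y ∈ nerveModule A (k + l) a b)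
    {U : Beads} (hU : U.Valid k) (f : sT A.Hom U a c →ₗ[K] K) :
    (fun W => if W.Valid l then sliceL c f (split U W a b (y (U ++ W))) else 0) ∈
      nerveModule A l c b := by
  rw [mem_nerveModule_iff] at hy ⊢
  refine ⟨fun W h => if_neg h, fun M _ _ pre β post hv => ?_⟩
  obtain ⟨Λ, rfl⟩ := exists_mlift_eq f
  refine Rel.sliceL (E := famEv y M) hv (LinearMap.lsmul K M) Λ (fun W hW Φ => ?_)
    (hy.2 M (U ++ pre) β post ?_)
  · simp only [famEv_val]
    rw [if_pos hW]
    exact (mlift_sliceL U W Φ Λ _).trans (mlift₂_split U W _ _)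
  · rw [List.append_assoc]
    exact valid_append.mpr ⟨k, l, rfl, hU, hv⟩

theorem sum_qmap_inj_left {k l : ℕ} {a b : A.Ob} {y : Fam A a b}
    (hy : y ∈ nerveModule A (k + l) a b) {U V : Beads} (hU : U.Valid k) (hV : V.Valid l) :
    ∑ W ∈ validBeads k, qmap (π U) (qid (sT A.Hom V)) a b
      (qmap (inj A k W) (qid (sT A.Hom V)) a b (split W V a b (y (W ++ V)))) =
        split U V a b (y (U ++ V)) := by
  refine ext_sliceR fun c f => ?_
  rw [map_sum]
  refine (Finset.sum_congr rfl fun W hW => (sliceR_qmap (π U) c f _).trans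
    (congrArg (π U a c) (sliceR_qmap (inj A k W) c f _))).trans ?_
  have h := sum_inj (sliceR_mem hy hV f)
  rw [← map_sum]
  refine (congrArg (π U a c) ((Finset.sum_congr rfl fun W hW => ?_).trans h)).trans ?_
  · rw [if_pos (mem_validBeads.mp hW)]
  · exact if_pos hU

theorem sum_qmap_inj_right {k l : ℕ} {a b : A.Ob} {y : Fam A a b}
    (hy : y ∈ nerveModule A (k + l) a b) {U V : Beads} (hU : U.Valid k) (hV : V.Valid l) :
    ∑ W ∈ validBeads l, qmap (qid (sT A.Hom U)) (π V) a b
      (qmap (qid (sT A.Hom U)) (inj A l W) a b (split U W a b (y (U ++ W)))) =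
        split U V a b (y (U ++ V)) := by
  refine ext_sliceL fun c f => ?_
  rw [map_sum]
  refine (Finset.sum_congr rfl fun W hW => (sliceL_qmap (π V) c f _).trans
    (congrArg (π V c b) (sliceL_qmap (inj A l W) c f _))).trans ?_
  have h := sum_inj (sliceL_mem hy hU f)
  rw [← map_sum]
  refine (congrArg (π V c b) ((Finset.sum_congr rfl fun W hW => ?_).trans h)).trans ?_
  · rw [if_pos (mem_validBeads.mp hW)]
  · exact if_pos hV

theorem qmap_interchange {O : Type u} {P P' P'' Q Q' Q'' : KQuiver K O} {a b : O}
    (φ : QHom (fun x => x) P P') (φ' : QHom (fun x => x) P' P'') (ψ : QHom (fun x => x) Q Q')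
    (ψ' : QHom (fun x => x) Q' Q'') (t : qtensor P Q a b) :
    qmap φ' ψ' a b (qmap φ ψ a b t) = qmap (qid P'') ψ' a b (qmap (qid P'') ψ a b
      (qmap φ' (qid Q) a b (qmap φ (qid Q) a b t))) := by
  simp only [qmap_qmap]
  rfl

variable (A) in
/-- The comultiplication of the templicial nerve. -/
def nerveComul (n k l : ℕ) : QHom (fun x => x) (nerve A n) (qtensor (nerve A k) (nerve A l)) :=
  fun a b => ∑ W₁ ∈ validBeads k, ∑ W₂ ∈ validBeads l,
    qmap (inj A k W₁) (inj A l W₂) a b ∘ₗ split W₁ W₂ a b ∘ₗ π (W₁ ++ W₂) a b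

theorem nerveComul_apply {k l : ℕ} {a b : A.Ob} (y : nerve A (k + l) a b) {U V : Beads}
    (hU : U.Valid k) (hV : V.Valid l) :
    qmap (π U) (π V) a b (nerveComul A (k + l) k l a b y) =
      split U V a b (π (U ++ V) a b y) := by
  have hy : y.1 ∈ nerveModule A (k + l) a b := y.2
  refine Eq.trans ?_ (sum_qmap_inj_right hy hU hV)
  rw [nerveComul, LinearMap.sum_apply, map_sum]
  simp only [LinearMap.sum_apply, map_sum]
  rw [Finset.sum_comm]
  refine Finset.sum_congr rfl fun W hW => ?_
  rw [← sum_qmap_inj_left hy hU (mem_validBeads.mp hW)]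
  rw [map_sum, map_sum]
  refine Finset.sum_congr rfl fun W' _ => ?_
  exact qmap_interchange _ _ _ _ _

end Comultiplication

section Naturality

set_option linter.unusedSectionVars false

open Chain Nerve

variable {K : Type u} [Field K]

theorem gap_shift {φ ψ : ℕ → ℕ} (k p q : ℕ) (β : Bead)
    (h : ∀ i ≤ β.sum, φ (p + i) = k + ψ (q + i)) : gap φ p β = gap ψ q β := by
  induction β generalizing p q with
  | nil => rfl
  | cons g β ih =>
    rw [List.sum_cons] at h
    have h0 := h 0 (by omega)
    rw [add_zero, add_zero] at h0
    rw [gap, gap, h g (by omega), h0, Nat.add_sub_add_left, ih (p + g) (q + g) fun i hi => by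
      rw [add_assoc, add_assoc, h _ (by omega)]]

theorem gaps_shift {φ ψ : ℕ → ℕ} (k p q : ℕ) (W : Beads)
    (h : ∀ i ≤ W.flatten.sum, φ (p + i) = k + ψ (q + i)) : gaps φ p W = gaps ψ q W := by
  induction W generalizing p q with
  | nil => rfl
  | cons b W ih =>
    rw [List.flatten_cons, List.sum_append] at h
    rw [gaps, gaps, gap_shift k p q b fun i hi => h i (by omega),
      ih (p + b.sum) (q + b.sum) fun i hi => by rw [add_assoc, add_assoc, h _ (by omega)]]

theorem FInt.sum_ext_left {k' k l' l : ℕ} (f : FInt k' k) (g : FInt l' l) {i : ℕ} (h : i ≤ k') :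
    (f.sum g).ext i = f.ext i := by
  rw [FInt.ext_of_le _ (by omega), FInt.ext_of_le _ h, FInt.val, dif_pos (by omega)]
  exact if_pos h

theorem FInt.sum_ext_right {k' k l' l : ℕ} (f : FInt k' k) (g : FInt l' l) {i : ℕ} (h : i ≤ l') :
    (f.sum g).ext (k' + i) = k + g.ext i := by
  rcases Nat.eq_zero_or_pos i with rfl | hi
  · rw [add_zero, f.sum_ext_left g le_rfl, f.ext_last, g.ext_zero, add_zero]
  · rw [FInt.ext_of_le _ (by omega), FInt.ext_of_le _ h, FInt.val, dif_pos (by omega)]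
    refine (if_neg (by simp only; omega)).trans ?_
    simp only [Nat.add_sub_cancel_left]

theorem gaps_sum_append {k' k l' l : ℕ} (f : FInt k' k) (g : FInt l' l) {U V : Beads}
    (hU : U.Valid k') (hV : V.Valid l') :
    gaps (f.sum g).ext 0 (U ++ V) = gaps f.ext 0 U ++ gaps g.ext 0 V := by
  rw [gaps_append, hU.2, gaps_shift 0 0 0 U (ψ := f.ext) fun i hi => by
    rw [zero_add, zero_add, f.sum_ext_left g (hU.2 ▸ hi)],
    gaps_shift k (0 + k') 0 V (ψ := g.ext) fun i hi => by
      rw [zero_add, zero_add, f.sum_ext_right g (hV.2 ▸ hi)]]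

section

variable {M : Type u} [AddCommGroup M] [Module K M] {O O' : Type u} {o : O → O'}
variable {H : O → O → ℤ → ModuleCat.{u} K} {H' : O' → O' → ℤ → ModuleCat.{u} K}

theorem cutL_runL (L₁ L₂ : List (Step H H' o)) {k : ℕ} (hk : L₁.length = k) {x y : O}
    (Ψ : ∀ z, Mult H' (o x) z (Mult H' z (o y) M)) :
    cutL (width L₁) (fun z => Mult.map (runL L₂) (runL L₁ (Ψ (o z)))) =
      runL (L₁ ++ L₂) (cutL k Ψ) := by
  refine Subtype.ext (funext fun c => ?_)
  show cutAt (width L₁) c (fun z p q => run L₂ (run L₁ (Ψ (o z)).1 p).1 q) =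
    run (L₁ ++ L₂) (fun v => cutAt k v fun z p q => ((Ψ z).1 p).1 q) c
  rw [run_append]
  congr 1
  funext z p q
  let X : Mult H' (o z) (o y) M →ₗ[K] M :=
    { toFun := fun Φ => run L₂ Φ.1 q
      map_add' := fun Φ Φ' => run_add L₂ Φ.1 Φ'.1 q
      map_smul' := fun r Φ => (run_map (LinearMap.lsmul K M r) L₂ Φ.1 q).symm }
  refine (run_map X L₁ (Ψ (o z)).1 p).trans (run_congr _ _ fun u hu => ?_)
  show run L₂ ((Ψ (o z)).1 u).1 q = _
  congr 1
  funext v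
  rw [cutAt_append' _ _ _ (hk.symm.trans hu.symm)]

theorem mlift₂_qmap_split {U V U' V' : Beads} {φ : QHom o (sT H U) (sT H' U')}
    {ψ : QHom o (sT H V) (sT H' V')} {L₁ L₂ : List (Step H H' o)} (hL : L₁.length = U'.length)
    (hw : width L₁ = U.length)
    (h₁ : ∀ (M : Type u) [AddCommGroup M] [Module K M] (x y : O) (Φ : Mult H' (o x) (o y) M)
      (t : sT H U x y), mlift U' (o x) (o y) Φ (φ x y t) = mlift U x y (runL L₁ Φ) t)
    (h₂ : ∀ (M : Type u) [AddCommGroup M] [Module K M] (x y : O) (Φ : Mult H' (o x) (o y) M)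
      (t : sT H V x y), mlift V' (o x) (o y) Φ (ψ x y t) = mlift V x y (runL L₂ Φ) t)
    {x y : O} (Ψ : ∀ z, Mult H' (o x) z (Mult H' z (o y) M)) (t : sT H (U ++ V) x y) :
    mlift₂ U' V' Ψ (qmap φ ψ x y (split U V x y t)) =
      mlift (U ++ V) x y (runL (L₁ ++ L₂) (cutL U'.length Ψ)) t := by
  rw [← cutL_runL L₁ L₂ hL Ψ, hw, ← mlift₂_split]
  refine LinearMap.congr_fun (f := mlift₂ U' V' Ψ ∘ₗ qmap φ ψ x y)
    (g := mlift₂ U V fun z => Mult.map (runL L₂) (runL L₁ (Ψ (o z)))) (q_ext fun z s r => ?_)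
    (split U V x y t)
  refine (congrArg (mlift₂ U' V' Ψ) (qmap_tmul φ ψ x y z s r)).trans ?_
  rw [mlift₂_tmul, mlift₂_tmul, h₁, h₂, ← mlift_map]

theorem lsum_linearMap_apply {ι : Type*} {M N : Type*} [AddCommGroup M] [Module K M]
    [AddCommGroup N] [Module K N] (l : List ι) (f : ι → M →ₗ[K] N) (x : M) :
    lsum l f x = lsum l fun i => f i x := by
  induction l with
  | nil => rfl
  | cons i l ih => rw [lsum_cons, lsum_cons, LinearMap.add_apply, ih]

theorem qmap_lsum {ι κ : Type*} {P Q : KQuiver K O} {P' Q' : KQuiver K O'} (l : List ι)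
    (m : List κ) (φ : ι → QHom o P P') (ψ : κ → QHom o Q Q') (a b : O) (t : qtensor P Q a b) :
    qmap (fun a b => lsum l fun i => φ i a b) (fun a b => lsum m fun j => ψ j a b) a b t =
      lsum l fun i => lsum m fun j => qmap (φ i) (ψ j) a b t := by
  have : qmap (fun a b => lsum l fun i => φ i a b) (fun a b => lsum m fun j => ψ j a b) a b =
      lsum l fun i => lsum m fun j => qmap (φ i) (ψ j) a b := q_ext fun c x y => by
    rw [qmap_tmul]
    simp only [lsum_linearMap_apply, qmap_tmul]
    rw [map_lsum (qtmul (P := P') (Q := Q') (o c)), lsum_linearMap_apply]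
    refine lsum_congr fun i _ => ?_
    rw [map_lsum (qtmul (P := P') (Q := Q') (o c) _)]
  rw [this]
  simp only [lsum_linearMap_apply]

end

variable {A B : AInftyCat K}

variable (A) in
/-- The action of a map of intervals on the templicial nerve. -/
def nerveMap {m n : ℕ} (f : FInt m n) : QHom (fun x => x) (nerve A n) (nerve A m) := fun a b =>
  (mapFam A f ∘ₗ (nerveModule A n a b).subtype).codRestrict (nerveModule A m a b)
    fun y => mapFam_mem f y.2

theorem nerveMap_apply {m n : ℕ} (f : FInt m n) (a b : A.Ob) (y : nerve A n a b) {W : Beads}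
    (hW : W.Valid m) :
    π W a b (nerveMap A f a b y) = bar f 0 W a b (π (imgs f 0 W) a b y) :=
  mapFam_of_valid f y.1 hW

theorem nerveApp_apply (f : AInftyFunctor A B) (n : ℕ) (a b : A.Ob) (y : nerve A n a b)
    {W : Beads} (hW : W.Valid n) :
    π W (f.obj a) (f.obj b) (nerveApp f n a b y) = push f (fun V => π V a b y) W :=
  pushFam_of_valid f y.1 hW

theorem qmap_zero_left {O : Type u} {P Q P' Q' : KQuiver K O} (ψ : QHom (fun x => x) Q Q')
    (φ : QHom (fun x => x) P P') (h : ∀ x y t, φ x y t = 0) (a b : O) (t : qtensor P Q a b) :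
    qmap φ ψ a b t = 0 := by
  refine LinearMap.congr_fun (g := 0) (q_ext fun c x y => ?_) t
  rw [qmap_tmul, h, map_zero]
  rfl

theorem qmap_zero_right {O : Type u} {P Q P' Q' : KQuiver K O} (φ : QHom (fun x => x) P P')
    (ψ : QHom (fun x => x) Q Q') (h : ∀ x y t, ψ x y t = 0) (a b : O) (t : qtensor P Q a b) :
    qmap φ ψ a b t = 0 := by
  refine LinearMap.congr_fun (g := 0) (q_ext fun c x y => ?_) t
  rw [qmap_tmul, h, map_zero]
  rfl

theorem nerveComul_natural {k' k l' l : ℕ} (f : FInt k' k) (g : FInt l' l) (a b : A.Ob)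
    (x : nerve A (k + l) a b) :
    nerveComul A (k' + l') k' l' a b (nerveMap A (f.sum g) a b x) =
      qmap (nerveMap A f) (nerveMap A g) a b (nerveComul A (k + l) k l a b x) := by
  refine ((resolves_π k').qmap (resolves_π l')).ext ?_
  rintro ⟨U, V⟩ hUV
  have hU := mem_validBeads.mp (Finset.mem_product.mp hUV).1
  have hV := mem_validBeads.mp (Finset.mem_product.mp hUV).2
  refine (nerveComul_apply _ hU hV).trans (Eq.trans ?_ (qmap_qmap _ _ _ _ _).symm)
  have e : qmap (o := fun x => x) (fun a b => π U a b ∘ₗ nerveMap A f a b)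
      (fun a b => π V a b ∘ₗ nerveMap A g a b) a b (nerveComul A (k + l) k l a b x) =
      qmap (bar f 0 U) (bar g 0 V) a b (qmap (π (imgs f 0 U)) (π (imgs g 0 V)) a b
        (nerveComul A (k + l) k l a b x)) := by
    refine Eq.trans ?_ (qmap_qmap _ _ _ _ _).symm
    congr 1
    congr 1
    · funext a b
      exact LinearMap.ext fun y => nerveMap_apply f a b y hU
    · funext a b
      exact LinearMap.ext fun y => nerveMap_apply g a b y hV
  refine mlift₂_ext fun M _ _ Ψ => ?_
  rw [mlift₂_split]
  refine (famEv_mapFam (f.sum g) x.1 (valid_append.mpr ⟨_, _, rfl, hU, hV⟩) _).trans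
    (Eq.trans ?_ (congrArg (mlift₂ U V Ψ) e.symm))
  rw [gaps_sum_append f g hU hV, Ev.bind_val, Expn.lsum_choices_append]
  have hU0 : ∀ b ∈ U, b ≠ [] := fun b hb => (hU.1 b hb).1
  have hV0 : ∀ b ∈ V, b ≠ [] := fun b hb => (hV.1 b hb).1
  rcases bar_spec (A := A) f U 0 (by rw [hU.2, zero_add]) hU0 with ⟨h1, h2⟩ | ⟨L₁, h1, h2⟩
  · rw [h1, lsum_nil, qmap_zero_left _ _ h2, map_zero]
  · rcases bar_spec (A := A) g V 0 (by rw [hV.2, zero_add]) hV0 with ⟨h3, h4⟩ | ⟨L₂, h3, h4⟩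
    · rw [h3, qmap_zero_right _ _ h4, map_zero]
      exact lsum_eq_zero fun _ _ => rfl
    · have m1 : (imgs f 0 U, L₁) ∈ (hatExpn A).choices (gaps f.ext 0 U) := by simp [h1]
      have m2 : (imgs g 0 V, L₂) ∈ (hatExpn A).choices (gaps g.ext 0 V) := by simp [h3]
      rw [nerveComul_apply x (valid_of_hat_gaps f hU m1) (valid_of_hat_gaps g hV m2)]
      obtain ⟨s1, s2, -⟩ := (hatExpn A).choices_spec m1
      rw [gaps_length] at s1
      refine Eq.trans ?_ (mlift₂_qmap_split s1 s2 h2 h4 Ψ _).symm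
      rw [h1, h3]
      simp only [lsum_cons, lsum_nil, add_zero]
      rfl

theorem nerveApp_comul (f : AInftyFunctor A B) (k l : ℕ) (a b : A.Ob) (y : nerve A (k + l) a b) :
    nerveComul B (k + l) k l (f.obj a) (f.obj b) (nerveApp f (k + l) a b y) =
      qmap (nerveApp f k) (nerveApp f l) a b (nerveComul A (k + l) k l a b y) := by
  refine ((resolves_π k).qmap (resolves_π l)).ext ?_
  rintro ⟨U, V⟩ hUV
  have hU := mem_validBeads.mp (Finset.mem_product.mp hUV).1
  have hV := mem_validBeads.mp (Finset.mem_product.mp hUV).2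
  refine (nerveComul_apply _ hU hV).trans (Eq.trans ?_
    (TempVect.qmap_comp (nerveApp f k) (nerveApp f l) (π U) (π V) a b _))
  have hp : ∀ {n : ℕ} {W : Beads}, W.Valid n → (fun a b => π W (f.obj a) (f.obj b) ∘ₗ
      nerveApp f n a b) = fun a b => lsum (W.map cuts).sections fun D =>
        (((-1 : K) ^ ((D.map Beads.eps).sum + sig D)) • appTens f W D a b) ∘ₗ
          π D.flatten a b := by
    intro n W hW
    funext a b
    refine LinearMap.ext fun y => (nerveApp_apply f n a b y hW).trans ?_
    rw [lsum_linearMap_apply, push, show Bead.subdiv = cuts from funext subdiv_eq_cuts]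
    rfl
  refine Eq.trans ?_ (congrArg₂ (fun φ ψ => qmap (o := f.obj) φ ψ a b
    (nerveComul A (k + l) k l a b y)) (hp hU).symm (hp hV).symm)
  refine Eq.trans ?_ (qmap_lsum _ _ _ _ a b _).symm
  refine mlift₂_ext fun M _ _ Ψ => ?_
  rw [mlift₂_split, map_lsum (mlift₂ U V Ψ)]
  refine (congrArg _ (pushFam_of_valid f y.1 (valid_append.mpr ⟨_, _, rfl, hU, hV⟩))).trans ?_
  refine (mlift_push f y.1 (U ++ V) _).trans ?_
  rw [Ev.bind_val, Expn.lsum_choices_append, lsum_cutExpn_choices]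
  refine lsum_congr fun D hD => ?_
  rw [lsum_cutExpn_choices, map_lsum (mlift₂ U V Ψ)]
  refine lsum_congr fun D' hD' => ?_
  have spec : ∀ {W : Beads} {D : List Beads}, D ∈ (W.map cuts).sections →
      ∀ (M : Type u) [AddCommGroup M] [Module K M] (x y : A.Ob)
        (Φ : Mult B.Hom (f.obj x) (f.obj y) M) (t : sT A.Hom D.flatten x y),
      mlift W (f.obj x) (f.obj y) Φ ((((-1 : K) ^ ((D.map Beads.eps).sum + sig D)) •
        appTens f W D x y) t) = mlift D.flatten x y (runL (D.map (stepOf f.barOp)) Φ) t := by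
    intro W D hD M _ _ x y Φ t
    have := map_flatten_of_mem_sections hD
    subst this
    rw [LinearMap.smul_apply, map_smul]
    exact mlift_appTens f D Φ t
  have e := (TempVect.qmap_comp (π D.flatten) (π D'.flatten)
    (fun x y => ((-1 : K) ^ ((D.map Beads.eps).sum + sig D)) • appTens f U D x y)
    (fun x y => ((-1 : K) ^ ((D'.map Beads.eps).sum + sig D')) • appTens f V D' x y) a b
    (nerveComul A (k + l) k l a b y)).trans (congrArg _ (nerveComul_apply y
      (valid_sections hU hD) (valid_sections hV hD')))
  refine Eq.trans ?_ (congrArg (mlift₂ U V Ψ) e.symm)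
  have hl := congrArg List.length (map_flatten_of_mem_sections hD)
  rw [List.length_map] at hl
  refine Eq.trans ?_ (mlift₂_qmap_split (L₁ := D.map (stepOf f.barOp))
    (L₂ := D'.map (stepOf f.barOp)) ?_ ?_ (spec hD) (spec hD') Ψ _).symm
  · rfl
  · rw [List.length_map, hl]
  · simp [width, stepOf, Function.comp_def, List.length_flatten]

end Naturality

section Coassociativity

set_option linter.unusedSectionVars false

open Chain Nerve

variable {K : Type u} [Field K] {O : Type u} {H : O → O → ℤ → ModuleCat.{u} K}

/-- Transport along an equality of lists of beads. -/
def castT {U V : Beads} (h : U = V) (x y : O) : sT H U x y →ₗ[K] sT H V x y :=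
  h ▸ LinearMap.id

theorem castT_fam {U V : Beads} (h : U = V) {x y : O} (t : ∀ W : Beads, sT H W x y) :
    castT h x y (t U) = t V := by
  subst h
  rfl

theorem castT_tcons {b : Bead} {U V : Beads} (h : U = V) {x y z : O} (a : H x z b.dim)
    (t : sT H U z y) :
    castT (congrArg (List.cons b) h) x y (tcons z a t) = tcons z a (castT h z y t) := by
  subst h
  rfl

theorem split_tcons (b : Bead) (U V : Beads) {x y z : O} (a : H x z b.dim)
    (t : sT H (U ++ V) z y) : split (b :: U) V x y (tcons z a t) =
      qassoc (fun x y => H x y b.dim) (sT H U) (sT H V) x y (qtmul z a (split U V z y t)) :=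
  congrArg (qassoc (fun x y => H x y b.dim) (sT H U) (sT H V) x y)
    (qmap_tmul (qid fun x y => H x y b.dim) (split U V) x y z a t)

set_option maxHeartbeats 1000000 in
theorem split_assoc (U V W : Beads) {x y : O} (t : sT H (U ++ (V ++ W)) x y) :
    qassoc (sT H U) (sT H V) (sT H W) x y (qmap (qid (sT H U)) (split V W) x y
      (split U (V ++ W) x y t)) = qmap (split U V) (qid (sT H W)) x y
        (split (U ++ V) W x y (castT (List.append_assoc U V W).symm x y t)) := by
  induction U generalizing x with
  | nil =>
    refine (congrArg (qassoc (sT H []) (sT H V) (sT H W) x y) (qmap_tmul (qid (sT H []))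
      (split V W) x y x (unitOne rfl : unitQ K O x x) t)).trans ?_
    refine LinearMap.congr_fun (f := qassoc (sT H []) (sT H V) (sT H W) x y ∘ₗ
      qtmul (P := sT H []) x (unitOne rfl : unitQ K O x x))
      (g := qmap (split [] V) (qid (sT H W)) x y) (q_ext fun c p q => ?_) (split V W x y t)
    exact (qassoc_tmul (sT H []) (sT H V) (sT H W) x y x c _ p q).trans
      (qmap_tmul (split [] V) (qid (sT H W)) x y c p q).symm
  | cons b U ih =>
    let Hb : KQuiver K O := fun x y => H x y b.dim
    let F : ∀ z, Hb x z → (qtensor (qtensor (sT H U) (sT H V)) (sT H W) z y →ₗ[K]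
        qtensor (qtensor (sT H (b :: U)) (sT H V)) (sT H W) x y) := fun z a =>
      qmap (qassoc Hb (sT H U) (sT H V)) (qid (sT H W)) x y ∘ₗ
        qassoc Hb (qtensor (sT H U) (sT H V)) (sT H W) x y ∘ₗ
          qtmul (P := Hb) z a
    have hF : ∀ z (a : Hb x z) (w : O) (p : qtensor (sT H U) (sT H V) z w) (q : sT H W w y),
        F z a (qtmul w p q) = qtmul w (qassoc Hb (sT H U) (sT H V) x w (qtmul z a p)) q :=
      fun z a w p q => (congrArg (qmap (qassoc Hb (sT H U) (sT H V)) (qid (sT H W)) x y)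
        (qassoc_tmul Hb (qtensor (sT H U) (sT H V)) (sT H W) x y z w a p q)).trans
          (qmap_tmul _ _ _ _ _ _ _)
    refine LinearMap.congr_fun (f := qassoc (sT H (b :: U)) (sT H V) (sT H W) x y ∘ₗ
      qmap (qid (sT H (b :: U))) (split V W) x y ∘ₗ split (b :: U) (V ++ W) x y)
      (g := qmap (split (b :: U) V) (qid (sT H W)) x y ∘ₗ split (b :: (U ++ V)) W x y ∘ₗ
        castT (List.append_assoc (b :: U) V W).symm x y)
      (tcons_ext (b := b) (W := U ++ (V ++ W)) fun z a s => ?_) t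
    trans F z a (qassoc (sT H U) (sT H V) (sT H W) z y (qmap (qid (sT H U)) (split V W) z y
      (split U (V ++ W) z y s)))
    · refine (congrArg (fun t => qassoc (sT H (b :: U)) (sT H V) (sT H W) x y
        (qmap (qid (sT H (b :: U))) (split V W) x y t)) (split_tcons b U (V ++ W) a s)).trans ?_
      refine LinearMap.congr_fun (f := qassoc (sT H (b :: U)) (sT H V) (sT H W) x y ∘ₗ
        qmap (qid (sT H (b :: U))) (split V W) x y ∘ₗ qassoc Hb (sT H U) (sT H (V ++ W)) x y ∘ₗ
          qtmul (P := Hb) z a)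
        (g := F z a ∘ₗ qassoc (sT H U) (sT H V) (sT H W) z y ∘ₗ
          qmap (qid (sT H U)) (split V W) z y) (q_ext fun w p q => ?_) (split U (V ++ W) z y s)
      refine (congrArg (fun t => qassoc (sT H (b :: U)) (sT H V) (sT H W) x y
        (qmap (qid (sT H (b :: U))) (split V W) x y t))
          (qassoc_tmul Hb (sT H U) (sT H (V ++ W)) x y z w a p q)).trans ?_
      refine (congrArg (qassoc (sT H (b :: U)) (sT H V) (sT H W) x y)
        (qmap_tmul (qid (sT H (b :: U))) (split V W) x y w (tcons z a p) q)).trans ?_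
      refine Eq.trans ?_ (congrArg (fun t => F z a (qassoc (sT H U) (sT H V) (sT H W) z y t))
        (qmap_tmul (qid (sT H U)) (split V W) z y w p q)).symm
      refine LinearMap.congr_fun (f := qassoc (sT H (b :: U)) (sT H V) (sT H W) x y ∘ₗ
        qtmul (P := sT H (b :: U)) w (tcons z a p))
        (g := F z a ∘ₗ qassoc (sT H U) (sT H V) (sT H W) z y ∘ₗ qtmul (P := sT H U) w p)
        (q_ext fun v q r => ?_) (split V W w y q)
      refine (qassoc_tmul (sT H (b :: U)) (sT H V) (sT H W) x y w v (tcons z a p) q r).trans ?_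
      refine Eq.trans ?_ (congrArg (F z a)
        (qassoc_tmul (sT H U) (sT H V) (sT H W) z y w v p q r)).symm
      refine Eq.trans ?_ (hF z a v _ r).symm
      exact congrArg (fun t => qtmul (P := qtensor (sT H (b :: U)) (sT H V)) v t r)
        (qassoc_tmul Hb (sT H U) (sT H V) x v z w a p q).symm
    · have hR : ∀ s' : sT H (U ++ V ++ W) z y, F z a (qmap (split U V) (qid (sT H W)) z y
          (split (U ++ V) W z y s')) = qmap (split (b :: U) V) (qid (sT H W)) x y
            (split (b :: (U ++ V)) W x y (tcons z a s')) := fun s' => by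
        refine Eq.trans ?_ (congrArg (fun t => qmap (split (b :: U) V) (qid (sT H W)) x y t)
          (split_tcons b (U ++ V) W a s')).symm
        refine LinearMap.congr_fun (f := F z a ∘ₗ qmap (split U V) (qid (sT H W)) z y)
          (g := qmap (split (b :: U) V) (qid (sT H W)) x y ∘ₗ
            qassoc Hb (sT H (U ++ V)) (sT H W) x y ∘ₗ qtmul (P := Hb) z a)
          (q_ext fun w p q => ?_) (split (U ++ V) W z y s')
        refine (congrArg (F z a) (qmap_tmul (split U V) (qid (sT H W)) z y w p q)).trans ?_
        refine (hF z a w (split U V z w p) q).trans ?_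
        refine Eq.trans ?_ (congrArg (qmap (split (b :: U) V) (qid (sT H W)) x y)
          (qassoc_tmul Hb (sT H (U ++ V)) (sT H W) x y z w a p q)).symm
        refine Eq.trans ?_
          (qmap_tmul (split (b :: U) V) (qid (sT H W)) x y w (tcons z a p) q).symm
        exact congrArg (fun t => qtmul (P := qtensor (sT H (b :: U)) (sT H V)) w t q)
          (split_tcons b U V a p).symm
      refine (congrArg (F z a) (ih s)).trans ((hR _).trans ?_)
      exact congrArg (fun t => qmap (split (b :: U) V) (qid (sT H W)) x y
        (split (b :: (U ++ V)) W x y t)) (castT_tcons (b := b) (x := x)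
          (List.append_assoc U V W).symm a s).symm

theorem qassoc_natural {P Q R P' Q' R' : KQuiver K O} (φ : QHom (fun x => x) P P')
    (ψ : QHom (fun x => x) Q Q') (χ : QHom (fun x => x) R R') (a b : O)
    (t : qtensor P (qtensor Q R) a b) :
    qmap (qmap φ ψ) χ a b (qassoc P Q R a b t) =
      qassoc P' Q' R' a b (qmap φ (qmap ψ χ) a b t) := by
  refine LinearMap.congr_fun (f := qmap (qmap φ ψ) χ a b ∘ₗ qassoc P Q R a b)
    (g := qassoc P' Q' R' a b ∘ₗ qmap φ (qmap ψ χ) a b) (q_ext fun c x s => ?_) t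
  refine Eq.trans ?_ (congrArg (qassoc P' Q' R' a b) (qmap_tmul φ (qmap ψ χ) a b c x s)).symm
  refine LinearMap.congr_fun (f := qmap (qmap φ ψ) χ a b ∘ₗ qassoc P Q R a b ∘ₗ qtmul c x)
    (g := qassoc P' Q' R' a b ∘ₗ qtmul c (φ a c x) ∘ₗ qmap ψ χ c b) (q_ext fun d y z => ?_) s
  simp only [LinearMap.comp_apply]
  rw [qassoc_tmul, qmap_tmul, qmap_tmul, qmap_tmul, qassoc_tmul]

variable {A : AInftyCat K}

theorem nerveComul_apply' {n k l : ℕ} (h : n = k + l) {a b : A.Ob} (y : nerve A n a b)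
    {U V : Beads} (hU : U.Valid k) (hV : V.Valid l) :
    qmap (π U) (π V) a b (nerveComul A n k l a b y) = split U V a b (π (U ++ V) a b y) := by
  subst h
  exact nerveComul_apply y hU hV

theorem nerveComul_coassoc (n k l p q r : ℕ) (hq : q = l + p) (hr : r = k + l) (h₁ : n = k + q)
    (h₂ : n = r + p) (a b : A.Ob) (x : nerve A n a b) :
    qassoc (nerve A k) (nerve A l) (nerve A p) a b
        (qmap (qid (nerve A k)) (nerveComul A q l p) a b (nerveComul A n k q a b x)) =
      qmap (nerveComul A r k l) (qid (nerve A p)) a b (nerveComul A n r p a b x) := by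
  refine (((resolves_π k).qmap (resolves_π l)).qmap (resolves_π p)).ext ?_
  rintro ⟨⟨U, V⟩, W⟩ h
  obtain ⟨h, hW⟩ := Finset.mem_product.mp h
  obtain ⟨hU, hV⟩ := Finset.mem_product.mp h
  have hU := mem_validBeads.mp hU
  have hV := mem_validBeads.mp hV
  have hW := mem_validBeads.mp hW
  have hUV : Beads.Valid r (U ++ V) := hr ▸ valid_append.mpr ⟨_, _, rfl, hU, hV⟩
  have hVW : Beads.Valid q (V ++ W) := hq ▸ valid_append.mpr ⟨_, _, rfl, hV, hW⟩
  have e₁ : qmap (π U) (qmap (π V) (π W)) a b (qmap (qid (nerve A k)) (nerveComul A q l p) a b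
      (nerveComul A n k q a b x)) = qmap (qid (sT A.Hom U)) (split V W) a b
        (split U (V ++ W) a b (π (U ++ (V ++ W)) a b x)) := by
    refine Eq.trans ?_ (congrArg _ (nerveComul_apply' h₁ x hU hVW))
    refine (qmap_qmap _ _ _ _ _).trans (Eq.trans ?_ (qmap_qmap _ _ _ _ _).symm)
    congr 1
    congr 1
    funext a b
    exact LinearMap.ext fun y => nerveComul_apply' hq y hV hW
  have e₂ : qmap (qmap (π U) (π V)) (π W) a b (qmap (nerveComul A r k l) (qid (nerve A p)) a b
      (nerveComul A n r p a b x)) = qmap (split U V) (qid (sT A.Hom W)) a b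
        (split (U ++ V) W a b (π (U ++ V ++ W) a b x)) := by
    refine Eq.trans ?_ (congrArg _ (nerveComul_apply' h₂ x hUV hW))
    refine (qmap_qmap _ _ _ _ _).trans (Eq.trans ?_ (qmap_qmap _ _ _ _ _).symm)
    congr 1
    congr 1
    funext a b
    exact LinearMap.ext fun y => nerveComul_apply' hr y hU hV
  refine (qassoc_natural (π U) (π V) (π W) a b _).trans ((congrArg _ e₁).trans ?_)
  refine (split_assoc U V W _).trans (Eq.trans ?_ e₂.symm)
  exact congrArg (fun t => qmap (split U V) (qid (sT A.Hom W)) a b (split (U ++ V) W a b t))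
    (castT_fam _ x.1)

theorem valid_zero {W : Beads} : W.Valid 0 ↔ W = [] := by
  refine ⟨fun h => ?_, fun h => h ▸ ⟨by simp, rfl⟩⟩
  cases W with
  | nil => rfl
  | cons b W =>
    obtain ⟨hb, hp⟩ := h.1 b (by simp)
    cases b with
    | nil => exact absurd rfl hb
    | cons g b =>
      have h1 := hp g (by simp)
      have h2 := h.2
      rw [List.flatten_cons, List.cons_append, List.sum_cons] at h2
      omega

variable (A) in
/-- The counit of the templicial nerve. -/
def nerveCounit : QHom (fun x => x) (nerve A 0) (unitQ K A.Ob) := fun a b => π [] a b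

theorem nerveCounit_left (n : ℕ) (a b : A.Ob) (x : nerve A n a b) :
    qmap (nerveCounit A) (qid (nerve A n)) a b (nerveComul A n 0 n a b x) =
      qtmul a (unitOne rfl) x := by
  refine ((Resolves.id (unitQ K A.Ob)).qmap (resolves_π n)).ext ?_
  rintro ⟨_, W⟩ h
  have hW := mem_validBeads.mp (Finset.mem_product.mp h).2
  refine (qmap_qmap _ _ _ _ _).trans (Eq.trans ?_
    (qmap_tmul (qid (unitQ K A.Ob)) (π W) a b a (unitOne rfl) x).symm)
  exact nerveComul_apply' (zero_add n).symm x (valid_zero.mpr rfl) hW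

theorem nerveCounit_right (n : ℕ) (a b : A.Ob) (x : nerve A n a b) :
    qmap (qid (nerve A n)) (nerveCounit A) a b (nerveComul A n n 0 a b x) =
      qtmul b x (unitOne rfl) := by
  refine ((resolves_π n).qmap (Resolves.id (unitQ K A.Ob))).ext ?_
  rintro ⟨W, _⟩ h
  have hW := mem_validBeads.mp (Finset.mem_product.mp h).1
  refine (qmap_qmap _ _ _ _ _).trans (Eq.trans ?_
    (qmap_tmul (π W) (qid (unitQ K A.Ob)) a b b x (unitOne rfl)).symm)
  refine (nerveComul_apply' (add_zero n).symm x hW (valid_zero.mpr rfl)).trans ?_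
  refine mlift₂_ext (U := W) (V := []) fun M _ _ Ψ => ?_
  rw [mlift₂_split]
  refine Eq.trans ?_ (mlift₂_tmul W [] Ψ b (π W a b x) (unitOne rfl : unitQ K A.Ob b b)).symm
  refine Eq.trans ?_ (mlift_nil b _ (unitOne rfl : unitQ K A.Ob b b)).symm
  let ev : Mult A.Hom b b M →ₗ[K] M :=
    { toFun := fun Φ => Φ.1 (nil b)
      map_add' := fun _ _ => rfl
      map_smul' := fun _ _ => rfl }
  refine Eq.trans ?_ ((one_smul K _).trans (mlift_map ev W (Ψ b) (π W a b x))).symm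
  show (famEv x.1 M).val (W ++ []) (cutL W.length Ψ) = (famEv x.1 M).val W (Mult.map ev (Ψ b))
  rw [List.append_nil]
  refine Ev.congr _ _ _ _ fun c hc => ?_
  exact cutAt_len c _ (len_of_degs hc).symm

theorem nerveCounit_bijective (a b : A.Ob) : Function.Bijective (nerveCounit A a b) := by
  refine ⟨fun x y h => (resolves_π 0).ext fun W hW => ?_, fun t => ?_⟩
  · rw [valid_zero.mp (mem_validBeads.mp hW)]
    exact h
  · have hm : (Pi.single [] t : Fam A a b) ∈ nerveModule A 0 a b := by
      refine ⟨fun W hW => Pi.single_eq_of_ne (fun e => hW (valid_zero.mpr e)) _,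
        fun pre β post hv => ?_⟩
      exact absurd (valid_zero.mp hv) (by simp)
    exact ⟨(⟨Pi.single [] t, hm⟩ : nerveModule A 0 a b), Pi.single_eq_same (M := fun W => sT A.Hom W a b) [] t⟩

theorem mapFam_congr {m n : ℕ} (f : FInt m n) {a b : A.Ob} {y z : Fam A a b}
    (h : ∀ W : Beads, W.Valid n → y W = z W) {W : Beads} (hW : W.Valid m) :
    mapFam A f y W = mapFam A f z W := by
  refine sT_ext fun M _ _ Φ => ?_
  refine (famEv_mapFam f y hW Φ).trans (Eq.trans ?_ (famEv_mapFam f z hW Φ).symm)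
  rw [Ev.bind_val, Ev.bind_val]
  exact lsum_congr fun Q hQ => by rw [famEv_val, famEv_val, h _ (valid_of_hat_gaps f hW hQ)]

variable (A) in
/-- The templicial nerve of an `A_∞`-category. -/
def nerveStr : TempStr K (nerve A) where
  map f := nerveMap A f
  map_id n _ _ x := (resolves_π n).ext fun _ hW => mapFam_id x.1 (mem_validBeads.mp hW)
  map_comp f g _ _ x := Subtype.ext (mapFam_comp f g x.1)
  comul n k l _ := nerveComul A n k l
  comul_natural f g a b x := nerveComul_natural f g a b x
  coassoc := nerveComul_coassoc
  counit := nerveCounit A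
  counit_left := nerveCounit_left
  counit_right := nerveCounit_right
  counit_bijective := nerveCounit_bijective

variable (K) in
/-- The templicial `A_∞`-nerve. -/
def templicialNerve : TemplicialNerve K where
  str := nerveStr
  map_apply _ _ _ f a b y _ hW := nerveMap_apply f a b y hW
  comul_apply _ _ _ _ h _ _ y _ _ h₁ h₂ := nerveComul_apply' h y h₁ h₂
  counit_apply _ _ _ _ := rfl
  app f n := nerveApp f n
  app_apply f n a b y _ hW := nerveApp_apply f n a b y hW
  app_natural f _ _ h a b y := (resolves_π _).ext fun W hW => by
    have hW := mem_validBeads.mp hW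
    refine (pushFam_of_valid f _ hW).trans ((push_mapFam f h y.1 hW).trans ?_)
    exact mapFam_congr h (fun V hV => (pushFam_of_valid f y.1 hV).symm) hW
  app_comul f n k l h a b y := by
    subst h
    exact nerveApp_comul f k l a b y
  app_counit f a b y := by
    refine (congrArg unitVal (pushFam_of_valid f y.1 (valid_zero.mpr rfl))).trans ?_
    have e : push f y.1 [] = condKMap K (congrArg f.obj) (y.1 []) := by
      refine (add_zero _).trans ?_
      refine Eq.trans ?_ (one_smul K _)
      exact congrArg (fun k : K => k • condKMap K (congrArg f.obj) (y.1 [])) (zpow_zero (-1 : K))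
    exact congrArg unitVal e
  app_id A n a b y := (resolves_π n).ext fun W hW => by
    have hW := mem_validBeads.mp hW
    exact (pushFam_of_valid _ y.1 hW).trans (push_id y.1 W hW)
  app_comp f g n a b y := (resolves_π n).ext fun W hW => by
    have hW := mem_validBeads.mp hW
    refine (pushFam_of_valid _ y.1 hW).trans ((push_comp f g y.1 W).trans ?_)
    refine Eq.trans ?_ (pushFam_of_valid g _ hW).symm
    exact push_congr g (fun V hV => (pushFam_of_valid f y.1 hV).symm) W hW

end Coassociativity

section Generators

set_option linter.unusedSectionVars false

open Chain Nerve

variable {K : Type u} [Field K] {n : ℕ}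

variable (K) in
open Classical in
/-- The generator of `condK K p` (which is `0` if `p` does not hold). -/
def condOne (p : Prop) : condK K p := ⟨if p then 1 else 0, fun h => if_neg h⟩

variable (K) in
/-- The generator `(i, j)` of `A_∞[Δⁿ](i, j)`, or `0` in the degrees and for the pairs where there is
none. -/
def simplexGen (i j : ULift.{u} (Fin (n + 1))) (d : ℤ) : simplexHom K n i j d :=
  condOne K (i.down ≤ j.down ∧ d = 0)

theorem simplexVal_gen {i j : ULift.{u} (Fin (n + 1))} {d : ℤ} (h : i.down ≤ j.down) (hd : d = 0) :
    simplexVal (simplexGen K i j d) = 1 := if_pos ⟨h, hd⟩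

theorem simplexGen_of_ne {i j : ULift.{u} (Fin (n + 1))} {d : ℤ} (hd : d ≠ 0) :
    simplexGen K i j d = 0 := simplex_ext (if_neg fun h => hd h.2)

theorem simplexGen_self (i : ULift.{u} (Fin (n + 1))) : simplexGen K i i 0 = simplexOne K i :=
  simplex_ext (simplexVal_gen le_rfl rfl)

variable (K) in
/-- The tensor product of the generators of a necklace in `Δⁿ` starting at `x`, with further
vertices `v (p + i)`. -/
def genTens (v : ℕ → ULift.{u} (Fin (n + 1))) : ∀ (W : Beads) (x : ULift.{u} (Fin (n + 1))) (_ : ℕ)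
    (y : ULift.{u} (Fin (n + 1))), sT (simplexHom K n) W x y
  | [], x, _, y => (condOne K (x = y) : condK K (x = y))
  | b :: W, x, p, y => tcons (v (p + b.sum)) (simplexGen K x (v (p + b.sum)) b.dim)
      (genTens v W (v (p + b.sum)) (p + b.sum) y)

variable {v : ℕ → ULift.{u} (Fin (n + 1))}

theorem genTens_zero {W : Beads} (h : ∃ b ∈ W, b.dim ≠ 0) (x : ULift.{u} (Fin (n + 1))) (p : ℕ)
    (y : ULift.{u} (Fin (n + 1))) : genTens K v W x p y = 0 := by
  induction W generalizing x p with
  | nil => simp at h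
  | cons b W ih =>
    show tcons (v (p + b.sum)) (simplexGen K x (v (p + b.sum)) b.dim)
      (genTens K v W (v (p + b.sum)) (p + b.sum) y) = 0
    by_cases hb : b.dim = 0
    · obtain ⟨c, hc, hd⟩ := h
      rcases List.mem_cons.mp hc with rfl | hc
      · exact absurd hb hd
      · rw [ih ⟨c, hc, hd⟩, map_zero]
    · rw [simplexGen_of_ne hb, map_zero, LinearMap.zero_apply]

theorem genTens_split (U V : Beads) (x : ULift.{u} (Fin (n + 1))) (p q : ℕ)
    (hq : q = p + U.flatten.sum) (hx : x = v p) (y : ULift.{u} (Fin (n + 1))) :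
    split U V x y (genTens K v (U ++ V) x p y) =
      qtmul (v q) (genTens K v U x p (v q)) (genTens K v V (v q) q y) := by
  induction U generalizing x p with
  | nil =>
    obtain rfl : q = p := hq
    subst hx
    have : (unitOne rfl : unitQ K _ (v q) (v q)) = genTens K v [] (v q) q (v q) :=
      unit_ext (if_pos rfl).symm
    exact congrArg (fun s => qtmul (P := sT (simplexHom K n) []) (v q) s
      (genTens K v V (v q) q y)) this
  | cons b U ih =>
    refine (split_tcons b U V _ _).trans ?_
    refine (congrArg (fun s => qassoc (fun x y => simplexHom K n x y b.dim) (sT (simplexHom K n) U)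
      (sT (simplexHom K n) V) x y (qtmul _ _ s)) (ih (v (p + b.sum)) (p + b.sum) ?_ rfl)).trans ?_
    · rw [hq, List.flatten_cons, List.sum_append, add_assoc]
    · exact qassoc_tmul (fun x y => simplexHom K n x y b.dim) (sT (simplexHom K n) U)
        (sT (simplexHom K n) V) x y _ _ _ _ _

theorem simplexMul_pair {x y z : ULift.{u} (Fin (n + 1))} (hxy : x.down ≤ y.down)
    (hyz : y.down ≤ z.down) {d e : ℤ} (a : simplexHom K n x y d) (b : simplexHom K n y z e)
    (ha : simplexVal a = 1) (hb : simplexVal b = 1) {k : ℤ} (hk : k = 0) :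
    simplexMul (cons d a (cons e b (nil z))) k = simplexGen K x z k := by
  refine simplex_ext ?_
  rw [simplexVal_mul, if_pos hk, simplexVal_gen (hxy.trans hyz) hk]
  show simplexVal a * simplexVal b = 1
  rw [ha, hb, one_mul]

variable (K n) in
/-- The multiplications of `A_∞[Δⁿ]`, with the signs of the bar construction. -/
def simplexBarOp (d : ℤ) : Op (simplexHom K n) (simplexHom K n) (fun x => x) d :=
  (simplexCat K n).barOp d

theorem simplexBarOp_apply {x y : ULift.{u} (Fin (n + 1))} (c : Chain (simplexHom K n) x y)
    (d : ℤ) : (simplexBarOp K n d).1 x y c = (-1 : K) ^ c.wt • simplexMul c d := rfl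

theorem simplexBarOp_of_len {x y : ULift.{u} (Fin (n + 1))} (c : Chain (simplexHom K n) x y)
    (d : ℤ) (h : c.len ≠ 2) : (simplexBarOp K n d).1 x y c = 0 := by
  rw [simplexBarOp_apply, simplexMul_of_coeff c d (simplexCoeff_of_len c h), smul_zero]

theorem simplexBarOp_pair {x y z : ULift.{u} (Fin (n + 1))} (hxy : x.down ≤ y.down)
    (hyz : y.down ≤ z.down) {d e : ℤ} (a : simplexHom K n x y d) (b : simplexHom K n y z e)
    (ha : simplexVal a = 1) (hb : simplexVal b = 1) (hd : d = 0) {k : ℤ} (hk : k = 0) :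
    (simplexBarOp K n k).1 x z (cons d a (cons e b (nil z))) = simplexGen K x z k := by
  subst hd
  rw [simplexBarOp_apply, simplexMul_pair hxy hyz a b ha hb hk]
  simp [wt]

theorem mem_cuts_pair_or {β : Bead} {S : Beads} (hS : S ∈ cuts β) (h : 2 < β.length) :
    S.length ≠ 2 ∨ ∃ b ∈ S, Bead.dim b ≠ 0 := by
  by_contra hc
  push Not at hc
  have h1 := congrArg List.length (flatten_of_mem_cuts hS).1
  match S, hc with
  | [s, t], hc =>
    have hs := hc.2 s (by simp)
    have ht := hc.2 t (by simp)
    simp only [Bead.dim, List.flatten_cons, List.flatten_nil, List.append_nil, List.length_append]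
      at hs ht h1
    omega

theorem rel_genTens (hv : Monotone fun i => (v i).down) (pre : Beads) (β : Bead) (post : Beads)
    (hβ : β ≠ []) {M : Type u} [AddCommGroup M] [Module K M] (x : ULift.{u} (Fin (n + 1))) (p : ℕ)
    (hx : x.down ≤ (v p).down) (y : ULift.{u} (Fin (n + 1))) :
    Rel (simplexBarOp K n) (famEv (fun W => genTens K v W x p y) M) pre β post := by
  intro Φ
  show (lsum (cuts β) fun S => mlift (pre ++ (S ++ post)) x y
    (insL pre.length S.length (simplexBarOp K n (β.length - 2)) Φ)
      (genTens K v (pre ++ (S ++ post)) x p y)) = mergeSum β fun c =>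
        mlift (pre ++ c :: post) x y Φ (genTens K v (pre ++ c :: post) x p y)
  induction pre generalizing x p with
  | cons b pre ih =>
    refine Eq.trans ?_ ((ih (v (p + b.sum)) (p + b.sum) le_rfl
      (Mult.cons b.dim Φ (simplexGen K x (v (p + b.sum)) b.dim))).trans ?_)
    · exact lsum_congr fun S _ => mlift_cons b (pre ++ (S ++ post)) x y _ _ _ _
    · refine congrArg (mergeSum β) (funext fun c => ?_)
      exact (mlift_cons b (pre ++ c :: post) x y _ _ _ _).symm
  | nil =>
    have hS : ∀ S : Beads, S.length ≠ 2 ∨ (∃ b ∈ S, Bead.dim b ≠ 0) →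
        mlift (S ++ post) x y (insL 0 S.length (simplexBarOp K n (β.length - 2)) Φ)
          (genTens K v (S ++ post) x p y) = 0 := by
      rintro S (h | ⟨b, hb, hd⟩)
      · refine (LinearMap.congr_fun (mlift_congr (S ++ post) _ 0 fun c hc => ?_) _).trans
          (LinearMap.congr_fun (map_zero (mlift (S ++ post) x y)) _)
        rw [List.map_append] at hc
        obtain ⟨z, q, t, rfl, hq, ht⟩ := degs_split c _ _ hc
        show cutAt S.length (q.append t) _ = 0
        rw [cutAt_append' _ _ _ (len_of_degs hq).symm]
        show Φ.1 (cons _ ((simplexBarOp K n _).1 _ _ q) t) = 0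
        rw [simplexBarOp_of_len q _ (by rwa [len_of_degs hq])]
        exact (Φ.2.head _ t).map_zero
      · rw [genTens_zero ⟨b, List.mem_append_left _ hb, hd⟩, map_zero]
    have hM : ∀ c : Bead, c.length + 1 = β.length → 2 < β.length →
        mlift (c :: post) x y Φ (genTens K v (c :: post) x p y) = 0 := fun c hc h => by
      rw [genTens_zero ⟨c, by simp, by simp only [Bead.dim]; omega⟩, map_zero]
    match β, hβ with
    | [g], _ =>
      simp only [cuts, List.flatMap_cons, List.flatMap_nil, List.append_nil, lsum_cons, lsum_nil,
        add_zero]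
      exact hS [[g]] (Or.inl (by simp))
    | [g, h], _ =>
      have hc : cuts [g, h] = [[[g], [h]], [[g, h]]] := rfl
      have h1 : (v (p + g)).down ≤ (v (p + g + h)).down := hv (by omega)
      have h0 : x.down ≤ (v (p + g)).down := hx.trans (hv (by omega))
      rw [hc, lsum_cons, lsum_cons, lsum_nil, add_zero]
      have e0 := hS [[g, h]] (Or.inl (by simp))
      refine (congrArg₂ (· + ·) ?_ e0).trans (add_zero _)
      refine Eq.trans ?_ (sub_zero _).symm
      refine (mlift_cons [g] ([h] :: post) x y _ _ _ _).trans
        ((mlift_cons [h] post _ y _ _ _ _).trans ?_)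
      refine Eq.trans ?_ (mlift_cons [g + h] post x y _ _ _ _).symm
      have hs : p + [g].sum + [h].sum = p + [g + h].sum := by simp [add_assoc]
      rw [hs]
      refine LinearMap.congr_fun (mlift_congr post _ _ fun t _ => ?_) _
      show Φ.1 (cons _ ((simplexBarOp K n _).1 _ _ (cons _ _ (cons _ _ (nil _)))) t) =
        Φ.1 (cons _ _ t)
      refine (congrArg (fun w => Φ.1 (cons _ w t)) (simplexBarOp_pair h0 (hs ▸ h1) _ _
        (simplexVal_gen h0 (sub_self 1)) (simplexVal_gen (hs ▸ h1) (sub_self 1)) (sub_self 1)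
        (sub_self 2))).trans ?_
      exact congrArg (fun d => Φ.1 (cons d (simplexGen K x _ d) t))
        ((sub_self (2 : ℤ)).trans (sub_self (1 : ℤ)).symm)
    | g :: h :: k :: β, _ =>
      refine (lsum_eq_zero fun S h => hS S (mem_cuts_pair_or h (by simp))).trans (Eq.symm ?_)
      refine (mergeSum_congr (ψ' := fun _ => 0) fun c hc _ _ => hM c hc (by simp)).trans ?_
      exact mergeSum_zero _

end Generators

section Generators

set_option linter.unusedSectionVars false

open Chain Nerve

variable {K : Type u} [Field K] {n : ℕ} {v : ℕ → ULift.{u} (Fin (n + 1))}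

theorem cons_runL_entry {O : Type u} {H : O → O → ℤ → ModuleCat.{u} K} {M : Type u} [AddCommGroup M]
    [Module K M] (L : List (Step H H fun x => x)) {x y z : O} (d : ℤ) (Φ : Mult H x y M)
    (a : H x z d) :
    Mult.cons d (runL (o := fun x => x) (⟨1, d, entryOp d⟩ :: L) Φ) a =
      runL (o := fun x => x) L (Mult.cons d Φ a) := by
  refine Subtype.ext (funext fun c => ?_)
  show run (o := fun x => x) L (fun v => Φ.1 (cons d ((cons d a (nil _)).entry d) v)) c =
    run (o := fun x => x) L (fun v => Φ.1 (cons d a v)) c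
  rw [entry_single]

variable (K n) in
/-- The expansion `hatExpn` for `A_∞[Δⁿ]`. -/
def simplexHat : Expn (simplexHom K n) (simplexHom K n) fun x => x := hatExpn (simplexCat K n)

theorem hat_genTens {φ : ℕ → ℕ} (hφ : Monotone φ) (W : Beads) (hW : ∀ b ∈ W, b ≠ []) {M : Type u}
    [AddCommGroup M] [Module K M] (p : ℕ) (x y : ULift.{u} (Fin (n + 1))) (hx : x = v (φ p))
    (Φ : Mult (simplexHom K n) x y M) :
    ((famEv (fun U => genTens K v U x (φ p) y) M).bind (simplexHat K n)).val (gaps φ p W) Φ =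
      mlift W x y Φ (genTens K (fun i => v (φ i)) W x p y) := by
  rw [Ev.bind_val]
  induction W generalizing x p with
  | nil =>
    refine (add_zero _).trans ?_
    refine LinearMap.congr_fun (mlift_congr [] _ _ fun c hc => ?_) _
    cases c with
    | nil => rfl
    | cons => simp at hc
  | cons b W ih =>
    have ih := ih (fun c hc => hW c (List.mem_cons_of_mem _ hc)) (p + b.sum) (v (φ (p + b.sum))) rfl
    have hs : φ p + (gap φ p b).sum = φ (p + b.sum) := by rw [add_comm, gap_sum hφ]
    have hb := hW b (by simp)
    have hd := gap_dim φ p b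
    rw [gaps, Expn.lsum_choices_cons]
    refine Eq.trans ?_ (mlift_cons b W x y _ Φ _ _).symm
    by_cases h0 : 0 ∈ gap φ p b
    · by_cases h1 : gap φ p b = [0]
      · rw [h1] at hs hd ⊢
        have ht : (simplexHat K n).terms [0] = [([], ⟨0, 0, (simplexCat K n).oneOp⟩)] :=
          hatExpn_unit
        rw [ht, lsum_cons, lsum_nil, add_zero]
        have hs : φ p = φ (p + b.sum) := hs
        refine Eq.trans ?_ (ih _)
        have hx' : x = v (φ (p + b.sum)) := by rw [hx, hs]
        subst hx'
        have hd : (0 : ℤ) = b.dim := hd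
        rw [← hd, simplexGen_self]
        refine lsum_congr fun q _ => ?_
        exact congrArg (fun i => mlift q.1 _ y (runL (o := fun x => x) q.2 (Mult.cons 0 Φ
          (simplexOne K _))) (genTens K v q.1 (v (φ (p + b.sum))) i y)) hs
      · rw [show (simplexHat K n).terms (gap φ p b) = [] from hatExpn_bad h0 h1, lsum_nil]
        rw [simplexGen_of_ne, map_zero, map_zero, LinearMap.zero_apply]
        intro hz
        match b, hb, hz, h0, h1 with
        | [g], _, _, h0, h1 => exact h1 (by simpa [gap, eq_comm] using h0)
        | g :: h :: b, _, hz, _, _ => simp [Bead.dim] at hz; omega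
    · rw [show (simplexHat K n).terms (gap φ p b) = [([gap φ p b], ⟨1, (gap φ p b).dim,
        entryOp (gap φ p b).dim⟩)] from hatExpn_pos h0, lsum_cons, lsum_nil, add_zero]
      rw [← hd]
      refine Eq.trans ?_ (ih _)
      refine lsum_congr fun q _ => ?_
      refine (mlift_cons (gap φ p b) q.1 x y _ _ _ _).trans ?_
      rw [cons_runL_entry, hs]
      rfl

theorem lsum_cut_strict {O O' : Type u} {H : O → O → ℤ → ModuleCat.{u} K}
    {H' : O' → O' → ℤ → ModuleCat.{u} K} {o : O → O'} {M : Type u} [AddCommGroup M] [Module K M]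
    (F : ∀ d, Op H H' o d) (hF : ∀ d {x y : O} (c : Chain H x y), c.len ≠ 1 → (F d).1 x y c = 0)
    {a b : O} (E : Ev H a b M) (W : Beads) (hW : ∀ b ∈ W, b ≠ []) (Φ : Mult H' (o a) (o b) M) :
    (E.bind (cutExpn F)).val W Φ =
      E.val W (runL (W.map fun b => (⟨1, b.dim, F b.dim⟩ : Step H H' o)) Φ) := by
  let u : Expn H H' o :=
    { terms := fun b => [([b], ⟨1, b.dim, F b.dim⟩)]
      width_eq := by simp
      deg_eq := by simp }
  have hu : ∀ W : Beads, u.choices W = [(W, W.map fun b => (⟨1, b.dim, F b.dim⟩ : Step H H' o))] := by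
    intro W
    induction W with
    | nil => rfl
    | cons b W ih => simp [Expn.choices, ih, u]
  refine (Ev.bind_congr E (cutExpn F) u W (fun β hβ X₀ X₁ L₀ L₁ Φ h0 h1 => ?_) Φ).trans ?_
  · simp only [cutExpn, u, lsum_map, lsum_cons, lsum_nil, add_zero]
    rw [lsum_cuts_single β (hW β hβ)]
    · rfl
    · intro S hS hl
      refine Eq.trans (slotL_congr E X₀ S X₁ L₀ L₁ β.dim Φ _ 0 h0 fun x y q hq => ?_) ?_
      · exact hF _ q (by rwa [len_of_degs hq])
      · rw [map_zero, map_zero]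
  · rw [Ev.bind_val, hu, lsum_cons, lsum_nil, add_zero]

variable (K) in
/-- The image of a strict functor `A_∞[Δᵐ] ⟶ A_∞[Δⁿ]` on the tensor product of generators. -/
theorem mlift_strict_genTens {m : ℕ} {M : Type u} [AddCommGroup M] [Module K M]
    (θ : Fin (m + 1) →o Fin (n + 1)) {v : ℕ → ULift.{u} (Fin (m + 1))}
    (hv : Monotone fun i => (v i).down) (W : Beads)
    (x : ULift.{u} (Fin (m + 1))) (p : ℕ) (hx : x = v p) (y : ULift.{u} (Fin (m + 1)))
    (F : ∀ d, Op (simplexHom K m) (simplexHom K n) (fun i => ⟨θ i.down⟩) d)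
    (hF : ∀ d {x y : ULift.{u} (Fin (m + 1))} (a : simplexHom K m x y d),
      (F d).1 x y (cons d a (nil y)) = (simplexStrict K θ).map x y d a)
    (Φ : Mult (simplexHom K n) ⟨θ x.down⟩ ⟨θ y.down⟩ M) (hy : y = v (p + W.flatten.sum)) :
    mlift W x y (runL (o := fun i : ULift.{u} (Fin (m + 1)) => (⟨θ i.down⟩ : ULift.{u} (Fin (n + 1))))
        (W.map fun b => (⟨1, b.dim, F b.dim⟩ : Step (simplexHom K m) (simplexHom K n) _)) Φ)
        (genTens K v W x p y) =
      mlift W _ _ Φ (genTens K (fun i => ⟨θ (v i).down⟩) W ⟨θ x.down⟩ p ⟨θ y.down⟩) := by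
  induction W generalizing x p with
  | nil =>
    obtain rfl : y = v p := hy
    subst hx
    refine (mlift_nil (H := simplexHom K m) (v p) _ _).trans
      (Eq.trans ?_ (mlift_nil (H := simplexHom K n) _ Φ _).symm)
    have e₁ : tval (genTens K v [] (v p) p (v p)) = 1 := if_pos rfl
    have e₂ : tval (genTens K (fun i => (⟨θ (v i).down⟩ : ULift.{u} (Fin (n + 1)))) [] ⟨θ (v p).down⟩
      p ⟨θ (v p).down⟩) = 1 := if_pos rfl
    rw [e₁, e₂]
    rfl
  | cons b W ih =>
    have hle : x.down ≤ (v (p + b.sum)).down := by rw [hx]; exact hv (Nat.le_add_right _ _)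
    refine (mlift_cons b W x y _ _ _ _).trans (Eq.trans ?_ (mlift_cons b W _ _ _ Φ _ _).symm)
    have ha : (F b.dim).1 x _ (cons b.dim (simplexGen K x (v (p + b.sum)) b.dim) (nil _)) =
        simplexGen K (⟨θ x.down⟩ : ULift.{u} (Fin (n + 1))) ⟨θ (v (p + b.sum)).down⟩ b.dim := by
      refine (hF b.dim _).trans (simplex_ext ?_)
      rw [simplexStrict_val]
      by_cases hb : b.dim = 0
      · rw [simplexVal_gen hle hb]
        exact (simplexVal_gen (θ.monotone hle) hb).symm
      · rw [simplexGen_of_ne hb, simplexGen_of_ne hb, map_zero]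
        exact (map_zero _).symm
    refine Eq.trans ?_ ((ih (v (p + b.sum)) (p + b.sum) rfl
      (Mult.cons (H := simplexHom K n) b.dim Φ (simplexGen K (⟨θ x.down⟩ : ULift.{u} (Fin (n + 1)))
        ⟨θ (v (p + b.sum)).down⟩ b.dim)) ?_))
    · rw [← ha]
      rfl
    · rw [hy, List.flatten_cons, List.sum_append, add_assoc]

end Generators

section Universal

set_option linter.unusedSectionVars false

open Chain Nerve Opposite SSet

variable {K : Type u} [Field K]

theorem genTens_congr {n : ℕ} {v v' : ℕ → ULift.{u} (Fin (n + 1))} (W : Beads)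
    (x : ULift.{u} (Fin (n + 1))) (p p' : ℕ) (y : ULift.{u} (Fin (n + 1)))
    (h : ∀ i ≤ W.flatten.sum, v (p + i) = v' (p' + i)) :
    genTens K v W x p y = genTens K v' W x p' y := by
  induction W generalizing x p p' with
  | nil => rfl
  | cons b W ih =>
    rw [List.flatten_cons, List.sum_append] at h
    rw [genTens, genTens, h b.sum (by omega)]
    rw [ih _ (p + b.sum) (p' + b.sum) fun i hi => by
      have := h (b.sum + i) (by omega)
      rwa [← add_assoc, ← add_assoc] at this]

theorem qtmul_genTens_congr {n : ℕ} {v : ℕ → ULift.{u} (Fin (n + 1))} (U V : Beads)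
    (x y z z' : ULift.{u} (Fin (n + 1))) (p q : ℕ) (h : z = z') :
    qtmul (P := sT (simplexHom K n) U) (Q := sT (simplexHom K n) V) z (genTens K v U x p z)
      (genTens K v V z q y) = qtmul z' (genTens K v U x p z') (genTens K v V z' q y) := by
  rw [h]

variable {k : SimplexCategory}

/-- A vertex of `Δᵏ` as an object of `A_∞[Δᵏ]`. -/
def vertexIdx (a : (stdSimplex.{u}.obj k).obj (op (SimplexCategory.mk 0))) :
    ULift.{u} (Fin (k.len + 1)) := ⟨(stdSimplex.objEquiv a).toOrderHom 0⟩

/-- The sequence of vertices of a simplex of `Δᵏ` (constant after the last vertex). -/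
def pathOf {m : ℕ} (σ : (stdSimplex.{u}.obj k).obj (op (SimplexCategory.mk m))) (i : ℕ) :
    ULift.{u} (Fin (k.len + 1)) :=
  ⟨(stdSimplex.objEquiv σ).toOrderHom ⟨min i m, Nat.lt_succ_of_le (min_le_right _ _)⟩⟩

variable {m : ℕ} (σ : (stdSimplex.{u}.obj k).obj (op (SimplexCategory.mk m)))

theorem pathOf_mono : Monotone fun i => (pathOf σ i).down := fun i j h =>
  (stdSimplex.objEquiv σ).toOrderHom.monotone (show min i m ≤ min j m from min_le_min_right m h)

theorem pathOf_map {l : ℕ} (f : FInt l m) (i : ℕ) :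
    pathOf ((stdSimplex.{u}.obj k).map f.hom.op σ) i = pathOf σ (f.ext i) := by
  refine ULift.ext _ _ (congrArg (stdSimplex.objEquiv σ).toOrderHom (Fin.ext ?_))
  have h1 := f.val_eq ⟨min i l, Nat.lt_succ_of_le (min_le_right _ _)⟩
  have h2 := f.val_lt (min i l)
  show (f.toOrderHom ⟨min i l, _⟩ : ℕ) = min (f.val (min i l)) m
  exact h1.symm.trans (min_eq_left (Nat.le_of_lt_succ h2)).symm

theorem vertexIdx_vertex (i : Fin (m + 1)) :
    vertexIdx (Free.vertex (stdSimplex.{u}.obj k) i σ) = pathOf σ i := by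
  refine ULift.ext _ _ (congrArg (stdSimplex.objEquiv σ).toOrderHom (Fin.ext ?_))
  show (i : ℕ) = min (i : ℕ) m
  omega

theorem vertexIdx_source {a b : (stdSimplex.{u}.obj k).obj (op (SimplexCategory.mk 0))}
    (σ : Free.Cell (stdSimplex.{u}.obj k) m a b) : vertexIdx a = pathOf σ.1 0 :=
  (congrArg vertexIdx σ.2.1).symm.trans (vertexIdx_vertex σ.1 0)

theorem vertexIdx_target {a b : (stdSimplex.{u}.obj k).obj (op (SimplexCategory.mk 0))}
    (σ : Free.Cell (stdSimplex.{u}.obj k) m a b) : vertexIdx b = pathOf σ.1 m :=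
  (congrArg vertexIdx σ.2.2).symm.trans (vertexIdx_vertex σ.1 (Fin.last m))

theorem pathOf_face (j l : ℕ) (h : j + l ≤ m) (i : ℕ) (hi : i ≤ l) :
    pathOf (Free.face (stdSimplex.{u}.obj k) j l h σ) i = pathOf σ (j + i) := by
  refine ULift.ext _ _ (congrArg (stdSimplex.objEquiv σ).toOrderHom (Fin.ext ?_))
  show min i l + j = min (j + i) m
  omega

open Classical in
variable (K) in
/-- The collection of tensor products of generators of a simplex of `Δᵏ`. -/
def simplexFam {a b : (stdSimplex.{u}.obj k).obj (op (SimplexCategory.mk 0))} :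
    Fam (simplexCat K k.len) (vertexIdx a) (vertexIdx b) := fun W =>
  if W.Valid m then genTens K (pathOf σ) W (vertexIdx a) 0 (vertexIdx b) else 0

theorem simplexFam_of_valid {a b : (stdSimplex.{u}.obj k).obj (op (SimplexCategory.mk 0))}
    {W : Beads} (h : W.Valid m) : simplexFam K (a := a) (b := b) σ W =
      genTens K (pathOf σ) W (vertexIdx a) 0 (vertexIdx b) := if_pos h

theorem simplexFam_mem {a b : (stdSimplex.{u}.obj k).obj (op (SimplexCategory.mk 0))}
    (σ : Free.Cell (stdSimplex.{u}.obj k) m a b) :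
    simplexFam K σ.1 ∈ nerveModule (simplexCat K k.len) m (vertexIdx a) (vertexIdx b) := by
  refine (mem_nerveModule_iff m _).mpr ⟨fun W h => if_neg h, fun M _ _ pre β post hv => ?_⟩
  refine Rel.congr_valid hv (fun W hW Φ => famEv_congr (simplexFam_of_valid σ.1 hW).symm Φ) ?_
  refine rel_genTens (pathOf_mono σ.1) pre β post (hv.1 β (by simp)).1 (vertexIdx a) 0
    (le_of_eq (congrArg ULift.down (vertexIdx_source σ))) _

variable (K) in
/-- The element of the nerve of `A_∞[Δᵏ]` given by a simplex of `Δᵏ`. -/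
def simplexElt {a b : (stdSimplex.{u}.obj k).obj (op (SimplexCategory.mk 0))}
    (σ : Free.Cell (stdSimplex.{u}.obj k) m a b) :
    nerve (simplexCat K k.len) m (vertexIdx a) (vertexIdx b) :=
  (⟨simplexFam K σ.1, simplexFam_mem σ⟩ : nerveModule (simplexCat K k.len) m _ _)

theorem π_simplexElt {a b : (stdSimplex.{u}.obj k).obj (op (SimplexCategory.mk 0))}
    (σ : Free.Cell (stdSimplex.{u}.obj k) m a b) {W : Beads} (h : W.Valid m) :
    π (A := simplexCat K k.len) W (vertexIdx a) (vertexIdx b) (simplexElt K σ) =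
      genTens K (pathOf σ.1) W (vertexIdx a) 0 (vertexIdx b) := if_pos h

variable (N : TemplicialNerve K)

variable (K k) in
/-- The linear maps `F(Δᵏ)_m ⟶ N(A_∞[Δᵏ])_m`. -/
def universalApp (m : ℕ) :
    QHom vertexIdx (Free.quiver (stdSimplex.{u}.obj k) K m) (nerve (simplexCat K k.len) m) :=
  fun _ _ => Free.extend fun σ => simplexElt K σ

theorem universalApp_gen {a b : (stdSimplex.{u}.obj k).obj (op (SimplexCategory.mk 0))}
    (σ : Free.Cell (stdSimplex.{u}.obj k) m a b) :
    universalApp K k m a b (Free.gen σ) = simplexElt K σ := Free.extend_gen _ σ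

theorem famEv_map (N : TemplicialNerve K) {A : AInftyCat K} {m l : ℕ} (f : FInt l m) {a b : A.Ob}
    (y : nerve A m a b) {W : Beads} (hW : W.Valid l) {M : Type u} [AddCommGroup M] [Module K M]
    (Φ : Mult A.Hom a b M) : mlift W a b Φ (π W a b ((N.str A).map f a b y)) =
      ((famEv (fun V => π V a b y) M).bind (hatExpn A)).val (gaps f.ext 0 W) Φ := by
  refine (congrArg _ ((N.map_apply A f a b y W hW).trans (mapFam_of_valid f y.1 hW).symm)).trans ?_
  exact famEv_mapFam f y.1 hW Φ

theorem simplexElt_map {l : ℕ} (f : FInt l m)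
    {a b : (stdSimplex.{u}.obj k).obj (op (SimplexCategory.mk 0))}
    (σ : Free.Cell (stdSimplex.{u}.obj k) m a b) :
    simplexElt K (σ.map (stdSimplex.{u}.obj k) f) =
      (N.str (simplexCat K k.len)).map f _ _ (simplexElt K σ) := by
  refine (resolves_π l).ext fun W hW => ?_
  have hW := mem_validBeads.mp hW
  refine (π_simplexElt _ hW).trans (sT_ext fun M _ _ Φ => ?_)
  refine Eq.trans ?_ (famEv_map N f (simplexElt K σ) hW Φ).symm
  have h := hat_genTens (K := K) (v := pathOf σ.1) f.ext_mono W (fun b hb => (hW.1 b hb).1) 0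
    (vertexIdx a) (vertexIdx b) (by rw [f.ext_zero]; exact vertexIdx_source σ) Φ
  refine (congrArg _ (genTens_congr W _ 0 0 _ fun i _ => pathOf_map σ.1 f _)).trans
    (h.symm.trans ?_)
  rw [f.ext_zero, Ev.bind_val]
  refine Eq.trans ?_ (Ev.bind_val _ _ _ _).symm
  refine lsum_congr fun Q hQ => ?_
  exact famEv_congr (π_simplexElt σ (valid_of_hat_gaps f hW hQ)).symm _

theorem simplexElt_comul (l₁ l₂ : ℕ) (h : m = l₁ + l₂)
    {a b : (stdSimplex.{u}.obj k).obj (op (SimplexCategory.mk 0))}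
    (σ : Free.Cell (stdSimplex.{u}.obj k) m a b) :
    (N.str (simplexCat K k.len)).comul m l₁ l₂ h _ _ (simplexElt K σ) =
      qtmul (vertexIdx (Free.vertex (stdSimplex.{u}.obj k) ⟨l₁, by omega⟩ σ.1))
        (simplexElt K (Free.front _ h σ)) (simplexElt K (Free.back _ h σ)) := by
  refine ((resolves_π l₁).qmap (resolves_π l₂)).ext ?_
  rintro ⟨U, V⟩ hUV
  have hU := mem_validBeads.mp (Finset.mem_product.mp hUV).1
  have hV := mem_validBeads.mp (Finset.mem_product.mp hUV).2
  have hs : Beads.Valid m (U ++ V) := h ▸ valid_append.mpr ⟨_, _, rfl, hU, hV⟩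
  refine (N.comul_apply _ m l₁ l₂ h _ _ (simplexElt K σ) U V hU hV).trans ?_
  refine Eq.trans ?_ (qmap_tmul (π U) (π V) _ _ _ (simplexElt K (Free.front _ h σ))
    (simplexElt K (Free.back _ h σ))).symm
  rw [π_simplexElt σ hs, π_simplexElt _ hU, π_simplexElt _ hV]
  refine (genTens_split U V (vertexIdx a) 0 l₁ (by rw [hU.2, zero_add])
    (vertexIdx_source σ) (vertexIdx b)).trans ?_
  refine (qtmul_genTens_congr U V _ _ _ _ 0 l₁
    (vertexIdx_vertex σ.1 ⟨l₁, by omega⟩).symm).trans ?_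
  refine congrArg₂ (fun s t => qtmul _ s t) (genTens_congr U _ 0 0 _ fun i hi => ?_)
    (genTens_congr V _ l₁ 0 _ fun i hi => ?_)
  · rw [hU.2] at hi
    exact ((pathOf_face σ.1 0 l₁ (by omega) (0 + i) (by omega)).trans (by rw [zero_add])).symm
  · rw [hV.2] at hi
    exact ((pathOf_face σ.1 l₁ l₂ (by omega) (0 + i) (by omega)).trans (by rw [zero_add])).symm

theorem universalApp_natural {l m : ℕ} (f : FInt l m)
    (a b : (stdSimplex.{u}.obj k).obj (op (SimplexCategory.mk 0)))
    (x : Free.quiver (stdSimplex.{u}.obj k) K m a b) :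
    universalApp K k l a b (Free.extend (fun σ => Free.gen (σ.map (stdSimplex.{u}.obj k) f)) x) =
      (N.str (simplexCat K k.len)).map f _ _ (universalApp K k m a b x) := by
  refine LinearMap.congr_fun (f := universalApp K k l a b ∘ₗ
      Free.extend fun σ => Free.gen (σ.map (stdSimplex.{u}.obj k) f))
    (g := (N.str (simplexCat K k.len)).map f _ _ ∘ₗ universalApp K k m a b)
    (Free.gen_ext fun σ => ?_) x
  exact (congrArg (universalApp K k l a b) (Free.extend_gen _ σ)).trans
    ((universalApp_gen _).trans ((simplexElt_map N f σ).trans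
      (congrArg _ (universalApp_gen σ)).symm))

theorem universalApp_comul (m l₁ l₂ : ℕ) (h : m = l₁ + l₂)
    (a b : (stdSimplex.{u}.obj k).obj (op (SimplexCategory.mk 0)))
    (x : Free.quiver (stdSimplex.{u}.obj k) K m a b) :
    (N.str (simplexCat K k.len)).comul m l₁ l₂ h _ _ (universalApp K k m a b x) =
      qmap (universalApp K k l₁) (universalApp K k l₂) a b
        (Free.comul (stdSimplex.{u}.obj k) K m l₁ l₂ h a b x) := by
  refine LinearMap.congr_fun (f := (N.str (simplexCat K k.len)).comul m l₁ l₂ h _ _ ∘ₗ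
      universalApp K k m a b)
    (g := qmap (universalApp K k l₁) (universalApp K k l₂) a b ∘ₗ
      Free.comul (stdSimplex.{u}.obj k) K m l₁ l₂ h a b)
    (Free.gen_ext fun σ => ?_) x
  refine (congrArg _ (universalApp_gen σ)).trans ((simplexElt_comul N l₁ l₂ h σ).trans
    (Eq.symm ?_))
  refine (congrArg (qmap (universalApp K k l₁) (universalApp K k l₂) a b)
    (Free.extend_gen _ σ)).trans ((qmap_tmul _ _ _ _ _ _ _).trans ?_)
  exact congrArg₂ (fun s t => qtmul _ s t) (universalApp_gen _) (universalApp_gen _)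

theorem universalApp_counit (a b : (stdSimplex.{u}.obj k).obj (op (SimplexCategory.mk 0)))
    (x : Free.quiver (stdSimplex.{u}.obj k) K 0 a b) :
    unitVal ((N.str (simplexCat K k.len)).counit _ _ (universalApp K k 0 a b x)) =
      unitVal (Free.counit (stdSimplex.{u}.obj k) K a b x) := by
  refine LinearMap.congr_fun (f := unitVal ∘ₗ (N.str (simplexCat K k.len)).counit _ _ ∘ₗ
      universalApp K k 0 a b)
    (g := unitVal ∘ₗ Free.counit (stdSimplex.{u}.obj k) K a b) (Free.gen_ext fun σ => ?_) x
  refine Eq.trans ?_ ((congrArg unitVal (Free.extend_gen _ σ)).trans (unitVal_one _)).symm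
  refine (congrArg (fun s => unitVal ((N.str (simplexCat K k.len)).counit _ _ s))
    (universalApp_gen σ)).trans ((congrArg unitVal (N.counit_apply _ _ _ _)).trans
      ((congrArg unitVal (π_simplexElt σ (W := []) (valid_zero.mpr rfl))).trans ?_))
  exact if_pos (congrArg vertexIdx (Free.cell_eq _ σ))

variable (k) in
/-- The morphism `F(Δᵏ) ⟶ N(A_∞[Δᵏ])`. -/
def universalHom : (free K).obj (stdSimplex.{u}.obj k) ⟶ N.functor.obj (simplexCat K k.len) where
  obj := vertexIdx
  app := universalApp K k
  natural f a b x := universalApp_natural N f a b x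
  comul m l₁ l₂ h a b x := universalApp_comul N m l₁ l₂ h a b x
  counit a b x := universalApp_counit N a b x

end Universal

section Comparison

set_option linter.unusedSectionVars false

open Chain Nerve Opposite SSet

variable {K : Type u} [Field K]

theorem simplexMap_barOp_of_len {m n : ℕ} (θ : Fin (m + 1) →o Fin (n + 1)) (d : ℤ)
    {x y : ULift.{u} (Fin (m + 1))} (c : Chain (simplexHom K m) x y) (h : c.len ≠ 1) :
    ((simplexMap K θ).barOp d).1 x y c = 0 := by
  show (-1 : K) ^ c.wt • (simplexStrict K θ).map x y d (c.entry d) = 0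
  rw [entry_of_len_ne c h]
  exact (congrArg _ (map_zero _)).trans (smul_zero _)

theorem simplexMap_barOp_single {m n : ℕ} (θ : Fin (m + 1) →o Fin (n + 1)) (d : ℤ)
    {x y : ULift.{u} (Fin (m + 1))} (a : simplexHom K m x y d) :
    ((simplexMap K θ).barOp d).1 x y (cons d a (nil y)) = (simplexStrict K θ).map x y d a := by
  show (-1 : K) ^ (cons d a (nil y)).wt • (simplexStrict K θ).map x y d ((cons d a (nil y)).entry d) =
    _
  rw [entry_single]
  simp [wt]

variable (N : TemplicialNerve K) {k k' : SimplexCategory} (θ : k ⟶ k')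

theorem simplexElt_app {m : ℕ} {a b : (stdSimplex.{u}.obj k).obj (op (SimplexCategory.mk 0))}
    (σ : Free.Cell (stdSimplex.{u}.obj k) m a b) :
    simplexElt K (σ.app (stdSimplex.{u}.map θ)) =
      N.app (simplexMap K θ.toOrderHom) m _ _ (simplexElt K σ) := by
  refine (resolves_π (A := simplexCat K k'.len) m).ext fun W hW => ?_
  have hW := mem_validBeads.mp hW
  refine (π_simplexElt _ hW).trans (Eq.symm ?_)
  refine (N.app_apply (simplexMap K θ.toOrderHom) m _ _ (simplexElt K σ) W hW).trans ?_
  refine sT_ext fun M _ _ Φ => ?_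
  refine (mlift_push _ _ W Φ).trans ?_
  refine (lsum_cut_strict _ (fun d _ _ c h => simplexMap_barOp_of_len θ.toOrderHom d c h) _ W
    (fun b hb => (hW.1 b hb).1) Φ).trans ?_
  refine (famEv_congr (t' := fun W => genTens K (pathOf σ.1) W (vertexIdx a) 0 (vertexIdx b))
    (π_simplexElt σ hW) _).trans ?_
  refine (mlift_strict_genTens K θ.toOrderHom (pathOf_mono σ.1) W (vertexIdx a) 0
    (vertexIdx_source σ) (vertexIdx b) (fun d => (simplexMap K θ.toOrderHom).barOp d)
    (fun d _ _ a => simplexMap_barOp_single θ.toOrderHom d a) Φ ?_).trans ?_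
  · rw [hW.2, zero_add]
    exact vertexIdx_target σ
  · rfl

theorem universalHom_natural :
    (free K).map (stdSimplex.{u}.map θ) ≫ universalHom k' N =
      universalHom k N ≫ N.functor.map ((cosimplicial K).map θ) := by
  refine TempVect.Hom.ext rfl (heq_of_eq ?_)
  funext m a b
  refine Free.gen_ext (X := stdSimplex.{u}.obj k) fun σ => ?_
  refine (congrArg (universalApp K k' m _ _) (Free.mapQ_gen K (stdSimplex.{u}.map θ) σ)).trans ?_
  refine (universalApp_gen _).trans ((simplexElt_app N θ σ).trans ?_)
  exact congrArg (N.app (simplexMap K θ.toOrderHom) m _ _) (universalApp_gen σ).symm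

/-- The morphism `F(Δᵏ) ⟶ N(A)` of an `A_∞`-functor `A_∞[Δᵏ] ⟶ A`. -/
def adjunct {A : AInftyCat K} (f : simplexCat K k.len ⟶ A) :
    (free K).obj (stdSimplex.{u}.obj k) ⟶ N.functor.obj A :=
  universalHom k N ≫ N.functor.map f

theorem adjunct_comp {A B : AInftyCat K} (g : simplexCat K k.len ⟶ A) (f : A ⟶ B) :
    adjunct N (g ≫ f) = adjunct N g ≫ N.functor.map f :=
  (congrArg (universalHom k N ≫ ·) (N.functor.map_comp g f)).trans (Category.assoc _ _ _).symm

theorem adjunct_map {A : AInftyCat K} (f : simplexCat K k'.len ⟶ A) :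
    adjunct N ((cosimplicial K).map θ ≫ f) =
      (free K).map (stdSimplex.{u}.map θ) ≫ adjunct N f :=
  (adjunct_comp N ((cosimplicial K).map θ) f).trans
    ((congrArg (· ≫ N.functor.map f) (universalHom_natural N θ).symm).trans (Category.assoc _ _ _))

/-- The comparison map `N^{A_∞}(A) ⟶ Ũ(N(A))`. -/
def comparison : simplicialNerve K ⟶ N.functor ⋙ underlying K where
  app A :=
    { app := fun k => TypeCat.ofHom fun f : simplexCat K k.unop.len ⟶ A => adjunct N f
      naturality := fun k k' θ => by
        ext f
        exact adjunct_map N θ.unop f }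
  naturality A B f := by
    ext k g
    exact adjunct_comp N g f

theorem isIso_comparison
    (h : ∀ (k : SimplexCategory) (A : AInftyCat K),
      Function.Bijective fun f : simplexCat K k.len ⟶ A => adjunct N f) :
    IsIso (comparison N) := by
  refine (NatTrans.isIso_iff_isIso_app _).mpr fun A => ?_
  refine (NatTrans.isIso_iff_isIso_app _).mpr fun k => ?_
  exact (isIso_iff_bijective _).mpr (h k.unop A)

end Comparison

section Paths

set_option linter.unusedSectionVars false

open Chain Nerve Opposite SSet

/-- The map of intervals given by a monotone function of natural numbers. -/
def FInt.ofNat {m n : ℕ} (f : ℕ → ℕ) (hf : Monotone f) (h0 : f 0 = 0) (hm : f m = n) : FInt m n where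
  toFun i := ⟨f i, by have := hf (Nat.le_of_lt_succ i.2); omega⟩
  monotone' i j h := hf (show (i : ℕ) ≤ j from h)
  map_zero := Fin.ext h0
  map_last := Fin.ext hm

theorem FInt.ofNat_ext {m n : ℕ} (f : ℕ → ℕ) (hf : Monotone f) (h0 : f 0 = 0) (hm : f m = n) {i : ℕ}
    (hi : i ≤ m) : (FInt.ofNat f hf h0 hm).ext i = f i := by
  rw [FInt.ext_of_le _ hi, FInt.val, dif_pos (Nat.lt_succ_of_le hi)]
  rfl

theorem gap_congr {φ ψ : ℕ → ℕ} {n : ℕ} (h : ∀ i ≤ n, φ i = ψ i) (p : ℕ) (β : Bead)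
    (hp : p + β.sum ≤ n) : gap φ p β = gap ψ p β := by
  induction β generalizing p with
  | nil => rfl
  | cons g β ih =>
    rw [List.sum_cons] at hp
    rw [gap, gap, h _ (by omega), h _ (by omega), ih _ (by omega)]

theorem gaps_congr {φ ψ : ℕ → ℕ} {n : ℕ} (h : ∀ i ≤ n, φ i = ψ i) (p : ℕ) (W : Beads)
    (hp : p + W.flatten.sum ≤ n) : gaps φ p W = gaps ψ p W := by
  induction W generalizing p with
  | nil => rfl
  | cons b W ih =>
    rw [List.flatten_cons, List.sum_append] at hp
    rw [gaps, gaps, gap_congr h _ _ (by omega), ih _ (by omega)]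

variable {k : SimplexCategory}

theorem simplex_path_ext {m : ℕ} {σ τ : (stdSimplex.{u}.obj k).obj (op (SimplexCategory.mk m))}
    (h : ∀ i ≤ m, pathOf σ i = pathOf τ i) : σ = τ := by
  refine stdSimplex.objEquiv.injective (SimplexCategory.Hom.ext _ _ (OrderHom.ext _ _ ?_))
  funext i
  have := congrArg ULift.down (h i (Nat.le_of_lt_succ i.2))
  have e : (⟨min (i : ℕ) m, Nat.lt_succ_of_le (min_le_right _ _)⟩ : Fin (m + 1)) = i :=
    Fin.ext (min_eq_left (Nat.le_of_lt_succ i.2))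
  simp only [pathOf] at this
  rw [e] at this
  exact this

/-- The simplex of `Δᵏ` of a sequence of vertices. -/
def pathSimplex (m : ℕ) (v : ℕ → ULift.{u} (Fin (k.len + 1))) (hv : Monotone fun i => (v i).down) :
    (stdSimplex.{u}.obj k).obj (op (SimplexCategory.mk m)) :=
  stdSimplex.objEquiv.symm (SimplexCategory.Hom.mk ⟨fun i => (v i).down, fun _ _ h => hv h⟩)

theorem pathOf_pathSimplex (m : ℕ) (v : ℕ → ULift.{u} (Fin (k.len + 1)))
    (hv : Monotone fun i => (v i).down) {i : ℕ} (hi : i ≤ m) :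
    pathOf (pathSimplex m v hv) i = v i :=
  (rfl : _ = v (min i m)).trans (congrArg v (min_eq_left hi))

/-- The vertex of `Δᵏ` of an object of `A_∞[Δᵏ]`. -/
def vtx (x : ULift.{u} (Fin (k.len + 1))) :
    (stdSimplex.{u}.obj k).obj (op (SimplexCategory.mk 0)) :=
  pathSimplex 0 (fun _ => x) fun _ _ _ => le_rfl

theorem vtx_eq {a : (stdSimplex.{u}.obj k).obj (op (SimplexCategory.mk 0))}
    {x : ULift.{u} (Fin (k.len + 1))} (h : vertexIdx a = x) : vtx x = a :=
  simplex_path_ext fun i hi => by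
    obtain rfl : i = 0 := by omega
    exact h.symm

theorem vertex_pathSimplex (m : ℕ) (v : ℕ → ULift.{u} (Fin (k.len + 1)))
    (hv : Monotone fun i => (v i).down) (i : Fin (m + 1)) :
    Free.vertex (stdSimplex.{u}.obj k) i (pathSimplex m v hv) = vtx (v i) :=
  (vtx_eq ((vertexIdx_vertex _ i).trans
    (pathOf_pathSimplex m v hv (Nat.le_of_lt_succ i.2)))).symm

/-- The sequence `v` of vertices is a path from `x` to `y` of length `m`. -/
def IsPath (v : ℕ → ULift.{u} (Fin (k.len + 1))) (m : ℕ) (x y : ULift.{u} (Fin (k.len + 1))) : Prop :=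
  Monotone (fun i => (v i).down) ∧ v 0 = x ∧ v m = y

/-- The simplex of a path. -/
def IsPath.cell {v : ℕ → ULift.{u} (Fin (k.len + 1))} {m : ℕ} {x y : ULift.{u} (Fin (k.len + 1))}
    (h : IsPath v m x y) : Free.Cell (stdSimplex.{u}.obj k) m (vtx x) (vtx y) :=
  ⟨pathSimplex m v h.1, (vertex_pathSimplex m v h.1 0).trans (congrArg vtx h.2.1),
    (vertex_pathSimplex m v h.1 (Fin.last m)).trans (congrArg vtx h.2.2)⟩

theorem IsPath.comp {v : ℕ → ULift.{u} (Fin (k.len + 1))} {m l : ℕ}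
    {x y : ULift.{u} (Fin (k.len + 1))} (h : IsPath v m x y) {f : ℕ → ℕ} (hf : Monotone f)
    (h0 : f 0 = 0) (hl : f l = m) : IsPath (fun i => v (f i)) l x y :=
  ⟨h.1.comp hf, (congrArg v h0).trans h.2.1, (congrArg v hl).trans h.2.2⟩

theorem IsPath.cell_map {v : ℕ → ULift.{u} (Fin (k.len + 1))} {m l : ℕ}
    {x y : ULift.{u} (Fin (k.len + 1))} (h : IsPath v m x y) {f : ℕ → ℕ} (hf : Monotone f)
    (h0 : f 0 = 0) (hl : f l = m) :
    h.cell.map (stdSimplex.{u}.obj k) (FInt.ofNat f hf h0 hl) = (h.comp hf h0 hl).cell := by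
  refine Subtype.ext (simplex_path_ext fun i hi => ?_)
  refine (pathOf_map h.cell.1 (FInt.ofNat f hf h0 hl) i).trans ?_
  rw [FInt.ofNat_ext f hf h0 hl hi]
  exact (pathOf_pathSimplex m v h.1 (hl ▸ hf hi)).trans
    (pathOf_pathSimplex l _ (h.comp hf h0 hl).1 hi).symm

theorem IsPath.front {v : ℕ → ULift.{u} (Fin (k.len + 1))} {m : ℕ}
    {x y : ULift.{u} (Fin (k.len + 1))} (h : IsPath v m x y) (l : ℕ) : IsPath v l x (v l) :=
  ⟨h.1, h.2.1, rfl⟩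

theorem IsPath.back {v : ℕ → ULift.{u} (Fin (k.len + 1))} {m : ℕ}
    {x y : ULift.{u} (Fin (k.len + 1))} (h : IsPath v m x y) {l l' : ℕ} (hl : m = l + l') :
    IsPath (fun i => v (l + i)) l' (v l) y :=
  ⟨fun _ _ hi => h.1 (Nat.add_le_add_left hi l), rfl, (congrArg v hl.symm).trans h.2.2⟩

variable {K : Type u} [Field K]

theorem IsPath.comul_gen {v : ℕ → ULift.{u} (Fin (k.len + 1))} {m : ℕ}
    {x y : ULift.{u} (Fin (k.len + 1))} (h : IsPath v m x y) (l₁ l₂ : ℕ) (hl : m = l₁ + l₂) :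
    Free.comul (stdSimplex.{u}.obj k) K m l₁ l₂ hl _ _ (Free.gen h.cell) =
      qtmul (P := Free.quiver (stdSimplex.{u}.obj k) K l₁)
        (Q := Free.quiver (stdSimplex.{u}.obj k) K l₂) (vtx (v l₁)) (Free.gen (h.front l₁).cell)
        (Free.gen (h.back hl).cell) := by
  refine (Free.extend_gen _ h.cell).trans (Free.tmul_congr K _ _ _ _ ?_ ?_ ?_)
  · exact vertex_pathSimplex m v h.1 ⟨l₁, by omega⟩
  · refine simplex_path_ext fun i hi => ?_
    refine (pathOf_face h.cell.1 0 l₁ (by omega) i hi).trans ?_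
    rw [zero_add]
    exact (pathOf_pathSimplex m v h.1 (by omega)).trans (pathOf_pathSimplex l₁ v h.1 hi).symm
  · refine simplex_path_ext fun i hi => ?_
    refine (pathOf_face h.cell.1 l₁ l₂ (by omega) i hi).trans ?_
    exact (pathOf_pathSimplex m v h.1 (by omega)).trans
      (pathOf_pathSimplex l₂ _ (h.back hl).1 hi).symm

end Paths

section Components

set_option linter.unusedSectionVars false

open Chain Nerve Opposite SSet

variable {K : Type u} [Field K] {N : TemplicialNerve K} {k : SimplexCategory} {A : AInftyCat K}
  (φ : (free K).obj (stdSimplex.{u}.obj k) ⟶ N.functor.obj A)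

/-- The images in `A` of the objects of `A_∞[Δᵏ]`. -/
def objOf (x : ULift.{u} (Fin (k.len + 1))) : A.Ob := TempVect.Hom.obj φ (vtx x)

/-- The image in `N(A)` of the simplex of a path. -/
def imageOf {v : ℕ → ULift.{u} (Fin (k.len + 1))} {m : ℕ} {x y : ULift.{u} (Fin (k.len + 1))}
    (h : IsPath v m x y) : nerve A m (objOf φ x) (objOf φ y) :=
  TempVect.Hom.app φ m (vtx x) (vtx y) (Free.gen (K := K) h.cell)

theorem imageOf_map {v : ℕ → ULift.{u} (Fin (k.len + 1))} {m l : ℕ}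
    {x y : ULift.{u} (Fin (k.len + 1))} (h : IsPath v m x y) {f : ℕ → ℕ} (hf : Monotone f)
    (h0 : f 0 = 0) (hl : f l = m) : imageOf φ (h.comp hf h0 hl) =
      (N.str A).map (FInt.ofNat f hf h0 hl) _ _ (imageOf φ h) := by
  refine Eq.trans ?_ (TempVect.Hom.natural φ (FInt.ofNat f hf h0 hl) (vtx x) (vtx y)
    (Free.gen (K := K) h.cell))
  refine congrArg (TempVect.Hom.app φ l (vtx x) (vtx y)) ?_
  refine (congrArg (fun σ => Free.gen (K := K) σ) (h.cell_map hf h0 hl).symm).trans ?_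
  exact (Free.extend_gen (K := K) (fun σ => Free.gen (K := K) (σ.map (stdSimplex.{u}.obj k)
    (FInt.ofNat f hf h0 hl))) h.cell).symm

theorem imageOf_split {v : ℕ → ULift.{u} (Fin (k.len + 1))} {m : ℕ}
    {x y : ULift.{u} (Fin (k.len + 1))} (h : IsPath v m x y) {l₁ l₂ : ℕ} (hl : m = l₁ + l₂)
    {U V : Beads} (hU : U.Valid l₁) (hV : V.Valid l₂) :
    split U V _ _ (π (U ++ V) _ _ (imageOf φ h)) =
      qtmul (objOf φ (v l₁)) (π U _ _ (imageOf φ (h.front l₁))) (π V _ _ (imageOf φ (h.back hl))) := by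
  refine (N.comul_apply A m l₁ l₂ hl _ _ (imageOf φ h) U V hU hV).symm.trans ?_
  refine (congrArg (qmap (π U) (π V) _ _) ((TempVect.Hom.comul φ m l₁ l₂ hl (vtx x) (vtx y)
    (Free.gen (K := K) h.cell)).trans
      (congrArg (qmap (φ.app l₁) (φ.app l₂) _ _) (h.comul_gen l₁ l₂ hl)))).trans ?_
  refine (congrArg (qmap (π U) (π V) _ _) (qmap_tmul (φ.app l₁) (φ.app l₂) (vtx x) (vtx y)
    (vtx (v l₁)) (Free.gen (h.front l₁).cell) (Free.gen (h.back hl).cell))).trans ?_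
  exact qmap_tmul _ _ _ _ _ _ _

theorem imageOf_counit {v : ℕ → ULift.{u} (Fin (k.len + 1))} {x y : ULift.{u} (Fin (k.len + 1))}
    (h : IsPath v 0 x y) : tval (π [] _ _ (imageOf φ h)) = 1 := by
  refine (congrArg unitVal (N.counit_apply A _ _ (imageOf φ h)).symm).trans ?_
  refine (TempVect.Hom.counit φ (vtx x) (vtx y) (Free.gen (K := K) h.cell)).trans ?_
  exact (congrArg unitVal (Free.extend_gen (K := K) _ h.cell)).trans (unitVal_one _)

theorem valid_ones {m : ℕ} (hm : m ≠ 0) : Beads.Valid m [List.replicate m 1] := by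
  refine ⟨fun b hb => ?_, by simp⟩
  obtain rfl := List.mem_singleton.mp hb
  exact ⟨by simpa using hm, fun g hg => by rw [(List.mem_replicate.mp hg).2]; exact one_pos⟩

/-- The element of a tensor product of length one, in the given degree. -/
def entryL {O : Type u} {H : O → O → ℤ → ModuleCat.{u} K} (b : Bead) (d : ℤ) (x y : O) :
    sT H [b] x y →ₗ[K] H x y d :=
  mlift [b] x y (⟨fun c => c.entry d, entry_multilinear x y d⟩ : Mult H x y (H x y d))

theorem mlift_of_split {O : Type u} {H : O → O → ℤ → ModuleCat.{u} K} {M : Type u} [AddCommGroup M]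
    [Module K M] {b : Bead} {W : Beads} {x y z : O} {t : sT H (b :: W) x y} {r : sT H [b] x z}
    {s : sT H W z y} (h : split [b] W x y t = qtmul z r s) (Φ : Mult H x y M) :
    mlift (b :: W) x y Φ t = mlift W z y (Mult.cons b.dim Φ (entryL b b.dim x z r)) s := by
  let Ψ : ∀ z, Mult H x z (Mult H z y M) := fun z =>
    Mult.map (Mult.cons b.dim Φ) ⟨fun c => c.entry b.dim, entry_multilinear x z b.dim⟩
  have h₁ : mlift (b :: W) x y Φ = mlift ([b] ++ W) x y (cutL 1 Ψ) :=
    mlift_congr (b :: W) Φ _ fun c hc => by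
      cases c with
      | nil => simp at hc
      | cons d a c =>
        rw [degs_cons, List.map_cons, List.cons.injEq] at hc
        exact congrArg Φ.1 (entry_cons_eq hc.1 a c).symm
  rw [h₁]
  refine (mlift₂_split [b] W Ψ t).symm.trans ((congrArg (mlift₂ [b] W Ψ) h).trans ?_)
  refine (mlift₂_tmul [b] W Ψ z r s).trans ?_
  exact congrArg (fun F => mlift W z y F s) (mlift_map (Mult.cons b.dim Φ) [b] _ r).symm

theorem entryL_of_ne {O : Type u} {H : O → O → ℤ → ModuleCat.{u} K} {b : Bead} {d : ℤ}
    (h : d ≠ b.dim) (x y : O) : entryL (H := H) b d x y = 0 := by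
  refine (mlift_congr [b] _ 0 fun c hc => ?_).trans (map_zero _)
  refine entry_degree c d fun e => h ?_
  have := deg_of_degs hc
  simp only [List.flatten_cons, List.flatten_nil, List.append_nil] at this
  rw [e, Bead.dim]
  omega

theorem imageOf_congr {v v' : ℕ → ULift.{u} (Fin (k.len + 1))} {m : ℕ}
    {x y : ULift.{u} (Fin (k.len + 1))} (h : IsPath v m x y) (h' : IsPath v' m x y)
    (e : ∀ i ≤ m, v i = v' i) : imageOf φ h = imageOf φ h' := by
  have : h.cell = h'.cell := Subtype.ext (simplex_path_ext fun i hi =>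
    (pathOf_pathSimplex m v h.1 hi).trans ((e i hi).trans (pathOf_pathSimplex m v' h'.1 hi).symm))
  rw [imageOf, imageOf, this]

open Classical in
/-- The component in degree `d` of the operation of an `A_∞`-functor on the generators of
a path. -/
def opOf (v : ℕ → ULift.{u} (Fin (k.len + 1))) (m : ℕ) (x y : ULift.{u} (Fin (k.len + 1))) (d : ℤ) :
    A.Hom (objOf φ x) (objOf φ y) d :=
  if h : IsPath v m x y then
    entryL (List.replicate m 1) d _ _ (π [List.replicate m 1] _ _ (imageOf φ h))
  else 0

theorem opOf_eq {v : ℕ → ULift.{u} (Fin (k.len + 1))} {m : ℕ} {x y : ULift.{u} (Fin (k.len + 1))}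
    (h : IsPath v m x y) (d : ℤ) : opOf φ v m x y d =
      entryL (List.replicate m 1) d _ _ (π [List.replicate m 1] _ _ (imageOf φ h)) := dif_pos h

theorem opOf_congr {v v' : ℕ → ULift.{u} (Fin (k.len + 1))} {m : ℕ}
    {x y : ULift.{u} (Fin (k.len + 1))} (h : IsPath v m x y) (h' : IsPath v' m x y)
    (e : ∀ i ≤ m, v i = v' i) (d : ℤ) : opOf φ v m x y d = opOf φ v' m x y d := by
  rw [opOf_eq φ h, opOf_eq φ h', imageOf_congr φ h h' e]

theorem opOf_degree (v : ℕ → ULift.{u} (Fin (k.len + 1))) (m : ℕ) (x y : ULift.{u} (Fin (k.len + 1)))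
    {d : ℤ} (h : d ≠ m - 1) : opOf φ v m x y d = 0 := by
  unfold opOf
  split_ifs
  · rw [entryL_of_ne (by rwa [Bead.dim, List.length_replicate])]
    rfl
  · rfl

theorem opOf_zero (v : ℕ → ULift.{u} (Fin (k.len + 1))) (x y : ULift.{u} (Fin (k.len + 1))) (d : ℤ) :
    opOf φ v 0 x y d = 0 := by
  unfold opOf
  split_ifs with h
  · have h0 : π [List.replicate 0 1] _ _ (imageOf φ h) = 0 :=
      (imageOf φ h).2.1 _ fun hv => (hv.1 _ (List.mem_singleton_self _)).1 rfl
    rw [h0, map_zero]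
  · rfl

/-- The vertices of a bead. -/
def partials (b : Bead) (i : ℕ) : ℕ := (b.take i).sum

theorem partials_mono (b : Bead) : Monotone (partials b) := fun i j h => by
  rw [partials, partials, ← Nat.add_sub_cancel' h, List.take_add, List.sum_append]
  exact Nat.le_add_right _ _

theorem partials_length (b : Bead) : partials b b.length = b.sum := by
  rw [partials, List.take_length]

theorem gap_partials (c b : Bead) :
    gap (partials (c ++ b)) c.length (List.replicate b.length 1) = b := by
  induction b generalizing c with
  | nil => rfl
  | cons g b ih =>
    have h := ih (c ++ [g])
    rw [List.append_assoc, List.singleton_append, List.length_append] at h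
    rw [List.length_cons, List.replicate_succ, gap]
    refine congrArg₂ List.cons ?_ h
    rw [partials, partials, List.take_left, List.take_append,
      List.take_of_length_le (Nat.le_succ _)]
    simp

theorem mlift_imageOf_map {v : ℕ → ULift.{u} (Fin (k.len + 1))} {m l : ℕ}
    {x y : ULift.{u} (Fin (k.len + 1))} (h : IsPath v m x y) {f : ℕ → ℕ} (hf : Monotone f)
    (h0 : f 0 = 0) (hl : f l = m) {W : Beads} (hW : W.Valid l) {M : Type u} [AddCommGroup M]
    [Module K M] (Φ : Mult A.Hom (objOf φ x) (objOf φ y) M) :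
    mlift W _ _ Φ (π W _ _ (imageOf φ (h.comp hf h0 hl))) =
      ((famEv (fun V => π V _ _ (imageOf φ h)) M).bind (hatExpn A)).val (gaps f 0 W) Φ := by
  rw [imageOf_map φ h hf h0 hl, famEv_map N _ _ hW]
  rw [gaps_congr (n := l) (fun i hi => FInt.ofNat_ext f hf h0 hl hi) 0 W (by rw [hW.2, zero_add])]

theorem entryL_imageOf {v : ℕ → ULift.{u} (Fin (k.len + 1))} {x y : ULift.{u} (Fin (k.len + 1))}
    {m : ℕ} {b : Bead} (hb : b ≠ []) (hpos : 0 ∉ b) (hm : b.sum = m) (h : IsPath v m x y) (d : ℤ) :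
    entryL b d _ _ (π [b] _ _ (imageOf φ h)) =
      opOf φ (fun i => v (partials b i)) b.length x y d := by
  subst hm
  have h' := h.comp (partials_mono b) rfl (partials_length b)
  rw [opOf_eq φ h' d]
  refine Eq.trans ?_ (mlift_imageOf_map φ h (partials_mono b) rfl (partials_length b)
    (valid_ones (mt List.length_eq_zero_iff.mp hb)) _).symm
  have hg : gaps (partials b) 0 [List.replicate b.length 1] = [b] :=
    congrArg (fun c => [c]) (gap_partials [] b)
  rw [hg, hat_of_pos _ (by simpa using hpos)]
  refine LinearMap.congr_fun (mlift_congr [b] _ _ fun c hc => rfl) _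

theorem mlift_imageOf_cons {v v₁ v₂ : ℕ → ULift.{u} (Fin (k.len + 1))} {m l : ℕ}
    {x y z : ULift.{u} (Fin (k.len + 1))} (h : IsPath v m x y) {b : Bead} {W : Beads}
    (hb : b ≠ []) (hpos : ∀ g ∈ b, 0 < g) (hW : W.Valid l) (hm : m = b.sum + l)
    (h₁ : IsPath v₁ b.length x z) (e₁ : ∀ i ≤ b.length, v₁ i = v (partials b i))
    (h₂ : IsPath v₂ l z y) (e₂ : ∀ i ≤ l, v₂ i = v (b.sum + i)) {M : Type u}
    [AddCommGroup M] [Module K M] (Φ : Mult A.Hom (objOf φ x) (objOf φ y) M) :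
    mlift (b :: W) _ _ Φ (π (b :: W) _ _ (imageOf φ h)) =
      mlift W _ _ (Mult.cons b.dim Φ (opOf φ v₁ b.length x z b.dim))
        (π W _ _ (imageOf φ h₂)) := by
  have hv : Beads.Valid b.sum [b] := ⟨fun c hc => by
    obtain rfl := List.mem_singleton.mp hc
    exact ⟨hb, hpos⟩, by simp⟩
  obtain rfl : z = v b.sum := h₂.2.1.symm.trans (e₂ 0 (Nat.zero_le l))
  refine (mlift_of_split (imageOf_split φ h hm hv hW) Φ).trans ?_
  rw [entryL_imageOf φ hb (fun h0 => lt_irrefl 0 (hpos 0 h0)) rfl (h.front b.sum),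
    imageOf_congr φ h₂ (h.back hm) e₂, opOf_congr φ h₁
      ((h.front b.sum).comp (partials_mono b) rfl (partials_length b)) e₁]

end Components

section BarMultilinear

open Chain

variable {K : Type u} [Field K] {O : Type u} {H : O → O → ℤ → ModuleCat.{u} K}
variable {M : Type u} [AddCommGroup M] [Module K M]

theorem sumMid_isLinearMap {V : Type u} [AddCommGroup V] [Module K V] {x y : O}
    (c : Chain H x y) (Θ : V → ∀ z w, Chain H x z → Chain H z w → Chain H w y → M)
    (h : ∀ z w p q t, IsLinearMap K fun a => Θ a z w p q t) :
    IsLinearMap K fun a => c.sumMid (Θ a) := by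
  induction c with
  | nil => exact isLinearMap_zero
  | cons d a c ih =>
    simp only [sumMid]
    exact isLinearMap_add (sumSplit_isLinearMap _ _ fun _ _ _ => h _ _ _ _ _)
      (ih _ fun _ _ _ _ _ => h _ _ _ _ _)

theorem barD_isMultilinear (b : ∀ {x y : O}, Chain H x y → ∀ d, H x y d)
    (hb : ∀ x y d, IsMultilinear fun c : Chain H x y => b c d) {x y : O} (Φ : Chain H x y → M)
    (hΦ : IsMultilinear Φ) : IsMultilinear (barD b Φ) := by
  intro z w p d t
  induction p with
  | nil =>
    simp only [nil_append, barD_cons]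
    refine isLinearMap_add (sumSplit_isLinearMap _ _ fun v q s => ?_)
      (isLinearMap_smul _ (sumMid_isLinearMap _ _ fun _ _ p q s =>
        isLinearMap_smul _ (hΦ.head _ _)))
    exact ((hΦ.head (d + q.deg + (q.len + 1 : ℕ) - 2) s).mk'.comp
      (hb _ _ _ _ _ (nil _) d q).mk').isLinear
  | cons e a p ih =>
    simp only [cons_append, barD_cons]
    refine isLinearMap_add ?_ (isLinearMap_smul _ (ih _ (hΦ.cons e a)))
    refine sumSplit_insert_isLinearMap p d t _ (fun v t₁ q => ?_) fun v p₁ p₂ _ =>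
      hΦ.cons ((cons e a p₁).deg + (cons e a p₁).len - 2) (b (cons e a p₁) _) _ _ p₂ d t
    have : (fun s : H _ _ d => Φ (cons ((cons e a (p.append (cons d s t₁))).deg +
        (cons e a (p.append (cons d s t₁))).len - 2) (b (cons e a (p.append (cons d s t₁))) _) q)) =
        fun s => Φ (cons (e + (p.deg + (d + t₁.deg)) + (p.len + (t₁.len + 1) + 1 : ℕ) - 2)
          (b (cons e a (p.append (cons d s t₁))) _) q) := by
      funext s
      exact cons_index (o := fun x => x) b Φ _ _ (by simp)
    rw [this]
    exact ((hΦ.head _ q).mk'.comp (hb _ _ _ _ _ (cons e a p) d t₁).mk').isLinear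

theorem sumSplit_first {x y : O} (c : Chain H x y) (φ : ∀ z, Chain H x z → Chain H z y → M)
    (h : ∀ z p q, p.len ≠ 0 → φ z p q = 0) : c.sumSplit φ = φ x (nil x) c := by
  cases c with
  | nil => rfl
  | cons d a c =>
    rw [sumSplit, sumSplit_congr c (ψ := fun _ _ _ => 0) fun z p q _ => h _ _ _ (by simp),
      sumSplit_zero, add_zero]

end BarMultilinear

section GeneratorChains

set_option linter.unusedSectionVars false

open Chain

variable {K : Type u} [Field K] {n : ℕ} {M : Type u} [AddCommGroup M] [Module K M]

/-- The product of the scalars of a chain. -/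
def coef {x y : ULift.{u} (Fin (n + 1))} : Chain (simplexHom K n) x y → K
  | nil _ => 1
  | cons _ a c => simplexVal a * coef c

/-- A sequence preceded by an element. -/
def natCons {α : Type*} (x : α) (v : ℕ → α) : ℕ → α
  | 0 => x
  | i + 1 => v i

/-- The objects of a chain (constant after the last one). -/
def path {x y : ULift.{u} (Fin (n + 1))} : Chain (simplexHom K n) x y → ℕ → ULift.{u} (Fin (n + 1))
  | nil x => fun _ => x
  | cons (x := x) _ _ c => natCons x (path c)

/-- The chain consists of generators. -/
def IsGen {x y : ULift.{u} (Fin (n + 1))} : Chain (simplexHom K n) x y → Prop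
  | nil _ => True
  | cons d a c => d = 0 ∧ simplexVal a = 1 ∧ IsGen c

theorem coef_append {x y z : ULift.{u} (Fin (n + 1))} (p : Chain (simplexHom K n) x y)
    (q : Chain (simplexHom K n) y z) : coef (p.append q) = coef p * coef q := by
  induction p with
  | nil => exact (one_mul _).symm
  | cons d a p ih => rw [cons_append, coef, coef, ih, mul_assoc]

theorem path_zero {x y : ULift.{u} (Fin (n + 1))} (c : Chain (simplexHom K n) x y) :
    path c 0 = x := by
  cases c <;> rfl

theorem path_of_le {x y : ULift.{u} (Fin (n + 1))} (c : Chain (simplexHom K n) x y) {i : ℕ}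
    (h : c.len ≤ i) : path c i = y := by
  induction c generalizing i with
  | nil => rfl
  | cons d a c ih =>
    cases i with
    | zero => simp at h
    | succ i => exact ih (by simpa using h)

theorem path_min {x y : ULift.{u} (Fin (n + 1))} (c : Chain (simplexHom K n) x y) (i : ℕ) :
    path c (min i c.len) = path c i := by
  rcases le_total i c.len with h | h
  · rw [min_eq_left h]
  · rw [min_eq_right h, path_of_le c le_rfl, path_of_le c h]

theorem path_append_left {x y z : ULift.{u} (Fin (n + 1))} (p : Chain (simplexHom K n) x y)
    (q : Chain (simplexHom K n) y z) {i : ℕ} (h : i ≤ p.len) : path (p.append q) i = path p i := by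
  induction p generalizing i with
  | nil =>
    obtain rfl : i = 0 := by simpa using h
    exact path_zero q
  | cons d a p ih =>
    cases i with
    | zero => rfl
    | succ i => exact ih q (by simpa using h)

theorem path_append_right {x y z : ULift.{u} (Fin (n + 1))} (p : Chain (simplexHom K n) x y)
    (q : Chain (simplexHom K n) y z) (i : ℕ) : path (p.append q) (p.len + i) = path q i := by
  induction p with
  | nil => rw [len_nil, zero_add]; rfl
  | cons d a p ih =>
    rw [len_cons, add_right_comm]
    exact ih q

theorem path_append_congr {x y z w : ULift.{u} (Fin (n + 1))} (p : Chain (simplexHom K n) x y)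
    {d : ℤ} (a a' : simplexHom K n y z d) (t : Chain (simplexHom K n) z w) :
    path (p.append (cons d a t)) = path (p.append (cons d a' t)) := by
  induction p with
  | nil => rfl
  | cons e b p ih => exact congrArg (natCons _) (ih a a')

theorem simplexVal_ne_zero {x y : ULift.{u} (Fin (n + 1))} {d : ℤ} {a : simplexHom K n x y d}
    (h : simplexVal a ≠ 0) : x.down ≤ y.down ∧ d = 0 := by
  by_contra hc
  exact h (simplexVal_eq a hc)

theorem deg_of_coef {x y : ULift.{u} (Fin (n + 1))} {c : Chain (simplexHom K n) x y}
    (h : coef c ≠ 0) : c.deg = 0 := by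
  induction c with
  | nil => rfl
  | cons d a c ih =>
    rw [deg_cons, ih (right_ne_zero_of_mul h), (simplexVal_ne_zero (left_ne_zero_of_mul h)).2, add_zero]

theorem path_mono {x y : ULift.{u} (Fin (n + 1))} {c : Chain (simplexHom K n) x y}
    (h : coef c ≠ 0) : Monotone fun i => (path c i).down := by
  induction c with
  | nil => exact fun _ _ _ => le_rfl
  | cons d a c ih =>
    refine monotone_nat_of_le_succ fun i => ?_
    cases i with
    | zero =>
      refine (simplexVal_ne_zero (left_ne_zero_of_mul h)).1.trans (le_of_eq ?_)
      exact congrArg ULift.down (path_zero c).symm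
    | succ i => exact ih (right_ne_zero_of_mul h) (Nat.le_succ i)

theorem IsGen.coef {x y : ULift.{u} (Fin (n + 1))} {c : Chain (simplexHom K n) x y} (h : IsGen c) :
    coef c = 1 := by
  induction c with
  | nil => rfl
  | cons d a c ih => rw [AInf.coef, h.2.1, ih h.2.2, one_mul]

theorem IsGen.wt {x y : ULift.{u} (Fin (n + 1))} {c : Chain (simplexHom K n) x y} (h : IsGen c) :
    c.wt = 0 := by
  induction c with
  | nil => rfl
  | cons d a c ih => rw [Chain.wt, h.1, ih h.2.2, mul_zero, add_zero]

theorem IsGen.coef_ne_zero {x y : ULift.{u} (Fin (n + 1))} {c : Chain (simplexHom K n) x y}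
    (h : IsGen c) : AInf.coef c ≠ 0 := by
  rw [h.coef]
  exact one_ne_zero

theorem IsGen.hat {x y : ULift.{u} (Fin (n + 1))} {c : Chain (simplexHom K n) x y} (h : IsGen c)
    (Φ : Chain (simplexHom K n) x y → M) : hat Φ c = Φ c := by
  rw [AInf.hat, h.wt, zpow_zero, one_smul]

theorem IsGen.of_append {x y z : ULift.{u} (Fin (n + 1))} {p : Chain (simplexHom K n) x y}
    {q : Chain (simplexHom K n) y z} (h : IsGen (p.append q)) : IsGen p ∧ IsGen q := by
  induction p with
  | nil => exact ⟨trivial, h⟩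
  | cons d a p ih => exact ⟨⟨h.1, h.2.1, (ih h.2.2).1⟩, (ih h.2.2).2⟩

theorem multilinear_ext_gen {x y : ULift.{u} (Fin (n + 1))} (c : Chain (simplexHom K n) x y)
    {Φ Ψ : Chain (simplexHom K n) x y → M} (hΦ : IsMultilinear Φ) (hΨ : IsMultilinear Ψ)
    (h : ∀ c, IsGen c → Φ c = Ψ c) : Φ c = Ψ c := by
  induction c with
  | nil => exact h _ trivial
  | @cons x y z d a c ih =>
    by_cases hd : x.down ≤ y.down ∧ d = 0
    · have ha : a = simplexVal a • simplexGen K x y d := simplex_ext (by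
        rw [map_smul, simplexVal_gen hd.1 hd.2, smul_eq_mul, mul_one])
      have e := ih (hΦ.cons d (simplexGen K x y d)) (hΨ.cons d (simplexGen K x y d))
        fun c hc => h _ ⟨hd.2, simplexVal_gen hd.1 hd.2, hc⟩
      rw [ha]
      refine ((hΦ.head d c).map_smul _ _).trans (Eq.trans ?_ ((hΨ.head d c).map_smul _ _).symm)
      exact congrArg _ e
    · have ha : a = 0 := simplex_ext ((simplexVal_eq a hd).trans (map_zero _).symm)
      rw [ha]
      exact (hΦ.head d c).map_zero.trans (hΨ.head d c).map_zero.symm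

theorem partials_replicate (m i : ℕ) : partials (List.replicate m 1) i = min i m := by
  rw [partials, List.take_replicate, List.sum_replicate, smul_eq_mul, mul_one]

theorem path_partials_cons {x : ULift.{u} (Fin (n + 1))} (v : ℕ → ULift.{u} (Fin (n + 1))) (b : Bead)
    (g : ℕ) : (fun i => natCons x v (partials ((g + 1) :: b) i)) =
      natCons x fun i => v (g + partials b i) := by
  funext i
  cases i with
  | zero => rfl
  | succ i =>
    show natCons x v (((g + 1) :: b).take (i + 1)).sum = _
    rw [List.take_succ_cons, List.sum_cons, add_right_comm]
    rfl

/-- The differential of the bar construction of `A_∞[Δⁿ]` on chains of generators. -/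
theorem barD_gen {x y : ULift.{u} (Fin (n + 1))} (c : Chain (simplexHom K n) x y) (hc : IsGen c)
    (Φ : Chain (simplexHom K n) x y → M) (hΦ : IsMultilinear Φ)
    (G : (ℕ → ULift.{u} (Fin (n + 1))) → ℕ → M) (hG : ∀ c, IsGen c → Φ c = G (path c) c.len) :
    barD (fun c d => (simplexBarOp K n d).1 _ _ c) Φ c =
      mergeSum (List.replicate c.len 1) fun b => G (fun i => path c (partials b i)) b.length := by
  induction c generalizing G with
  | nil => rfl
  | @cons x y z d a c ih =>
    have hz : ∀ (w : ULift.{u} (Fin (n + 1))) (e : ℤ) (q : Chain (simplexHom K n) x w)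
        (t : Chain (simplexHom K n) w z), q.len ≠ 2 →
        Φ (cons e ((simplexBarOp K n e).1 _ _ q) t) = 0 := fun w e q t hq => by
      rw [simplexBarOp_of_len q e hq]
      exact (hΦ.head e t).map_zero
    rw [barD_cons, ih hc.2.2 (fun c => Φ (cons d a c)) (hΦ.cons d a)
      (fun v l => G (natCons x v) (l + 1)) fun c' h' => hG _ ⟨hc.1, hc.2.1, h'⟩]
    cases c with
    | nil =>
      refine (add_zero _).symm.trans ?_
      rw [add_zero]
      refine (congrArg₂ (· + ·) (hz _ _ (cons d a (nil _)) (nil _) (by simp))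
        (smul_zero _)).trans (add_zero _)
    | @cons _ w _ e a' c =>
      obtain ⟨rfl, ha, rfl, ha', hc'⟩ := hc
      have hxy := (simplexVal_ne_zero (ha ▸ one_ne_zero : simplexVal a ≠ 0)).1
      have hyw := (simplexVal_ne_zero (ha' ▸ one_ne_zero : simplexVal a' ≠ 0)).1
      rw [sumSplit]
      refine (congrArg₂ (· + ·) ((congrArg₂ (· + ·) (hz _ _ _ _ (by simp))
        (sumSplit_first c _ fun _ p q hp => hz _ _ _ _ (by simpa using hp))).trans (zero_add _))
        rfl).trans ?_
      have e1 : Φ (cons _ ((simplexBarOp K n ((cons 0 a (cons 0 a' (nil w))).deg +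
          (cons 0 a (cons 0 a' (nil w))).len - 2)).1 _ _ (cons 0 a (cons 0 a' (nil w)))) c) =
          G (natCons x (path c)) (c.len + 1) := by
        rw [simplexBarOp_pair hxy hyw a a' ha ha' rfl (by simp)]
        exact hG _ ⟨by simp, simplexVal_gen (hxy.trans hyw) (by simp), hc'⟩
      rw [e1]
      show _ = mergeSum (1 :: 1 :: List.replicate c.len 1) _
      rw [mergeSum, sub_eq_add_neg]
      refine congrArg₂ (· + ·) ?_ ?_
      · refine congrArg₂ G (Eq.trans (congrArg (natCons x) (funext fun i => ?_))
          (path_partials_cons (path (cons 0 a' c)) (List.replicate c.len 1) 1).symm) (by simp)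
        refine Eq.trans ?_ (congrArg (path (cons 0 a' c)) (add_comm _ _))
        show path c i = path c _
        rw [partials_replicate]
        exact (path_min c i).symm
      · have e2 : ((-1 : K) ^ ((0 : ℤ) + 1)) = -1 := by simp
        rw [e2, neg_one_smul]
        refine congrArg Neg.neg ?_
        show mergeSum (1 :: List.replicate c.len 1) _ = _
        refine congrArg (mergeSum _) (funext fun b => ?_)
        refine congrArg₂ G ?_ rfl
        refine Eq.trans ?_ (path_partials_cons (path (cons 0 a' c)) b 0).symm
        simp only [zero_add]

end GeneratorChains

section Inverse

set_option linter.unusedSectionVars false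

open Chain Nerve Opposite SSet

variable {K : Type u} [Field K] {N : TemplicialNerve K} {k : SimplexCategory} {A : AInftyCat K}
  (φ : (free K).obj (stdSimplex.{u}.obj k) ⟶ N.functor.obj A)

theorem zero_mem_gap {f : ℕ → ℕ} {m i : ℕ} (hi : i < m) (p : ℕ) (h : f (p + i + 1) = f (p + i)) :
    0 ∈ gap f p (List.replicate m 1) := by
  induction m generalizing p i with
  | zero => omega
  | succ m ih =>
    rw [List.replicate_succ, gap]
    cases i with
    | zero =>
      rw [add_zero] at h
      rw [h, Nat.sub_self]
      exact List.mem_cons_self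
    | succ i =>
      refine List.mem_cons_of_mem _ (ih (Nat.lt_of_succ_lt_succ hi) (p + 1) ?_)
      rw [add_right_comm p 1 i]
      exact h

/-- The monotone map of natural numbers with `i` and `i + 1` in the same fibre. -/
def collapse (i j : ℕ) : ℕ := if j ≤ i then j else j - 1

/-- The strictly monotone map of natural numbers with `i + 1` not in the image. -/
def skip (i j : ℕ) : ℕ := if j ≤ i then j else j + 1

theorem collapse_mono (i : ℕ) : Monotone (collapse i) := fun a b h => by
  unfold collapse
  split_ifs <;> omega

theorem skip_mono (i : ℕ) : Monotone (skip i) := fun a b h => by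
  unfold skip
  split_ifs <;> omega

theorem apply_skip_collapse {α : Type*} (v : ℕ → α) {i : ℕ} (h : v i = v (i + 1)) (j : ℕ) :
    v (skip i (collapse i j)) = v j := by
  unfold skip collapse
  split_ifs with h1 h2
  · rfl
  · obtain rfl : j = i + 1 := by omega
    exact h
  · congr 1
    omega

theorem exists_collapse {v : ℕ → ULift.{u} (Fin (k.len + 1))} {m i : ℕ}
    {x y : ULift.{u} (Fin (k.len + 1))} (h : IsPath v (m + 1) x y) (hi : i ≤ m)
    (e : v i = v (i + 1)) : ∃ (w : ℕ → ULift.{u} (Fin (k.len + 1))) (_ : IsPath w m x y),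
      v = fun j => w (collapse i j) := by
  refine ⟨fun j => v (skip i j), ⟨h.1.comp (skip_mono i), h.2.1, ?_⟩,
    funext fun j => (apply_skip_collapse v e j).symm⟩
  refine Eq.trans ?_ h.2.2
  show v (if m ≤ i then m else m + 1) = v (m + 1)
  split_ifs
  · obtain rfl : m = i := by omega
    exact e
  · rfl

theorem opOf_collapse {w : ℕ → ULift.{u} (Fin (k.len + 1))} {m i : ℕ}
    {x y : ULift.{u} (Fin (k.len + 1))} (h : IsPath w m x y) (hi : i ≤ m) (d : ℤ) :
    opOf φ (fun j => w (collapse i j)) (m + 1) x y d =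
      ((famEv (fun V => π V _ _ (imageOf φ h)) (A.Hom (objOf φ x) (objOf φ y) d)).bind
        (hatExpn A)).val [gap (collapse i) 0 (List.replicate (m + 1) 1)]
          ⟨fun c => c.entry d, entry_multilinear _ _ d⟩ := by
  have hl : collapse i (m + 1) = m := by
    unfold collapse
    rw [if_neg (by omega)]
    rfl
  rw [opOf_eq φ (h.comp (collapse_mono i) rfl hl)]
  exact mlift_imageOf_map φ h (collapse_mono i) rfl hl (valid_ones (Nat.succ_ne_zero m)) _

/-- The operations vanish on degenerate paths. -/
theorem opOf_degenerate {v : ℕ → ULift.{u} (Fin (k.len + 1))} {m i : ℕ}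
    {x y : ULift.{u} (Fin (k.len + 1))} (h : IsPath v (m + 1) x y) (hm : m ≠ 0) (hi : i ≤ m)
    (e : v i = v (i + 1)) (d : ℤ) : opOf φ v (m + 1) x y d = 0 := by
  obtain ⟨w, hw, rfl⟩ := exists_collapse h hi e
  refine (opOf_collapse φ hw hi d).trans ?_
  have h0 : 0 ∈ gap (collapse i) 0 (List.replicate (m + 1) 1) :=
    zero_mem_gap (i := i) (by omega) 0 (by simp [collapse])
  have h1 : gap (collapse i) 0 (List.replicate (m + 1) 1) ≠ [0] := fun h => by
    have := congrArg List.length h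
    simp at this
    omega
  rw [Ev.bind_val, Expn.lsum_choices_cons, hatExpn_bad h0 h1, lsum_nil]

theorem opOf_unit (v : ℕ → ULift.{u} (Fin (k.len + 1))) (x : ULift.{u} (Fin (k.len + 1)))
    (h : IsPath v 1 x x) : opOf φ v 1 x x 0 = A.one (objOf φ x) := by
  obtain ⟨w, hw, rfl⟩ := exists_collapse h le_rfl (h.2.1.trans h.2.2.symm)
  refine (opOf_collapse φ hw le_rfl 0).trans ?_
  rw [Ev.bind_val, Expn.lsum_choices_cons]
  have hg : gap (collapse 0) 0 (List.replicate (0 + 1) 1) = [0] := rfl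
  rw [hg, hatExpn_unit, lsum_cons, lsum_nil, add_zero]
  refine (add_zero _).trans ?_
  refine (mlift_nil (objOf φ x) _ _).trans ?_
  refine (congrArg (· • _) (imageOf_counit φ hw)).trans ((one_smul K _).trans ?_)
  exact entry_single 0 (A.one (objOf φ x))

/-- The operations of the `A_∞`-functor of a morphism `F(Δᵏ) ⟶ N(A)`. -/
def functorApp {x y : ULift.{u} (Fin (k.len + 1))} (c : Chain (simplexHom K k.len) x y) (d : ℤ) :
    A.Hom (objOf φ x) (objOf φ y) d :=
  coef c • opOf φ (path c) c.len x y d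

theorem isPath_path {x y : ULift.{u} (Fin (k.len + 1))} {c : Chain (simplexHom K k.len) x y}
    (h : coef c ≠ 0) : IsPath (path c) c.len x y :=
  ⟨path_mono h, path_zero c, path_of_le c le_rfl⟩

theorem functorApp_of_path {x y : ULift.{u} (Fin (k.len + 1))}
    (c : Chain (simplexHom K k.len) x y) (d : ℤ)
    (h : IsPath (path c) c.len x y → opOf φ (path c) c.len x y d = 0) : functorApp φ c d = 0 := by
  by_cases hc : coef c = 0
  · rw [functorApp, hc, zero_smul]
  · rw [functorApp, h (isPath_path hc), smul_zero]

theorem functorApp_gen {x y : ULift.{u} (Fin (k.len + 1))} {c : Chain (simplexHom K k.len) x y}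
    (h : IsGen c) (d : ℤ) : functorApp φ c d = opOf φ (path c) c.len x y d := by
  rw [functorApp, h.coef, one_smul]

theorem functorApp_degree {x y : ULift.{u} (Fin (k.len + 1))}
    (c : Chain (simplexHom K k.len) x y) (d : ℤ) (h : d ≠ c.deg + c.len - 1) :
    functorApp φ c d = 0 := by
  by_cases hc : coef c = 0
  · rw [functorApp, hc, zero_smul]
  · rw [deg_of_coef hc, zero_add] at h
    rw [functorApp, opOf_degree φ _ _ _ _ h, smul_zero]

theorem functorApp_nil (x : ULift.{u} (Fin (k.len + 1))) (d : ℤ) :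
    functorApp φ (nil x : Chain (simplexHom K k.len) x x) d = 0 := by
  rw [functorApp, len_nil, opOf_zero, smul_zero]

theorem functorApp_multilinear (x y : ULift.{u} (Fin (k.len + 1))) (d : ℤ) :
    IsMultilinear fun c : Chain (simplexHom K k.len) x y => functorApp φ c d := by
  intro z w p e t
  have h : (fun a : simplexHom K k.len z w e => functorApp φ (p.append (cons e a t)) d) =
      fun a => simplexVal a • ((coef p * coef t) •
        opOf φ (path (p.append (cons e (0 : simplexHom K k.len z w e) t))) (p.len + (t.len + 1))
          x y d) := by
    funext a
    rw [functorApp, coef_append, coef, path_append_congr p a 0 t, len_append, len_cons, smul_smul]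
    congr 1
    ring
  rw [h]
  exact (simplexVal.smulRight _).isLinear

theorem functorApp_one (x : ULift.{u} (Fin (k.len + 1))) :
    functorApp φ (cons 0 (simplexOne K x) (nil x)) 0 = A.one (objOf φ x) := by
  have hg : IsGen (cons 0 (simplexOne K x) (nil x)) := ⟨rfl, rfl, trivial⟩
  rw [functorApp_gen φ hg]
  exact opOf_unit φ _ x (isPath_path hg.coef_ne_zero)

theorem functorApp_unit {x y z : ULift.{u} (Fin (k.len + 1))}
    (p : Chain (simplexHom K k.len) x y) (t : Chain (simplexHom K k.len) y z) (d : ℤ)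
    (h : 1 < p.len + 1 + t.len) : functorApp φ (p.append (cons 0 (simplexOne K y) t)) d = 0 := by
  refine functorApp_of_path φ _ _ fun hp => ?_
  have hl : (p.append (cons 0 (simplexOne K y) t)).len = (p.len + t.len) + 1 := by
    rw [len_append, len_cons, add_assoc]
  rw [hl] at hp ⊢
  refine opOf_degenerate φ (i := p.len) hp (by omega) (by omega) ?_ d
  refine (path_append_right p _ 0).trans (Eq.trans ?_ (path_append_right p _ 1).symm)
  exact (path_zero t).symm

/-- The operations `functorApp` with the signs of the bar construction. -/
def functorBar {x y : ULift.{u} (Fin (k.len + 1))} (c : Chain (simplexHom K k.len) x y) (d : ℤ) :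
    A.Hom (objOf φ x) (objOf φ y) d :=
  hat (fun c => functorApp φ c d) c

theorem isPath_of_isGen {x y : ULift.{u} (Fin (k.len + 1))} {c : Chain (simplexHom K k.len) x y}
    (h : IsGen c) : IsPath (path c) c.len x y := isPath_path h.coef_ne_zero

theorem functorBar_gen {x y : ULift.{u} (Fin (k.len + 1))} {c : Chain (simplexHom K k.len) x y}
    (h : IsGen c) (d : ℤ) : functorBar φ c d = opOf φ (path c) c.len x y d :=
  (h.hat _).trans (functorApp_gen φ h d)

/-- The decompositions of a chain of generators correspond to the cuts of a bead. -/
theorem barT_gen : ∀ (n : ℕ) {x y : ULift.{u} (Fin (k.len + 1))}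
    (c : Chain (simplexHom K k.len) x y) (hc : IsGen c), c.len ≤ n → ∀ {M : Type u}
    [AddCommGroup M] [Module K M] (Ψ : Mult A.Hom (objOf φ x) (objOf φ y) M),
    barT (o := objOf φ) (functorBar φ) Ψ.1 c = lsum (cuts (List.replicate c.len 1)) fun S =>
      mlift S _ _ Ψ (π S _ _ (imageOf φ (isPath_of_isGen hc)))
  | _, _, _, nil x, hc, _, M, _, _, Ψ => by
    refine Eq.trans ?_ (add_zero _).symm
    refine Eq.trans ?_ (mlift_nil (objOf φ x) Ψ _).symm
    exact ((congrArg (· • _) (imageOf_counit φ (isPath_of_isGen hc))).trans (one_smul K _)).symm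
  | 0, _, _, cons _ _ _, _, hn, _, _, _, _ => by simp at hn
  | n + 1, x, y, cons d a c, hc, hn, M, _, _, Ψ => by
    rw [barT_cons]
    show _ = lsum (cuts (1 :: List.replicate c.len 1)) fun S =>
      mlift S _ _ Ψ (π S _ _ (imageOf φ (isPath_of_isGen hc)))
    rw [lsum_cuts_cons, sumSplit_eq_lsum (List.replicate c.len 1) c (by simp)]
    refine lsum_congr fun r hr => ?_
    have hr := append_of_mem_splits hr
    have hl := congrArg List.length hr
    rw [List.length_append, List.length_replicate] at hl
    obtain ⟨z, p, q, hp, rfl⟩ := c.exists_append r.1.length (by omega)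
    rw [cutAt_append' _ _ _ hp.symm]
    rw [len_append] at hl
    have hr1 : r.1 = List.replicate p.len 1 := by
      refine List.eq_replicate_iff.mpr ⟨hp.symm, fun b hb => ?_⟩
      exact (List.mem_replicate.mp (hr ▸ List.mem_append_left r.2 hb)).2
    have hr2 : r.2 = List.replicate q.len 1 := by
      refine List.eq_replicate_iff.mpr ⟨by omega, fun b hb => ?_⟩
      exact (List.mem_replicate.mp (hr ▸ List.mem_append_right r.1 hb)).2
    obtain ⟨hp', hq'⟩ := IsGen.of_append (p := cons d a p) hc
    have e := barT_gen n q hq' (by rw [len_cons, len_append] at hn; omega) (Mult.cons _ Ψ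
      (functorBar φ (cons d a p) ((cons d a p).deg + (cons d a p).len - 1)))
    refine Eq.trans e ?_
    rw [hr1, hr2]
    refine lsum_congr fun S hS => ?_
    have hS : Beads.Valid q.len S := valid_cuts hS (fun g hg => by
      rw [(List.mem_replicate.mp hg).2]; exact one_pos) (n := q.len) (by simp)
    have hs : List.replicate (p.len + 1) 1 = 1 :: List.replicate p.len 1 := rfl
    have hb : (1 :: List.replicate p.len 1).length = (cons d a p).len := by simp
    have hsum : List.sum (1 :: List.replicate p.len 1) = (cons d a p).len := by simp [add_comm]
    refine Eq.trans ?_ (mlift_imageOf_cons φ (isPath_of_isGen hc) (v₁ := path (cons d a p))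
      (v₂ := path q) (l := q.len) (z := z) (by simp) (by simp) hS ?_ ?_ ?_ (isPath_of_isGen hq')
      (fun i _ => ?_) Ψ).symm
    · refine LinearMap.congr_fun (congrArg (mlift S _ _) (Subtype.ext (funext fun v => ?_))) _
      refine (cons_index (o := objOf φ) (functorBar φ) Ψ.1 (cons d a p) v
        (e' := Bead.dim (1 :: List.replicate p.len 1)) ?_).trans ?_
      · rw [deg_of_coef hp'.coef_ne_zero, zero_add, Bead.dim, hb]
      · rw [functorBar_gen φ hp', hb]
        rfl
    · rw [hsum, ← len_append, cons_append]
    · rw [hb]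
      exact isPath_of_isGen hp'
    · intro i hi
      rw [hb] at hi
      rw [← hs, partials_replicate, min_eq_left (by simpa using hi)]
      exact (path_append_left (cons d a p) q hi).symm
    · rw [hsum]
      exact (path_append_right (cons d a p) q i).symm

end Inverse

section InverseRelation

set_option linter.unusedSectionVars false

open Chain Nerve Opposite SSet

variable {K : Type u} [Field K]

theorem bar_of_degree (A : AInftyCat K) {x y : A.Ob} (c : Chain A.Hom x y) {d : ℤ}
    (h : d ≠ c.deg + c.len - 2) : A.bar c d = 0 := by
  rw [AInftyCat.bar, hat, A.mul_degree c d h, smul_zero]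

theorem insL_entry (A : AInftyCat K) {x y : A.Ob} (d e : ℤ) (S : Beads) (c : Chain A.Hom x y)
    (hc : c.degs = S.map Bead.dim) (he : e = S.flatten.length - 2) :
    (insL 0 S.length (A.barOp e) ⟨fun c => c.entry d, entry_multilinear x y d⟩).1 c =
      A.bar c d := by
  let F : ∀ z, Chain A.Hom x z → Chain A.Hom z y → A.Hom x y d := fun _ q t =>
    (cons e (A.bar q e) t).entry d
  have h : (insL 0 S.length (A.barOp e) ⟨fun c => c.entry d, entry_multilinear x y d⟩).1 c =
      cutAt S.length c F := by cases c <;> rfl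
  refine (h.trans (cutAt_len c F (len_of_degs hc).symm)).trans ?_
  show (cons e (A.bar c e) (nil y)).entry d = A.bar c d
  by_cases hd : d = e
  · subst hd
    exact entry_single d _
  · have h := deg_of_degs hc
    refine (entry_degree _ d ?_).trans (bar_of_degree A c ?_).symm
    · simpa using hd
    · rw [h, ← he]
      exact hd

variable {N : TemplicialNerve K} {k : SimplexCategory} {A : AInftyCat K}
  (φ : (free K).obj (stdSimplex.{u}.obj k) ⟶ N.functor.obj A)

theorem functorBar_relation_gen {x y : ULift.{u} (Fin (k.len + 1))}
    (c : Chain (simplexHom K k.len) x y) (hc : IsGen c) (d : ℤ) :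
    barD (fun c d => (simplexBarOp K k.len d).1 _ _ c) (fun c => functorBar φ c d) c =
      barT (o := objOf φ) (functorBar φ) (fun v => A.bar v d) c := by
  let Ψ : Mult A.Hom (objOf φ x) (objOf φ y) (A.Hom (objOf φ x) (objOf φ y) d) :=
    ⟨fun v => A.bar v d, hat_isMultilinear (A.mul_multilinear _ _ d)⟩
  refine (barD_gen c hc _ (hat_isMultilinear (functorApp_multilinear φ x y d))
    (fun v l => opOf φ v l x y d) fun c hc => functorBar_gen φ hc d).trans ?_
  refine Eq.trans ?_ (barT_gen φ c.len c hc le_rfl Ψ).symm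
  by_cases hn : c.len = 0
  · cases c with
    | cons => simp at hn
    | nil =>
      refine Eq.trans ?_ (add_zero _).symm
      refine Eq.trans ?_ (mlift_nil (objOf φ x) Ψ _).symm
      have : Ψ.1 (nil (objOf φ x)) = 0 := by
        show hat (fun v => A.mul v d) (nil (objOf φ x)) = 0
        rw [hat, A.mul_nil, smul_zero]
      rw [this, smul_zero]
      rfl
  have h := ((mem_nerveModule_iff _ _).1 (imageOf φ (isPath_of_isGen hc)).2).2
    (A.Hom (objOf φ x) (objOf φ y) d) [] (List.replicate c.len 1) [] (valid_ones hn)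
    ⟨fun c => c.entry d, entry_multilinear _ _ d⟩
  refine Eq.trans ?_ (h.symm.trans ?_)
  · refine mergeSum_congr_pos (fun g hg => ?_) fun b hl hb hp hs => ?_
    · rw [(List.mem_replicate.mp hg).2]
      exact one_pos
    · exact (entryL_imageOf φ hb (fun h0 => lt_irrefl 0 (hp 0 h0)) (by simpa using hs)
        (isPath_of_isGen hc) d).symm
  · refine lsum_congr fun S hS => ?_
    have hS := (flatten_of_mem_cuts hS).1
    show mlift (S ++ []) _ _ _ (π (S ++ []) _ _ _) = _
    rw [List.append_nil]
    refine LinearMap.congr_fun (mlift_congr S _ _ fun v hv => ?_) _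
    refine insL_entry A d _ S v hv ?_
    rw [hS]

theorem functorBar_relation {x y : ULift.{u} (Fin (k.len + 1))}
    (c : Chain (simplexHom K k.len) x y) (d : ℤ) :
    barD (fun c d => (simplexBarOp K k.len d).1 _ _ c) (fun c => functorBar φ c d) c =
      barT (o := objOf φ) (functorBar φ) (fun v => A.bar v d) c := by
  refine multilinear_ext_gen c (barD_isMultilinear _ (fun x y d => (simplexBarOp K k.len d).2 x y) _
    (hat_isMultilinear (functorApp_multilinear φ x y d))) (fun z w p e t => ?_)
    fun c hc => functorBar_relation_gen φ c hc d
  refine barT_isMultilinear (o := objOf φ) (functorBar φ) (fun x d => ?_)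
    (fun x y d => hat_isMultilinear (functorApp_multilinear φ x y d)) _ _
    (hat_isMultilinear (A.mul_multilinear _ _ d)) z w p e t le_rfl
  rw [functorBar, hat, functorApp_nil, smul_zero]

/-- The `A_∞`-functor of a morphism `F(Δᵏ) ⟶ N(A)`. -/
def inverseFunctor : AInftyFunctor (simplexCat K k.len) A where
  obj := objOf φ
  app := functorApp φ
  app_degree := functorApp_degree φ
  app_nil := functorApp_nil φ
  app_multilinear := functorApp_multilinear φ
  relation {x y} c d := AInftyFunctor.hat_inj c
    ((barD_hat (simplexCat K k.len).mul (fun c => functorApp φ c d)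
      (functorApp_multilinear φ x y d) c).symm.trans ((functorBar_relation φ c d).trans
        (barT_hat (o := objOf φ) (functorApp φ) (fun v => A.mul v d)
          (A.mul_multilinear _ _ d) c)))
  app_one := functorApp_one φ
  app_unit := functorApp_unit φ

end InverseRelation

section LeftInverse

set_option linter.unusedSectionVars false

open Chain Nerve Opposite SSet

variable {K : Type u} [Field K]

theorem lsum_cuts_singles {M : Type*} [AddCommGroup M] (m : ℕ) (φ : Beads → M)
    (h : ∀ S : Beads, (∃ b ∈ S, Bead.dim b ≠ 0) → φ S = 0) :
    lsum (cuts (List.replicate m 1)) φ = φ (List.replicate m [1]) := by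
  induction m generalizing φ with
  | zero => exact add_zero _
  | succ m ih =>
    rw [List.replicate_succ, lsum_cuts_cons]
    have e : (lsum (splits (List.replicate m 1)) fun p => lsum (cuts p.2) fun S =>
        φ ((1 :: p.1) :: S)) = lsum (cuts (List.replicate m 1)) fun S => φ ([1] :: S) := by
      cases m with
      | zero => exact add_zero _
      | succ m =>
        rw [List.replicate_succ, lsum_splits_cons 1 (List.replicate m 1) fun a b =>
          lsum (cuts b) fun S => φ ((1 :: a) :: S)]
        refine (congrArg _ (lsum_eq_zero fun p _ => lsum_eq_zero fun S _ => h _ ?_)).trans (add_zero _)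
        refine ⟨_, List.mem_cons_self, ?_⟩
        simp only [Bead.dim, List.length_cons]
        omega
    rw [e, ih (fun S => φ ([1] :: S)) fun S hS => h _ ?_]
    · rfl
    · obtain ⟨b, hb, hd⟩ := hS
      exact ⟨b, List.mem_cons_of_mem _ hb, hd⟩

theorem mlift_genTens_path {n : ℕ} {v : ℕ → ULift.{u} (Fin (n + 1))} {M : Type u} [AddCommGroup M]
    [Module K M] {x y : ULift.{u} (Fin (n + 1))} (c : Chain (simplexHom K n) x y) (hc : IsGen c)
    (p : ℕ) (h : ∀ i ≤ c.len, v (p + i) = path c i) (Φ : Mult (simplexHom K n) x y M) :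
    mlift (List.replicate c.len [1]) x y Φ (genTens K v (List.replicate c.len [1]) x p y) = Φ.1 c := by
  induction c generalizing p with
  | nil x =>
    refine (mlift_nil x Φ _).trans ?_
    have e : tval (genTens K v [] x p x) = 1 := if_pos rfl
    exact (congrArg (· • _) e).trans (one_smul _ _)
  | @cons x z y d a c ih =>
    obtain ⟨rfl, ha, hc⟩ := hc
    obtain rfl : v (p + [1].sum) = z := (h 1 (by simp)).trans (path_zero c)
    have ha' : a = simplexGen K x (v (p + [1].sum)) 0 := simplex_ext (ha.trans
      (simplexVal_gen (simplexVal_ne_zero (ha ▸ one_ne_zero : simplexVal a ≠ 0)).1 rfl).symm)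
    refine (mlift_cons [1] (List.replicate c.len [1]) x y _ Φ _ _).trans ?_
    refine (ih hc (p + [1].sum) (fun i hi => ?_) _).trans ?_
    · refine Eq.trans ?_ (h (i + 1) (by rw [len_cons]; omega))
      rw [List.sum_singleton, add_assoc, add_comm 1 i]
    · exact congrArg (fun w => Φ.1 (cons 0 w c)) ha'.symm

theorem mlift_push_single {A B : AInftyCat K} (f : AInftyFunctor A B) {a b : A.Ob} (y : Fam A a b)
    (β : Bead) {M : Type u} [AddCommGroup M] [Module K M] (Φ : Mult B.Hom (f.obj a) (f.obj b) M) :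
    mlift [β] _ _ Φ (push f y [β]) = lsum (cuts β) fun S =>
      mlift S a b (runL (o := f.obj) [⟨S.length, β.dim, f.barOp β.dim⟩] Φ) (y S) := by
  have h : (cutExpn f.barOp).choices [β] = (cuts β).map fun S =>
      (S, [⟨S.length, β.dim, f.barOp β.dim⟩]) := by
    simp [Expn.choices, cutExpn, ← List.map_eq_flatMap, Function.comp_def]
  rw [mlift_push, Ev.bind_val, h, lsum_map]
  rfl

variable (N : TemplicialNerve K) {k : SimplexCategory} {A : AInftyCat K}
  (f : simplexCat K k.len ⟶ A)

theorem opOf_adjunct {x y : ULift.{u} (Fin (k.len + 1))} (c : Chain (simplexHom K k.len) x y)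
    (hc : IsGen c) (hn : c.len ≠ 0) (d : ℤ) :
    opOf (adjunct N f) (path c) c.len x y d = AInftyFunctor.app f c d := by
  have h := isPath_of_isGen hc
  let β : Bead := List.replicate c.len 1
  let Φ : Mult A.Hom (f.obj x) (f.obj y) (A.Hom (f.obj x) (f.obj y) d) :=
    ⟨fun c => c.entry d, entry_multilinear _ _ d⟩
  have hg : d ≠ β.dim → d ≠ c.deg + c.len - 1 := by
    rw [deg_of_coef hc.coef_ne_zero, zero_add, Bead.dim, List.length_replicate]
    exact id
  refine (opOf_eq (adjunct N f) h d).trans ?_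
  have e₁ : π [β] (f.obj x) (f.obj y) (imageOf (adjunct N f) h) =
      push f (fun V => π (A := simplexCat K k.len) V x y (simplexElt K h.cell)) [β] := by
    refine Eq.trans ?_ (N.app_apply f c.len x y (simplexElt K h.cell) [β] (valid_ones hn))
    refine congrArg (fun t => π [β] (f.obj x) (f.obj y) (N.app f c.len x y t)) ?_
    exact universalApp_gen h.cell
  refine (congrArg (mlift [β] _ _ Φ) e₁).trans ((mlift_push_single f _ β Φ).trans ?_)
  have hS : ∀ S ∈ cuts β, π (A := simplexCat K k.len) S x y (simplexElt K h.cell) =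
      genTens K (pathOf h.cell.1) S x 0 y := fun S hS => by
    refine π_simplexElt h.cell (valid_cuts hS (fun g hg => ?_) (by simp [β]))
    rw [(List.mem_replicate.mp hg).2]
    exact one_pos
  refine (lsum_congr fun S h => congrArg (mlift S x y _) (hS S h)).trans ?_
  refine (lsum_cuts_singles c.len (fun S => mlift S x y (runL (o := f.obj)
    [⟨S.length, β.dim, f.barOp β.dim⟩] Φ) (genTens K (pathOf h.cell.1) S x 0 y))
      fun S hS => ?_).trans ?_
  · show mlift S x y _ (genTens K _ S x 0 y) = 0
    rw [genTens_zero hS, map_zero]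
  · refine (mlift_genTens_path c hc 0 (fun i hi => ?_) _).trans ?_
    · rw [zero_add]
      exact pathOf_pathSimplex c.len _ h.1 hi
    · refine (cutAt_len c _ (List.length_replicate ..)).trans ?_
      show (cons β.dim (f.bar c β.dim) (nil (f.obj y))).entry d = AInftyFunctor.app f c d
      by_cases hd : d = β.dim
      · subst hd
        exact (entry_single _ _).trans (hc.hat fun c => AInftyFunctor.app f c β.dim)
      · refine (entry_degree _ d ?_).trans (AInftyFunctor.app_degree f c d ?_).symm
        · simpa using hd
        · exact hg hd

theorem functorApp_adjunct {x y : ULift.{u} (Fin (k.len + 1))}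
    (c : Chain (simplexHom K k.len) x y) (d : ℤ) :
    functorApp (adjunct N f) c d = AInftyFunctor.app f c d := by
  refine multilinear_ext_gen c (functorApp_multilinear (adjunct N f) x y d)
    (AInftyFunctor.app_multilinear f x y d) fun c hc => ?_
  by_cases hn : c.len = 0
  · cases c with
    | nil => exact (functorApp_nil (adjunct N f) _ d).trans (AInftyFunctor.app_nil f _ d).symm
    | cons => simp at hn
  · exact (functorApp_gen (adjunct N f) hc d).trans (opOf_adjunct N f c hc hn d)

theorem inverseFunctor_adjunct : inverseFunctor (adjunct N f) = f :=
  AInftyFunctor.ext' rfl fun _ _ c d => heq_of_eq (functorApp_adjunct N f c d)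

end LeftInverse

section Bijectivity

set_option linter.unusedSectionVars false

open Chain Nerve Opposite SSet

variable {K : Type u} [Field K] {N : TemplicialNerve K} {k : SimplexCategory} {A : AInftyCat K}

variable (K) in
theorem exists_isGen {v : ℕ → ULift.{u} (Fin (k.len + 1))} {m : ℕ}
    {x y : ULift.{u} (Fin (k.len + 1))} (h : IsPath v m x y) :
    ∃ c : Chain (simplexHom K k.len) x y, IsGen c ∧ c.len = m ∧ ∀ i ≤ m, path c i = v i := by
  induction m generalizing v x with
  | zero =>
    obtain rfl : x = y := h.2.1.symm.trans h.2.2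
    refine ⟨nil x, trivial, rfl, fun i hi => ?_⟩
    obtain rfl : i = 0 := by omega
    exact h.2.1.symm
  | succ m ih =>
    obtain ⟨c, hc, hl, hp⟩ := ih (h.back (add_comm m 1))
    refine ⟨cons 0 (simplexGen K x (v 1) 0) c, ⟨rfl, simplexVal_gen ?_ rfl, hc⟩,
      congrArg (· + 1) hl, fun i hi => ?_⟩
    · exact (le_of_eq (congrArg ULift.down h.2.1.symm)).trans (h.1 (Nat.zero_le 1))
    · cases i with
      | zero => exact h.2.1.symm
      | succ i => exact (hp i (by omega)).trans (congrArg v (add_comm 1 i))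

theorem opOf_eq_functorApp (φ : (free K).obj (stdSimplex.{u}.obj k) ⟶ N.functor.obj A)
    {v : ℕ → ULift.{u} (Fin (k.len + 1))} {m : ℕ} {x y : ULift.{u} (Fin (k.len + 1))}
    (h : IsPath v m x y) {c : Chain (simplexHom K k.len) x y} (hc : IsGen c) (hl : c.len = m)
    (hp : ∀ i ≤ m, path c i = v i) (d : ℤ) : opOf φ v m x y d = functorApp φ c d := by
  subst hl
  exact (opOf_congr φ h (isPath_of_isGen hc) (fun i hi => (hp i hi).symm) d).trans
    (functorApp_gen φ hc d).symm

theorem opOf_of_not_isPath (φ : (free K).obj (stdSimplex.{u}.obj k) ⟶ N.functor.obj A)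
    {v : ℕ → ULift.{u} (Fin (k.len + 1))} {m : ℕ} {x y : ULift.{u} (Fin (k.len + 1))}
    (h : ¬ IsPath v m x y) (d : ℤ) : opOf φ v m x y d = 0 := dif_neg h

theorem AInftyFunctor.app_heq {A B : AInftyCat K} {f g : AInftyFunctor A B} (h : f = g)
    {x y : A.Ob} (c : Chain A.Hom x y) (d : ℤ) : HEq (f.app c d) (g.app c d) := by
  subst h
  rfl

section

variable {o : ((free K).obj (stdSimplex.{u}.obj k)).O → (N.functor.obj A).O}
  {f₁ f₂ : ∀ n : ℕ, QHom o (((free K).obj (stdSimplex.{u}.obj k)).X n) ((N.functor.obj A).X n)}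
  {n₁ n₂ c₁ c₂ u₁ u₂}

theorem mlift_imageOf_congr
    (hop : ∀ (v : ℕ → ULift.{u} (Fin (k.len + 1))) (m : ℕ) (x y : ULift.{u} (Fin (k.len + 1)))
      (d : ℤ), opOf (N := N) (TempVect.Hom.mk o f₁ n₁ c₁ u₁) v m x y d =
        opOf (N := N) (TempVect.Hom.mk o f₂ n₂ c₂ u₂) v m x y d) (W : Beads)
    {v : ℕ → ULift.{u} (Fin (k.len + 1))} {m : ℕ} {x y : ULift.{u} (Fin (k.len + 1))}
    (h : IsPath v m x y) (hW : W.Valid m) {M : Type u} [AddCommGroup M] [Module K M]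
    (Φ : Mult A.Hom (o (vtx x)) (o (vtx y)) M) :
    mlift W _ _ Φ (π W _ _ (imageOf (N := N) (TempVect.Hom.mk o f₁ n₁ c₁ u₁) h)) =
      mlift W _ _ Φ (π W _ _ (imageOf (N := N) (TempVect.Hom.mk o f₂ n₂ c₂ u₂) h)) := by
  induction W generalizing v m x with
  | nil =>
    obtain rfl : m = 0 := hW.2.symm
    obtain rfl : x = y := h.2.1.symm.trans h.2.2
    refine (mlift_nil (o (vtx x)) Φ _).trans (Eq.trans ?_ (mlift_nil (o (vtx x)) Φ _).symm)
    exact congrArg (· • _) ((imageOf_counit (N := N) (TempVect.Hom.mk o f₁ n₁ c₁ u₁) h).trans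
      (imageOf_counit (N := N) (TempVect.Hom.mk o f₂ n₂ c₂ u₂) h).symm)
  | cons b W ih =>
    obtain ⟨hb, hpos⟩ := hW.1 b List.mem_cons_self
    have hm : m = b.sum + W.flatten.sum := by
      rw [← hW.2, List.flatten_cons, List.sum_append]
    have hv : Beads.Valid W.flatten.sum W := ⟨fun c hc => hW.1 c (List.mem_cons_of_mem _ hc), rfl⟩
    have h₁ := (h.front b.sum).comp (partials_mono b) rfl (partials_length b)
    refine (mlift_imageOf_cons (N := N) (TempVect.Hom.mk o f₁ n₁ c₁ u₁) h hb hpos hv hm h₁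
      (fun _ _ => rfl) (h.back hm) (fun _ _ => rfl) Φ).trans (Eq.trans ?_
        (mlift_imageOf_cons (N := N) (TempVect.Hom.mk o f₂ n₂ c₂ u₂) h hb hpos hv hm h₁
          (fun _ _ => rfl) (h.back hm) (fun _ _ => rfl) Φ).symm)
    rw [hop]
    exact ih (h.back hm) hv _

theorem app_eq_of_opOf
    (hop : ∀ (v : ℕ → ULift.{u} (Fin (k.len + 1))) (m : ℕ) (x y : ULift.{u} (Fin (k.len + 1)))
      (d : ℤ), opOf (N := N) (TempVect.Hom.mk o f₁ n₁ c₁ u₁) v m x y d =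
        opOf (N := N) (TempVect.Hom.mk o f₂ n₂ c₂ u₂) v m x y d) : f₁ = f₂ := by
  funext m a b
  refine Free.gen_ext (X := stdSimplex.{u}.obj k) fun σ => ?_
  obtain ⟨x, rfl⟩ : ∃ x, vtx x = a := ⟨vertexIdx a, vtx_eq rfl⟩
  obtain ⟨y, rfl⟩ : ∃ y, vtx y = b := ⟨vertexIdx b, vtx_eq rfl⟩
  have h : IsPath (pathOf σ.1) m x y :=
    ⟨pathOf_mono σ.1, (vertexIdx_source σ).symm, (vertexIdx_target σ).symm⟩
  have hσ : h.cell = σ :=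
    Subtype.ext (simplex_path_ext fun i hi => pathOf_pathSimplex m _ h.1 hi)
  rw [← hσ]
  refine (resolves_π (A := A) m).ext fun W hW => sT_ext fun M _ _ Φ => ?_
  exact mlift_imageOf_congr hop W h (mem_validBeads.mp hW) Φ

end

theorem inverseFunctor_injective : Function.Injective
    (inverseFunctor : ((free K).obj (stdSimplex.{u}.obj k) ⟶ N.functor.obj A) → _) := by
  intro φ ψ h
  have ho : TempVect.Hom.obj φ = TempVect.Hom.obj ψ := by
    funext a
    obtain ⟨x, rfl⟩ : ∃ x, vtx x = a := ⟨vertexIdx a, vtx_eq rfl⟩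
    exact congrFun (congrArg AInftyFunctor.obj h) x
  obtain ⟨o, f₁, n₁, c₁, u₁⟩ := φ
  obtain ⟨o', f₂, n₂, c₂, u₂⟩ := ψ
  dsimp only at ho
  subst ho
  obtain rfl : f₁ = f₂ := by
    refine app_eq_of_opOf (n₁ := n₁) (c₁ := c₁) (u₁ := u₁) (n₂ := n₂) (c₂ := c₂) (u₂ := u₂)
      fun v m x y d => ?_
    by_cases hp : IsPath v m x y
    · obtain ⟨c, hc, hl, e⟩ := exists_isGen K hp
      have h₁ := opOf_eq_functorApp (N := N) (TempVect.Hom.mk o f₁ n₁ c₁ u₁) hp hc hl e d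
      have h₂ := opOf_eq_functorApp (N := N) (TempVect.Hom.mk o f₂ n₂ c₂ u₂) hp hc hl e d
      exact h₁.trans ((eq_of_heq (AInftyFunctor.app_heq h c d)).trans h₂.symm)
    · have h₁ := opOf_of_not_isPath (N := N) (TempVect.Hom.mk o f₁ n₁ c₁ u₁) hp d
      exact h₁.trans (opOf_of_not_isPath (N := N) (TempVect.Hom.mk o f₂ n₂ c₂ u₂) hp d).symm
  rfl

variable (N) in
theorem adjunct_bijective (k : SimplexCategory) (A : AInftyCat K) :
    Function.Bijective fun f : simplexCat K k.len ⟶ A => adjunct N f := by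
  have h := inverseFunctor_adjunct (k := k) (A := A) N
  exact ⟨Function.LeftInverse.injective (g := inverseFunctor) h, fun φ =>
    ⟨inverseFunctor φ, inverseFunctor_injective (h (inverseFunctor φ))⟩⟩

end Bijectivity

end

end AInf

theorem mainTheorem2 (K : Type u) [Field K] :
    Nonempty (AInf.TemplicialNerve K) ∧
      ∀ N : AInf.TemplicialNerve K,
        Nonempty (N.functor ⋙ AInf.underlying K ≅ AInf.simplicialNerve K) :=
  ⟨⟨AInf.templicialNerve K⟩, fun N =>
    haveI := AInf.isIso_comparison N (AInf.adjunct_bijective N)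
    ⟨(asIso (AInf.comparison N)).symm⟩⟩
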